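/- **Setting.** Points of $\mathbf R^4$ are $x=(x_0,\dots,x_3)$ with $x_0$ the time variable; $|k|=2k_0+k_1+k_2+k_3$ for multi-indices $k$, and $|x|_{\mathfrak s}=|x_0|^{1/2}+|x_1|+|x_2|+|x_3|$. Formal expressions are built from commuting symbols $X_0,\dots,X_3$, $\Xi$ and an operation $\mathcal I$, with commutative multiplication and $\mathcal I(X^k)=0$. Let $\mathcal U$ be the smallest collection containing all $X^k$ and $\mathcal I(\Xi)$ such that $\tau_1,\tau_2,\tau_3\in\mathcal U$ implies $\mathcal I(\tau_1\tau_2\tau_3)\in\mathcal U$, let $\mathcal W=\{\Xi\}\cup\{\tau_1\tau_2\tau_3:\tau_i\in\mathcal U\}$, and let $T$ be the vector space with basis $\mathcal W$, graded by $|X^k|=|k|$, $|\Xi|=-\frac52-\kappa$, $|\mathcal I(\tau)|=|\tau|+2$, $|\tau\bar\tau|=|\tau|+|\bar\tau|$. Let $T^+$ be the polynomial algebra in the symbols $X_i$ and $\mathscr I_\ell(\tau)$, where $\tau\in\mathcal W$ is not a monomial $X^k$ and $|\ell|<|\tau|+2$, graded by $|\mathscr I_\ell(\tau)|=|\tau|+2-|\ell|$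 (other $\mathscr I_\ell(\tau)$ are $0$). Let $\Delta\colon T\to T\otimes T^+$ be the multiplicative map with $\Delta\Xi=\Xi\otimes1$, $\Delta X_i=X_i\otimes1+1\otimes X_i$ and $\Delta\mathcal I(\tau)=(\mathcal I\otimes\mathrm{id})\Delta\tau+\sum_k\frac{X^k}{k!}\otimes\mathscr I_k(\tau)$, and put $\Gamma_f=(\mathrm{id}\otimes f)\Delta$ for linear functionals $f$ on $T^+$. The structure group is $G=\{\Gamma_f: f \text{ multiplicative}\}$. **Kernels and models.** A kernel is a sum $K=\sum_{n\ge0}K_n$ of smooth functions with $K_n$ supported in $\{|x|_{\mathfrak s}\le2^{-n}\}$ and $\sup_{n,x}2^{-n(3+|k|)}|D^kK_n(x)|<\infty$ for every $k$. It annihilates degree $N$ if $\int K_n(x)x^k\,dx=0$ for all $n$ and $|k|\le N$. A model consists of linear maps $\Pi_x\colon T\to\mathcal D'(\mathbf R^4)$ and multiplicative functionals $\gamma_{xy}$ on $T^+$ such that $\Gamma_{xy}=\Gamma_{\gamma_{xy}}$ satisfies $\Gamma_{xy}\Gamma_{yz}=\Gamma_{xz}$ and $\Pi_x\Gamma_{xy}=\Pi_y$,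 and, for some integer $r>\frac52+\kappa$ and for all $\tau\in\mathcal W$, $|(\Pi_x\tau)(\varphi_x^\lambda)|\lesssim\lambda^{|\tau|}$ and $\|\Gamma_{xy}\tau\|_\beta\lesssim|x-y|_{\mathfrak s}^{|\tau|-\beta}$ for $\beta<|\tau|$. Here the bounds are locally uniform in $x,y$, and uniform over $\lambda\in(0,1]$ and over smooth $\varphi$ that are supported in the unit ball of $|\cdot|_{\mathfrak s}$ and have derivatives up to order $r$ bounded by $1$; $\varphi_x^\lambda$ is the parabolic rescaling of $\varphi$ around $x$. The family $\Pi$ is admissible for $K$ if $(\Pi_xX^k)(y)=(y-x)^k$ and $\Pi_x\mathcal I\tau=K*\Pi_x\tau-\Pi_x\mathcal J(x)\tau$ for $\tau\in\mathcal W$, with $\mathcal J(x)\tau=\sum_{|k|<|\tau|+2}\frac{X^k}{k!}\int D^kK(x-y)(\Pi_x\tau)(dy)$; a model is admissible if its $\Pi$ is. Given $\Pi$, let $f_x$ be the multiplicative functional on $T^+$ with $f_x(X_i)=-x_i$ and $f_x(\mathscr I_\ell\tau)=-\sum_{|k+\ell|<|\tau|+2}\frac{(-x)^k}{k!}\int D^{k+\ell}K(x-y)(\Pi_x\tau)(dy)$;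 let $F_x=\Gamma_{f_x}$ and $\boldsymbol\Pi=\Pi_xF_x^{-1}$. **Renormalisation group.** Let $\mathfrak R$ be the set of linear maps $M\colon T\to T$ that commute with $\mathcal I$ and with multiplication by every $X^k$ (that is, $M(X^k\tau)=X^kM\tau$ whenever $\tau$ and $X^k\tau$ lie in $T$), and for which there are linear maps $\Delta^M\colon T\to T\otimes T^+$ and $\hat\Delta^M\colon T^+\to T^+\otimes T^+$ with the following two properties. 1. For every kernel $K$ and every model $(\Pi,\Gamma)$ admissible for $K$, put $\Pi^M_x=(\Pi_x\otimes f_x)\Delta^M$ and $\gamma^M_{xy}=(\gamma_{xy}\otimes f_x)\hat\Delta^M$, with $f_x$ built from $\Pi$. Then $\gamma^M_{xy}$ is multiplicative, $\Pi^M$ is again admissible, $\Pi^M_x\Gamma_{\gamma^M_{xy}}=\Pi^M_y$, and the map $\boldsymbol\Pi^M$ associated with $\Pi^M$ satisfies $\boldsymbol\Pi^M=\boldsymbol\Pi M$. Each of these identities on $T$, evaluated at a symbol $\tau\in\mathcal W$ (the identity $(\Pi^M_xX^k)(y)=(y-x)^k$ excepted), is only required for kernels annihilating degree $N(\tau)$,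 where $N\colon\mathcal W\to\mathbf N$ is a fixed function. 2. For $\tau\in T_\alpha$ and $\sigma\in T^+_\alpha$ one has $\Delta^M\tau-\tau\otimes1\in T_{>\alpha}\otimes T^+$ and $\hat\Delta^M\sigma-\sigma\otimes1\in T^+_{>\alpha}\otimes T^+$. **Contractions.** Let $L_1,\dots,L_5\colon T\to T$ send $\tau\in\mathcal W$ to the sum of all expressions obtained by contracting to a point one occurrence in $\tau$ of, respectively, $\mathcal I(\Xi)^2$, $\mathcal I(\Xi)^3$, $\mathcal I(\mathcal I(\Xi)^2)\,\mathcal I(\Xi)^2$, $\mathcal I(\mathcal I(\Xi)^3)\,\mathcal I(\Xi)^2$, $\mathcal I(\mathcal I(\Xi)^3)\,\mathcal I(\Xi)$. Occurrences are counted with multiplicity, at the root or inside any factor $\mathcal I(\cdot)$; the remaining factors at the vertices of the contracted subtree become factors at the contracted vertex; an expression containing $\mathcal I(X^k)$ is $0$. For $C\in\mathbf R^5$ let $M=\exp(-\sum_iC_iL_i)$, which is well defined because $\sum_iC_iL_i$ is locally nilpotent. **Proposition.** For every sufficiently small $\kappa>0$ such that $|\tau|+2\notin\mathbf N$ for all $\tau\in\mathcal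 W$ other than the monomials $X^k$, there is a function $N\colon\mathcal W\to\mathbf N$ such that, for every $C\in\mathbf R^5$, the map $M=\exp(-\sum_iC_iL_i)$ belongs to $\mathfrak R$. Furthermore, let $\tau\in T$, let $K$ be a kernel annihilating degree $N(\bar\tau)$ for each symbol $\bar\tau$ occurring in $\tau$, and let $(\Pi,\Gamma)$ be a model admissible for $K$ such that $\Pi_x\bar\tau$ is a continuous function for all $x$ and all $\bar\tau\in T$, and such that $\Pi_x(X^k\bar\tau)=(\cdot-x)^k\,\Pi_x\bar\tau$ whenever $\bar\tau$ and $X^k\bar\tau$ lie in $T$. Then, for any $\Delta^M,\hat\Delta^M$ with property 1, the distributions $\Pi^M_x\tau$ and $\Pi_xM\tau$ are continuous functions and $$\bigl(\Pi_x^M\tau\bigr)(x)=\bigl(\Pi_xM\tau\bigr)(x)\qquad\text{for every }x\in\mathbf R^4 .$$ -/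

import Mathlib

open scoped TensorProduct ContDiff

noncomputable section

namespace Phi43

/-! ## Formal expressions -/

/-- Space-time multi-indices; the coordinate `0` is time. -/
abbrev Idx := Fin 4 →₀ ℕ

/-- One layer of a formal expression: a power of the `X_i`, a power of `Ξ`, and the unordered
family of the `σ` such that `I(σ)` is a factor. -/
def SymF (α : Type) : Type := Idx × ℕ × Multiset α

instance : QPF SymF where
  map f s := (s.1, s.2.1, s.2.2.map f)
  P := ⟨Idx × ℕ × ℕ, fun a => Fin a.2.2⟩
  abs p := (p.1.1, p.1.2.1, Finset.univ.val.map p.2)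
  repr s := ⟨(s.1, s.2.1, s.2.2.toList.length), fun i => s.2.2.toList.get i⟩
  abs_repr := by
    rintro α ⟨k, m, s⟩
    refine Prod.ext rfl (Prod.ext rfl ?_)
    change Multiset.map (fun i => s.toList.get i) (Finset.univ : Finset (Fin s.toList.length)).val = s
    rw [Fin.univ_val_map, List.ofFn_get, Multiset.coe_toList]
  abs_map := by
    rintro α β f ⟨a, g⟩
    refine Prod.ext rfl (Prod.ext rfl ?_)
    exact (Multiset.map_map f g (Finset.univ : Finset (Fin a.2.2)).val).symm

/-- Formal expressions `X^k Ξ^m ∏ I(σ)` in commuting variables: the initial algebra of `SymF`,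
i.e. the free commutative monoid on `X_0, …, X_3, Ξ` with a free unary operation `I`. -/
def Sym : Type := QPF.Fix SymF

namespace Sym

/-- The expression `X^k Ξ^m ∏_{σ ∈ s} I(σ)`. -/
def node (k : Idx) (m : ℕ) (s : Multiset Sym) : Sym := QPF.Fix.mk (F := SymF) (k, m, s)

/-- The exponent of `X`. -/
def exp (τ : Sym) : Idx := (QPF.Fix.dest (F := SymF) τ).1

/-- The exponent of `Ξ` at the root. -/
def noise (τ : Sym) : ℕ := (QPF.Fix.dest (F := SymF) τ).2.1

/-- The `σ` such that `I(σ)` is a factor, with multiplicity. -/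
def branches (τ : Sym) : Multiset Sym := (QPF.Fix.dest (F := SymF) τ).2.2

@[simp] theorem exp_node (k : Idx) (m : ℕ) (s : Multiset Sym) : (node k m s).exp = k :=
  congrArg (fun p : SymF Sym => p.1) (QPF.Fix.dest_mk (F := SymF) (k, m, s))

@[simp] theorem noise_node (k : Idx) (m : ℕ) (s : Multiset Sym) : (node k m s).noise = m :=
  congrArg (fun p : SymF Sym => p.2.1) (QPF.Fix.dest_mk (F := SymF) (k, m, s))

@[simp] theorem branches_node (k : Idx) (m : ℕ) (s : Multiset Sym) :
    (node k m s).branches = s :=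
  congrArg (fun p : SymF Sym => p.2.2) (QPF.Fix.dest_mk (F := SymF) (k, m, s))

@[simp] theorem node_eta (τ : Sym) : node τ.exp τ.noise τ.branches = τ :=
  QPF.Fix.mk_dest (F := SymF) τ

theorem induction {p : Sym → Prop}
    (h : ∀ k m s, (∀ σ ∈ s, p σ) → p (node k m s)) (τ : Sym) : p τ := by
  refine QPF.Fix.ind (F := SymF) p ?_ τ
  rintro x ⟨u, rfl⟩
  refine h u.1 u.2.1 (u.2.2.map Subtype.val) ?_
  intro σ hσ
  obtain ⟨v, _, rfl⟩ := Multiset.mem_map.1 hσ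
  exact v.2

theorem wf_branches : WellFounded (fun σ τ : Sym => σ ∈ τ.branches) := by
  refine ⟨fun τ => ?_⟩
  induction τ using Sym.induction with
  | h k m s ih => exact ⟨_, fun σ hσ => ih σ (by simpa using hσ)⟩

/-- Recursion on formal expressions: from `τ` to the `σ` for which `I(σ)` is a factor of `τ`. -/
instance : WellFoundedRelation Sym := ⟨_, wf_branches⟩

theorem ext_iff3 {σ τ : Sym} :
    σ = τ ↔ σ.exp = τ.exp ∧ σ.noise = τ.noise ∧ σ.branches = τ.branches := by
  refine ⟨by rintro rfl; simp, fun ⟨h1, h2, h3⟩ => ?_⟩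
  rw [← node_eta σ, ← node_eta τ, h1, h2, h3]

/-- Product of formal expressions. -/
instance : CommMonoid Sym where
  mul σ τ := node (σ.exp + τ.exp) (σ.noise + τ.noise) (σ.branches + τ.branches)
  one := node 0 0 0
  mul_assoc a b c := by
    change node _ _ _ = node _ _ _
    simp only [HMul.hMul, exp_node, noise_node, branches_node, add_assoc]
  one_mul a := by
    change node ((node 0 0 0).exp + a.exp) ((node 0 0 0).noise + a.noise)
      ((node 0 0 0).branches + a.branches) = a
    simp
  mul_one a := by
    change node (a.exp + (node 0 0 0).exp) (a.noise + (node 0 0 0).noise)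
      (a.branches + (node 0 0 0).branches) = a
    simp
  mul_comm a b := by
    change node _ _ _ = node _ _ _
    simp only [add_comm]

/-- The symbol `Ξ`. -/
def Xi : Sym := node 0 1 0

/-- The symbol `X^k`. -/
def Xpow (k : Idx) : Sym := node k 0 0

/-- The symbol `I(τ)`. -/
def int (τ : Sym) : Sym := node 0 0 {τ}

/-- `τ` is a Taylor monomial `X^k`. -/
def IsPoly (τ : Sym) : Prop := ∃ k, τ = Xpow k

/-- The collection `U`: the smallest one containing the `X^k` and `I(Ξ)`, and containing
`I(τ₁ τ₂ τ₃)` for `τ₁, τ₂, τ₃` in it, unless `τ₁ τ₂ τ₃` is a monomial `X^k`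
(in which case `I(τ₁ τ₂ τ₃)` is `0`). -/
inductive InU : Sym → Prop
  | mono (k : Idx) : InU (Xpow k)
  | intXi : InU (int Xi)
  | int (τ₁ τ₂ τ₃ : Sym) : InU τ₁ → InU τ₂ → InU τ₃ → ¬ IsPoly (τ₁ * τ₂ * τ₃) →
      InU (int (τ₁ * τ₂ * τ₃))

/-- The collection `W = {Ξ} ∪ {τ₁ τ₂ τ₃ : τᵢ ∈ U}`. -/
def InW (τ : Sym) : Prop :=
  τ = Xi ∨ ∃ τ₁ τ₂ τ₃, InU τ₁ ∧ InU τ₂ ∧ InU τ₃ ∧ τ = τ₁ * τ₂ * τ₃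

theorem one_eq_Xpow : (1 : Sym) = Xpow 0 := rfl

theorem InW.Xpow (k : Idx) : InW (Xpow k) :=
  Or.inr ⟨_, 1, 1, .mono k, .mono 0, .mono 0, by simp⟩

theorem InW.int {τ : Sym} (h : InW τ) (hp : ¬ IsPoly τ) : InW (int τ) := by
  refine Or.inr ⟨Sym.int τ, 1, 1, ?_, .mono 0, .mono 0, by simp⟩
  rcases h with rfl | ⟨a, b, c, ha, hb, hc, rfl⟩
  · exact .intXi
  · exact .int a b c ha hb hc hp

/-- The total number of occurrences of `Ξ`. -/
def numXi (τ : Sym) : ℕ := τ.noise + (τ.branches.attach.map fun σ => numXi σ.1).sum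
termination_by τ
decreasing_by exact σ.2

theorem numXi_eq (τ : Sym) : τ.numXi = τ.noise + (τ.branches.map numXi).sum := by
  rw [numXi, Multiset.attach_map_val' τ.branches numXi]

end Sym

/-- The degree of a multi-index in the parabolic scaling: time counts double. -/
def sdeg (k : Idx) : ℕ := 2 * k 0 + k 1 + k 2 + k 3

/-- `k!` -/
def ifac (k : Idx) : ℕ := ∏ i, (k i).factorial

/-- The multi-indices of degree `< c`. -/
def idxBelow (c : ℝ) : Finset Idx :=
  Set.Finite.toFinset (s := {k : Idx | (sdeg k : ℝ) < c}) (by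
    refine Set.Finite.subset (Set.finite_Iic (Finsupp.equivFunOnFinite.symm fun _ => ⌈c⌉₊)) ?_
    intro k hk i
    have h1 : sdeg k < ⌈c⌉₊ := Nat.lt_ceil.2 hk
    have h2 : k i ≤ sdeg k := by
      fin_cases i <;> simp [sdeg] <;> omega
    simpa using h2.trans h1.le)

/-- The homogeneity of a formal expression, with `|Ξ| = -5/2 - κ` and `|I(σ)| = |σ| + 2`. -/
def deg (κ : ℝ) (τ : Sym) : ℝ :=
  sdeg τ.exp + τ.noise * (-(5 / 2) - κ) + (τ.branches.attach.map fun σ => deg κ σ.1 + 2).sum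
termination_by τ
decreasing_by exact σ.2

theorem deg_eq (κ : ℝ) (τ : Sym) : deg κ τ =
    sdeg τ.exp + τ.noise * (-(5 / 2) - κ) + (τ.branches.map fun σ => deg κ σ + 2).sum := by
  rw [deg, Multiset.attach_map_val' τ.branches (fun σ => deg κ σ + 2)]

/-! ## The model space `T` -/

/-- The basis symbols of `T`. -/
abbrev W : Type := {τ : Sym // τ.InW}

/-- The model space: linear combinations of elements of `W`. -/
abbrev T : Type := W →₀ ℝ

/-- The algebra of linear combinations of arbitrary formal expressions, which contains `T`. -/
abbrev Amb : Type := MonoidAlgebra ℝ Sym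

/-- The basis element of `T` given by a symbol. -/
def sym (w : W) : T := Finsupp.single w 1

/-- The basis element `X^k` of `T`. -/
def mono (k : Idx) : T := sym ⟨Sym.Xpow k, Sym.InW.Xpow k⟩

/-- The inclusion of `T` into the ambient algebra. -/
def incl : T →ₗ[ℝ] Amb :=
  Finsupp.lift Amb ℝ W fun w => MonoidAlgebra.of ℝ Sym w.1

open Classical in
/-- The projection of the ambient algebra onto `T`; it annihilates the symbols outside `W`. -/
def proj : Amb →ₗ[ℝ] T :=
  (Finsupp.lift T ℝ Sym fun τ => if h : τ.InW then sym ⟨τ, h⟩ else 0) ∘ₗ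
    (MonoidAlgebra.coeffLinearEquiv ℝ).toLinearMap

open Classical in
/-- Abstract integration on the ambient algebra, with the convention `I(X^k) = 0`. -/
def intA : Amb →ₗ[ℝ] Amb :=
  (Finsupp.lift Amb ℝ Sym fun τ => if τ.IsPoly then 0 else MonoidAlgebra.of ℝ Sym τ.int) ∘ₗ
    (MonoidAlgebra.coeffLinearEquiv ℝ).toLinearMap

/-- The abstract integration map `I : T → T`. -/
def intT : T →ₗ[ℝ] T := proj ∘ₗ intA ∘ₗ incl

/-! ## The space `T⁺`, the map `Δ` and the structure group -/

/-- The index set of the symbols `𝓘_ℓ(τ)`: here `τ ∈ W` is not a monomial, `|ℓ| < |τ| + 2`. -/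
abbrev JGen (κ : ℝ) : Type :=
  {p : Idx × Sym // p.2.InW ∧ ¬ p.2.IsPoly ∧ (sdeg p.1 : ℝ) < deg κ p.2 + 2}

/-- `T⁺` consists of the polynomials in the commuting symbols `X_i` and `𝓘_ℓ(τ)`. -/
abbrev Tp (κ : ℝ) : Type := MvPolynomial (Fin 4 ⊕ JGen κ) ℝ

/-- The degrees of the generators of `T⁺`. -/
def genDeg (κ : ℝ) : Fin 4 ⊕ JGen κ → ℝ
  | .inl i => sdeg (Finsupp.single i 1)
  | .inr p => deg κ p.1.2 + 2 - sdeg p.1.1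

open Classical in
/-- `𝓘_ℓ(τ)` as an element of `T⁺`, understood as `0` when it is not one of the generators. -/
def JJ (κ : ℝ) (l : Idx) (τ : Sym) : Tp κ :=
  if h : τ.InW ∧ ¬ τ.IsPoly ∧ (sdeg l : ℝ) < deg κ τ + 2 then
    MvPolynomial.X (Sum.inr ⟨(l, τ), h⟩) else 0

/-- `Δ` on formal expressions. It is multiplicative, with `ΔX_i = X_i ⊗ 1 + 1 ⊗ X_i`, `ΔΞ = Ξ ⊗ 1`,
`ΔI(σ) = (I ⊗ id) Δσ + ∑_k X^k / k! ⊗ 𝓘_k(σ)`. -/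
def deltaA (κ : ℝ) (τ : Sym) : Amb ⊗[ℝ] Tp κ :=
  (∏ i, (MonoidAlgebra.of ℝ Sym (Sym.Xpow (Finsupp.single i 1)) ⊗ₜ[ℝ] (1 : Tp κ)
      + (1 : Amb) ⊗ₜ[ℝ] MvPolynomial.X (Sum.inl i)) ^ τ.exp i)
    * (MonoidAlgebra.of ℝ Sym Sym.Xi ⊗ₜ[ℝ] (1 : Tp κ)) ^ τ.noise
    * (τ.branches.attach.map fun σ =>
        LinearMap.rTensor (Tp κ) intA (deltaA κ σ.1)
        + ∑ k ∈ idxBelow (deg κ σ.1 + 2), ((ifac k : ℝ)⁻¹ •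
            (MonoidAlgebra.of ℝ Sym (Sym.Xpow k) ⊗ₜ[ℝ] JJ κ k σ.1))).prod
termination_by τ
decreasing_by exact σ.2

/-- The map `Δ : T → T ⊗ T⁺`. -/
def Delta (κ : ℝ) : T →ₗ[ℝ] T ⊗[ℝ] Tp κ :=
  Finsupp.lift (T ⊗[ℝ] Tp κ) ℝ W fun w => LinearMap.rTensor (Tp κ) proj (deltaA κ w.1)

/-- `id ⊗ f : V ⊗ T⁺ → V` for a linear functional `f` on `T⁺`. -/
def slice {κ : ℝ} (V : Type) [AddCommGroup V] [Module ℝ V] (f : Tp κ →ₗ[ℝ] ℝ) :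
    V ⊗[ℝ] Tp κ →ₗ[ℝ] V :=
  (TensorProduct.rid ℝ V).toLinearMap ∘ₗ LinearMap.lTensor V f

/-- `Γ_f = (id ⊗ f) Δ`. The structure group consists of the `Γ_f` with `f` multiplicative. -/
def Gam {κ : ℝ} (f : Tp κ →ₗ[ℝ] ℝ) : T →ₗ[ℝ] T := slice T f ∘ₗ Delta κ

/-! ## The contraction rules and the maps `M` -/

open Classical in
/-- All ways of removing `j` factors `I(Ξ)` from a product of factors `I(σ)`, `σ ∈ B`: the
multiset of what is left, one entry for each choice of `j` occurrences. -/
def removeLeaves (j : ℕ) (B : Multiset Sym) : Multiset (Multiset Sym) :=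
  (B.antidiagonal.filter fun p => p.1 = Multiset.replicate j Sym.Xi).map Prod.snd

/-- The sum over all replacements by `1` of a factor `I(Ξ)^j` at the root of `τ`. -/
def contractLeaves (j : ℕ) (τ : Sym) : Amb :=
  ((removeLeaves j τ.branches).map fun u =>
    MonoidAlgebra.of ℝ Sym (Sym.node τ.exp τ.noise u)).sum

open Classical in
/-- The sum over all contractions to a point of a subtree `I(I(Ξ)^i) I(Ξ)^j` which contains the
root of `τ`. The factors which do not belong to the subtree stay attached to the contracted
vertex. -/
def contractCherry (i j : ℕ) (τ : Sym) : Amb :=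
  (τ.branches.map fun a =>
    ((removeLeaves j (τ.branches.erase a)).map fun u =>
      ((removeLeaves i a.branches).map fun v =>
        MonoidAlgebra.of ℝ Sym (Sym.node (τ.exp + a.exp) (τ.noise + a.noise) (u + v))).sum).sum).sum

/-- The five contractions at the root. The patterns are, in this order,
`I(Ξ)^2`, `I(Ξ)^3`, `I(I(Ξ)^2) I(Ξ)^2`, `I(I(Ξ)^3) I(Ξ)^2`, `I(I(Ξ)^3) I(Ξ)`. -/
def contractRoot : Fin 5 → Sym → Amb
  | 0 => contractLeaves 2
  | 1 => contractLeaves 3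
  | 2 => contractCherry 2 2
  | 3 => contractCherry 3 2
  | 4 => contractCherry 3 1

open Classical in
/-- The sum over all contractions of the `i`-th pattern anywhere in `τ`: either at the root, or
inside one of the factors `I(σ)`. -/
def contractA (i : Fin 5) (τ : Sym) : Amb :=
  contractRoot i τ + (τ.branches.attach.map fun σ =>
    intA (contractA i σ.1) *
      MonoidAlgebra.of ℝ Sym (Sym.node τ.exp τ.noise (τ.branches.erase σ.1))).sum
termination_by τ
decreasing_by exact σ.2

/-- The generators `L_1, …, L_5`, as linear maps on `T`. -/
def contract (i : Fin 5) : T →ₗ[ℝ] T :=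
  Finsupp.lift T ℝ W fun w => proj (contractA i w.1)

/-- The exponential of a locally nilpotent linear map. -/
def expT (A : Module.End ℝ T) : T →ₗ[ℝ] T :=
  Finsupp.lift T ℝ W fun w => ∑ᶠ n : ℕ, ((n.factorial : ℝ)⁻¹ • (A ^ n) (sym w))

/-- `M = exp(-∑ C_i L_i)`. -/
def renormMap (C : Fin 5 → ℝ) : T →ₗ[ℝ] T := expT (-∑ i, C i • contract i)

/-- The span of the formal expressions with fewer than `n` occurrences of `Ξ`. -/
def lowA (n : ℕ) : Submodule ℝ Amb :=
  Submodule.span ℝ {a | ∃ τ : Sym, τ.numXi < n ∧ a = MonoidAlgebra.of ℝ Sym τ}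

/-- The elements of `T` all of whose symbols have fewer than `n` occurrences of `Ξ`. -/
def lowT (n : ℕ) : Submodule ℝ T := Finsupp.supported ℝ ℝ {w | w.1.numXi < n}

theorem Sym.numXi_node (k : Idx) (m : ℕ) (s : Multiset Sym) :
    (Sym.node k m s).numXi = m + (s.map Sym.numXi).sum := by
  rw [Sym.numXi_eq]; simp

theorem Sym.numXi_mul (σ τ : Sym) : (σ * τ).numXi = σ.numXi + τ.numXi := by
  change (Sym.node _ _ _).numXi = _
  rw [Sym.numXi_node, σ.numXi_eq, τ.numXi_eq, Multiset.map_add, Multiset.sum_add]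
  omega

theorem removeLeaves_numXi {j : ℕ} {B u : Multiset Sym} (h : u ∈ removeLeaves j B) :
    (u.map Sym.numXi).sum + j = (B.map Sym.numXi).sum := by
  classical
  obtain ⟨p, hp, rfl⟩ := Multiset.mem_map.1 h
  obtain ⟨h1, h2⟩ := Multiset.mem_filter.1 hp
  rw [Multiset.mem_antidiagonal] at h1
  rw [← h1, h2, Multiset.map_add, Multiset.sum_add, Multiset.map_replicate,
    Multiset.sum_replicate]
  have : Sym.Xi.numXi = 1 := by rw [Sym.Xi, Sym.numXi_node]; simp
  rw [this]; simp [add_comm]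

theorem contractLeaves_mem {j : ℕ} (hj : 0 < j) (τ : Sym) : contractLeaves j τ ∈ lowA τ.numXi := by
  refine _root_.multiset_sum_mem _ fun a ha => ?_
  obtain ⟨u, hu, rfl⟩ := Multiset.mem_map.1 ha
  refine Submodule.subset_span ⟨_, ?_, rfl⟩
  have := removeLeaves_numXi hu
  rw [Sym.numXi_node, τ.numXi_eq]; omega

theorem contractCherry_mem {i j : ℕ} (hj : 0 < j) (τ : Sym) :
    contractCherry i j τ ∈ lowA τ.numXi := by
  classical
  refine _root_.multiset_sum_mem _ fun x hx => ?_
  obtain ⟨a, ha, rfl⟩ := Multiset.mem_map.1 hx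
  refine _root_.multiset_sum_mem _ fun x hx => ?_
  obtain ⟨u, hu, rfl⟩ := Multiset.mem_map.1 hx
  refine _root_.multiset_sum_mem _ fun x hx => ?_
  obtain ⟨v, hv, rfl⟩ := Multiset.mem_map.1 hx
  refine Submodule.subset_span ⟨_, ?_, rfl⟩
  have h1 := removeLeaves_numXi hu
  have h2 := removeLeaves_numXi hv
  have h3 : (τ.branches.map Sym.numXi).sum
      = a.numXi + ((τ.branches.erase a).map Sym.numXi).sum := by
    conv_lhs => rw [← Multiset.cons_erase ha]
    rw [Multiset.map_cons, Multiset.sum_cons]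
  rw [Sym.numXi_node, τ.numXi_eq, h3, a.numXi_eq, Multiset.map_add, Multiset.sum_add]
  have h4 : ((Multiset.map Sym.numXi u).sum + j : ℕ) =
    ((τ.branches.erase a).map Sym.numXi).sum := by convert h1
  omega

theorem intA_mem {n : ℕ} {a : Amb} (ha : a ∈ lowA n) : intA a ∈ lowA n := by
  refine (Submodule.span_le (p := (lowA n).comap intA)).2 ?_ ha
  rintro _ ⟨τ, hτ, rfl⟩
  change intA _ ∈ lowA n
  by_cases h : τ.IsPoly
  · simp [intA, MonoidAlgebra.of_apply, h]
  · have : intA (MonoidAlgebra.of ℝ Sym τ) = MonoidAlgebra.of ℝ Sym τ.int := by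
      simp [intA, MonoidAlgebra.of_apply, h]
    rw [this]
    refine Submodule.subset_span ⟨_, ?_, rfl⟩
    rw [Sym.int, Sym.numXi_node]; simpa using hτ

theorem mul_of_mem {n : ℕ} {a : Amb} (ha : a ∈ lowA n) (τ : Sym) :
    a * MonoidAlgebra.of ℝ Sym τ ∈ lowA (n + τ.numXi) := by
  refine (Submodule.span_le
    (p := (lowA (n + τ.numXi)).comap (LinearMap.mulRight ℝ (MonoidAlgebra.of ℝ Sym τ)))).2 ?_ ha
  rintro _ ⟨σ, hσ, rfl⟩
  change MonoidAlgebra.of ℝ Sym σ * MonoidAlgebra.of ℝ Sym τ ∈ lowA (n + τ.numXi)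
  rw [← map_mul]
  refine Submodule.subset_span ⟨_, ?_, rfl⟩
  rw [Sym.numXi_mul]; omega

theorem contractA_mem (i : Fin 5) (τ : Sym) : contractA i τ ∈ lowA τ.numXi := by
  classical
  induction τ using Sym.induction with
  | h k m s ih =>
    rw [contractA]
    refine add_mem ?_ (_root_.multiset_sum_mem _ fun x hx => ?_)
    · fin_cases i
      · exact contractLeaves_mem (by norm_num) _
      · exact contractLeaves_mem (by norm_num) _
      · exact contractCherry_mem (by norm_num) _
      · exact contractCherry_mem (by norm_num) _
      · exact contractCherry_mem (by norm_num) _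
    · obtain ⟨σ, -, rfl⟩ := Multiset.mem_map.1 hx
      have hσ : σ.1 ∈ s := by simpa using σ.2
      convert mul_of_mem (intA_mem (ih σ.1 hσ)) _ using 2
      rw [Sym.numXi_node, Sym.numXi_node]
      simp only [Sym.noise_node, Sym.branches_node]
      conv_lhs => rw [← Multiset.cons_erase hσ]
      rw [Multiset.map_cons, Multiset.sum_cons]
      have : s.erase σ.1 = (Sym.node k m s).branches.erase σ.1 := by simp
      rw [this]
      have h2 : ∀ a b c : ℕ, a + (b + c) = b + (a + c) := by omega
      rw [h2]

theorem proj_mem {n : ℕ} {a : Amb} (ha : a ∈ lowA n) : proj a ∈ lowT n := by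
  refine (Submodule.span_le (p := (lowT n).comap proj)).2 ?_ ha
  rintro _ ⟨τ, hτ, rfl⟩
  change proj _ ∈ lowT n
  by_cases h : τ.InW
  · have : proj (MonoidAlgebra.of ℝ Sym τ) = sym ⟨τ, h⟩ := by
      simp [proj, MonoidAlgebra.of_apply, h]
    rw [this]
    exact Finsupp.single_mem_supported ℝ 1 hτ
  · simp [proj, MonoidAlgebra.of_apply, h]

/-- Each contraction strictly decreases the number of occurrences of `Ξ`. -/
theorem contract_mem (i : Fin 5) {n : ℕ} {t : T} (ht : t ∈ lowT (n + 1)) :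
    contract i t ∈ lowT n := by
  rw [contract, Finsupp.lift_apply]
  refine Submodule.sum_mem _ fun w hw => Submodule.smul_mem _ _ ?_
  have h1 : w.1.numXi < n + 1 := (Finsupp.mem_supported ℝ t).1 ht hw
  have h2 : lowT w.1.numXi ≤ lowT n :=
    Finsupp.supported_mono fun v (hv : v.1.numXi < w.1.numXi) => by
      change v.1.numXi < n
      omega
  exact h2 (proj_mem (contractA_mem i w.1))

/-- The map `∑ C_i L_i` is locally nilpotent, so that the sums which define `exp(-∑ C_i L_i)`
are finite. -/
theorem sum_contract_pow (C : Fin 5 → ℝ) (w : W) (n : ℕ) (hn : w.1.numXi < n) :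
    ((-∑ i, C i • contract i : Module.End ℝ T) ^ n) (sym w) = 0 := by
  have key : ∀ m : ℕ, ∀ t ∈ lowT m, ((-∑ i, C i • contract i : Module.End ℝ T) ^ m) t = 0 := by
    intro m
    induction m with
    | zero =>
      intro t ht
      have : t = 0 := by
        rw [← Finsupp.support_eq_empty, ← Finset.coe_eq_empty, ← Set.subset_empty_iff]
        intro v hv
        exact absurd ((Finsupp.mem_supported ℝ t).1 ht hv) (Nat.not_lt_zero _)
      simp [this]
    | succ m ih =>
      intro t ht
      rw [pow_succ, Module.End.mul_apply]
      refine ih _ ?_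
      rw [LinearMap.neg_apply, LinearMap.sum_apply]
      exact neg_mem (Submodule.sum_mem _ fun i _ => Submodule.smul_mem _ _ (contract_mem i ht))
  exact key n _ (Finsupp.single_mem_supported ℝ 1 hn)

/-! ## Kernels and distributions on space-time -/

/-- Space-time points; the coordinate `0` is time. -/
abbrev Pt : Type := Fin 4 → ℝ

/-- Smooth compactly supported functions on space-time. -/
abbrev TestFn : Type := TestFunction (⊤ : TopologicalSpace.Opens Pt) ℝ ⊤

/-- Distributions on space-time. -/
abbrev Dist : Type := Distribution (⊤ : TopologicalSpace.Opens Pt) ℝ ⊤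

/-- The parabolic distance of `x` to the origin. -/
def snorm (x : Pt) : ℝ := Real.sqrt |x 0| + |x 1| + |x 2| + |x 3|

/-- `x^k` -/
def ipow (x : Pt) (k : Idx) : ℝ := ∏ i, x i ^ k i

/-- The partial derivative in the `i`-th direction. -/
def pd (i : Fin 4) (f : Pt → ℝ) : Pt → ℝ := fun x => fderiv ℝ f x (Pi.single i 1)

/-- The partial derivative `D^k`. -/
def pdk (k : Idx) (f : Pt → ℝ) : Pt → ℝ :=
  (pd 0)^[k 0] ((pd 1)^[k 1] ((pd 2)^[k 2] ((pd 3)^[k 3] f)))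

theorem contDiff_pd (i : Fin 4) {f : Pt → ℝ} (hf : ContDiff ℝ ∞ f) : ContDiff ℝ ∞ (pd i f) :=
  (hf.fderiv_right (m := ∞) (by simp)).clm_apply contDiff_const

theorem contDiff_pd_iter (i : Fin 4) (n : ℕ) {f : Pt → ℝ} (hf : ContDiff ℝ ∞ f) :
    ContDiff ℝ ∞ ((pd i)^[n] f) := by
  induction n with
  | zero => exact hf
  | succ n ih => rw [Function.iterate_succ_apply']; exact contDiff_pd i ih

theorem contDiff_pdk (k : Idx) {f : Pt → ℝ} (hf : ContDiff ℝ ∞ f) : ContDiff ℝ ∞ (pdk k f) :=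
  contDiff_pd_iter 0 _ (contDiff_pd_iter 1 _ (contDiff_pd_iter 2 _ (contDiff_pd_iter 3 _ hf)))

theorem hasCompactSupport_pd (i : Fin 4) {f : Pt → ℝ} (hf : HasCompactSupport f) :
    HasCompactSupport (pd i f) :=
  (hf.fderiv (𝕜 := ℝ)).comp_left (g := fun L : Pt →L[ℝ] ℝ => L (Pi.single i 1)) rfl

theorem hasCompactSupport_pd_iter (i : Fin 4) (n : ℕ) {f : Pt → ℝ} (hf : HasCompactSupport f) :
    HasCompactSupport ((pd i)^[n] f) := by
  induction n with
  | zero => exact hf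
  | succ n ih => rw [Function.iterate_succ_apply']; exact hasCompactSupport_pd i ih

theorem hasCompactSupport_pdk (k : Idx) {f : Pt → ℝ} (hf : HasCompactSupport f) :
    HasCompactSupport (pdk k f) :=
  hasCompactSupport_pd_iter 0 _ (hasCompactSupport_pd_iter 1 _
    (hasCompactSupport_pd_iter 2 _ (hasCompactSupport_pd_iter 3 _ hf)))

/-- A kernel `K = ∑_n K_n` which is regularising of order `2` for the parabolic scaling, in which
space-time has effective dimension `5`. -/
structure Kernel where
  /-- The pieces `K_n`. -/
  part : ℕ → Pt → ℝ
  smooth : ∀ n, ContDiff ℝ ∞ (part n)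
  support : ∀ n y, part n y ≠ 0 → snorm y ≤ (2 : ℝ)⁻¹ ^ n
  bound : ∀ k : Idx, ∃ C : ℝ, ∀ n y, |pdk k (part n) y| ≤ C * 2 ^ (n * (3 + sdeg k))

/-- The pieces of the kernel annihilate all polynomials of (parabolic) degree at most `N`. -/
def Kernel.Annihilates (K : Kernel) (N : ℕ) : Prop :=
  ∀ n (k : Idx), sdeg k ≤ N → ∫ y, K.part n y * ipow y k = 0

theorem Kernel.hasCompactSupport (K : Kernel) (n : ℕ) : HasCompactSupport (K.part n) := by
  refine HasCompactSupport.of_support_subset_isCompact (isCompact_closedBall (0 : Pt) 1) ?_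
  intro y hy
  have h1 : snorm y ≤ 1 :=
    (K.support n y hy).trans (pow_le_one₀ (by norm_num) (by norm_num))
  have h0 := Real.sqrt_nonneg |y 0|
  have hs : |y 0| ≤ 1 := by
    have h2 : Real.sqrt |y 0| ≤ 1 := by
      unfold snorm at h1
      linarith [abs_nonneg (y 1), abs_nonneg (y 2), abs_nonneg (y 3)]
    nlinarith [Real.sq_sqrt (abs_nonneg (y 0))]
  unfold snorm at h1
  rw [mem_closedBall_zero_iff, pi_norm_le_iff_of_nonneg zero_le_one]
  intro i
  rw [Real.norm_eq_abs]
  fin_cases i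
  · exact hs
  · change |y 1| ≤ 1
    linarith [abs_nonneg (y 1), abs_nonneg (y 2), abs_nonneg (y 3)]
  · change |y 2| ≤ 1
    linarith [abs_nonneg (y 1), abs_nonneg (y 2), abs_nonneg (y 3)]
  · change |y 3| ≤ 1
    linarith [abs_nonneg (y 1), abs_nonneg (y 2), abs_nonneg (y 3)]

/-- The test function `y ↦ (D^k K_n)(x - y)`. -/
def Kernel.testD (K : Kernel) (n : ℕ) (k : Idx) (x : Pt) : TestFn where
  toFun y := pdk k (K.part n) (x - y)
  contDiff' := (contDiff_pdk k (K.smooth n)).comp (contDiff_const.sub contDiff_id)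
  hasCompactSupport' :=
    (hasCompactSupport_pdk k (K.hasCompactSupport n)).comp_homeomorph (Homeomorph.subLeft x)
  tsupport_subset' := fun _ _ => trivial

/-- The test function `y ↦ ∫ φ(z) K_n(z - y) dz`. -/
def Kernel.testConv (K : Kernel) (n : ℕ) (φ : TestFn) : TestFn where
  toFun y := ∫ z, φ z * K.part n (z - y)
  contDiff' := by
    have h := HasCompactSupport.contDiff_convolution_right (n := ⊤) (μ := MeasureTheory.volume)
      (ContinuousLinearMap.mul ℝ ℝ)
      ((K.hasCompactSupport n).comp_homeomorph (Homeomorph.neg Pt))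
      φ.continuous.locallyIntegrable ((K.smooth n).comp contDiff_neg)
    convert h using 2 with y
    simp [MeasureTheory.convolution_def]
  hasCompactSupport' := by
    have h := HasCompactSupport.convolution (μ := MeasureTheory.volume)
      (ContinuousLinearMap.mul ℝ ℝ) φ.hasCompactSupport
      ((K.hasCompactSupport n).comp_homeomorph (Homeomorph.neg Pt))
    convert h using 2 with y
    simp [MeasureTheory.convolution_def]
  tsupport_subset' := fun _ _ => trivial

/-- `∫ D^k K(x - y) η(dy)`, understood as the sum over `n` of `η` tested against
`(D^k K_n)(x - ·)`. -/
def Kernel.jet (K : Kernel) (η : Dist) (k : Idx) (x : Pt) : ℝ := ∑' n, η (K.testD n k x)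

/-! ## Admissible models -/

/-- The multiplicative functional `f_x` on `T⁺` associated with the maps `Π_x`. -/
def fchar (κ : ℝ) (K : Kernel) (Pi : Pt → T →ₗ[ℝ] Dist) (x : Pt) : Tp κ →ₐ[ℝ] ℝ :=
  MvPolynomial.aeval fun g => match g with
    | .inl i => - x i
    | .inr p => - ∑ k ∈ idxBelow (deg κ p.1.2 + 2 - sdeg p.1.1),
        ipow (-x) k / ifac k * K.jet (Pi x (sym ⟨p.1.2, p.2.1⟩)) (p.1.1 + k) x

/-- `F_x = (id ⊗ f_x) Δ`. -/
def Fmap (κ : ℝ) (K : Kernel) (Pi : Pt → T →ₗ[ℝ] Dist) (x : Pt) : T →ₗ[ℝ] T :=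
  Gam (fchar κ K Pi x).toLinearMap

/-- `𝚷 = Π_x F_x⁻¹`. -/
def bold (κ : ℝ) (K : Kernel) (Pi : Pt → T →ₗ[ℝ] Dist) (x : Pt) : T →ₗ[ℝ] Dist :=
  Pi x ∘ₗ (Ring.inverse (Fmap κ K Pi x : Module.End ℝ T) : Module.End ℝ T)

/-- `𝒥(x) τ = ∑_{|k| < |τ| + 2} X^k / k! ∫ D^k K(x - y) (Π_x τ)(dy)`. -/
def Jmap (κ : ℝ) (K : Kernel) (Pi : Pt → T →ₗ[ℝ] Dist) (x : Pt) (w : W) : T :=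
  ∑ k ∈ idxBelow (deg κ w.1 + 2), (K.jet (Pi x (sym w)) k x / ifac k) • mono k

/-- `(Π_x X^k)(y) = (y - x)^k`. -/
def AdmissiblePoly (Pi : Pt → T →ₗ[ℝ] Dist) : Prop :=
  ∀ (x : Pt) (k : Idx) (φ : TestFn), Pi x (mono k) φ = ∫ y, ipow (y - x) k * φ y

/-- `Π_x I τ = K * Π_x τ - Π_x 𝒥(x) τ` for the symbol `τ`; the convergence of the series over `n`
which define `K * Π_x τ` and `𝒥(x) τ` is part of the assertion. -/
def AdmissibleInt (κ : ℝ) (K : Kernel) (Pi : Pt → T →ₗ[ℝ] Dist) (w : W) : Prop :=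
  ∀ x : Pt,
    (∀ k ∈ idxBelow (deg κ w.1 + 2), Summable fun n => Pi x (sym w) (K.testD n k x)) ∧
    ∀ φ : TestFn, HasSum (fun n => Pi x (sym w) (K.testConv n φ))
      (Pi x (intT (sym w)) φ + Pi x (Jmap κ K Pi x w) φ)

/-- The class of smooth functions supported in the unit ball around the origin, all of whose
derivatives of order at most `r` are bounded by `1`. -/
def Bump (r : ℕ) : Set (Pt → ℝ) :=
  {φ | ContDiff ℝ ∞ φ ∧ (∀ y, φ y ≠ 0 → snorm y ≤ 1) ∧
    ∀ k : Idx, k 0 + k 1 + k 2 + k 3 ≤ r → ∀ y, |pdk k φ y| ≤ 1}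

/-- `φ_x^λ (t, y) = λ⁻⁵ φ(λ⁻² (t - s), λ⁻¹ (y - x))` for the point `(s, x)`. -/
def rescale (φ : Pt → ℝ) (x : Pt) (l : ℝ) : Pt → ℝ := fun y =>
  (l ^ 5)⁻¹ * φ fun i => if i = 0 then (l ^ 2)⁻¹ * (y i - x i) else l⁻¹ * (y i - x i)

/-- Models. The element `Γ_{xy}` of the structure group is given by the corresponding
multiplicative functional `γ_{xy}` on `T⁺`. Since there are finitely many symbols below each
homogeneity, it suffices to write the bounds for the basis symbols. -/
structure Model (κ : ℝ) where
  Pi : Pt → T →ₗ[ℝ] Dist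
  γ : Pt → Pt → Tp κ →ₐ[ℝ] ℝ
  Γ_mul : ∀ x y z, Gam (γ x y).toLinearMap ∘ₗ Gam (γ y z).toLinearMap = Gam (γ x z).toLinearMap
  Pi_Γ : ∀ x y, Pi x ∘ₗ Gam (γ x y).toLinearMap = Pi y
  r : ℕ
  r_gt : 5 / 2 + κ < r
  Pi_bound : ∀ S : Set Pt, IsCompact S → ∀ w : W, ∃ C : ℝ, ∀ x ∈ S, ∀ l : ℝ, 0 < l → l ≤ 1 →
    ∀ φ ∈ Bump r, ∀ ψ : TestFn, ⇑ψ = rescale φ x l → |Pi x (sym w) ψ| ≤ C * l ^ deg κ w.1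
  Γ_bound : ∀ S : Set Pt, IsCompact S → ∀ w v : W, deg κ v.1 < deg κ w.1 → ∃ C : ℝ,
    ∀ x ∈ S, ∀ y ∈ S, |Gam (γ x y).toLinearMap (sym w) v|
      ≤ C * snorm (x - y) ^ (deg κ w.1 - deg κ v.1)

/-- Admissible models for the kernel `K`. -/
def Model.Admissible {κ : ℝ} (Z : Model κ) (K : Kernel) : Prop :=
  AdmissiblePoly Z.Pi ∧ ∀ w, AdmissibleInt κ K Z.Pi w

/-- The continuous function `g` represents the distribution `η`. -/
def IsContRep (η : Dist) (g : Pt → ℝ) : Prop :=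
  Continuous g ∧ ∀ φ : TestFn, η φ = ∫ y, g y * φ y

/-- All the `Π_x τ` are continuous functions. -/
def Model.IsContinuous {κ : ℝ} (Z : Model κ) : Prop := ∀ x τ, ∃ g, IsContRep (Z.Pi x τ) g

/-- `σ = X^k τ` in `T`. -/
def IsMonoMul (k : Idx) (τ σ : T) : Prop :=
  incl σ = MonoidAlgebra.of ℝ Sym (Sym.Xpow k) * incl τ

/-- `Π_x (X^k τ) = (· - x)^k Π_x τ` whenever `X^k τ` belongs to `T`. -/
def Model.RespectsX {κ : ℝ} (Z : Model κ) : Prop :=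
  ∀ (k : Idx) (τ σ : T), IsMonoMul k τ σ → ∀ (x : Pt) (φ ψ : TestFn),
    (∀ y, ψ y = ipow (y - x) k * φ y) → Z.Pi x σ φ = Z.Pi x τ ψ

/-! ## The renormalisation group -/

/-- `Π_x^M = (Π_x ⊗ f_x) Δ^M`. -/
def PiM {κ : ℝ} (Z : Model κ) (K : Kernel) (ΔM : T →ₗ[ℝ] T ⊗[ℝ] Tp κ) (x : Pt) :
    T →ₗ[ℝ] Dist :=
  Z.Pi x ∘ₗ slice T (fchar κ K Z.Pi x).toLinearMap ∘ₗ ΔM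

/-- `γ_{xy}^M = (γ_{xy} ⊗ f_x) Δ̂^M`. -/
def gamM {κ : ℝ} (Z : Model κ) (K : Kernel) (ΔhM : Tp κ →ₗ[ℝ] Tp κ ⊗[ℝ] Tp κ) (x y : Pt) :
    Tp κ →ₗ[ℝ] ℝ :=
  (Z.γ x y).toLinearMap ∘ₗ slice (Tp κ) (fchar κ K Z.Pi x).toLinearMap ∘ₗ ΔhM

/-- The maps `Δ^M`, `Δ̂^M` describe the action of `M` on admissible models: for every kernel `K`
and every admissible model, `γ^M` is multiplicative, the `Π^M` are again admissible,
`Π_x^M Γ_{xy}^M = Π_y^M`, and the map `𝚷^M` associated with `Π^M` is `𝚷 M`. As always, `K` has to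
annihilate polynomials of a sufficiently high degree, here depending on the symbol `τ` to which
these identities are applied: the degree `N τ` suffices. -/
structure Describes (κ : ℝ) (N : W → ℕ) (M : T →ₗ[ℝ] T) (ΔM : T →ₗ[ℝ] T ⊗[ℝ] Tp κ)
    (ΔhM : Tp κ →ₗ[ℝ] Tp κ ⊗[ℝ] Tp κ) : Prop where
  γ_one : ∀ (K : Kernel) (Z : Model κ), Z.Admissible K → ∀ x y, gamM Z K ΔhM x y 1 = 1
  γ_mul : ∀ (K : Kernel) (Z : Model κ), Z.Admissible K → ∀ x y σ σ',
    gamM Z K ΔhM x y (σ * σ') = gamM Z K ΔhM x y σ * gamM Z K ΔhM x y σ'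
  poly : ∀ (K : Kernel) (Z : Model κ), Z.Admissible K → AdmissiblePoly (PiM Z K ΔM)
  int : ∀ (w : W) (K : Kernel), K.Annihilates (N w) → ∀ Z : Model κ, Z.Admissible K →
    AdmissibleInt κ K (PiM Z K ΔM) w
  Pi_Γ : ∀ (w : W) (K : Kernel), K.Annihilates (N w) → ∀ Z : Model κ, Z.Admissible K →
    ∀ x y, PiM Z K ΔM x (Gam (gamM Z K ΔhM x y) (sym w)) = PiM Z K ΔM y (sym w)
  bold : ∀ (w : W) (K : Kernel), K.Annihilates (N w) → ∀ Z : Model κ, Z.Admissible K →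
    ∀ x y, bold κ K (PiM Z K ΔM) x (sym w) = bold κ K Z.Pi y (M (sym w))

/-- `T_α` -/
def Teq (κ α : ℝ) : Submodule ℝ T := Finsupp.supported ℝ ℝ {w | deg κ w.1 = α}

/-- `T_{>α}` -/
def Tgt (κ α : ℝ) : Submodule ℝ T := Finsupp.supported ℝ ℝ {w | α < deg κ w.1}

/-- `T⁺_α` -/
def Tpeq (κ α : ℝ) : Submodule ℝ (Tp κ) :=
  MvPolynomial.weightedHomogeneousSubmodule ℝ (genDeg κ) α

/-- `T⁺_{>α}` -/
def Tpgt (κ α : ℝ) : Submodule ℝ (Tp κ) := ⨆ β : Set.Ioi α, Tpeq κ β.1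

/-- `V ⊗ T⁺` as a subspace of `E ⊗ T⁺`, for a subspace `V` of `E`. -/
def tensorTp (κ : ℝ) {E : Type} [AddCommGroup E] [Module ℝ E] (V : Submodule ℝ E) :
    Submodule ℝ (E ⊗[ℝ] Tp κ) :=
  LinearMap.range (LinearMap.rTensor (Tp κ) V.subtype)

/-- The renormalisation group. -/
def RenormGroup (κ : ℝ) (N : W → ℕ) : Set (T →ₗ[ℝ] T) :=
  {M | (∀ τ, M (intT τ) = intT (M τ)) ∧
    (∀ (k : Idx) (τ σ : T), IsMonoMul k τ σ → IsMonoMul k (M τ) (M σ)) ∧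
    ∃ ΔM ΔhM, Describes κ N M ΔM ΔhM ∧
      (∀ α, ∀ τ ∈ Teq κ α, ΔM τ - τ ⊗ₜ[ℝ] (1 : Tp κ) ∈ tensorTp κ (Tgt κ α)) ∧
      (∀ α, ∀ σ ∈ Tpeq κ α, ΔhM σ - σ ⊗ₜ[ℝ] (1 : Tp κ) ∈ tensorTp κ (Tpgt κ α))}

end Phi43

end

noncomputable section

namespace Phi43

/-! ## The monoid of formal expressions -/

namespace Sym

/-! Write M_f for `renB f c`, a linear map attached to a character f of T⁺ and to the constants c.
For f = f_x it gives Π^M_x = Π_x M_f, and for the trivial character it is M itself. Its form is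
dictated by two facts. First, at most one contraction fits at a vertex: a symbol of W has at most
three branches per vertex, and every pattern uses so many of them that the contracted vertex keeps
at most one (`Contr.inW`), too few for another pattern. Hence M_f = M_f° ∘ (1 + R), where R is the
signed combination of the contractions at the root and M_f° is multiplicative. Second, M_f raises
homogeneities, so Π_x I(M_f σ) has had jets of degree above |σ| + 2 subtracted, whereas an
admissible Π^M_x I(σ) may subtract only those below |σ| + 2. Therefore M_f° I(σ) = I(M_f σ) + P,
where P restores the part of 𝒥(x) M_f σ of degree larger than |σ| + 2 (`corr`). With this choice
admissibility of Π^M is immediate (`admissibleInt_PiM`).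

The algebraic core is the relation M_f Γ_h = Γ_g M_{f∘g} (`renB_hat`), in which f∘g = `comp f g` is
defined by Γ_f Γ_g = Γ_{f∘g} and h = `hat f g c` by recursion. It holds by induction on the weight,
because R commutes with the structure group: Γ_f neither creates nor destroys factors I(Ξ)
(`rootB_GamB`). Two choices of (f, g) give the two identities for the renormalised model. For (f_x,
γ_xy) one has f_x∘γ_xy = f_y (`agreeTo_fchar`), hence Π^M_x Γ^M_xy = Π^M_y. For (trivial, f_x) the
character h is the one belonging to Π^M (`agreeTo_PiM`), hence M F^M_x = F_x M_{f_x}, that is 𝚷^M =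
𝚷 M. Both identifications of characters use that K annihilates the polynomials which occur, so they
hold only on generators of bounded weight (`AgreeTo`). This is why N(τ) is taken to be the weight of
τ.

All constructions have coefficients in an arbitrary commutative algebra B and are natural in B. The
tautological character of T⁺ yields Δ^M, and the two inclusions into T⁺ ⊗ T⁺ yield Δ̂^M; their
triangularity is the statement that M_f raises homogeneities. With B = ℝ[t] and constants t·c one
recognises the exponential: at the trivial character M_c M_d = M_{c+d}, because two successive
contractions at the root vanish, and the derivative of M_{tc} at t = 0 is -∑ C_i L_i
(`renormMap_eq`).

For the values at x, property 1 determines Π^M by recursion on the weight, since 𝚷^M is prescribed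
and F^M_x is unipotent (`PiM_unique`). It then suffices that M_{f_x} τ - M τ contains only symbols
of positive homogeneity or with a nontrivial factor X^k (`renT_sub_support`). Continuous
representatives of the former vanish at x by the bounds on the model, those of the latter because of
the factor (· - x)^k. -/

@[simp] theorem exp_mul (σ τ : Sym) : (σ * τ).exp = σ.exp + τ.exp := exp_node _ _ _
@[simp] theorem noise_mul (σ τ : Sym) : (σ * τ).noise = σ.noise + τ.noise := noise_node _ _ _
@[simp] theorem branches_mul (σ τ : Sym) : (σ * τ).branches = σ.branches + τ.branches :=
  branches_node _ _ _
@[simp] theorem exp_one : (1 : Sym).exp = 0 := exp_node _ _ _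
@[simp] theorem noise_one : (1 : Sym).noise = 0 := noise_node _ _ _
@[simp] theorem branches_one : (1 : Sym).branches = 0 := branches_node _ _ _
@[simp] theorem exp_Xpow (k : Idx) : (Xpow k).exp = k := exp_node _ _ _
@[simp] theorem noise_Xpow (k : Idx) : (Xpow k).noise = 0 := noise_node _ _ _
@[simp] theorem branches_Xpow (k : Idx) : (Xpow k).branches = 0 := branches_node _ _ _
@[simp] theorem exp_int (τ : Sym) : (int τ).exp = 0 := exp_node _ _ _
@[simp] theorem noise_int (τ : Sym) : (int τ).noise = 0 := noise_node _ _ _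
@[simp] theorem branches_int (τ : Sym) : (int τ).branches = {τ} := branches_node _ _ _
@[simp] theorem exp_Xi : Xi.exp = 0 := exp_node _ _ _
@[simp] theorem noise_Xi : Xi.noise = 1 := noise_node _ _ _
@[simp] theorem branches_Xi : Xi.branches = 0 := branches_node _ _ _

theorem Xpow_add (k l : Idx) : Xpow (k + l) = Xpow k * Xpow l := by
  rw [ext_iff3]; simp

theorem Xpow_zero : Xpow 0 = 1 := rfl

/-- `X ↦ X^k` as a monoid homomorphism. -/
def XpowHom : Multiplicative Idx →* Sym where
  toFun k := Xpow k.toAdd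
  map_one' := rfl
  map_mul' _ _ := Xpow_add _ _

theorem Xpow_eq_prod (k : Idx) : Xpow k = ∏ i, Xpow (Finsupp.single i 1) ^ k i := by
  have h : k = ∑ i, k i • Finsupp.single i 1 := by
    ext j
    simp
  have h1 : ∀ (s : Finset (Fin 4)), Xpow (∑ i ∈ s, k i • Finsupp.single i 1)
      = ∏ i ∈ s, Xpow (Finsupp.single i 1) ^ k i := by
    intro s
    have := map_prod XpowHom (fun i => Multiplicative.ofAdd (k i • Finsupp.single i 1 : Idx)) s
    rw [← ofAdd_sum] at this
    refine this.trans (Finset.prod_congr rfl fun i _ => ?_)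
    rw [ofAdd_nsmul, map_pow]; rfl
  conv_lhs => rw [h]
  exact h1 _

theorem prod_int (s : Multiset Sym) : (s.map int).prod = node 0 0 s := by
  induction s using Multiset.induction with
  | empty => rfl
  | cons a s ih => rw [Multiset.map_cons, Multiset.prod_cons, ih, ext_iff3]; simp

theorem Xi_pow (n : ℕ) : Xi ^ n = node 0 n 0 := by
  induction n with
  | zero => rfl
  | succ n ih => rw [pow_succ, ih, ext_iff3]; simp

theorem eq_prod (τ : Sym) : τ = Xpow τ.exp * Xi ^ τ.noise * (τ.branches.map int).prod := by
  rw [prod_int, Xi_pow, ext_iff3]; simp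

theorem isPoly_iff {τ : Sym} : τ.IsPoly ↔ τ.noise = 0 ∧ τ.branches = 0 := by
  constructor
  · rintro ⟨k, rfl⟩; simp
  · rintro ⟨h1, h2⟩; exact ⟨τ.exp, by rw [ext_iff3]; simp [h1, h2]⟩

theorem isPoly_Xpow (k : Idx) : (Xpow k).IsPoly := ⟨k, rfl⟩
theorem not_isPoly_Xi : ¬ Xi.IsPoly := by simp [isPoly_iff]

/-- The relation between a symbol and its image under a multiplicative map follows from the
relation for the generators. -/
theorem gen_induction {Q : Type*} [CommMonoid Q] (p : Sym → Q → Prop) (Φ : Sym →* Q) (h1 : p 1 1)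
    (hm : ∀ σ τ a b, p σ a → p τ b → p (σ * τ) (a * b))
    (hX : ∀ i, p (Xpow (Finsupp.single i 1)) (Φ (Xpow (Finsupp.single i 1))))
    (τ : Sym) (hXi : τ.noise ≠ 0 → p Xi (Φ Xi)) (hb : ∀ σ ∈ τ.branches, p (int σ) (Φ (int σ))) :
    p τ (Φ τ) := by
  have hpow : ∀ (σ : Sym), p σ (Φ σ) → ∀ n : ℕ, p (σ ^ n) (Φ (σ ^ n)) := by
    intro σ h n
    induction n with
    | zero => simpa using h1
    | succ n ih => rw [pow_succ, map_mul]; exact hm _ _ _ _ ih h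
  have hpow' : p (Xi ^ τ.noise) (Φ (Xi ^ τ.noise)) := by
    by_cases h : τ.noise = 0
    · simpa [h] using h1
    · exact hpow _ (hXi h) _
  rw [eq_prod τ, map_mul, map_mul]
  refine hm _ _ _ _ (hm _ _ _ _ ?_ hpow') ?_
  · rw [Xpow_eq_prod, map_prod]
    refine Finset.induction_on Finset.univ (by simpa using h1) fun a s ha ih => ?_
    rw [Finset.prod_insert ha, Finset.prod_insert ha]
    exact hm _ _ _ _ (hpow _ (hX a) _) ih
  · have : ∀ s : Multiset Sym, (∀ σ ∈ s, p (int σ) (Φ (int σ))) →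
        p (s.map int).prod (Φ (s.map int).prod) := by
      intro s
      induction s using Multiset.induction with
      | empty => intro _; simpa using h1
      | cons a s ih =>
        intro h
        rw [Multiset.map_cons, Multiset.prod_cons, map_mul]
        exact hm _ _ _ _ (h a (Multiset.mem_cons_self _ _))
          (ih fun σ hσ => h σ (Multiset.mem_cons_of_mem hσ))
    exact this _ hb

/-- Two multiplicative maps which agree on the generators occurring in `τ` agree at `τ`. -/
theorem hom_congr {Q : Type*} [CommMonoid Q] (Φ Ψ : Sym →* Q)
    (hX : ∀ i, Φ (Xpow (Finsupp.single i 1)) = Ψ (Xpow (Finsupp.single i 1)))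
    (τ : Sym) (hXi : τ.noise ≠ 0 → Φ Xi = Ψ Xi) (hb : ∀ σ ∈ τ.branches, Φ (int σ) = Ψ (int σ)) :
    Φ τ = Ψ τ := by
  refine (gen_induction (fun σ a => a = Ψ σ) Φ (map_one Ψ).symm ?_ hX τ hXi hb)
  rintro σ τ a b rfl rfl
  exact (map_mul Ψ _ _).symm

/-- A weight of formal expressions: the total degree of the `X`, plus two for each `I`. -/
def wt (τ : Sym) : ℕ := sdeg τ.exp + (τ.branches.attach.map fun σ => wt σ.1 + 2).sum
termination_by τ
decreasing_by exact σ.2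

theorem wt_eq (τ : Sym) : τ.wt = sdeg τ.exp + (τ.branches.map fun σ => wt σ + 2).sum := by
  rw [wt, Multiset.attach_map_val' τ.branches (fun σ => wt σ + 2)]

end Sym

@[simp] theorem sdeg_zero : sdeg 0 = 0 := by simp [sdeg]
@[simp] theorem sdeg_add (k l : Idx) : sdeg (k + l) = sdeg k + sdeg l := by
  simp [sdeg]; ring

/-! ### Weight, number of noises and homogeneity -/

namespace Sym

@[simp] theorem wt_mul (σ τ : Sym) : (σ * τ).wt = σ.wt + τ.wt := by
  rw [wt_eq, wt_eq σ, wt_eq τ]; simp; ring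
@[simp] theorem wt_int (σ : Sym) : (int σ).wt = σ.wt + 2 := by rw [wt_eq]; simp
@[simp] theorem wt_Xpow (k : Idx) : (Xpow k).wt = sdeg k := by rw [wt_eq]; simp
@[simp] theorem wt_Xi : Xi.wt = 0 := by rw [wt_eq]; simp
@[simp] theorem numXi_int (σ : Sym) : (int σ).numXi = σ.numXi := by rw [int, numXi_node]; simp
@[simp] theorem numXi_Xpow (k : Idx) : (Xpow k).numXi = 0 := by rw [Xpow, numXi_node]; simp
@[simp] theorem numXi_Xi : Xi.numXi = 1 := by rw [Xi, numXi_node]; simp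

/-- Decrease of the weight along branches drives the inductions for which structural induction is
too weak: a contraction at the root exposes branches which lie one level deeper in the original
symbol, and these still have smaller weight. -/
theorem wt_branch {σ τ : Sym} (h : σ ∈ τ.branches) : σ.wt + 2 ≤ τ.wt := by
  rw [wt_eq τ]
  exact (Multiset.single_le_sum (by simp) _
    (Multiset.mem_map_of_mem (fun σ => wt σ + 2) h)).trans (Nat.le_add_left _ _)

theorem numXi_branch {σ τ : Sym} (h : σ ∈ τ.branches) : σ.numXi ≤ τ.numXi := by
  rw [numXi_eq τ]
  exact (Multiset.single_le_sum (by simp) _ (Multiset.mem_map_of_mem numXi h)).trans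
    (Nat.le_add_left _ _)

/-- Each noise costs `5 / 2 + κ`, and everything else is integral. Comparisons between homogeneity,
weight and number of noises reduce to linear arithmetic through this formula. -/
theorem deg_eq_wt (κ : ℝ) (τ : Sym) : deg κ τ = τ.wt - (5 / 2 + κ) * τ.numXi := by
  induction τ using Sym.induction with
  | h k m s ih =>
    rw [deg_eq, wt_eq, numXi_eq]
    simp only [exp_node, noise_node, branches_node]
    have : (s.map fun σ => deg κ σ + 2).sum
        = ((s.map fun σ => wt σ + 2).sum : ℕ) - (5 / 2 + κ) * ((s.map numXi).sum : ℕ) := by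
      clear * - ih
      induction s using Multiset.induction with
      | empty => simp
      | cons a s ihs =>
        simp only [Multiset.map_cons, Multiset.sum_cons]
        rw [ihs fun σ hσ => ih σ (Multiset.mem_cons_of_mem hσ), ih a (Multiset.mem_cons_self _ _)]
        push_cast; ring
    rw [this]; push_cast; ring

theorem deg_mul (κ : ℝ) (σ τ : Sym) : deg κ (σ * τ) = deg κ σ + deg κ τ := by
  simp only [deg_eq_wt, wt_mul, numXi_mul]; push_cast; ring
theorem deg_int (κ : ℝ) (σ : Sym) : deg κ (int σ) = deg κ σ + 2 := by
  simp only [deg_eq_wt, wt_int, numXi_int]; push_cast; ring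
theorem deg_Xpow (κ : ℝ) (k : Idx) : deg κ (Xpow k) = sdeg k := by
  simp [deg_eq_wt]
theorem deg_Xi (κ : ℝ) : deg κ Xi = -(5 / 2) - κ := by
  simp [deg_eq_wt]; ring

/-! ### The collections `U` and `W` -/

theorem InU.inW {τ : Sym} (h : InU τ) : InW τ :=
  Or.inr ⟨τ, 1, 1, h, .mono 0, .mono 0, by simp⟩

theorem InW.intU {τ : Sym} (h : InW τ) (hp : ¬ IsPoly τ) : InU (Sym.int τ) := by
  rcases h with rfl | ⟨a, b, c, ha, hb, hc, rfl⟩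
  · exact .intXi
  · exact .int a b c ha hb hc hp

theorem InU.cases' {τ : Sym} (h : InU τ) :
    (∃ k, τ = Xpow k) ∨ ∃ σ, τ = Sym.int σ ∧ InW σ ∧ ¬ IsPoly σ := by
  cases h with
  | mono k => exact Or.inl ⟨k, rfl⟩
  | intXi => exact Or.inr ⟨_, rfl, Or.inl rfl, not_isPoly_Xi⟩
  | int a b c ha hb hc hp => exact Or.inr ⟨_, rfl, Or.inr ⟨a, b, c, ha, hb, hc, rfl⟩, hp⟩

theorem InW_Xi : InW Xi := Or.inl rfl

theorem InU.noise {τ : Sym} (h : InU τ) : τ.noise = 0 := by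
  rcases h.cases' with ⟨k, rfl⟩ | ⟨σ, rfl, -⟩ <;> simp

theorem InU.branches {τ : Sym} (h : InU τ) :
    (∀ σ ∈ τ.branches, InW σ ∧ ¬ IsPoly σ) ∧ τ.branches.card ≤ 1 ∧
      (τ.branches.card = 1 → τ.exp = 0) := by
  rcases h.cases' with ⟨k, rfl⟩ | ⟨σ, rfl, h1, h2⟩
  · simp
  · simp [h1, h2]

/-- The elements of `W` other than `Ξ`. -/
theorem inW_iff {τ : Sym} : InW τ ↔ τ = Xi ∨ τ.noise = 0 ∧
    (∀ σ ∈ τ.branches, InW σ ∧ ¬ IsPoly σ) ∧ τ.branches.card ≤ 3 ∧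
      (τ.branches.card = 3 → τ.exp = 0) := by
  constructor
  · rintro (rfl | ⟨a, b, c, ha, hb, hc, rfl⟩)
    · exact Or.inl rfl
    · refine Or.inr ⟨by simp [ha.noise, hb.noise, hc.noise], ?_, ?_, ?_⟩
      · intro σ hσ
        simp only [branches_mul, Multiset.mem_add] at hσ
        rcases hσ with (h | h) | h
        exacts [ha.branches.1 _ h, hb.branches.1 _ h, hc.branches.1 _ h]
      · have h1 := ha.branches.2.1
        have h2 := hb.branches.2.1
        have h3 := hc.branches.2.1
        simp only [branches_mul, Multiset.card_add]; omega
      · intro h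
        have h1 := ha.branches.2
        have h2 := hb.branches.2
        have h3 := hc.branches.2
        simp only [branches_mul, Multiset.card_add] at h
        simp [h1.2 (by omega), h2.2 (by omega), h3.2 (by omega)]
  · rintro (rfl | ⟨hn, hb, hc, he⟩)
    · exact Or.inl rfl
    · refine Or.inr ?_
      have key : τ = Xpow τ.exp * (τ.branches.map Sym.int).prod := by
        conv_lhs => rw [eq_prod τ, hn, pow_zero, mul_one]
      have hU : ∀ σ ∈ τ.branches, InU (Sym.int σ) := fun σ hσ => (hb σ hσ).1.intU (hb σ hσ).2
      rw [key]
      generalize τ.branches = s at hc he hU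
      interval_cases h : s.card
      · rw [Multiset.card_eq_zero.1 h]
        exact ⟨Xpow τ.exp, 1, 1, .mono _, .mono 0, .mono 0, by simp⟩
      · obtain ⟨a, rfl⟩ := Multiset.card_eq_one.1 h
        exact ⟨Xpow τ.exp, _, 1, .mono _, hU a (by simp), .mono 0, by simp⟩
      · obtain ⟨a, b, rfl⟩ := Multiset.card_eq_two.1 h
        exact ⟨Xpow τ.exp, _, _, .mono _, hU a (by simp), hU b (by simp), by simp [mul_assoc]⟩
      · obtain ⟨a, b, c, rfl⟩ := Multiset.card_eq_three.1 h
        exact ⟨_, _, _, hU a (by simp), hU b (by simp), hU c (by simp),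
          by simp [he rfl, Xpow_zero, mul_assoc]⟩

theorem InW.branch {σ τ : Sym} (h : InW τ) (hσ : σ ∈ τ.branches) : InW σ ∧ ¬ IsPoly σ := by
  rcases inW_iff.1 h with rfl | ⟨-, h, -⟩
  · simp at hσ
  · exact h σ hσ

theorem InW.noise {τ : Sym} (h : InW τ) (h1 : τ ≠ Xi) : τ.noise = 0 := by
  rcases inW_iff.1 h with rfl | ⟨h, -⟩
  exacts [absurd rfl h1, h]

/-- A single noise already makes |σ| + 2 smaller than the weight of I(σ) when κ > 0. Hence the
monomials X^k with |k| < |σ| + 2 that Γ_f produces from I(σ) have smaller weight than I(σ). -/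
theorem InW.one_le_numXi {τ : Sym} (h : InW τ) (hp : ¬ IsPoly τ) : 1 ≤ τ.numXi := by
  induction τ using Sym.induction with
  | h k m s ih =>
    rcases inW_iff.1 h with h1 | ⟨h1, h2, -⟩
    · rw [h1]; simp
    · rw [isPoly_iff] at hp
      have : (Sym.node k m s).branches ≠ 0 := fun h0 => hp ⟨h1, h0⟩
      obtain ⟨σ, hσ⟩ := Multiset.exists_mem_of_ne_zero this
      exact (ih σ (by simpa using hσ) (h2 σ hσ).1 (h2 σ hσ).2).trans (numXi_branch hσ)

end Sym

/-! ## The ambient algebra over a ring of coefficients -/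

section Ambient

variable {B Q : Type*} [CommRing B] [CommRing Q] [Algebra B Q]

/-- A formal expression as a basis element. -/
abbrev mon (B : Type*) [CommRing B] (τ : Sym) : MonoidAlgebra B Sym := MonoidAlgebra.single τ 1

/-- The generator `X_i`. -/
abbrev Xg (i : Fin 4) : Sym := Sym.Xpow (Finsupp.single i 1)

theorem mon_mul (σ τ : Sym) : mon B (σ * τ) = mon B σ * mon B τ := by
  simp [MonoidAlgebra.single_mul_single]

theorem smul_mon (b : B) (τ : Sym) : b • mon B τ = MonoidAlgebra.single τ b := by
  simp [MonoidAlgebra.smul_single]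

/-- `MonoidAlgebra.single` with coefficient one, as a monoid homomorphism. -/
theorem mon_eq_of (τ : Sym) : mon B τ = MonoidAlgebra.of B Sym τ := rfl

/-- The multiplicative map with given values at the generators. -/
def evHom {Q : Type*} [CommMonoid Q] (x : Fin 4 → Q) (ξ : Q) (ι : Sym → Q) : Sym →* Q where
  toFun τ := (∏ i, x i ^ τ.exp i) * ξ ^ τ.noise * (τ.branches.map ι).prod
  map_one' := by simp
  map_mul' σ τ := by
    simp only [Sym.exp_mul, Finsupp.add_apply, pow_add, Finset.prod_mul_distrib, Sym.noise_mul,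
      Sym.branches_mul, Multiset.map_add, Multiset.prod_add]
    simp only [mul_assoc, mul_left_comm, mul_comm]

theorem evHom_apply {Q : Type*} [CommMonoid Q] (x : Fin 4 → Q) (ξ : Q) (ι : Sym → Q) (τ : Sym) :
    evHom x ξ ι τ = (∏ i, x i ^ τ.exp i) * ξ ^ τ.noise * (τ.branches.map ι).prod := rfl

theorem evHom_X {Q : Type*} [CommMonoid Q] (x : Fin 4 → Q) (ξ : Q) (ι : Sym → Q) (i : Fin 4) :
    evHom x ξ ι (Xg i) = x i := by
  rw [evHom_apply]
  simp only [Sym.exp_Xpow, Sym.noise_Xpow, Sym.branches_Xpow, pow_zero, Multiset.map_zero,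
    Multiset.prod_zero, mul_one]
  rw [Finset.prod_eq_single i]
  · simp
  · intro j _ hj; simp [hj.symm]
  · simp

theorem evHom_Xi {Q : Type*} [CommMonoid Q] (x : Fin 4 → Q) (ξ : Q) (ι : Sym → Q) :
    evHom x ξ ι Sym.Xi = ξ := by simp [evHom_apply]

theorem evHom_int {Q : Type*} [CommMonoid Q] (x : Fin 4 → Q) (ξ : Q) (ι : Sym → Q) (σ : Sym) :
    evHom x ξ ι (Sym.int σ) = ι σ := by simp [evHom_apply]

/-- The morphism of algebras with given values at the generators. -/
def evAlg (B : Type*) {Q : Type*} [CommRing B] [CommRing Q] [Algebra B Q]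
    (x : Fin 4 → Q) (ξ : Q) (ι : Sym → Q) : MonoidAlgebra B Sym →ₐ[B] Q :=
  MonoidAlgebra.lift B Q Sym (evHom x ξ ι)

section
variable (x : Fin 4 → Q) (ξ : Q) (ι : Sym → Q)

theorem evAlg_mon (τ : Sym) : evAlg B x ξ ι (mon B τ)
    = (∏ i, x i ^ τ.exp i) * ξ ^ τ.noise * (τ.branches.map ι).prod := by
  rw [evAlg, MonoidAlgebra.lift_single, one_smul, evHom_apply]
theorem evAlg_X (i : Fin 4) : evAlg B x ξ ι (mon B (Xg i)) = x i := by
  rw [evAlg, MonoidAlgebra.lift_single, one_smul, evHom_X]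
theorem evAlg_Xi : evAlg B x ξ ι (mon B Sym.Xi) = ξ := by
  rw [evAlg, MonoidAlgebra.lift_single, one_smul, evHom_Xi]
theorem evAlg_int (σ : Sym) : evAlg B x ξ ι (mon B (Sym.int σ)) = ι σ := by
  rw [evAlg, MonoidAlgebra.lift_single, one_smul, evHom_int]
end

theorem ringHom_congr {P : Type*} [CommRing P] (Φ Ψ : MonoidAlgebra B Sym →+* P) (τ : Sym)
    (hX : ∀ i, Φ (mon B (Xg i)) = Ψ (mon B (Xg i)))
    (hXi : τ.noise ≠ 0 → Φ (mon B Sym.Xi) = Ψ (mon B Sym.Xi))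
    (hb : ∀ σ ∈ τ.branches, Φ (mon B (Sym.int σ)) = Ψ (mon B (Sym.int σ))) :
    Φ (mon B τ) = Ψ (mon B τ) :=
  Sym.hom_congr ((Φ : MonoidAlgebra B Sym →* P).comp (MonoidAlgebra.of B Sym))
    ((Ψ : MonoidAlgebra B Sym →* P).comp (MonoidAlgebra.of B Sym)) hX τ hXi hb

theorem algHom_congr (Φ Ψ : MonoidAlgebra B Sym →ₐ[B] Q) (τ : Sym)
    (hX : ∀ i, Φ (mon B (Xg i)) = Ψ (mon B (Xg i)))
    (hXi : τ.noise ≠ 0 → Φ (mon B Sym.Xi) = Ψ (mon B Sym.Xi))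
    (hb : ∀ σ ∈ τ.branches, Φ (mon B (Sym.int σ)) = Ψ (mon B (Sym.int σ))) :
    Φ (mon B τ) = Ψ (mon B τ) :=
  ringHom_congr (Φ : MonoidAlgebra B Sym →+* Q) (Ψ : MonoidAlgebra B Sym →+* Q) τ hX hXi hb

/-- The linear map with given values at the formal expressions. -/
def linExt {V : Type*} [AddCommGroup V] [Module B V] (F : Sym → V) :
    MonoidAlgebra B Sym →ₗ[B] V :=
  (Finsupp.lift V B Sym F) ∘ₗ (MonoidAlgebra.coeffLinearEquiv B).toLinearMap

theorem linExt_single {V : Type*} [AddCommGroup V] [Module B V] (F : Sym → V) (τ : Sym) (b : B) :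
    linExt F (MonoidAlgebra.single τ b) = b • F τ := by
  simp [linExt]

@[simp] theorem linExt_mon {V : Type*} [AddCommGroup V] [Module B V] (F : Sym → V) (τ : Sym) :
    linExt F (mon B τ) = F τ := by rw [linExt_single, one_smul]

/-- The elements all of whose symbols belong to `S`. -/
abbrev supp (B : Type*) [CommRing B] (S : Set Sym) : Submodule B (MonoidAlgebra B Sym) :=
  MonoidAlgebra.supported B B S

theorem supp_eq_span (S : Set Sym) : supp B S = Submodule.span B (mon B '' S) :=
  MonoidAlgebra.supported_eq_span_single B S

theorem mon_mem_supp {S : Set Sym} {τ : Sym} (h : τ ∈ S) : mon B τ ∈ supp B S := by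
  rw [supp_eq_span]; exact Submodule.subset_span ⟨τ, h, rfl⟩

theorem single_mem_supp {S : Set Sym} {τ : Sym} (h : τ ∈ S) (b : B) :
    MonoidAlgebra.single τ b ∈ supp B S := by
  rw [← smul_mon]; exact Submodule.smul_mem _ _ (mon_mem_supp h)

theorem supp_mono {S S' : Set Sym} (h : S ⊆ S') : supp B S ≤ supp B S' := by
  intro u hu
  rw [MonoidAlgebra.mem_supported] at hu ⊢
  exact hu.trans h

theorem map_mem_of_supp {V : Type*} [AddCommGroup V] [Module B V] {S : Set Sym}
    (L : MonoidAlgebra B Sym →ₗ[B] V) (N : Submodule B V) (h : ∀ σ ∈ S, L (mon B σ) ∈ N)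
    {u : MonoidAlgebra B Sym} (hu : u ∈ supp B S) : L u ∈ N := by
  rw [supp_eq_span] at hu
  refine (Submodule.span_le (p := N.comap L)).2 ?_ hu
  rintro _ ⟨σ, hσ, rfl⟩
  exact h σ hσ

theorem linMap_congr {V : Type*} [AddCommGroup V] [Module B V] {S : Set Sym}
    (L L' : MonoidAlgebra B Sym →ₗ[B] V) (h : ∀ σ ∈ S, L (mon B σ) = L' (mon B σ))
    {u : MonoidAlgebra B Sym} (hu : u ∈ supp B S) : L u = L' u := by
  have := map_mem_of_supp (L - L') ⊥ (S := S) (by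
    intro σ hσ; simp [h σ hσ]) hu
  simpa [sub_eq_zero] using this

theorem linMap_ext {V : Type*} [AddCommGroup V] [Module B V]
    (L L' : MonoidAlgebra B Sym →ₗ[B] V) (h : ∀ σ, L (mon B σ) = L' (mon B σ)) : L = L' := by
  refine LinearMap.ext fun u => ?_
  exact linMap_congr (S := Set.univ) L L' (fun σ _ => h σ)
    (MonoidAlgebra.mem_supported.2 (Set.subset_univ _))

theorem mul_mem_supp {S S' S'' : Set Sym} (h : ∀ σ ∈ S, ∀ τ ∈ S', σ * τ ∈ S'')
    {u v : MonoidAlgebra B Sym} (hu : u ∈ supp B S) (hv : v ∈ supp B S') : u * v ∈ supp B S'' := by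
  refine map_mem_of_supp (LinearMap.mulRight B v) _ (fun σ hσ => ?_) hu
  refine map_mem_of_supp (LinearMap.mulLeft B (mon B σ)) _ (fun τ hτ => ?_) hv
  rw [LinearMap.mulLeft_apply, ← mon_mul]
  exact mon_mem_supp (h σ hσ τ hτ)

/-- `u` is `τ` plus symbols of larger weight. -/
def Lead (θ : Sym → ℝ) (τ : Sym) (u : MonoidAlgebra B Sym) : Prop :=
  u - mon B τ ∈ supp B {σ | θ τ < θ σ}

theorem lead_self (θ : Sym → ℝ) (τ : Sym) : Lead θ τ (mon B τ) := by simp [Lead]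

theorem Lead.mul {θ : Sym → ℝ} (hθ : ∀ σ τ, θ (σ * τ) = θ σ + θ τ) {σ τ : Sym}
    {u v : MonoidAlgebra B Sym} (hu : Lead θ σ u) (hv : Lead θ τ v) : Lead θ (σ * τ) (u * v) := by
  have : u * v - mon B (σ * τ) = mon B σ * (v - mon B τ) + (u - mon B σ) * mon B τ
      + (u - mon B σ) * (v - mon B τ) := by rw [mon_mul]; ring
  rw [Lead, this]
  refine add_mem (add_mem ?_ ?_) ?_
  · refine mul_mem_supp (S := {σ}) ?_ (mon_mem_supp rfl) hv
    intro ρ' hρ' ρ hρ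
    simp only [Set.mem_ofPred_eq, Set.mem_singleton_iff, hθ] at *
    subst hρ'; linarith
  · refine mul_mem_supp (S' := {τ}) ?_ hu (mon_mem_supp rfl)
    intro ρ hρ ρ' hρ'
    simp only [Set.mem_ofPred_eq, Set.mem_singleton_iff, hθ] at *
    subst hρ'; linarith
  · refine mul_mem_supp ?_ hu hv
    intro ρ hρ ρ' hρ'
    simp only [Set.mem_ofPred_eq, hθ] at *; linarith

/-- Leading terms multiply when θ is additive, so triangularity of a morphism only has to be checked
on generators. -/
theorem lead_algHom {θ : Sym → ℝ} (hθ : ∀ σ τ, θ (σ * τ) = θ σ + θ τ)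
    (Φ : MonoidAlgebra B Sym →ₐ[B] MonoidAlgebra B Sym) (τ : Sym)
    (hX : ∀ i, Lead θ (Xg i) (Φ (mon B (Xg i))))
    (hXi : Lead θ Sym.Xi (Φ (mon B Sym.Xi)))
    (hb : ∀ σ ∈ τ.branches, Lead θ (Sym.int σ) (Φ (mon B (Sym.int σ)))) :
    Lead θ τ (Φ (mon B τ)) := by
  refine Sym.gen_induction (fun σ u => Lead θ σ u)
    ((Φ : MonoidAlgebra B Sym →* MonoidAlgebra B Sym).comp (MonoidAlgebra.of B Sym))
    (lead_self θ 1) ?_ ?_ τ ?_ ?_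
  · intro _ _ _ _ h h'; exact h.mul hθ h'
  · exact hX
  · exact fun _ => hXi
  · exact hb

theorem Lead.mem {θ : Sym → ℝ} {τ : Sym} {u : MonoidAlgebra B Sym} (h : Lead θ τ u) :
    u ∈ supp B {σ | θ τ ≤ θ σ} := by
  have : u = (u - mon B τ) + mon B τ := by ring
  rw [this]
  refine add_mem (supp_mono (fun σ h => ?_) h) (mon_mem_supp ?_)
  · exact le_of_lt (Set.mem_ofPred_eq ▸ h)
  · simp

open Classical in
/-- Abstract integration, with `I(X^k) = 0`. -/
def intB (B : Type*) [CommRing B] : MonoidAlgebra B Sym →ₗ[B] MonoidAlgebra B Sym :=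
  linExt fun τ => if τ.IsPoly then 0 else mon B τ.int

theorem intB_mon {τ : Sym} (h : ¬ τ.IsPoly) : intB B (mon B τ) = mon B τ.int := by
  simp [intB, h]
theorem intB_poly {τ : Sym} (h : τ.IsPoly) : intB B (mon B τ) = 0 := by
  simp [intB, h]

theorem intB_mem_supp {S S' : Set Sym} (h : ∀ σ ∈ S, ¬ σ.IsPoly → σ.int ∈ S')
    {u : MonoidAlgebra B Sym} (hu : u ∈ supp B S) : intB B u ∈ supp B S' := by
  refine map_mem_of_supp _ _ (fun σ hσ => ?_) hu
  by_cases hp : σ.IsPoly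
  · rw [intB_poly hp]; exact zero_mem _
  · rw [intB_mon hp]; exact mon_mem_supp (h σ hσ hp)

/-- Translation of the polynomials by `a`. -/
def trans (a : Fin 4 → B) : MonoidAlgebra B Sym →ₐ[B] MonoidAlgebra B Sym :=
  evAlg B (fun i => mon B (Xg i) + algebraMap B _ (a i)) (mon B Sym.Xi) fun σ => mon B σ.int

theorem trans_X (a : Fin 4 → B) (i : Fin 4) :
    trans a (mon B (Xg i)) = mon B (Xg i) + algebraMap B _ (a i) := evAlg_X _ _ _ _
theorem trans_Xi (a : Fin 4 → B) : trans a (mon B Sym.Xi) = mon B Sym.Xi := evAlg_Xi _ _ _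
theorem trans_int (a : Fin 4 → B) (σ : Sym) : trans a (mon B σ.int) = mon B σ.int :=
  evAlg_int _ _ _ _

theorem algHom_ext_gen {Φ Ψ : MonoidAlgebra B Sym →ₐ[B] Q}
    (hX : ∀ i, Φ (mon B (Xg i)) = Ψ (mon B (Xg i)))
    (hXi : Φ (mon B Sym.Xi) = Ψ (mon B Sym.Xi))
    (hb : ∀ σ, Φ (mon B (Sym.int σ)) = Ψ (mon B (Sym.int σ))) : Φ = Ψ :=
  MonoidAlgebra.algHom_ext (fun τ => algHom_congr Φ Ψ τ hX (fun _ => hXi) fun σ _ => hb σ)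
    (Subsingleton.elim _ _)

theorem trans_trans (a b : Fin 4 → B) (u : MonoidAlgebra B Sym) :
    trans a (trans b u) = trans (a + b) u := by
  have : (trans a).comp (trans b) = trans (a + b) := by
    apply algHom_ext_gen
    · intro i
      simp only [AlgHom.comp_apply, trans_X, map_add, AlgHom.commutes, Pi.add_apply]
      ring
    · simp only [AlgHom.comp_apply, trans_Xi]
    · intro σ; simp only [AlgHom.comp_apply, trans_int]
  exact congrArg (fun Φ : MonoidAlgebra B Sym →ₐ[B] MonoidAlgebra B Sym => Φ u) this

theorem trans_zero (u : MonoidAlgebra B Sym) : trans 0 u = u := by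
  have : trans (0 : Fin 4 → B) = AlgHom.id B _ := by
    apply algHom_ext_gen
    · intro i; simp [trans_X]
    · simp [trans_Xi]
    · intro σ; simp [trans_int]
  rw [this]; rfl

open Classical in
/-- The projection onto the symbols whose polynomial part has degree larger than `c`. -/
def trGt (B : Type*) [CommRing B] (c : ℝ) : MonoidAlgebra B Sym →ₗ[B] MonoidAlgebra B Sym :=
  linExt fun τ => if c < sdeg τ.exp then mon B τ else 0

theorem trGt_mon_of_lt {c : ℝ} {τ : Sym} (h : c < sdeg τ.exp) : trGt B c (mon B τ) = mon B τ := by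
  simp [trGt, h]
theorem trGt_mon_of_le {c : ℝ} {τ : Sym} (h : sdeg τ.exp ≤ c) : trGt B c (mon B τ) = 0 := by
  simp [trGt, not_lt.2 h]

theorem trGt_mem_supp {S S' : Set Sym} {c : ℝ} (h : ∀ σ ∈ S, c < sdeg σ.exp → σ ∈ S')
    {u : MonoidAlgebra B Sym} (hu : u ∈ supp B S) : trGt B c u ∈ supp B S' := by
  refine map_mem_of_supp _ _ (fun σ hσ => ?_) hu
  rcases lt_or_ge c (sdeg σ.exp) with h1 | h1
  · rw [trGt_mon_of_lt h1]; exact mon_mem_supp (h σ hσ h1)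
  · rw [trGt_mon_of_le h1]; exact zero_mem _

theorem trGt_trGt {c d : ℝ} (h : c ≤ d) (u : MonoidAlgebra B Sym) :
    trGt B d (trGt B c u) = trGt B d u := by
  have : trGt B d ∘ₗ trGt B c = trGt B d := by
    refine linMap_ext _ _ fun σ => ?_
    rw [LinearMap.comp_apply]
    rcases lt_or_ge c (sdeg σ.exp) with h1 | h1
    · rw [trGt_mon_of_lt h1]
    · rw [trGt_mon_of_le h1, map_zero, trGt_mon_of_le (h1.trans h)]
  exact congrArg (fun L : MonoidAlgebra B Sym →ₗ[B] MonoidAlgebra B Sym => L u) this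

/-- Expanding (X + a)^k only lowers exponents and leaves the branches alone. The minus sign adapts
this to `Lead`, whose remainder has larger values of θ. -/
theorem exp_trans (a : Fin 4 → B) (τ : Sym) :
    Lead (fun σ => -(sdeg σ.exp : ℝ)) τ (trans a (mon B τ)) := by
  refine lead_algHom (by intro σ τ; simp; ring) _ τ (fun i => ?_) ?_ fun σ _ => ?_
  · rw [trans_X, Lead, add_sub_cancel_left]
    refine single_mem_supp (τ := 1) ?_ _
    simp [sdeg, Finsupp.single_apply]
    fin_cases i <;> simp
  · rw [trans_Xi]; exact lead_self _ _
  · rw [trans_int]; exact lead_self _ _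

/-- A translation never raises the degree of the polynomial part, so what is cut off beforehand
cannot reappear above the cutoff. -/
theorem trGt_trans_trGt (c : ℝ) (a : Fin 4 → B) (u : MonoidAlgebra B Sym) :
    trGt B c (trans a (trGt B c u)) = trGt B c (trans a u) := by
  have : trGt B c ∘ₗ (trans a).toLinearMap ∘ₗ trGt B c = trGt B c ∘ₗ (trans a).toLinearMap := by
    refine linMap_ext _ _ fun σ => ?_
    simp only [LinearMap.comp_apply, AlgHom.toLinearMap_apply]
    rcases lt_or_ge c (sdeg σ.exp) with h1 | h1
    · rw [trGt_mon_of_lt h1]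
    · rw [trGt_mon_of_le h1, map_zero, map_zero]
      refine Eq.symm ((Submodule.mem_bot B).1 ?_)
      refine map_mem_of_supp _ ⊥ (fun ρ hρ => ?_) (exp_trans a σ).mem
      rw [trGt_mon_of_le]
      · exact zero_mem _
      · simp only [Set.mem_ofPred_eq, neg_le_neg_iff] at hρ; linarith
  exact congrArg (fun L : MonoidAlgebra B Sym →ₗ[B] MonoidAlgebra B Sym => L u) this

/-- The symbols `X^k`. -/
def polySet : Set Sym := {τ | τ.IsPoly}

theorem mem_polySet {τ : Sym} : τ ∈ polySet ↔ τ.IsPoly := Iff.rfl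

theorem trans_mem_poly (a : Fin 4 → B) {u : MonoidAlgebra B Sym} (hu : u ∈ supp B polySet) :
    trans a u ∈ supp B polySet := by
  refine map_mem_of_supp (trans a).toLinearMap _ ?_ hu
  intro τ hτ
  refine Sym.gen_induction (fun σ u => σ.IsPoly → u ∈ supp B polySet)
    ((trans a : MonoidAlgebra B Sym →* MonoidAlgebra B Sym).comp (MonoidAlgebra.of B Sym))
    (fun h => mon_mem_supp h) ?_ ?_ τ ?_ ?_ hτ
  · intro σ ρ u v hu hv h
    rw [Sym.isPoly_iff] at h
    simp only [Sym.noise_mul, Sym.branches_mul] at h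
    refine mul_mem_supp ?_ (hu ?_) (hv ?_)
    · intro σ hσ τ hτ
      rw [polySet, Set.mem_ofPred_eq, Sym.isPoly_iff] at *
      simp [hσ, hτ]
    · rw [Sym.isPoly_iff]
      exact ⟨by omega, (add_eq_zero.1 h.2).1⟩
    · rw [Sym.isPoly_iff]
      exact ⟨by omega, (add_eq_zero.1 h.2).2⟩
  · intro i _
    change trans a (mon B (Xg i)) ∈ _
    rw [trans_X]
    exact add_mem (mon_mem_supp (mem_polySet.2 ⟨_, rfl⟩))
      (single_mem_supp (τ := 1) (mem_polySet.2 ⟨0, rfl⟩) _)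
  · intro h; exact absurd (Sym.isPoly_iff.1 hτ).1 h
  · intro σ hσ; rw [(Sym.isPoly_iff.1 hτ).2] at hσ; simp at hσ

theorem trGt_mem_poly (c : ℝ) {u : MonoidAlgebra B Sym} (hu : u ∈ supp B polySet) :
    trGt B c u ∈ supp B polySet := trGt_mem_supp (fun _ h _ => h) hu

theorem mem_supp_univ (u : MonoidAlgebra B Sym) : u ∈ supp B Set.univ :=
  MonoidAlgebra.mem_supported.2 (Set.subset_univ _)

/-- Monomials `X^k` of degree less than `c`. -/
def polyLt (c : ℝ) : Set Sym := {τ | τ.IsPoly ∧ (sdeg τ.exp : ℝ) < c}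

theorem mem_polyLt {c : ℝ} {τ : Sym} : τ ∈ polyLt c ↔ τ.IsPoly ∧ (sdeg τ.exp : ℝ) < c := Iff.rfl

theorem polyLt_mono {c d : ℝ} (h : c ≤ d) : polyLt c ⊆ polyLt d := fun _ hτ =>
  mem_polyLt.2 ⟨hτ.1, hτ.2.trans_le h⟩

theorem polyLt_subset (c : ℝ) : polyLt c ⊆ polySet := fun _ hτ => hτ.1

theorem trans_mem_polyLt (a : Fin 4 → B) {c : ℝ} {u : MonoidAlgebra B Sym}
    (hu : u ∈ supp B (polyLt c)) : trans a u ∈ supp B (polyLt c) := by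
  refine map_mem_of_supp (trans a).toLinearMap _ (fun σ hσ => ?_) hu
  have h1 := trans_mem_poly a (mon_mem_supp hσ.1)
  have h2 := (exp_trans a σ).mem
  rw [MonoidAlgebra.mem_supported] at h1 h2 ⊢
  intro ρ hρ
  refine mem_polyLt.2 ⟨h1 hρ, ?_⟩
  have h3 := h2 hρ
  simp only [Set.mem_ofPred_eq, neg_le_neg_iff] at h3
  exact lt_of_le_of_lt h3 hσ.2

theorem intB_eq_zero {u : MonoidAlgebra B Sym} (hu : u ∈ supp B polySet) : intB B u = 0 := by
  refine (Submodule.mem_bot B).1 (map_mem_of_supp _ ⊥ (fun σ hσ => ?_) hu)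
  rw [intB_poly hσ]; exact zero_mem _

/-- An algebra morphism is determined on polynomials by its values at the `X_i`. -/
theorem algHom_poly_congr {Q : Type*} [CommRing Q] [Algebra B Q]
    (Φ Ψ : MonoidAlgebra B Sym →ₐ[B] Q) (hX : ∀ i, Φ (mon B (Xg i)) = Ψ (mon B (Xg i)))
    {u : MonoidAlgebra B Sym} (hu : u ∈ supp B polySet) : Φ u = Ψ u := by
  refine linMap_congr Φ.toLinearMap Ψ.toLinearMap (fun σ hσ => ?_) hu
  have hσ' := Sym.isPoly_iff.1 (mem_polySet.1 hσ)
  refine algHom_congr Φ Ψ σ hX (fun h => absurd hσ'.1 h) fun ρ hρ => ?_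
  rw [hσ'.2] at hρ; simp at hρ

/-- The symbols in `W`. -/
def setW : Set Sym := {τ | τ.InW}
/-- The symbols in `U`. -/
def setU : Set Sym := {τ | τ.InU}
theorem mem_setW {τ : Sym} : τ ∈ setW ↔ τ.InW := Iff.rfl
theorem mem_setU {τ : Sym} : τ ∈ setU ↔ τ.InU := Iff.rfl

theorem poly_subset_U : polySet ⊆ setU := by
  rintro τ ⟨k, rfl⟩; exact .mono k

theorem intB_mem_U {u : MonoidAlgebra B Sym} (hu : u ∈ supp B setW) : intB B u ∈ supp B setU :=
  intB_mem_supp (fun _ h hp => Sym.InW.intU h hp) hu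

theorem mul_mem_W {u v w : MonoidAlgebra B Sym} (hu : u ∈ supp B setU) (hv : v ∈ supp B setU)
    (hw : w ∈ supp B setU) : u * v * w ∈ supp B setW := by
  refine mul_mem_supp (S := {σ | ∃ a b, a.InU ∧ b.InU ∧ σ = a * b}) ?_
    (mul_mem_supp ?_ hu hv) hw
  · intro σ hσ c hc
    obtain ⟨a, b, ha, hb, rfl⟩ := hσ
    exact Or.inr ⟨a, b, c, ha, hb, hc, rfl⟩
  · intro a ha b hb; exact ⟨a, b, ha, hb, rfl⟩

theorem mon_Xpow (k : Idx) : mon B (Sym.Xpow k) = ∏ i, mon B (Xg i) ^ k i := by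
  rw [mon_eq_of, Sym.Xpow_eq_prod, map_prod]
  simp only [map_pow, mon_eq_of]

theorem algHom_mem_poly {Φ : MonoidAlgebra B Sym →ₐ[B] MonoidAlgebra B Sym}
    (hX : ∀ i, ∃ a, Φ (mon B (Xg i)) = mon B (Xg i) + algebraMap B _ a) (k : Idx) :
    Φ (mon B (Sym.Xpow k)) ∈ supp B polySet := by
  choose a ha using hX
  have h := mon_mem_supp (B := B) (mem_polySet.2 (Sym.isPoly_Xpow k))
  rw [algHom_poly_congr Φ (trans a) (fun i => by rw [ha, trans_X]) h]
  exact trans_mem_poly _ h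

/-- Products of three elements of U are mapped factor by factor: a monomial becomes a polynomial,
and the images of the I(σ) lie in the span of U by assumption. This applies to Γ_f as well as to the
multiplicative part of M_f. -/
theorem algHom_mem_W {Φ : MonoidAlgebra B Sym →ₐ[B] MonoidAlgebra B Sym}
    (hX : ∀ i, ∃ a, Φ (mon B (Xg i)) = mon B (Xg i) + algebraMap B _ a)
    (hXi : Φ (mon B Sym.Xi) = mon B Sym.Xi) {τ : Sym} (hτ : τ.InW)
    (hb : ∀ σ ∈ τ.branches, Φ (mon B σ.int) ∈ supp B setU) : Φ (mon B τ) ∈ supp B setW := by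
  have key : ∀ a, a.InU → (∀ σ ∈ a.branches, Φ (mon B σ.int) ∈ supp B setU) →
      Φ (mon B a) ∈ supp B setU := by
    intro a ha h
    rcases ha.cases' with ⟨k, rfl⟩ | ⟨σ, rfl, -⟩
    · exact supp_mono poly_subset_U (algHom_mem_poly hX k)
    · exact h σ (by simp)
  rcases hτ with rfl | ⟨a, b, c, ha, hb', hc, rfl⟩
  · rw [hXi]; exact mon_mem_supp Sym.InW_Xi
  · rw [mon_mul, mon_mul, map_mul, map_mul]
    exact mul_mem_W (key a ha fun σ h => hb σ (by simp [h])) (key b hb' fun σ h => hb σ (by simp [h]))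
      (key c hc fun σ h => hb σ (by simp [h]))

end Ambient

end Phi43

end

noncomputable section

namespace Phi43

/-! ## The structure group over a ring of coefficients -/

section Group

variable {κ : ℝ} {B B' : Type} [CommRing B] [CommRing B'] [Algebra ℝ B] [Algebra ℝ B']

/-- Change of coefficients. -/
abbrev push (φ : B →ₐ[ℝ] B') : MonoidAlgebra B Sym →ₐ[ℝ] MonoidAlgebra B' Sym :=
  MonoidAlgebra.mapAlgHom Sym φ

theorem push_mon (φ : B →ₐ[ℝ] B') (τ : Sym) : push φ (mon B τ) = mon B' τ := by
  simp [MonoidAlgebra.mapAlgHom_single]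

theorem push_smul (φ : B →ₐ[ℝ] B') (b : B) (u : MonoidAlgebra B Sym) :
    push φ (b • u) = φ b • push φ u := by
  have : ∀ (A : Type) [CommRing A] (a : A) (v : MonoidAlgebra A Sym),
      a • v = MonoidAlgebra.single 1 a * v := by
    intro A _ a v
    rw [Algebra.smul_def]; rfl
  rw [this, this, map_mul, MonoidAlgebra.mapAlgHom_single]

theorem push_algebraMap (φ : B →ₐ[ℝ] B') (b : B) :
    push φ (algebraMap B (MonoidAlgebra B Sym) b) = algebraMap B' (MonoidAlgebra B' Sym) (φ b) :=
  MonoidAlgebra.mapAlgHom_single _ _ _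

/-- Two maps which are semilinear with respect to a change of coefficients agree if they agree on
the basis. -/
theorem semi_congr {V : Type*} [AddCommGroup V] [Module B' V] {S : Set Sym} (φ : B →ₐ[ℝ] B')
    (L L' : MonoidAlgebra B Sym →+ V) (hL : ∀ b u, L (b • u) = φ b • L u)
    (hL' : ∀ b u, L' (b • u) = φ b • L' u) (h : ∀ σ ∈ S, L (mon B σ) = L' (mon B σ))
    {u : MonoidAlgebra B Sym} (hu : u ∈ supp B S) : L u = L' u := by
  rw [supp_eq_span] at hu
  induction hu using Submodule.span_induction with
  | mem x hx => obtain ⟨σ, hσ, rfl⟩ := hx; exact h σ hσ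
  | zero => simp
  | add x y _ _ hx hy => rw [map_add, map_add, hx, hy]
  | smul b x _ hx => rw [hL, hL', hx]

theorem push_linear (φ : B →ₐ[ℝ] B') (L : MonoidAlgebra B Sym →ₗ[B] MonoidAlgebra B Sym)
    (L' : MonoidAlgebra B' Sym →ₗ[B'] MonoidAlgebra B' Sym) {S : Set Sym}
    (h : ∀ σ ∈ S, push φ (L (mon B σ)) = L' (mon B' σ)) {u : MonoidAlgebra B Sym}
    (hu : u ∈ supp B S) : push φ (L u) = L' (push φ u) := by
  refine semi_congr (S := S) φ ((push φ : MonoidAlgebra B Sym →+ _).comp L.toAddMonoidHom)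
    (L'.toAddMonoidHom.comp (push φ : MonoidAlgebra B Sym →+ _)) ?_ ?_ ?_ hu
  · intro b u
    change push φ (L (b • u)) = φ b • push φ (L u)
    rw [map_smul, push_smul]
  · intro b u
    change L' (push φ (b • u)) = φ b • L' (push φ u)
    rw [push_smul, map_smul]
  · intro σ hσ
    change push φ (L (mon B σ)) = L' (push φ (mon B σ))
    rw [push_mon]; exact h σ hσ

theorem push_intB (φ : B →ₐ[ℝ] B') (u : MonoidAlgebra B Sym) :
    push φ (intB B u) = intB B' (push φ u) := by
  refine push_linear φ _ _ (S := Set.univ) (fun σ _ => ?_) (mem_supp_univ u)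
  by_cases hp : σ.IsPoly
  · rw [intB_poly hp, intB_poly hp, map_zero]
  · rw [intB_mon hp, intB_mon hp, push_mon]

theorem push_trGt (φ : B →ₐ[ℝ] B') (c : ℝ) (u : MonoidAlgebra B Sym) :
    push φ (trGt B c u) = trGt B' c (push φ u) := by
  refine push_linear φ _ _ (S := Set.univ) (fun σ _ => ?_) (mem_supp_univ u)
  rcases lt_or_ge c (sdeg σ.exp) with h1 | h1
  · rw [trGt_mon_of_lt h1, trGt_mon_of_lt h1, push_mon]
  · rw [trGt_mon_of_le h1, trGt_mon_of_le h1, map_zero]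

theorem push_algHom (φ : B →ₐ[ℝ] B') (Φ : MonoidAlgebra B Sym →ₐ[B] MonoidAlgebra B Sym)
    (Φ' : MonoidAlgebra B' Sym →ₐ[B'] MonoidAlgebra B' Sym) (τ : Sym)
    (hX : ∀ i, push φ (Φ (mon B (Xg i))) = Φ' (mon B' (Xg i)))
    (hXi : push φ (Φ (mon B Sym.Xi)) = Φ' (mon B' Sym.Xi))
    (hb : ∀ σ ∈ τ.branches, push φ (Φ (mon B σ.int)) = Φ' (mon B' σ.int)) :
    push φ (Φ (mon B τ)) = Φ' (mon B' τ) := by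
  have := ringHom_congr ((push φ : MonoidAlgebra B Sym →+* MonoidAlgebra B' Sym).comp
      (Φ : MonoidAlgebra B Sym →+* MonoidAlgebra B Sym))
    ((Φ' : MonoidAlgebra B' Sym →+* MonoidAlgebra B' Sym).comp
      (push φ : MonoidAlgebra B Sym →+* MonoidAlgebra B' Sym)) τ
    (fun i => ?_) (fun _ => ?_) fun σ hσ => ?_
  · change push φ (Φ (mon B τ)) = Φ' (push φ (mon B τ)) at this
    rwa [push_mon] at this
  · change push φ (Φ (mon B _)) = Φ' (push φ (mon B _))
    rw [push_mon, hX]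
  · change push φ (Φ (mon B _)) = Φ' (push φ (mon B _))
    rw [push_mon, hXi]
  · change push φ (Φ (mon B _)) = Φ' (push φ (mon B _))
    rw [push_mon, hb σ hσ]

theorem push_trans (φ : B →ₐ[ℝ] B') (a : Fin 4 → B) (u : MonoidAlgebra B Sym) :
    push φ (trans a u) = trans (fun i => φ (a i)) (push φ u) := by
  refine push_linear φ (trans a).toLinearMap (trans (fun i => φ (a i))).toLinearMap
    (S := Set.univ) (fun σ _ => ?_) (mem_supp_univ u)
  simp only [AlgHom.toLinearMap_apply]
  refine push_algHom φ _ _ σ (fun i => ?_) ?_ fun σ _ => ?_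
  · rw [trans_X, trans_X, map_add, push_mon, push_algebraMap]
  · rw [trans_Xi, trans_Xi, push_mon]
  · rw [trans_int, trans_int, push_mon]

/-- The values of a character at the `X_i`. -/
def charX (f : Tp κ →ₐ[ℝ] B) (i : Fin 4) : B := f (MvPolynomial.X (Sum.inl i))

/-- `∑_k X^k / k! f(𝓘_k(σ))` -/
def jetI (f : Tp κ →ₐ[ℝ] B) : MonoidAlgebra B Sym →ₗ[B] MonoidAlgebra B Sym :=
  linExt fun σ => ∑ k ∈ idxBelow (deg κ σ + 2),
    MonoidAlgebra.single (Sym.Xpow k) ((ifac k : ℝ)⁻¹ • f (JJ κ k σ))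

theorem jetI_mon (f : Tp κ →ₐ[ℝ] B) (σ : Sym) : jetI f (mon B σ) = ∑ k ∈ idxBelow (deg κ σ + 2),
    MonoidAlgebra.single (Sym.Xpow k) ((ifac k : ℝ)⁻¹ • f (JJ κ k σ)) := linExt_mon _ _

theorem jetI_eq_zero (f : Tp κ →ₐ[ℝ] B) {σ : Sym} (h : ¬ (σ.InW ∧ ¬ σ.IsPoly)) :
    jetI f (mon B σ) = 0 := by
  rw [jetI_mon]
  refine Finset.sum_eq_zero fun k _ => ?_
  rw [JJ, dif_neg (fun h' => h ⟨h'.1, h'.2.1⟩), map_zero, smul_zero, MonoidAlgebra.single_zero]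

theorem mem_idxBelow {c : ℝ} {k : Idx} : k ∈ idxBelow c ↔ (sdeg k : ℝ) < c := by
  simp [idxBelow]

theorem push_jetI (φ : B →ₐ[ℝ] B') (f : Tp κ →ₐ[ℝ] B) (u : MonoidAlgebra B Sym) :
    push φ (jetI f u) = jetI (φ.comp f) (push φ u) := by
  refine push_linear φ _ _ (S := Set.univ) (fun σ _ => ?_) (mem_supp_univ u)
  rw [jetI_mon, jetI_mon, map_sum]
  refine Finset.sum_congr rfl fun k _ => ?_
  rw [MonoidAlgebra.mapAlgHom_single, map_smul, AlgHom.comp_apply]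

/-- Evaluation of the right factor by means of a character. -/
def evTensor (f : Tp κ →ₐ[ℝ] B) : Amb ⊗[ℝ] Tp κ →ₐ[ℝ] MonoidAlgebra B Sym :=
  Algebra.TensorProduct.lift (MonoidAlgebra.mapAlgHom Sym (Algebra.ofId ℝ B))
    (MonoidAlgebra.singleOneAlgHom.comp f) fun _ _ => Commute.all _ _

theorem evTensor_tmul (f : Tp κ →ₐ[ℝ] B) (u : Amb) (p : Tp κ) :
    evTensor f (u ⊗ₜ p) = f p • MonoidAlgebra.mapAlgHom Sym (Algebra.ofId ℝ B) u := by
  rw [evTensor, Algebra.TensorProduct.lift_tmul, mul_comm, Algebra.smul_def]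
  rfl

theorem intA_eq_intB : intA = intB ℝ := rfl

theorem evTensor_intA (f : Tp κ →ₐ[ℝ] B) (x : Amb ⊗[ℝ] Tp κ) :
    evTensor f (LinearMap.rTensor (Tp κ) intA x) = intB B (evTensor f x) := by
  induction x using TensorProduct.induction_on with
  | zero => simp
  | tmul u p =>
    rw [LinearMap.rTensor_tmul, evTensor_tmul, evTensor_tmul, map_smul, intA_eq_intB]
    congr 1
    exact push_intB (Algebra.ofId ℝ B) u
  | add x y hx hy => rw [map_add, map_add, map_add, map_add, hx, hy]

theorem evTensor_mon (f : Tp κ →ₐ[ℝ] B) (τ : Sym) (p : Tp κ) :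
    evTensor f (MonoidAlgebra.of ℝ Sym τ ⊗ₜ p) = MonoidAlgebra.single τ (f p) := by
  rw [evTensor_tmul, ← mon_eq_of]
  have := push_mon (Algebra.ofId ℝ B) τ
  rw [this, smul_mon]

/-- The element `Γ_f` of the structure group, on the ambient algebra. -/
def GamB (f : Tp κ →ₐ[ℝ] B) : MonoidAlgebra B Sym →ₐ[B] MonoidAlgebra B Sym :=
  evAlg B (fun i => mon B (Xg i) + algebraMap B _ (charX f i)) (mon B Sym.Xi)
    fun σ => intB B (evTensor f (deltaA κ σ)) + jetI f (mon B σ)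

/-- Link with the given Δ: evaluating its right factor by a character gives an algebra morphism of
the ambient algebra. From here on the structure group is handled through generators, without
tensors. -/
theorem GamB_eq_evTensor (f : Tp κ →ₐ[ℝ] B) (τ : Sym) :
    GamB f (mon B τ) = evTensor f (deltaA κ τ) := by
  rw [GamB, evAlg_mon, deltaA,
    Multiset.attach_map_val' τ.branches (fun σ => LinearMap.rTensor (Tp κ) intA (deltaA κ σ)
        + ∑ k ∈ idxBelow (deg κ σ + 2), ((ifac k : ℝ)⁻¹ •
            (MonoidAlgebra.of ℝ Sym (Sym.Xpow k) ⊗ₜ[ℝ] JJ κ k σ)))]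
  rw [map_mul, map_mul, map_prod, map_pow, map_multiset_prod, Multiset.map_map, evTensor_mon,
    map_one]
  congr 1
  · congr 1
    refine Finset.prod_congr rfl fun i _ => ?_
    rw [map_pow, map_add, evTensor_mon, map_one]
    congr 2
    have := evTensor_mon f 1 (MvPolynomial.X (Sum.inl i))
    rw [map_one] at this
    exact this.symm
  · congr 1
    refine Multiset.map_congr rfl fun σ _ => ?_
    rw [Function.comp_apply, map_add, evTensor_intA, jetI_mon, map_sum]
    congr 1
    refine Finset.sum_congr rfl fun k _ => ?_
    rw [map_smul, evTensor_mon, MonoidAlgebra.smul_single]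

theorem GamB_X (f : Tp κ →ₐ[ℝ] B) (i : Fin 4) :
    GamB f (mon B (Xg i)) = mon B (Xg i) + algebraMap B _ (charX f i) := evAlg_X _ _ _ _
theorem GamB_Xi (f : Tp κ →ₐ[ℝ] B) : GamB f (mon B Sym.Xi) = mon B Sym.Xi := evAlg_Xi _ _ _
theorem GamB_int (f : Tp κ →ₐ[ℝ] B) (σ : Sym) :
    GamB f (mon B σ.int) = intB B (GamB f (mon B σ)) + jetI f (mon B σ) := by
  rw [GamB_eq_evTensor f σ, GamB, evAlg_int]

theorem push_GamB (φ : B →ₐ[ℝ] B') (f : Tp κ →ₐ[ℝ] B) (u : MonoidAlgebra B Sym) :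
    push φ (GamB f u) = GamB (φ.comp f) (push φ u) := by
  refine push_linear φ (GamB f).toLinearMap (GamB (φ.comp f)).toLinearMap
    (S := Set.univ) (fun σ _ => ?_) (mem_supp_univ u)
  change push φ (GamB f (mon B σ)) = GamB (φ.comp f) (mon B' σ)
  rename_i h
  clear h
  induction σ using Sym.induction with
  | h k m s ih =>
    refine push_algHom φ _ _ _ (fun i => ?_) ?_ fun σ hσ => ?_
    · rw [GamB_X, GamB_X, map_add, push_mon, push_algebraMap]; rfl
    · rw [GamB_Xi, GamB_Xi, push_mon]
    · rw [GamB_int, GamB_int, map_add, push_intB, push_jetI, ih σ (by simpa using hσ), push_mon]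

theorem jetI_mem (f : Tp κ →ₐ[ℝ] B) (σ : Sym) :
    jetI f (mon B σ) ∈ supp B (polyLt (deg κ σ + 2)) := by
  rw [jetI_mon]
  refine sum_mem fun k hk => single_mem_supp (mem_polyLt.2 ⟨Sym.isPoly_Xpow k, ?_⟩) _
  rw [Sym.exp_Xpow]; exact mem_idxBelow.1 hk

theorem jetI_poly (f : Tp κ →ₐ[ℝ] B) {u : MonoidAlgebra B Sym} (hu : u ∈ supp B polySet) :
    jetI f u = 0 := by
  refine (Submodule.mem_bot B).1 (map_mem_of_supp _ ⊥ (fun σ hσ => ?_) hu)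
  rw [jetI_eq_zero f fun h => h.2 hσ]; exact zero_mem _

theorem GamB_poly (f : Tp κ →ₐ[ℝ] B) {u : MonoidAlgebra B Sym} (hu : u ∈ supp B polySet) :
    GamB f u = trans (charX f) u :=
  algHom_poly_congr _ _ (fun i => by rw [GamB_X, trans_X]) hu

theorem GamB_intB (f : Tp κ →ₐ[ℝ] B) (u : MonoidAlgebra B Sym) :
    GamB f (intB B u) = intB B (GamB f u) + jetI f u := by
  refine linMap_congr (S := Set.univ) ((GamB f).toLinearMap ∘ₗ intB B)
    (intB B ∘ₗ (GamB f).toLinearMap + jetI f) (fun σ _ => ?_) (mem_supp_univ u)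
  simp only [LinearMap.comp_apply, LinearMap.add_apply, AlgHom.toLinearMap_apply]
  by_cases hp : σ.IsPoly
  · have h := mon_mem_supp (B := B) (mem_polySet.2 hp)
    rw [intB_poly hp, jetI_poly f h, GamB_poly f h, intB_eq_zero (trans_mem_poly _ h), map_zero,
      add_zero]
  · rw [intB_mon hp, GamB_int]

theorem jetI_mem_poly (f : Tp κ →ₐ[ℝ] B) (u : MonoidAlgebra B Sym) :
    jetI f u ∈ supp B polySet := by
  refine map_mem_of_supp (S := Set.univ) (jetI f) _ (fun σ _ => ?_) (mem_supp_univ u)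
  exact supp_mono (polyLt_subset _) (jetI_mem f σ)

theorem GamB_mem_W (f : Tp κ →ₐ[ℝ] B) {τ : Sym} (hτ : τ.InW) :
    GamB f (mon B τ) ∈ supp B setW := by
  induction τ using Sym.induction with
  | h k m s ih =>
    refine algHom_mem_W (fun i => ⟨_, GamB_X f i⟩) (GamB_Xi f) hτ fun σ hσ => ?_
    rw [GamB_int]
    exact add_mem (intB_mem_U (ih σ (by simpa using hσ) (hτ.branch hσ).1))
      (supp_mono poly_subset_U (jetI_mem_poly f _))

theorem GamB_mem_supp_W (f : Tp κ →ₐ[ℝ] B) {u : MonoidAlgebra B Sym} (hu : u ∈ supp B setW) :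
    GamB f u ∈ supp B setW :=
  map_mem_of_supp (GamB f).toLinearMap _ (fun _ h => GamB_mem_W f h) hu

/-- `Γ_f τ` is `τ` plus terms of larger weight, for a weight which is larger for the polynomials
produced by `Δ`. -/
theorem GamB_lead (f : Tp κ →ₐ[ℝ] B) {θ : Sym → ℝ} (hθ : ∀ σ τ, θ (σ * τ) = θ σ + θ τ)
    {c : ℝ} (hint : ∀ σ, θ σ.int = θ σ + c) (hX : ∀ i, θ (Xg i) < 0)
    (hp : ∀ σ : Sym, σ.InW → ¬ σ.IsPoly → ∀ k : Idx, (sdeg k : ℝ) < deg κ σ + 2 →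
      θ σ.int < θ (Sym.Xpow k)) {τ : Sym} (hτ : τ.InW) : Lead θ τ (GamB f (mon B τ)) := by
  have h1 : θ 1 = 0 := by
    have := hθ 1 1
    rw [mul_one] at this; linarith
  induction τ using Sym.induction with
  | h k m s ih =>
    refine lead_algHom hθ _ _ (fun i => ?_) ?_ fun σ hσ => ?_
    · rw [GamB_X, Lead, add_sub_cancel_left]
      refine single_mem_supp (τ := 1) ?_ _
      rw [Set.mem_ofPred_eq, h1]; exact hX i
    · rw [GamB_Xi]; exact lead_self _ _
    · obtain ⟨hσW, hσp⟩ := hτ.branch hσ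
      have h2 := ih σ (by simpa using hσ) hσW
      rw [GamB_int, Lead, add_sub_right_comm]
      refine add_mem ?_ ?_
      · rw [← intB_mon hσp, ← map_sub]
        refine intB_mem_supp (fun ρ hρ _ => ?_) h2
        simp only [Set.mem_ofPred_eq, hint] at *; linarith
      · refine supp_mono (fun ρ hρ => ?_) (jetI_mem f σ)
        obtain ⟨⟨k, rfl⟩, hρ⟩ := mem_polyLt.1 hρ
        rw [Sym.exp_Xpow] at hρ
        exact hp σ hσW hσp k hρ

theorem one_le_sdeg_single (i : Fin 4) : 1 ≤ sdeg (Finsupp.single i 1) := by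
  fin_cases i <;> simp [sdeg]

theorem GamB_lead_deg (f : Tp κ →ₐ[ℝ] B) {τ : Sym} (hτ : τ.InW) :
    Lead (fun σ => -deg κ σ) τ (GamB f (mon B τ)) := by
  refine GamB_lead f (fun σ τ => ?_) (c := -2) (fun σ => ?_) (fun i => ?_) (fun σ _ _ k h => ?_) hτ
  · simp only [Sym.deg_mul]; ring
  · simp only [Sym.deg_int]; ring
  · have := one_le_sdeg_single i
    simp only [Xg, Sym.deg_Xpow, Left.neg_neg_iff]
    exact_mod_cast this
  · simp only [Sym.deg_int, Sym.deg_Xpow]; linarith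

/-- The monomials created from I(σ) satisfy |k| < |σ| + 2 and σ contains a noise, so for κ > 0 they
lose weight. The weight being a natural number, this makes Γ_f unipotent and is what allows it to be
inverted. -/
theorem GamB_lead_wt (hκ : 0 < κ) (f : Tp κ →ₐ[ℝ] B) {τ : Sym} (hτ : τ.InW) :
    Lead (fun σ => -(σ.wt : ℝ)) τ (GamB f (mon B τ)) := by
  refine GamB_lead f (fun σ τ => ?_) (c := -2) (fun σ => ?_) (fun i => ?_)
    (fun σ h1 h2 k h => ?_) hτ
  · simp only [Sym.wt_mul]; push_cast; ring
  · simp only [Sym.wt_int]; push_cast; ring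
  · have := one_le_sdeg_single i
    simp only [Xg, Sym.wt_Xpow, Left.neg_neg_iff]
    exact_mod_cast this
  · have h3 : (1 : ℝ) ≤ σ.numXi := by exact_mod_cast h1.one_le_numXi h2
    rw [Sym.deg_eq_wt] at h
    simp only [Sym.wt_int, Sym.wt_Xpow]; push_cast
    nlinarith

end Group

end Phi43

end

noncomputable section

namespace Phi43

/-! ## Contractions at the root -/

section Contraction

open Polynomial

variable {B : Type} [CommRing B]

/-- The ambient algebra with coefficients in `B`. -/
abbrev AmbB (B : Type) [CommRing B] : Type := MonoidAlgebra B Sym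

open Classical in
/-- The shift `I(Ξ) ↦ I(Ξ) + s`. -/
def shiftS (B : Type) [CommRing B] : AmbB B →ₐ[B] (AmbB B)[X] :=
  evAlg B (fun i => C (mon B (Xg i))) (C (mon B Sym.Xi))
    fun σ => C (mon B σ.int) + if σ = Sym.Xi then X else 0

/-- The sum over all ways of replacing `j` factors `I(Ξ)` at the root by `1`. -/
def leafB (B : Type) [CommRing B] (j : ℕ) : AmbB B →ₗ[B] AmbB B :=
  ((lcoeff (AmbB B) j).restrictScalars B) ∘ₗ (shiftS B).toLinearMap

theorem leafB_apply (j : ℕ) (u : AmbB B) : leafB B j u = (shiftS B u).coeff j := rfl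

open Classical in
/-- The shift `I(σ) ↦ I(σ) + s 1_{σ = Ξ} + ε D_i σ`, where `D_i` removes `i` leaves. -/
def shiftT (B : Type) [CommRing B] (i : ℕ) : AmbB B →ₐ[B] (AmbB B)[X][X] :=
  evAlg B (fun i => C (C (mon B (Xg i)))) (C (C (mon B Sym.Xi)))
    fun σ => C (C (mon B σ.int) + if σ = Sym.Xi then X else 0) + X * C (C (leafB B i (mon B σ)))

/-- The sum over all contractions of a subtree `I(I(Ξ)^i) I(Ξ)^j` containing the root. -/
def cherryB (B : Type) [CommRing B] (i j : ℕ) : AmbB B →ₗ[B] AmbB B :=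
  ((lcoeff (AmbB B) j).restrictScalars B) ∘ₗ ((lcoeff (AmbB B)[X] 1).restrictScalars B) ∘ₗ
    (shiftT B i).toLinearMap

theorem cherryB_apply (i j : ℕ) (u : AmbB B) :
    cherryB B i j u = ((shiftT B i u).coeff 1).coeff j := rfl

theorem mon_node (k : Idx) (m : ℕ) (s : Multiset Sym) :
    mon B (Sym.node k m s) = mon B (Sym.node k m 0) * (s.map fun σ => mon B σ.int).prod := by
  have : Sym.node k m s = Sym.node k m 0 * (s.map Sym.int).prod := by
    rw [Sym.prod_int, Sym.ext_iff3]; simp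
  rw [this, mon_mul, mon_eq_of (s.map Sym.int).prod, map_multiset_prod, Multiset.map_map]
  rfl

theorem prod_gen (τ : Sym) :
    (∏ i, mon B (Xg i) ^ τ.exp i) * mon B Sym.Xi ^ τ.noise = mon B (Sym.node τ.exp τ.noise 0) := by
  rw [← mon_Xpow, mon_eq_of Sym.Xi, ← map_pow, ← mon_eq_of, ← mon_mul, Sym.Xi_pow]
  congr 1
  rw [Sym.ext_iff3]; simp

open Classical in
theorem shiftS_mon (τ : Sym) : shiftS B (mon B τ) = C (mon B (Sym.node τ.exp τ.noise 0)) *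
    (τ.branches.map fun σ => C (mon B σ.int) + if σ = Sym.Xi then X else 0).prod := by
  rw [shiftS, evAlg_mon, ← prod_gen]
  simp only [map_mul, map_prod, map_pow]

open Classical in
theorem prod_leaf (s : Multiset Sym) :
    (s.map fun σ => if σ = Sym.Xi then (X : (AmbB B)[X]) else 0).prod
      = if s = Multiset.replicate s.card Sym.Xi then X ^ s.card else 0 := by
  induction s using Multiset.induction with
  | empty => simp
  | cons a s ih =>
    rw [Multiset.map_cons, Multiset.prod_cons, ih, Multiset.card_cons, Multiset.replicate_succ]
    by_cases ha : a = Sym.Xi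
    · subst ha
      simp only [if_true, Multiset.cons_inj_right]
      split_ifs
      · rw [pow_succ, mul_comm]
      · simp
    · rw [if_neg ha, zero_mul, if_neg]
      intro h
      exact ha (Multiset.eq_of_mem_replicate (n := s.card + 1)
        (by rw [Multiset.replicate_succ, ← h]; simp))

open Classical in
-- Expanding the product amounts to choosing the factors from which the variable is taken. The
-- choice contributes to the coefficient of order j exactly when it consists of j copies of Ξ, which
-- is the combinatorial definition of removing leaves, with multiplicities.
theorem coeff_prod_leaf (s : Multiset Sym) (j : ℕ) :
    ((s.map fun σ : Sym => C (mon B σ.int) + if σ = Sym.Xi then X else 0).prod).coeff j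
      = ((removeLeaves j s).map fun u => (u.map fun σ => mon B σ.int).prod).sum := by
  have h0 : ∀ σ : Sym, C (mon B σ.int) + (if σ = Sym.Xi then X else 0)
      = (if σ = Sym.Xi then X else 0) + C (mon B σ.int) := fun σ => add_comm _ _
  simp only [h0]
  rw [Multiset.prod_map_add, ← lcoeff_apply, map_multiset_sum, Multiset.map_map, removeLeaves,
    Multiset.map_map]
  have : ∀ t : Multiset (Multiset Sym × Multiset Sym),
      (t.map (lcoeff (AmbB B) j ∘ fun p =>
        (p.1.map fun σ => if σ = Sym.Xi then (X : (AmbB B)[X]) else 0).prod *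
        (p.2.map fun σ => C (mon B σ.int)).prod)).sum
      = ((t.filter fun p => p.1 = Multiset.replicate j Sym.Xi).map
        ((fun u => (u.map fun σ => mon B σ.int).prod) ∘ Prod.snd)).sum := by
    intro t
    induction t using Multiset.induction with
    | empty => simp
    | cons p t ih =>
      rw [Multiset.map_cons, Multiset.sum_cons, ih, Multiset.filter_cons, Multiset.map_add,
        Multiset.sum_add]
      congr 1
      rw [Function.comp_apply, lcoeff_apply, prod_leaf]
      have h1 : (p.2.map fun σ => (C (mon B σ.int) : (AmbB B)[X])).prod
          = C (p.2.map fun σ => mon B σ.int).prod := by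
        rw [map_multiset_prod, Multiset.map_map]; rfl
      rw [h1, coeff_mul_C]
      by_cases h : p.1 = Multiset.replicate j Sym.Xi
      · have h2 : p.1.card = j := by rw [h, Multiset.card_replicate]
        rw [h2, if_pos h, if_pos h]; simp
      · rw [if_neg h]
        split_ifs with h2
        · rw [coeff_X_pow, if_neg, zero_mul]; · simp
          rintro rfl; exact h h2
        · simp
  exact this _

theorem leafB_mon (j : ℕ) (τ : Sym) : leafB B j (mon B τ) =
    ((removeLeaves j τ.branches).map fun u => mon B (Sym.node τ.exp τ.noise u)).sum := by
  rw [leafB_apply, shiftS_mon, coeff_C_mul, coeff_prod_leaf, ← Multiset.sum_map_mul_left]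
  simp only [← mon_node]

open Classical in
-- Leibniz rule: the linear coefficient arises by differentiating one factor at a time.
theorem coeff_one_prod {R : Type*} [CommRing R] (s : Multiset Sym) (a b : Sym → R) :
    ((s.map fun σ => C (a σ) + X * C (b σ)).prod).coeff 0 = (s.map a).prod ∧
    ((s.map fun σ => C (a σ) + X * C (b σ)).prod).coeff 1
      = (s.map fun σ => b σ * ((s.erase σ).map a).prod).sum := by
  induction s using Multiset.induction with
  | empty => simp [coeff_one]
  | cons c s ih =>
    constructor
    · rw [Multiset.map_cons, Multiset.prod_cons, mul_coeff_zero, ih.1]; simp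
    · rw [Multiset.map_cons, Multiset.prod_cons, add_mul, coeff_add, coeff_C_mul, ih.2, mul_assoc,
        coeff_X_mul, coeff_C_mul, ih.1, Multiset.map_cons, Multiset.sum_cons,
        Multiset.erase_cons_head, add_comm, ← Multiset.sum_map_mul_left]
      congr 2
      refine Multiset.map_congr rfl fun σ hσ => ?_
      by_cases h : c = σ
      · subst h
        rw [Multiset.erase_cons_head]
        conv_rhs => rw [← Multiset.cons_erase hσ]
        rw [Multiset.map_cons, Multiset.prod_cons]; ring
      · rw [Multiset.erase_cons_tail _ h, Multiset.map_cons, Multiset.prod_cons]; ring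

open Classical in
-- The linear order in the outer variable singles out one branch a, inside which i leaves are
-- removed; the order j in the inner variable removes j leaves from the other branches. Encoding the
-- contraction in a multiplicative shift reduces its commutation properties to generators.
theorem cherryB_mon_eq (i j : ℕ) (τ : Sym) : cherryB B i j (mon B τ) =
    (τ.branches.map fun a =>
      leafB B i (mon B a) * leafB B j (mon B (Sym.node τ.exp τ.noise (τ.branches.erase a)))).sum := by
  rw [cherryB_apply, shiftT, evAlg_mon]
  have h1 : (∏ i, (C (C (mon B (Xg i))) : (AmbB B)[X][X]) ^ τ.exp i) * C (C (mon B Sym.Xi)) ^ τ.noise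
      = C (C (mon B (Sym.node τ.exp τ.noise 0))) := by
    rw [← prod_gen]; simp only [map_mul, map_prod, map_pow]
  rw [h1, coeff_C_mul, (coeff_one_prod _ _ _).2, coeff_C_mul, ← lcoeff_apply, map_multiset_sum,
    ← Multiset.sum_map_mul_left, Multiset.map_map]
  congr 1
  refine Multiset.map_congr rfl fun a _ => ?_
  rw [Function.comp_apply, lcoeff_apply, coeff_C_mul, leafB_apply j, shiftS_mon, coeff_C_mul]
  simp only [Sym.exp_node, Sym.noise_node, Sym.branches_node]
  ring

theorem mem_removeLeaves {j : ℕ} {s u : Multiset Sym} (h : u ∈ removeLeaves j s) :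
    s = u + Multiset.replicate j Sym.Xi := by
  classical
  obtain ⟨p, hp, rfl⟩ := Multiset.mem_map.1 h
  obtain ⟨h1, h2⟩ := Multiset.mem_filter.1 hp
  rw [Multiset.mem_antidiagonal] at h1
  rw [← h1, add_comm, h2]

theorem int_Xi_pow (j : ℕ) : Sym.Xi.int ^ j = Sym.node 0 0 (Multiset.replicate j Sym.Xi) := by
  rw [← Sym.prod_int, Multiset.map_replicate, Multiset.prod_replicate]

theorem leafB_mem (j : ℕ) (τ : Sym) :
    leafB B j (mon B τ) ∈ supp B {ρ | τ = ρ * Sym.Xi.int ^ j} := by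
  rw [leafB_mon]
  refine multiset_sum_mem _ fun u hu => ?_
  obtain ⟨v, hv, rfl⟩ := Multiset.mem_map.1 hu
  refine mon_mem_supp ?_
  rw [Set.mem_ofPred_eq, int_Xi_pow, Sym.ext_iff3]
  simp [mem_removeLeaves hv]

theorem cherryB_mem (i j : ℕ) (τ : Sym) : cherryB B i j (mon B τ) ∈
    supp B {ρ | ∃ ρ₁ ρ₂, τ = (ρ₂ * Sym.Xi.int ^ i).int * (ρ₁ * Sym.Xi.int ^ j) ∧ ρ = ρ₁ * ρ₂} := by
  classical
  rw [cherryB_mon_eq]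
  refine multiset_sum_mem _ fun u hu => ?_
  obtain ⟨a, ha, rfl⟩ := Multiset.mem_map.1 hu
  refine mul_mem_supp ?_ (leafB_mem i a) (leafB_mem j _)
  intro ρ₂ h2 ρ₁ h1
  rw [Set.mem_ofPred_eq] at h1 h2 ⊢
  refine ⟨ρ₁, ρ₂, ?_, mul_comm _ _⟩
  rw [← h1, ← h2, Sym.ext_iff3]
  simp [Multiset.cons_erase ha]

/-- `ρ` is obtained from `τ` by a contraction at the root. -/
inductive Contr : Sym → Sym → Prop
  | leaf (j : ℕ) (ρ : Sym) : 2 ≤ j → Contr (ρ * Sym.Xi.int ^ j) ρ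
  | cherry (i j : ℕ) (ρ₁ ρ₂ : Sym) : 2 ≤ i → 1 ≤ j → 4 ≤ i + j →
      Contr ((ρ₂ * Sym.Xi.int ^ i).int * (ρ₁ * Sym.Xi.int ^ j)) (ρ₁ * ρ₂)

/-- The linear combination of the contractions at the root. -/
def rootB (c : Fin 5 → B) : AmbB B →ₗ[B] AmbB B :=
  -(c 0 • leafB B 2 + c 1 • leafB B 3 + c 2 • cherryB B 2 2 + c 3 • cherryB B 3 2
    + c 4 • cherryB B 3 1)

theorem rootB_apply (c : Fin 5 → B) (u : AmbB B) : rootB c u =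
    -(c 0 • leafB B 2 u + c 1 • leafB B 3 u + c 2 • cherryB B 2 2 u + c 3 • cherryB B 3 2 u
    + c 4 • cherryB B 3 1 u) := rfl

theorem rootB_mem (c : Fin 5 → B) (τ : Sym) : rootB c (mon B τ) ∈ supp B {ρ | Contr τ ρ} := by
  have h1 : ∀ j, 2 ≤ j → leafB B j (mon B τ) ∈ supp B {ρ | Contr τ ρ} := fun j hj =>
    supp_mono (fun ρ hρ => by
      rw [Set.mem_ofPred_eq] at hρ ⊢
      rw [hρ]; exact .leaf j ρ hj) (leafB_mem j τ)
  have h2 : ∀ i j, 2 ≤ i → 1 ≤ j → 4 ≤ i + j →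
      cherryB B i j (mon B τ) ∈ supp B {ρ | Contr τ ρ} := fun i j hi hj hij =>
    supp_mono (fun ρ hρ => by
      rw [Set.mem_ofPred_eq] at hρ ⊢
      obtain ⟨ρ₁, ρ₂, rfl, rfl⟩ := hρ; exact .cherry i j ρ₁ ρ₂ hi hj hij) (cherryB_mem i j τ)
  rw [rootB_apply]
  exact neg_mem (add_mem (add_mem (add_mem (add_mem (Submodule.smul_mem _ _ (h1 2 le_rfl))
    (Submodule.smul_mem _ _ (h1 3 (by norm_num))))
    (Submodule.smul_mem _ _ (h2 2 2 le_rfl (by norm_num) le_rfl)))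
    (Submodule.smul_mem _ _ (h2 3 2 (by norm_num) (by norm_num) (by norm_num))))
    (Submodule.smul_mem _ _ (h2 3 1 (by norm_num) (by norm_num) (by norm_num))))

namespace Sym

theorem wt_pow (τ : Sym) (n : ℕ) : (τ ^ n).wt = n * τ.wt := by
  induction n with
  | zero => rw [pow_zero, zero_mul]; exact wt_Xpow 0
  | succ n ih => rw [pow_succ, wt_mul, ih]; ring
theorem numXi_pow (τ : Sym) (n : ℕ) : (τ ^ n).numXi = n * τ.numXi := by
  induction n with
  | zero => rw [pow_zero, zero_mul]; exact numXi_Xpow 0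
  | succ n ih => rw [pow_succ, numXi_mul, ih]; ring
theorem branches_int_Xi_pow (n : ℕ) : (Xi.int ^ n).branches = Multiset.replicate n Xi := by
  rw [int_Xi_pow, branches_node]

end Sym

theorem Contr.wt {τ ρ : Sym} (h : Contr τ ρ) : ρ.wt < τ.wt := by
  cases h with
  | leaf j ρ hj => simp [Sym.wt_pow]; omega
  | cherry i j ρ₁ ρ₂ hi hj hij => simp [Sym.wt_pow]; omega

theorem Contr.numXi {τ ρ : Sym} (h : Contr τ ρ) : ρ.numXi < τ.numXi := by
  cases h with
  | leaf j ρ hj => simp [Sym.numXi_pow, Sym.numXi_mul]; omega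
  | cherry i j ρ₁ ρ₂ hi hj hij => simp [Sym.numXi_pow, Sym.numXi_mul]; omega

/-- The contracted subtree has homogeneity -j(1/2 + κ), respectively 2 - (i + j)(1/2 + κ). The
latter is negative because i + j ≥ 4 and κ > 0; in the borderline case i + j = 4 it equals -4κ. -/
theorem Contr.deg {κ : ℝ} (hκ : 0 < κ) {τ ρ : Sym} (h : Contr τ ρ) : deg κ τ < deg κ ρ := by
  cases h with
  | leaf j ρ hj =>
    have : (2 : ℝ) ≤ j := by exact_mod_cast hj
    simp only [Sym.deg_eq_wt, Sym.wt_mul, Sym.numXi_mul, Sym.wt_pow, Sym.numXi_pow, Sym.wt_int,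
      Sym.numXi_int, Sym.wt_Xi, Sym.numXi_Xi]
    push_cast
    nlinarith
  | cherry i j ρ₁ ρ₂ hi hj hij =>
    have : (4 : ℝ) ≤ i + j := by exact_mod_cast hij
    simp only [Sym.deg_eq_wt, Sym.wt_mul, Sym.numXi_mul, Sym.wt_pow, Sym.numXi_pow, Sym.wt_int,
      Sym.numXi_int, Sym.wt_Xi, Sym.numXi_Xi]
    push_cast
    nlinarith

/-- The result of a contraction in `W` has at most one branch; its branches occur in the symbol or
in one of its branches. -/
theorem Contr.inW {τ ρ : Sym} (h : Contr τ ρ) (hτ : τ.InW) : ρ.noise = 0 ∧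
    ρ.branches.card ≤ 1 ∧ (∀ σ ∈ ρ.branches, σ.InW ∧ ¬ σ.IsPoly ∧ σ.wt < τ.wt) ∧ ρ.InW := by
  have key : ρ.noise = 0 ∧ ρ.branches.card ≤ 1 ∧
      (∀ σ ∈ ρ.branches, σ.InW ∧ ¬ σ.IsPoly ∧ σ.wt < τ.wt) := by
    have hwt := h.wt
    cases h with
    | leaf j ρ hj =>
      rcases Sym.inW_iff.1 hτ with h0 | ⟨h1, h2, h3, -⟩
      · have := congrArg (fun τ : Sym => τ.branches.card) h0
        simp [Sym.branches_int_Xi_pow] at this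
        omega
      · simp only [Sym.noise_mul, Sym.branches_mul, Multiset.card_add, Sym.branches_int_Xi_pow,
          Multiset.card_replicate] at h1 h3
        refine ⟨by omega, by omega, fun σ hσ => ?_⟩
        have h4 := h2 σ (by simp [hσ])
        exact ⟨h4.1, h4.2, lt_trans (by have := Sym.wt_branch hσ; omega) hwt⟩
    | cherry i j ρ₁ ρ₂ hi hj hij =>
      rcases Sym.inW_iff.1 hτ with h0 | ⟨h1, h2, h3, -⟩
      · have := congrArg (fun τ : Sym => τ.branches.card) h0
        simp at this
      · have h5 := h2 (ρ₂ * Sym.Xi.int ^ i) (by simp)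
        rcases Sym.inW_iff.1 h5.1 with h0 | ⟨g1, g2, g3, -⟩
        · have := congrArg (fun τ : Sym => τ.branches.card) h0
          simp [Sym.branches_int_Xi_pow] at this
          omega
        · simp only [Sym.noise_mul, Sym.branches_mul, Multiset.card_add, Sym.branches_int_Xi_pow,
            Multiset.card_replicate, Sym.branches_int, Sym.noise_int,
            Multiset.card_singleton] at h1 h3 g1 g3
          -- The root leaves at most 2 - j branches for ρ₁ and the inner vertex at most 3 - i for
          -- ρ₂, together at most 5 - (i + j) ≤ 1.
          refine ⟨by rw [Sym.noise_mul]; omega, by simp; omega, fun σ hσ => ?_⟩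
          have h6 : σ.InW ∧ ¬ σ.IsPoly := by
            rw [Sym.branches_mul, Multiset.mem_add] at hσ
            rcases hσ with hσ | hσ
            · exact h2 σ (by simp [hσ])
            · exact g2 σ (by simp [hσ])
          exact ⟨h6.1, h6.2, lt_trans (by have := Sym.wt_branch hσ; omega) hwt⟩
  refine ⟨key.1, key.2.1, key.2.2, Sym.inW_iff.2 (Or.inr ⟨key.1, fun σ hσ => ?_, ?_, ?_⟩)⟩
  · exact ⟨(key.2.2 σ hσ).1, (key.2.2 σ hσ).2.1⟩
  · have := key.2.1; omega
  · have := key.2.1; omega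

theorem leafB_eq_zero {i : ℕ} {σ : Sym} (h : σ.branches.card < i) : leafB B i (mon B σ) = 0 := by
  refine (Submodule.mem_bot B).1 ?_
  have := leafB_mem (B := B) i σ
  have h0 : {ρ : Sym | σ = ρ * Sym.Xi.int ^ i} = ∅ := by
    refine Set.eq_empty_of_forall_notMem fun ρ hρ => ?_
    rw [Set.mem_ofPred_eq] at hρ
    have := congrArg (fun τ : Sym => τ.branches.card) hρ
    simp [Sym.branches_int_Xi_pow] at this
    omega
  rw [h0, supp_eq_span, Set.image_empty, Submodule.span_empty] at this
  exact this

theorem leafB_poly {i : ℕ} (hi : 1 ≤ i) {u : AmbB B} (hu : u ∈ supp B polySet) :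
    leafB B i u = 0 := by
  refine (Submodule.mem_bot B).1 (map_mem_of_supp _ ⊥ (fun σ hσ => ?_) hu)
  rw [leafB_eq_zero]
  · exact zero_mem _
  · rw [(Sym.isPoly_iff.1 (mem_polySet.1 hσ)).2]; exact hi

/-- Constant polynomials. -/
def constHom (B A : Type) [CommRing B] [CommRing A] [Algebra B A] : A →ₐ[B] A[X] :=
  { (C : A →+* A[X]) with commutes' := fun _ => rfl }

theorem constHom_apply {A : Type} [CommRing A] [Algebra B A] (a : A) : constHom B A a = C a := rfl

theorem shiftS_poly {u : AmbB B} (hu : u ∈ supp B polySet) : shiftS B u = C u :=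
  algHom_poly_congr (shiftS B) (constHom B (AmbB B)) (fun _ => evAlg_X _ _ _ _) hu

theorem shiftT_poly (i : ℕ) {u : AmbB B} (hu : u ∈ supp B polySet) : shiftT B i u = C (C u) :=
  algHom_poly_congr (shiftT B i) ((constHom B (AmbB B)[X]).comp (constHom B (AmbB B)))
    (fun _ => evAlg_X _ _ _ _) hu

theorem shiftS_intB (u : AmbB B) :
    shiftS B (intB B u) = C (intB B u) + u.coeff Sym.Xi • X := by
  classical
  refine linMap_congr (S := Set.univ) ((shiftS B).toLinearMap ∘ₗ intB B)
    ((constHom B (AmbB B)).toLinearMap ∘ₗ intB B +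
      linExt fun σ => if σ = Sym.Xi then X else 0) (fun σ _ => ?_) (mem_supp_univ u) |>.trans ?_
  · simp only [LinearMap.comp_apply, LinearMap.add_apply, AlgHom.toLinearMap_apply, linExt_mon]
    by_cases hp : σ.IsPoly
    · rw [intB_poly hp, map_zero, map_zero, zero_add, if_neg]
      rintro rfl; exact Sym.not_isPoly_Xi hp
    · rw [intB_mon hp]; exact evAlg_int _ _ _ _
  · rw [LinearMap.add_apply]
    congr 1
    refine (LinearMap.congr_fun (linMap_ext _ (((Finsupp.lapply Sym.Xi ∘ₗ
      (MonoidAlgebra.coeffLinearEquiv B).toLinearMap)).smulRight (X : (AmbB B)[X])) fun σ => ?_) u)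
    rw [linExt_mon, LinearMap.smulRight_apply]
    simp only [LinearMap.comp_apply, LinearEquiv.coe_coe, Finsupp.lapply_apply,
      MonoidAlgebra.coeffLinearEquiv_apply, MonoidAlgebra.coeff_single, Finsupp.single_apply]
    split_ifs <;> simp

theorem shiftT_intB {i : ℕ} (hi : 1 ≤ i) (u : AmbB B) : shiftT B i (intB B u)
    = C (C (intB B u) + u.coeff Sym.Xi • X) + X * C (C (leafB B i u)) := by
  classical
  let c2 := (constHom B (AmbB B)[X]).toLinearMap
  have h := linMap_congr (V := (AmbB B)[X][X]) (S := Set.univ) ((shiftT B i).toLinearMap ∘ₗ intB B)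
    (c2 ∘ₗ (shiftS B).toLinearMap ∘ₗ intB B +
      LinearMap.mulLeft B X ∘ₗ c2 ∘ₗ (constHom B (AmbB B)).toLinearMap ∘ₗ leafB B i)
      (fun σ _ => ?_) (mem_supp_univ u)
  · refine h.trans ?_
    simp only [LinearMap.comp_apply, LinearMap.add_apply, AlgHom.toLinearMap_apply,
      LinearMap.mulLeft_apply, shiftS_intB, c2, constHom_apply]
  · simp only [LinearMap.comp_apply, LinearMap.add_apply, AlgHom.toLinearMap_apply,
      LinearMap.mulLeft_apply]
    by_cases hp : σ.IsPoly
    · rw [intB_poly hp, leafB_poly hi (mon_mem_supp (mem_polySet.2 hp))]; simp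
    · rw [intB_mon hp, shiftT, shiftS, evAlg_int, evAlg_int]; rfl

theorem intertwine {Q : Type} [CommRing Q] [Algebra B Q] (S : AmbB B →ₐ[B] Q)
    (G : AmbB B →ₐ[B] AmbB B) (P : Q →+* Q) (τ : Sym)
    (hX : ∀ i, S (G (mon B (Xg i))) = P (S (mon B (Xg i))))
    (hXi : S (G (mon B Sym.Xi)) = P (S (mon B Sym.Xi)))
    (hb : ∀ σ ∈ τ.branches, S (G (mon B σ.int)) = P (S (mon B σ.int))) :
    S (G (mon B τ)) = P (S (mon B τ)) :=
  ringHom_congr ((S : AmbB B →+* Q).comp (G : AmbB B →+* AmbB B)) (P.comp (S : AmbB B →+* Q)) τ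
    hX (fun _ => hXi) hb

/-- An algebra morphism which does not create or destroy factors `I(Ξ)` commutes with the removal
of leaves. -/
theorem leafB_comm (G : AmbB B →ₐ[B] AmbB B)
    (hX : ∀ i, ∃ a, G (mon B (Xg i)) = mon B (Xg i) + algebraMap B _ a)
    (hXi : G (mon B Sym.Xi) = mon B Sym.Xi) (H p : Sym → AmbB B) (τ : Sym)
    (hint : ∀ σ ∈ τ.branches, G (mon B σ.int) = intB B (H σ) + p σ ∧ p σ ∈ supp B polySet ∧
      (H σ).coeff Sym.Xi = (mon B σ).coeff Sym.Xi) (j : ℕ) :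
    leafB B j (G (mon B τ)) = G (leafB B j (mon B τ)) := by
  classical
  have h : shiftS B (G (mon B τ)) = mapRingHom (G : AmbB B →+* AmbB B) (shiftS B (mon B τ)) := by
    refine intertwine (shiftS B) G (mapRingHom (G : AmbB B →+* AmbB B)) τ
      (fun i => ?_) ?_ fun σ hσ => ?_
    · have h1 := mon_mem_supp (B := B) (mem_polySet.2 (Sym.isPoly_Xpow (Finsupp.single i 1)))
      rw [shiftS_poly h1, shiftS_poly (algHom_mem_poly hX _)]
      simp
    · rw [hXi, shiftS, evAlg_Xi]; simp [hXi]
    · obtain ⟨h1, h2, h3⟩ := hint σ hσ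
      rw [h1, map_add, shiftS_intB, shiftS_poly h2, h3, shiftS, evAlg_int]
      simp only [coe_mapRingHom, Polynomial.map_add, map_C, RingHom.coe_coe, h1,
        MonoidAlgebra.coeff_single, Finsupp.single_apply]
      split_ifs <;> simp [add_right_comm]
  rw [leafB_apply, h, coe_mapRingHom, coeff_map]; rfl

/-- As for leaves, it suffices that `shiftT` intertwines G with G acting on coefficients, which is
tested on generators. The additional term of `shiftT` at I(σ) is the removal of i leaves inside σ,
so that operation has to commute as well, and `hleaf` provides this. -/
theorem cherryB_comm (G : AmbB B →ₐ[B] AmbB B)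
    (hX : ∀ i, ∃ a, G (mon B (Xg i)) = mon B (Xg i) + algebraMap B _ a)
    (hXi : G (mon B Sym.Xi) = mon B Sym.Xi) (H p : Sym → AmbB B) (τ : Sym) {i : ℕ} (hi : 1 ≤ i)
    (hint : ∀ σ ∈ τ.branches, G (mon B σ.int) = intB B (H σ) + p σ ∧ p σ ∈ supp B polySet ∧
      (H σ).coeff Sym.Xi = (mon B σ).coeff Sym.Xi)
    (hleaf : ∀ σ ∈ τ.branches, leafB B i (H σ) = G (leafB B i (mon B σ))) (j : ℕ) :
    cherryB B i j (G (mon B τ)) = G (cherryB B i j (mon B τ)) := by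
  classical
  let G2 := mapRingHom (mapRingHom (G : AmbB B →+* AmbB B))
  have h : shiftT B i (G (mon B τ)) = G2 (shiftT B i (mon B τ)) := by
    refine intertwine (Q := (AmbB B)[X][X]) (shiftT B i) G G2 τ (fun i' => ?_) ?_ fun σ hσ => ?_
    · have h1 := mon_mem_supp (B := B) (mem_polySet.2 (Sym.isPoly_Xpow (Finsupp.single i' 1)))
      rw [shiftT_poly i h1, shiftT_poly i (algHom_mem_poly hX _)]
      simp [G2]
    · rw [hXi, shiftT, evAlg_Xi]; simp [hXi, G2]
    · obtain ⟨h1, h2, h3⟩ := hint σ hσ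
      rw [h1, map_add, shiftT_intB hi, shiftT_poly i h2, h3, shiftT, evAlg_int, hleaf σ hσ]
      simp only [G2, coe_mapRingHom, Polynomial.map_add, Polynomial.map_mul, map_C, map_X,
        RingHom.coe_coe, h1, MonoidAlgebra.coeff_single, Finsupp.single_apply]
      split_ifs <;> simp [add_right_comm]
  rw [cherryB_apply, h, coe_mapRingHom, coeff_map, coe_mapRingHom, coeff_map]; rfl

/-- The abstract H and p serve two applications: for Γ_f they are Γ_f σ and the jet of σ, and for
the multiplicative part of M they are M σ and 0. -/
theorem rootB_comm (G : AmbB B →ₐ[B] AmbB B)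
    (hX : ∀ i, ∃ a, G (mon B (Xg i)) = mon B (Xg i) + algebraMap B _ a)
    (hXi : G (mon B Sym.Xi) = mon B Sym.Xi) (H p : Sym → AmbB B) (τ : Sym)
    (hint : ∀ σ ∈ τ.branches, G (mon B σ.int) = intB B (H σ) + p σ ∧ p σ ∈ supp B polySet ∧
      (H σ).coeff Sym.Xi = (mon B σ).coeff Sym.Xi)
    (hleaf : ∀ σ ∈ τ.branches, ∀ i, 2 ≤ i → leafB B i (H σ) = G (leafB B i (mon B σ)))
    (c : Fin 5 → B) : rootB c (G (mon B τ)) = G (rootB c (mon B τ)) := by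
  have h1 := leafB_comm G hX hXi H p τ hint
  have h2 := fun i hi => cherryB_comm G hX hXi H p τ (i := i) (le_trans one_le_two hi) hint
    fun σ hσ => hleaf σ hσ i hi
  rw [rootB_apply, rootB_apply, h1, h1, h2 2 le_rfl, h2 3 (by norm_num), h2 3 (by norm_num)]
  simp only [map_neg, map_add, map_smul]

theorem coeff_Xi_of_noise {u : AmbB B} (hu : u ∈ supp B {ρ : Sym | ρ.noise = 0}) :
    u.coeff Sym.Xi = 0 := by
  rw [MonoidAlgebra.mem_supported'] at hu
  exact hu _ (by simp)

theorem coeff_mon_Xi {σ : Sym} (h : σ ≠ Sym.Xi) : (mon B σ).coeff Sym.Xi = 0 := by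
  rw [MonoidAlgebra.coeff_single]; simp [h]

theorem rootB_int (c : Fin 5 → B) (σ : Sym) : rootB c (mon B σ.int) = 0 := by
  refine (Submodule.mem_bot B).1 ?_
  have h := rootB_mem c σ.int
  have h0 : {ρ : Sym | Contr σ.int ρ} = ∅ := by
    refine Set.eq_empty_of_forall_notMem fun ρ hρ => ?_
    rw [Set.mem_ofPred_eq] at hρ
    generalize h1 : σ.int = τ at hρ
    have h1 := congrArg (fun τ : Sym => τ.branches.card) h1
    cases hρ with
    | leaf j ρ hj => simp [Sym.branches_int_Xi_pow] at h1; omega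
    | cherry i j ρ₁ ρ₂ hi hj hij => simp [Sym.branches_int_Xi_pow] at h1; omega
  rw [h0, supp_eq_span, Set.image_empty, Submodule.span_empty] at h
  exact h

theorem rootB_poly (c : Fin 5 → B) {u : AmbB B} (hu : u ∈ supp B polySet) : rootB c u = 0 := by
  refine (Submodule.mem_bot B).1 (map_mem_of_supp _ ⊥ (fun σ hσ => ?_) hu)
  have h := rootB_mem c σ
  have h0 : {ρ : Sym | Contr σ ρ} = ∅ := by
    refine Set.eq_empty_of_forall_notMem fun ρ hρ => ?_
    rw [Set.mem_ofPred_eq] at hρ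
    have h1 := congrArg Multiset.card (Sym.isPoly_iff.1 (mem_polySet.1 hσ)).2
    cases hρ with
    | leaf j ρ hj => simp [Sym.branches_int_Xi_pow] at h1; omega
    | cherry i j ρ₁ ρ₂ hi hj hij => simp [Sym.branches_int_Xi_pow] at h1
  rw [h0, supp_eq_span, Set.image_empty, Submodule.span_empty] at h
  exact h

theorem rootB_mem_W (c : Fin 5 → B) {u : AmbB B} (hu : u ∈ supp B setW) :
    rootB c u ∈ supp B setW := by
  refine map_mem_of_supp _ _ (fun σ hσ => ?_) hu
  refine supp_mono (fun ρ hρ => ?_) (rootB_mem c σ)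
  rw [Set.mem_ofPred_eq] at hρ
  exact (hρ.inW (mem_setW.1 hσ)).2.2.2

end Contraction

/-! ### Contractions at the root commute with the structure group -/

section ContractionReal

theorem contractRoot_eq (i : Fin 5) (τ : Sym) : contractRoot i τ =
    (![leafB ℝ 2, leafB ℝ 3, cherryB ℝ 2 2, cherryB ℝ 3 2, cherryB ℝ 3 1] i) (mon ℝ τ) := by
  classical
  have h1 : ∀ j, contractLeaves j τ = leafB ℝ j (mon ℝ τ) := fun j => by
    rw [leafB_mon]; rfl
  have h2 : ∀ i j, contractCherry i j τ = cherryB ℝ i j (mon ℝ τ) := fun i j => by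
    rw [cherryB_mon_eq, contractCherry]
    congr 1
    refine Multiset.map_congr (by congr) fun a _ => ?_
    rw [leafB_mon, leafB_mon, ← Multiset.sum_map_mul_left]
    simp only [Sym.exp_node, Sym.noise_node, Sym.branches_node]
    congr 1
    refine Multiset.map_congr ?_ fun u _ => ?_
    · congr
    · rw [← Multiset.sum_map_mul_right]
      congr 1
      refine Multiset.map_congr rfl fun v _ => ?_
      rw [← mon_mul, ← mon_eq_of]
      congr 1
      rw [Sym.ext_iff3]; simp [add_comm]
  fin_cases i
  · exact h1 2
  · exact h1 3
  · exact h2 2 2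
  · exact h2 3 2
  · exact h2 3 1

theorem rootB_real (c : Fin 5 → ℝ) (τ : Sym) :
    rootB c (mon ℝ τ) = -∑ i, c i • contractRoot i τ := by
  simp only [contractRoot_eq, rootB_apply, Fin.sum_univ_five]
  rfl

variable {B B' : Type} [CommRing B] [CommRing B'] [Algebra ℝ B] [Algebra ℝ B']

theorem push_rootB (φ : B →ₐ[ℝ] B') (c : Fin 5 → B) (u : AmbB B) :
    push φ (rootB c u) = rootB (fun i => φ (c i)) (push φ u) := by
  classical
  refine push_linear φ _ _ (S := Set.univ) (fun τ _ => ?_) (mem_supp_univ u)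
  have h1 : ∀ j σ, push φ (leafB B j (mon B σ)) = leafB B' j (mon B' σ) := fun j σ => by
    rw [leafB_mon, leafB_mon, map_multiset_sum, Multiset.map_map]
    congr 1
    exact Multiset.map_congr rfl fun u _ => push_mon φ _
  have h2 : ∀ i j σ, push φ (cherryB B i j (mon B σ)) = cherryB B' i j (mon B' σ) := by
    intro i j σ
    rw [cherryB_mon_eq, cherryB_mon_eq, map_multiset_sum, Multiset.map_map]
    congr 1
    refine Multiset.map_congr rfl fun u _ => ?_
    rw [Function.comp_apply, map_mul, h1, h1]
  rw [rootB_apply, rootB_apply]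
  simp only [map_neg, map_add, push_smul, h1, h2]

variable {κ : ℝ}

theorem GamB_noise (f : Tp κ →ₐ[ℝ] B) (τ : Sym) :
    GamB f (mon B τ) ∈ supp B {ρ | ρ.noise = τ.noise} := by
  refine Sym.gen_induction (fun σ u => u ∈ supp B {ρ : Sym | ρ.noise = σ.noise})
    ((GamB f : AmbB B →* AmbB B).comp (MonoidAlgebra.of B Sym)) (mon_mem_supp rfl)
    ?_ (fun i => ?_) τ (fun _ => ?_) fun σ _ => ?_
  · intro σ τ u v hu hv
    refine mul_mem_supp ?_ hu hv
    intro ρ hρ ρ' hρ'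
    rw [Set.mem_ofPred_eq] at *
    simp [hρ, hρ']
  · change GamB f (mon B (Xg i)) ∈ _
    rw [GamB_X]
    exact add_mem (mon_mem_supp rfl) (single_mem_supp (τ := 1) (by simp) _)
  · change GamB f (mon B Sym.Xi) ∈ _
    rw [GamB_Xi]; exact mon_mem_supp rfl
  · change GamB f (mon B σ.int) ∈ _
    rw [GamB_int]
    refine add_mem (intB_mem_supp (fun ρ _ _ => by simp) (mem_supp_univ _)) ?_
    refine supp_mono (fun ρ hρ => ?_) (jetI_mem_poly f _)
    rw [Set.mem_ofPred_eq, (Sym.isPoly_iff.1 (mem_polySet.1 hρ)).1]; simp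

theorem GamB_int_data (f : Tp κ →ₐ[ℝ] B) {σ : Sym} (hσ : σ.InW) :
    GamB f (mon B σ.int) = intB B (GamB f (mon B σ)) + jetI f (mon B σ) ∧
      jetI f (mon B σ) ∈ supp B polySet ∧
      (GamB f (mon B σ)).coeff Sym.Xi = (mon B σ).coeff Sym.Xi := by
  refine ⟨GamB_int f σ, jetI_mem_poly f _, ?_⟩
  by_cases h : σ = Sym.Xi
  · rw [h, GamB_Xi]
  · rw [coeff_mon_Xi h]
    have := GamB_noise f σ
    rw [hσ.noise h] at this
    exact coeff_Xi_of_noise this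

theorem leafB_GamB (f : Tp κ →ₐ[ℝ] B) {τ : Sym} (hτ : τ.InW) (i : ℕ) :
    leafB B i (GamB f (mon B τ)) = GamB f (leafB B i (mon B τ)) :=
  leafB_comm (GamB f) (fun i => ⟨charX f i, GamB_X f i⟩) (GamB_Xi f) (fun σ => GamB f (mon B σ))
    (fun σ => jetI f (mon B σ)) τ (fun _ hρ => GamB_int_data f (hτ.branch hρ).1) i

theorem rootB_GamB_mon (f : Tp κ →ₐ[ℝ] B) (c : Fin 5 → B) {τ : Sym} (hτ : τ.InW) :
    rootB c (GamB f (mon B τ)) = GamB f (rootB c (mon B τ)) :=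
  rootB_comm (GamB f) (fun i => ⟨charX f i, GamB_X f i⟩) (GamB_Xi f) (fun σ => GamB f (mon B σ))
    (fun σ => jetI f (mon B σ)) τ (fun _ hσ => GamB_int_data f (hτ.branch hσ).1)
    (fun _ hσ i _ => leafB_GamB f (hτ.branch hσ).1 i) c

/-- The contractions at the root commute with the structure group. -/
theorem rootB_GamB (f : Tp κ →ₐ[ℝ] B) (c : Fin 5 → B) {u : AmbB B} (hu : u ∈ supp B setW) :
    rootB c (GamB f u) = GamB f (rootB c u) := by
  have h := linMap_congr (rootB c ∘ₗ (GamB f).toLinearMap) ((GamB f).toLinearMap ∘ₗ rootB c)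
    (fun τ hτ => by
      rw [LinearMap.comp_apply, LinearMap.comp_apply]
      exact rootB_GamB_mon f c (mem_setW.1 hτ)) hu
  rw [LinearMap.comp_apply, LinearMap.comp_apply] at h
  exact h

end ContractionReal

end Phi43

end

noncomputable section

namespace Phi43

/-! ## The renormalisation maps -/

section Renorm

variable {κ : ℝ} {B B' : Type} [CommRing B] [CommRing B'] [Algebra ℝ B] [Algebra ℝ B']

/-- The polynomial correction in the renormalisation of `I(σ)`. -/
def corr (f : Tp κ →ₐ[ℝ] B) (σ : Sym) : AmbB B →ₗ[B] AmbB B :=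
  -(trGt B (deg κ σ + 2) ∘ₗ (trans (-charX f)).toLinearMap ∘ₗ jetI f)

theorem corr_apply (f : Tp κ →ₐ[ℝ] B) (σ : Sym) (u : AmbB B) :
    corr f σ u = -trGt B (deg κ σ + 2) (trans (-charX f) (jetI f u)) := rfl

/-- The images of the symbols under the renormalisation map based at the character `f`. -/
def renSym (f : Tp κ →ₐ[ℝ] B) (c : Fin 5 → B) (τ : Sym) : AmbB B :=
  evAlg B (fun i => mon B (Xg i)) (mon B Sym.Xi)
    (fun σ => if _ : σ.wt < τ.wt then
      intB B (renSym f c σ) + corr f σ (renSym f c σ) else 0) (mon B τ + rootB c (mon B τ))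
termination_by τ.wt

/-- The multiplicative part of the renormalisation map. -/
def renMul (f : Tp κ →ₐ[ℝ] B) (c : Fin 5 → B) : AmbB B →ₐ[B] AmbB B :=
  evAlg B (fun i => mon B (Xg i)) (mon B Sym.Xi)
    (fun σ => intB B (renSym f c σ) + corr f σ (renSym f c σ))

/-- The renormalisation map `Π_x^{-1} Π_x^M`, where `f = f_x`. -/
def renB (f : Tp κ →ₐ[ℝ] B) (c : Fin 5 → B) : AmbB B →ₗ[B] AmbB B := linExt (renSym f c)

variable (f : Tp κ →ₐ[ℝ] B) (c : Fin 5 → B)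

theorem renMul_X (i : Fin 4) : renMul f c (mon B (Xg i)) = mon B (Xg i) := evAlg_X _ _ _ _
theorem renMul_Xi : renMul f c (mon B Sym.Xi) = mon B Sym.Xi := evAlg_Xi _ _ _
theorem renMul_int (σ : Sym) : renMul f c (mon B σ.int)
    = intB B (renB f c (mon B σ)) + corr f σ (renB f c (mon B σ)) := by
  rw [renB, linExt_mon]; exact evAlg_int _ _ _ _

/-- The guard on the weight in `renSym` is never active: the branches of τ, and those of any
contraction of τ at the root, have weight below that of τ. Removing it exhibits M_f as M_f° ∘ (1 +
R). -/
theorem renB_mon (τ : Sym) :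
    renB f c (mon B τ) = renMul f c (mon B τ) + renMul f c (rootB c (mon B τ)) := by
  rw [renB, linExt_mon, renSym, map_add]
  set Φ := evAlg B (fun i => mon B (Xg i)) (mon B Sym.Xi)
    (fun σ => if _ : σ.wt < τ.wt then
      intB B (renSym f c σ) + corr f σ (renSym f c σ) else 0) with hΦ
  have key : ∀ ρ : Sym, ρ.wt ≤ τ.wt → Φ (mon B ρ) = renMul f c (mon B ρ) := by
    intro ρ hρ
    refine algHom_congr _ _ ρ (fun i => ?_) (fun _ => ?_) fun σ hσ => ?_
    · rw [hΦ, evAlg_X, renMul_X]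
    · rw [hΦ, evAlg_Xi, renMul_Xi]
    · have := Sym.wt_branch hσ
      rw [hΦ, evAlg_int, dif_pos (by omega), renMul, evAlg_int]
  rw [key τ le_rfl]
  have h := linMap_congr Φ.toLinearMap (renMul f c).toLinearMap
    (fun ρ hρ => key ρ (by rw [Set.mem_ofPred_eq] at hρ; exact hρ.wt.le)) (rootB_mem c τ)
  rw [AlgHom.toLinearMap_apply, AlgHom.toLinearMap_apply] at h
  rw [h]

theorem renB_apply (u : AmbB B) : renB f c u = renMul f c u + renMul f c (rootB c u) := by
  have h := linMap_congr (S := Set.univ) (renB f c)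
    ((renMul f c).toLinearMap + (renMul f c).toLinearMap ∘ₗ rootB c)
    (fun τ _ => renB_mon f c τ) (mem_supp_univ u)
  rw [LinearMap.add_apply, LinearMap.comp_apply] at h
  exact h

theorem renMul_poly {u : AmbB B} (hu : u ∈ supp B polySet) : renMul f c u = u :=
  algHom_poly_congr (renMul f c) (AlgHom.id B _) (fun i => renMul_X f c i) hu

theorem renB_poly {u : AmbB B} (hu : u ∈ supp B polySet) : renB f c u = u := by
  rw [renB_apply, rootB_poly c hu, map_zero, add_zero, renMul_poly f c hu]

theorem renB_int (σ : Sym) : renB f c (mon B σ.int)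
    = intB B (renB f c (mon B σ)) + corr f σ (renB f c (mon B σ)) := by
  rw [renB_mon, rootB_int, map_zero, add_zero, renMul_int]

theorem renB_Xi : renB f c (mon B Sym.Xi) = mon B Sym.Xi := by
  have : rootB c (mon B Sym.Xi) = 0 := by
    refine (Submodule.mem_bot B).1 ?_
    have h := rootB_mem c Sym.Xi
    have h0 : {ρ : Sym | Contr Sym.Xi ρ} = ∅ := by
      refine Set.eq_empty_of_forall_notMem fun ρ hρ => ?_
      rw [Set.mem_ofPred_eq] at hρ
      have := hρ.wt
      simp at this
    rw [h0, supp_eq_span, Set.image_empty, Submodule.span_empty] at h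
    exact h
  rw [renB_mon, this, map_zero, add_zero, renMul_Xi]

theorem corr_mem_poly (σ : Sym) (u : AmbB B) : corr f σ u ∈ supp B polySet :=
  neg_mem (trGt_mem_poly _ (trans_mem_poly _ (jetI_mem_poly f u)))

theorem renMul_mem_W {τ : Sym} (hτ : τ.InW)
    (h : ∀ σ ∈ τ.branches, renB f c (mon B σ) ∈ supp B setW) :
    renMul f c (mon B τ) ∈ supp B setW := by
  refine algHom_mem_W (fun i => ⟨0, ?_⟩) (renMul_Xi f c) hτ fun σ hσ => ?_
  · rw [renMul_X, map_zero, add_zero]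
  · rw [renMul_int]
    exact add_mem (intB_mem_U (h σ hσ)) (supp_mono poly_subset_U (corr_mem_poly f σ _))

theorem renB_mem_W {τ : Sym} (hτ : τ.InW) : renB f c (mon B τ) ∈ supp B setW := by
  induction hn : τ.wt using Nat.strong_induction_on generalizing τ with
  | _ n ih =>
    subst hn
    rw [renB_mon]
    refine add_mem (renMul_mem_W f c hτ fun σ hσ => ?_) ?_
    · have := Sym.wt_branch hσ
      exact ih σ.wt (by omega) (hτ.branch hσ).1 rfl
    · refine map_mem_of_supp (renMul f c).toLinearMap _ (fun ρ hρ => ?_) (rootB_mem c τ)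
      rw [Set.mem_ofPred_eq] at hρ
      refine renMul_mem_W f c (hρ.inW hτ).2.2.2 fun σ hσ => ?_
      obtain ⟨h1, -, h2⟩ := (hρ.inW hτ).2.2.1 σ hσ
      exact ih σ.wt h2 h1 rfl

theorem renB_mem_supp_W {u : AmbB B} (hu : u ∈ supp B setW) : renB f c u ∈ supp B setW :=
  map_mem_of_supp _ _ (fun _ h => renB_mem_W f c h) hu

/-- The symbols which may occur in the renormalisation of `σ`. -/
def renSet (κ : ℝ) (σ : Sym) : Set Sym :=
  {ρ | deg κ σ ≤ deg κ ρ ∧ ρ.numXi ≤ σ.numXi ∧ ρ.wt ≤ σ.wt}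

theorem mem_renSet {σ ρ : Sym} :
    ρ ∈ renSet κ σ ↔ deg κ σ ≤ deg κ ρ ∧ ρ.numXi ≤ σ.numXi ∧ ρ.wt ≤ σ.wt := Iff.rfl

/-- The three gradings must be treated together. A correction X^k at I(σ) stems from a symbol ρ of
M_f σ and satisfies |σ| + 2 < |k| < |ρ| + 2. The left inequality raises the homogeneity; the right
one lowers the weight, since ρ is no heavier than σ and contains a noise; and X^k has no noise while
σ has one. -/
theorem renMul_lead (hκ : 0 < κ) {τ : Sym}
    (h : ∀ σ ∈ τ.branches, ¬ σ.IsPoly ∧ renB f c (mon B σ) ∈ supp B (renSet κ σ) ∧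
      Lead (deg κ) σ (renB f c (mon B σ)) ∧
      Lead (fun ρ => -(ρ.numXi : ℝ)) σ (renB f c (mon B σ)) ∧
      Lead (fun ρ => -(ρ.wt : ℝ)) σ (renB f c (mon B σ))) :
    Lead (deg κ) τ (renMul f c (mon B τ)) ∧
      Lead (fun ρ => -(ρ.numXi : ℝ)) τ (renMul f c (mon B τ)) ∧
      Lead (fun ρ => -(ρ.wt : ℝ)) τ (renMul f c (mon B τ)) := by
  have key : ∀ θ : Sym → ℝ, (∀ σ τ, θ (σ * τ) = θ σ + θ τ) → (∃ a, ∀ σ, θ σ.int = θ σ + a) →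
      (∀ σ ρ, ρ ∈ renSet κ σ → ρ.InW → ¬ ρ.IsPoly → ∀ k : Idx, deg κ σ + 2 < sdeg k →
        sdeg k < deg κ ρ + 2 → θ σ.int < θ (Sym.Xpow k)) →
      (∀ σ ∈ τ.branches, Lead θ σ (renB f c (mon B σ))) → Lead θ τ (renMul f c (mon B τ)) := by
    intro θ hθ ⟨a, ha⟩ hk hL
    refine lead_algHom hθ _ τ (fun i => ?_) ?_ fun σ hσ => ?_
    · rw [renMul_X]; exact lead_self _ _
    · rw [renMul_Xi]; exact lead_self _ _
    · rw [renMul_int, Lead, add_sub_right_comm]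
      refine add_mem ?_ ?_
      · rw [← intB_mon (h σ hσ).1, ← map_sub]
        refine intB_mem_supp (fun ρ hρ _ => ?_) (hL σ hσ)
        simp only [Set.mem_ofPred_eq, ha] at *; linarith
      · have h2 : corr f σ (renB f c (mon B σ)) ∈ supp B {ρ | θ σ.int < θ ρ} := by
          refine map_mem_of_supp _ _ (fun ρ hρ => ?_) (h σ hσ).2.1
          rw [corr_apply]
          by_cases h : ρ.InW ∧ ¬ ρ.IsPoly
          · refine neg_mem (trGt_mem_supp (fun μ hμ hk' => ?_)
              (trans_mem_polyLt _ (jetI_mem f ρ)))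
            obtain ⟨⟨k, rfl⟩, hμ⟩ := mem_polyLt.1 hμ
            rw [Sym.exp_Xpow] at hk' hμ
            rw [Set.mem_ofPred_eq]
            exact hk σ ρ hρ h.1 h.2 k hk' hμ
          · rw [jetI_eq_zero f h, map_zero, map_zero, neg_zero]; exact zero_mem _
        exact h2
  refine ⟨key _ (Sym.deg_mul κ) ⟨2, Sym.deg_int κ⟩ ?_ fun σ hσ => (h σ hσ).2.2.1,
    key _ ?_ ⟨0, ?_⟩ ?_ fun σ hσ => (h σ hσ).2.2.2.1,
    key _ ?_ ⟨-2, ?_⟩ ?_ fun σ hσ => (h σ hσ).2.2.2.2⟩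
  · intro σ ρ _ _ _ k hk _
    rw [Sym.deg_int, Sym.deg_Xpow]; exact hk
  · intro σ τ; rw [Sym.numXi_mul]; push_cast; ring
  · intro σ; rw [Sym.numXi_int]; ring
  · intro σ ρ hρ h1 h2 k _ _
    have := h1.one_le_numXi h2
    have h3 := hρ.2.1
    rw [Sym.numXi_int, Sym.numXi_Xpow]
    simp only [Nat.cast_zero, neg_zero, Left.neg_neg_iff, Nat.cast_pos]
    omega
  · intro σ τ; rw [Sym.wt_mul]; push_cast; ring
  · intro σ; rw [Sym.wt_int]; push_cast; ring
  · intro σ ρ hρ h1 h2 k _ hk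
    have h3 : (1 : ℝ) ≤ ρ.numXi := by exact_mod_cast h1.one_le_numXi h2
    have h4 : (ρ.wt : ℝ) ≤ σ.wt := by exact_mod_cast hρ.2.2
    rw [Sym.deg_eq_wt] at hk
    rw [Sym.wt_int, Sym.wt_Xpow]
    push_cast
    nlinarith

theorem renB_lead (hκ : 0 < κ) {τ : Sym} (hτ : τ.InW) :
    renB f c (mon B τ) ∈ supp B (renSet κ τ) ∧ Lead (deg κ) τ (renB f c (mon B τ)) ∧
      Lead (fun ρ => -(ρ.numXi : ℝ)) τ (renB f c (mon B τ)) ∧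
      Lead (fun ρ => -(ρ.wt : ℝ)) τ (renB f c (mon B τ)) := by
  induction hn : τ.wt using Nat.strong_induction_on generalizing τ with
  | _ n ih =>
    subst hn
    have h1 : ∀ ρ : Sym, (∀ σ ∈ ρ.branches, σ.InW ∧ ¬ σ.IsPoly ∧ σ.wt < τ.wt) →
      Lead (deg κ) ρ (renMul f c (mon B ρ)) ∧
      Lead (fun ρ => -(ρ.numXi : ℝ)) ρ (renMul f c (mon B ρ)) ∧
      Lead (fun ρ => -(ρ.wt : ℝ)) ρ (renMul f c (mon B ρ)) := fun ρ hρ =>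
      renMul_lead f c hκ fun σ hσ => by
        obtain ⟨h1, h2, h3⟩ := hρ σ hσ
        exact ⟨h2, ih σ.wt h3 h1 rfl⟩
    have h2 := h1 τ fun σ hσ => by
      have := Sym.wt_branch hσ
      exact ⟨(hτ.branch hσ).1, (hτ.branch hσ).2, by omega⟩
    have key : ∀ θ : Sym → ℝ, (∀ ρ, Contr τ ρ → θ τ < θ ρ) →
        (∀ ρ, Contr τ ρ → Lead θ ρ (renMul f c (mon B ρ))) → Lead θ τ (renMul f c (mon B τ)) →
        Lead θ τ (renB f c (mon B τ)) := by
      intro θ hC hL h0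
      rw [renB_mon, Lead, add_sub_right_comm]
      refine add_mem h0 (map_mem_of_supp (renMul f c).toLinearMap _ (fun ρ hρ => ?_)
        (rootB_mem c τ))
      rw [Set.mem_ofPred_eq] at hρ
      refine supp_mono (fun μ hμ => ?_) (hL ρ hρ).mem
      have := hC ρ hρ
      simp only [Set.mem_ofPred_eq] at *; linarith
    have h3 : ∀ ρ, Contr τ ρ → _ := fun ρ hρ => h1 ρ (hρ.inW hτ).2.2.1
    have g1 := key (deg κ) (fun ρ hρ => hρ.deg hκ) (fun ρ hρ => (h3 ρ hρ).1) h2.1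
    have g2 := key (fun ρ => -(ρ.numXi : ℝ)) (fun ρ hρ => by simpa using hρ.numXi)
      (fun ρ hρ => (h3 ρ hρ).2.1) h2.2.1
    have g3 := key (fun ρ => -(ρ.wt : ℝ)) (fun ρ hρ => by simpa using hρ.wt)
      (fun ρ hρ => (h3 ρ hρ).2.2) h2.2.2
    refine ⟨?_, g1, g2, g3⟩
    have e1 := g1.mem
    have e2 := g2.mem
    have e3 := g3.mem
    rw [MonoidAlgebra.mem_supported] at e1 e2 e3 ⊢
    intro ρ hρ
    have d1 := e1 hρ
    have d2 := e2 hρ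
    have d3 := e3 hρ
    simp only [Set.mem_ofPred_eq, neg_le_neg_iff, Nat.cast_le] at d1 d2 d3
    exact mem_renSet.2 ⟨d1, d2, d3⟩

theorem push_corr (φ : B →ₐ[ℝ] B') (σ : Sym) (u : AmbB B) :
    push φ (corr f σ u) = corr (φ.comp f) σ (push φ u) := by
  have h : (fun i => φ ((-charX f) i)) = -charX (φ.comp f) :=
    funext fun i => map_neg φ (charX f i)
  rw [corr_apply, corr_apply, map_neg, push_trGt, push_trans, push_jetI, h]

/-- Naturality in the coefficients. It allows M_f to be computed once for a universal character and
then specialised, and the constants to be replaced by polynomials in a parameter. -/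
theorem push_renB_mon (φ : B →ₐ[ℝ] B') (τ : Sym) :
    push φ (renB f c (mon B τ)) = renB (φ.comp f) (fun i => φ (c i)) (mon B' τ) := by
  induction hn : τ.wt using Nat.strong_induction_on generalizing τ with
  | _ n ih =>
    subst hn
    have key : ∀ ρ ∈ {ρ : Sym | ρ.wt ≤ τ.wt}, push φ ((renMul f c).toLinearMap (mon B ρ))
        = (renMul (φ.comp f) (fun i => φ (c i))).toLinearMap (mon B' ρ) := by
      intro ρ hρ
      rw [Set.mem_ofPred_eq] at hρ
      rw [AlgHom.toLinearMap_apply, AlgHom.toLinearMap_apply]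
      refine push_algHom φ _ _ ρ (fun i => ?_) ?_ fun σ hσ => ?_
      · rw [renMul_X, renMul_X, push_mon]
      · rw [renMul_Xi, renMul_Xi, push_mon]
      · have := Sym.wt_branch hσ
        rw [renMul_int, renMul_int, map_add, push_intB, push_corr,
          ih σ.wt (by omega) σ rfl]
    rw [renB_mon, renB_mon, map_add]
    have h1 := key τ (by simp)
    have h2 := push_linear φ (renMul f c).toLinearMap
      (renMul (φ.comp f) (fun i => φ (c i))).toLinearMap key (u := rootB c (mon B τ))
      (supp_mono (fun ρ hρ => by simp only [Set.mem_ofPred_eq] at *; exact hρ.wt.le)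
        (rootB_mem c τ))
    rw [AlgHom.toLinearMap_apply, AlgHom.toLinearMap_apply] at h1 h2
    rw [h1, h2, push_rootB, push_mon]

/-- The trivial character. -/
def triv (κ : ℝ) (B : Type) [CommRing B] [Algebra ℝ B] : Tp κ →ₐ[ℝ] B :=
  MvPolynomial.aeval fun _ => 0

theorem charX_triv : charX (triv κ B) = 0 := by
  ext i; simp [charX, triv]

theorem jetI_triv (u : AmbB B) : jetI (triv κ B) u = 0 := by
  refine (Submodule.mem_bot B).1 (map_mem_of_supp (S := Set.univ) _ ⊥ (fun σ _ => ?_)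
    (mem_supp_univ u))
  rw [jetI_mon]
  refine (Submodule.mem_bot B).2 (Finset.sum_eq_zero fun k _ => ?_)
  rw [JJ]
  split_ifs <;> simp [triv]

theorem corr_triv (σ : Sym) (u : AmbB B) : corr (triv κ B) σ u = 0 := by
  rw [corr_apply, jetI_triv, map_zero, map_zero, neg_zero]

theorem push_triv (φ : B →ₐ[ℝ] B') : φ.comp (triv κ B) = triv κ B' := by
  apply MvPolynomial.algHom_ext; intro i; simp [triv]

end Renorm

end Phi43

end

noncomputable section

namespace Phi43

/-! ## Composition of characters and the action of renormalisation on characters -/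

section Comp

variable {κ : ℝ} {B B' : Type} [CommRing B] [CommRing B'] [Algebra ℝ B] [Algebra ℝ B']

/-- No `|σ| + 2` is a natural number. -/
def Nonres (κ : ℝ) : Prop := ∀ σ : Sym, σ.InW → ¬ σ.IsPoly → ∀ n : ℕ, deg κ σ + 2 ≠ n

/-- The character whose values at the `X_i` and whose jets are given. -/
def charOf (κ : ℝ) (x : Fin 4 → B) (J : Sym → AmbB B) : Tp κ →ₐ[ℝ] B :=
  MvPolynomial.aeval (Sum.elim x fun p : JGen κ =>
    (ifac p.1.1 : ℝ) • (J p.1.2).coeff (Sym.Xpow p.1.1))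

theorem charX_charOf (x : Fin 4 → B) (J : Sym → AmbB B) : charX (charOf κ x J) = x := by
  ext i; simp [charX, charOf]

theorem ifac_ne_zero (k : Idx) : (ifac k : ℝ) ≠ 0 := by
  rw [ifac, Nat.cast_ne_zero]
  exact Finset.prod_ne_zero_iff.2 fun i _ => Nat.factorial_ne_zero _

theorem charOf_JJ (x : Fin 4 → B) (J : Sym → AmbB B) {σ : Sym} (h1 : σ.InW) (h2 : ¬ σ.IsPoly)
    {k : Idx} (hk : (sdeg k : ℝ) < deg κ σ + 2) :
    charOf κ x J (JJ κ k σ) = (ifac k : ℝ) • (J σ).coeff (Sym.Xpow k) := by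
  rw [JJ, dif_pos ⟨h1, h2, hk⟩]
  simp [charOf]

theorem coeff_jetI (f : Tp κ →ₐ[ℝ] B) {σ : Sym} {k : Idx} (hk : (sdeg k : ℝ) < deg κ σ + 2) :
    (jetI f (mon B σ)).coeff (Sym.Xpow k) = (ifac k : ℝ)⁻¹ • f (JJ κ k σ) := by
  classical
  have hinj : ∀ l, Sym.Xpow l = Sym.Xpow k ↔ l = k := fun l =>
    ⟨fun h => by simpa using congrArg Sym.exp h, fun h => by rw [h]⟩
  rw [jetI_mon, MonoidAlgebra.coeff_sum, Finsupp.finsetSum_apply]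
  simp only [MonoidAlgebra.coeff_single, Finsupp.single_apply, hinj]
  rw [Finset.sum_ite_eq', if_pos (mem_idxBelow.2 hk)]

theorem char_ext {f g : Tp κ →ₐ[ℝ] B} (hX : charX f = charX g)
    (hJ : ∀ σ : Sym, σ.InW → ¬ σ.IsPoly → jetI f (mon B σ) = jetI g (mon B σ)) : f = g := by
  apply MvPolynomial.algHom_ext
  rintro (i | ⟨⟨k, σ⟩, h⟩)
  · exact congrFun hX i
  · have h1 := congrArg (fun u => (ifac k : ℝ) • u.coeff (Sym.Xpow k)) (hJ σ h.1 h.2.1)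
    simp only [coeff_jetI _ h.2.2, smul_smul, mul_inv_cancel₀ (ifac_ne_zero k), one_smul] at h1
    rwa [JJ, dif_pos h] at h1

/-- A character of T⁺ records only the coefficients with |k| < |σ| + 2, while `trGt` retains those
with |k| > |σ| + 2. Nonresonance excludes equality, so nothing is lost between the two strict
inequalities. -/
theorem jetI_charOf (hκ : Nonres κ) (x : Fin 4 → B) (J : Sym → AmbB B) {σ : Sym} (h1 : σ.InW)
    (h2 : ¬ σ.IsPoly) (hJ : J σ ∈ supp B polySet) :
    jetI (charOf κ x J) (mon B σ) = J σ - trGt B (deg κ σ + 2) (J σ) := by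
  classical
  let L : AmbB B →ₗ[B] AmbB B := linExt fun τ => ∑ k ∈ idxBelow (deg κ σ + 2),
    MonoidAlgebra.single (Sym.Xpow k) ((mon B τ).coeff (Sym.Xpow k))
  have hL : ∀ u, L u = ∑ k ∈ idxBelow (deg κ σ + 2),
      MonoidAlgebra.single (Sym.Xpow k) (u.coeff (Sym.Xpow k)) := by
    intro u
    let L' : AmbB B →ₗ[B] AmbB B := ∑ k ∈ idxBelow (deg κ σ + 2),
      MonoidAlgebra.lsingle (Sym.Xpow k) ∘ₗ Finsupp.lapply (Sym.Xpow k) ∘ₗ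
        (MonoidAlgebra.coeffLinearEquiv B).toLinearMap
    have h := linMap_congr (S := Set.univ) L L' (fun τ _ => by
      rw [linExt_mon, LinearMap.sum_apply]; rfl) (mem_supp_univ u)
    rw [h, LinearMap.sum_apply]; rfl
  have h3 : jetI (charOf κ x J) (mon B σ) = L (J σ) := by
    rw [jetI_mon, hL]
    refine Finset.sum_congr rfl fun k hk => ?_
    rw [charOf_JJ _ _ h1 h2 (mem_idxBelow.1 hk), smul_smul, inv_mul_cancel₀ (ifac_ne_zero k),
      one_smul]
  rw [h3]
  have h4 := linMap_congr L (LinearMap.id - trGt B (deg κ σ + 2)) (fun τ hτ => ?_) hJ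
  · rw [h4]; rfl
  obtain ⟨l, rfl⟩ := mem_polySet.1 hτ
  have hinj : ∀ k, Sym.Xpow l = Sym.Xpow k ↔ l = k := fun k =>
    ⟨fun h => by simpa using congrArg Sym.exp h, fun h => by rw [h]⟩
  rw [hL, LinearMap.sub_apply, LinearMap.id_apply]
  simp only [MonoidAlgebra.coeff_single, Finsupp.single_apply, hinj]
  have h5 : ∀ k, MonoidAlgebra.single (Sym.Xpow k) (if l = k then (1 : B) else 0)
      = if l = k then mon B (Sym.Xpow l) else 0 := by
    intro k; split_ifs with h
    · rw [h]
    · rw [MonoidAlgebra.single_zero]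
  simp only [h5]
  rw [Finset.sum_ite_eq]
  rcases lt_or_ge (sdeg l : ℝ) (deg κ σ + 2) with h | h
  · rw [if_pos (mem_idxBelow.2 h), trGt_mon_of_le (by rw [Sym.exp_Xpow]; exact h.le), sub_zero]
  · have := hκ σ h1 h2 (sdeg l)
    rw [if_neg (fun h' => absurd (mem_idxBelow.1 h') (not_lt.2 h)),
      trGt_mon_of_lt (by rw [Sym.exp_Xpow]; exact lt_of_le_of_ne h this), sub_self]

theorem trGt_polyLt {c : ℝ} {u : AmbB B} (hu : u ∈ supp B (polyLt c)) : trGt B c u = 0 := by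
  refine (Submodule.mem_bot B).1 (map_mem_of_supp _ ⊥ (fun σ hσ => ?_) hu)
  rw [trGt_mon_of_le (mem_polyLt.1 hσ).2.le]; exact zero_mem _

theorem coeff_push (φ : B →ₐ[ℝ] B') (u : AmbB B) (τ : Sym) :
    (push φ u).coeff τ = φ (u.coeff τ) := by
  rfl

theorem comp_charOf (φ : B →ₐ[ℝ] B') (x : Fin 4 → B) (J : Sym → AmbB B) :
    φ.comp (charOf κ x J) = charOf κ (fun i => φ (x i)) fun σ => push φ (J σ) := by
  apply MvPolynomial.algHom_ext
  rintro (i | p)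
  · simp [charOf]
  · simp only [AlgHom.comp_apply, charOf, MvPolynomial.aeval_X, Sum.elim_inr, map_smul, coeff_push]

/-- The jets of the composition of characters. -/
def compJ (f g : Tp κ →ₐ[ℝ] B) : AmbB B →ₗ[B] AmbB B :=
  jetI f ∘ₗ (GamB g).toLinearMap + (GamB f).toLinearMap ∘ₗ jetI g

theorem compJ_apply (f g : Tp κ →ₐ[ℝ] B) (u : AmbB B) :
    compJ f g u = jetI f (GamB g u) + GamB f (jetI g u) := rfl

/-- The composition of characters, dual to the composition of the operators `Γ_f`. -/
def comp (f g : Tp κ →ₐ[ℝ] B) : Tp κ →ₐ[ℝ] B :=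
  charOf κ (fun i => charX f i + charX g i) fun σ => compJ f g (mon B σ)

theorem charX_comp (f g : Tp κ →ₐ[ℝ] B) : charX (comp f g) = charX f + charX g :=
  charX_charOf _ _

theorem jetI_mem_of_supp (f : Tp κ →ₐ[ℝ] B) {c : ℝ} {u : AmbB B}
    (hu : u ∈ supp B {ρ | deg κ ρ ≤ c}) : jetI f u ∈ supp B (polyLt (c + 2)) := by
  refine map_mem_of_supp _ _ (fun ρ hρ => ?_) hu
  rw [Set.mem_ofPred_eq] at hρ
  exact supp_mono (polyLt_mono (by linarith)) (jetI_mem f ρ)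

theorem GamB_mem_deg (f : Tp κ →ₐ[ℝ] B) {τ : Sym} (hτ : τ.InW) :
    GamB f (mon B τ) ∈ supp B {ρ | deg κ ρ ≤ deg κ τ} := by
  refine supp_mono (fun ρ hρ => ?_) (GamB_lead_deg f hτ).mem
  simp only [Set.mem_ofPred_eq] at *; linarith

theorem compJ_mem (f g : Tp κ →ₐ[ℝ] B) {σ : Sym} (hσ : σ.InW) :
    compJ f g (mon B σ) ∈ supp B (polyLt (deg κ σ + 2)) := by
  rw [compJ_apply]
  refine add_mem (jetI_mem_of_supp f (GamB_mem_deg g hσ)) ?_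
  rw [GamB_poly f (jetI_mem_poly g _)]
  exact trans_mem_polyLt _ (jetI_mem g σ)

/-- No truncation is visible: Γ_g does not raise homogeneities and translations do not raise
degrees, so the right-hand side at σ has degree below |σ| + 2 and is faithfully recorded by the
character. -/
theorem jetI_comp (hκ : Nonres κ) (f g : Tp κ →ₐ[ℝ] B) {u : AmbB B} (hu : u ∈ supp B setW) :
    jetI (comp f g) u = jetI f (GamB g u) + GamB f (jetI g u) := by
  rw [← compJ_apply]
  refine linMap_congr _ _ (fun σ hσ => ?_) hu
  by_cases hp : σ.IsPoly
  · have h := mon_mem_supp (B := B) (mem_polySet.2 hp)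
    rw [compJ_apply, jetI_poly _ h, jetI_poly _ h, map_zero, GamB_poly g h,
      jetI_poly _ (trans_mem_poly _ h), add_zero]
  · have h := compJ_mem f g (mem_setW.1 hσ)
    rw [comp, jetI_charOf hκ _ _ hσ hp (supp_mono (polyLt_subset _) h), trGt_polyLt h, sub_zero]

theorem GamB_comp_mon (hκ : Nonres κ) (f g : Tp κ →ₐ[ℝ] B) {τ : Sym} (hτ : τ.InW) :
    GamB f (GamB g (mon B τ)) = GamB (comp f g) (mon B τ) := by
  induction τ using Sym.induction with
  | h k m s ih =>
    refine algHom_congr ((GamB f).comp (GamB g)) (GamB (comp f g)) _ (fun i => ?_) (fun _ => ?_)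
      fun σ hσ => ?_
    · rw [AlgHom.comp_apply, GamB_X, map_add, GamB_X, AlgHom.commutes, GamB_X, charX_comp,
        Pi.add_apply, map_add, add_assoc]
    · rw [AlgHom.comp_apply, GamB_Xi, GamB_Xi, GamB_Xi]
    · have h := (hτ.branch hσ).1
      rw [AlgHom.comp_apply, GamB_int, map_add, GamB_intB, GamB_int,
        ih σ (by simpa using hσ) h, jetI_comp hκ f g (mon_mem_supp (mem_setW.2 h)), add_assoc]

theorem GamB_comp (hκ : Nonres κ) (f g : Tp κ →ₐ[ℝ] B) {u : AmbB B} (hu : u ∈ supp B setW) :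
    GamB f (GamB g u) = GamB (comp f g) u :=
  linMap_congr ((GamB f).comp (GamB g)).toLinearMap (GamB (comp f g)).toLinearMap
    (fun _ hτ => GamB_comp_mon hκ f g (mem_setW.1 hτ)) hu

theorem comp_triv (hκ : Nonres κ) (g : Tp κ →ₐ[ℝ] B) : comp (triv κ B) g = g := by
  refine char_ext ?_ fun σ h1 h2 => ?_
  · rw [charX_comp, charX_triv, zero_add]
  · rw [jetI_comp hκ _ _ (mon_mem_supp (mem_setW.2 h1)), jetI_triv, zero_add,
      GamB_poly _ (jetI_mem_poly g _), charX_triv, trans_zero]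

theorem push_compJ (φ : B →ₐ[ℝ] B') (f g : Tp κ →ₐ[ℝ] B) (u : AmbB B) :
    push φ (compJ f g u) = compJ (φ.comp f) (φ.comp g) (push φ u) := by
  rw [compJ_apply, compJ_apply, map_add, push_jetI, push_GamB, push_GamB, push_jetI]

theorem push_comp (φ : B →ₐ[ℝ] B') (f g : Tp κ →ₐ[ℝ] B) :
    φ.comp (comp f g) = comp (φ.comp f) (φ.comp g) := by
  have h1 : (fun i => φ (charX f i + charX g i))
      = fun i => charX (φ.comp f) i + charX (φ.comp g) i := funext fun i => map_add _ _ _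
  have h2 : (fun σ => push φ (compJ f g (mon B σ)))
      = fun σ => compJ (φ.comp f) (φ.comp g) (mon B' σ) :=
    funext fun σ => by rw [push_compJ, push_mon]
  rw [comp, comp, comp_charOf, h1, h2]

/-! ### The renormalised character -/

/-- The linear map `σ ↦ P(σ)` where `P(σ)` is the polynomial part of the renormalisation of
`I(σ)`. -/
def corrL (f : Tp κ →ₐ[ℝ] B) (c : Fin 5 → B) : AmbB B →ₗ[B] AmbB B :=
  linExt fun σ => corr f σ (renB f c (mon B σ))

theorem corrL_mon (f : Tp κ →ₐ[ℝ] B) (c : Fin 5 → B) (σ : Sym) :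
    corrL f c (mon B σ) = corr f σ (renB f c (mon B σ)) := linExt_mon _ _

theorem corrL_mem (f : Tp κ →ₐ[ℝ] B) (c : Fin 5 → B) (u : AmbB B) :
    corrL f c u ∈ supp B polySet := by
  refine map_mem_of_supp (S := Set.univ) _ _ (fun σ _ => ?_) (mem_supp_univ u)
  rw [corrL_mon]; exact corr_mem_poly f σ _

theorem renMul_intB (f : Tp κ →ₐ[ℝ] B) (c : Fin 5 → B) (u : AmbB B) :
    renMul f c (intB B u) = intB B (renB f c u) + corrL f c u := by
  have h := linMap_congr (S := Set.univ) ((renMul f c).toLinearMap ∘ₗ intB B)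
    (intB B ∘ₗ renB f c + corrL f c) (fun σ _ => ?_) (mem_supp_univ u)
  · rw [LinearMap.add_apply, LinearMap.comp_apply, LinearMap.comp_apply,
      AlgHom.toLinearMap_apply] at h
    exact h
  rw [LinearMap.add_apply, LinearMap.comp_apply, LinearMap.comp_apply, AlgHom.toLinearMap_apply,
    corrL_mon]
  by_cases hp : σ.IsPoly
  · have h := mon_mem_supp (B := B) (mem_polySet.2 hp)
    rw [intB_poly hp, renB_poly f c h, map_zero, intB_poly hp, zero_add, corr_apply,
      jetI_poly f h, map_zero, map_zero, neg_zero]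
  · rw [intB_mon hp, renMul_int]

theorem push_corrL (φ : B →ₐ[ℝ] B') (f : Tp κ →ₐ[ℝ] B) (c : Fin 5 → B) (u : AmbB B) :
    push φ (corrL f c u) = corrL (φ.comp f) (fun i => φ (c i)) (push φ u) := by
  refine push_linear φ (corrL f c) (corrL (φ.comp f) fun i => φ (c i)) (S := Set.univ)
    (fun σ _ => ?_) (mem_supp_univ u)
  rw [corrL_mon, corrL_mon, push_corr, push_renB_mon]

/-- The jet of the renormalised character at `σ`, in terms of `Γσ`. -/
def hatJ (f g : Tp κ →ₐ[ℝ] B) (c : Fin 5 → B) (σ : Sym) (u : AmbB B) : AmbB B :=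
  jetI g (renB (comp f g) c (mon B σ))
    + GamB g (corr (comp f g) σ (renB (comp f g) c (mon B σ))) - corrL f c u

/-- The images of the symbols under `Γ` for the renormalised character. -/
def hatG (f g : Tp κ →ₐ[ℝ] B) (c : Fin 5 → B) (τ : Sym) : AmbB B :=
  evAlg B (fun i => mon B (Xg i) + algebraMap B _ (charX g i)) (mon B Sym.Xi)
    (fun σ => if _ : σ.wt < τ.wt then intB B (hatG f g c σ) + (hatJ f g c σ (hatG f g c σ)
      - trGt B (deg κ σ + 2) (hatJ f g c σ (hatG f g c σ))) else 0) (mon B τ)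
termination_by τ.wt

/-- The renormalised character: `M_f Γ_h = Γ_g M_{fg}` for `h = hat f g`. -/
def hat (f g : Tp κ →ₐ[ℝ] B) (c : Fin 5 → B) : Tp κ →ₐ[ℝ] B :=
  charOf κ (charX g) fun σ => hatJ f g c σ (hatG f g c σ)

theorem charX_hat (f g : Tp κ →ₐ[ℝ] B) (c : Fin 5 → B) : charX (hat f g c) = charX g :=
  charX_charOf _ _

theorem hatJ_mem (f g : Tp κ →ₐ[ℝ] B) (c : Fin 5 → B) (σ : Sym) (u : AmbB B) :
    hatJ f g c σ u ∈ supp B polySet := by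
  refine sub_mem (add_mem (jetI_mem_poly _ _) ?_) (corrL_mem f c u)
  rw [GamB_poly g (corr_mem_poly _ _ _)]
  exact trans_mem_poly _ (corr_mem_poly _ _ _)

/-- The jets of `hat f g c` at σ refer to Γσ for that same character. The circle is broken by the
recursion `hatG`, which defines Γσ first and is here recognised as the operator of the character
built from it. -/
theorem GamB_hat_eq (hκ : Nonres κ) (f g : Tp κ →ₐ[ℝ] B) (c : Fin 5 → B) {τ : Sym}
    (hτ : τ.InW) : GamB (hat f g c) (mon B τ) = hatG f g c τ := by
  induction τ using Sym.induction with
  | h k m s ih =>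
    rw [hatG]
    refine algHom_congr _ _ _ (fun i => ?_) (fun _ => ?_) fun σ hσ => ?_
    · rw [GamB_X, evAlg_X, charX_hat]
    · rw [GamB_Xi, evAlg_Xi]
    · obtain ⟨h1, h2⟩ := hτ.branch hσ
      have := Sym.wt_branch hσ
      rw [GamB_int, evAlg_int, dif_pos (by omega), ih σ (by simpa using hσ) h1, hat,
        jetI_charOf hκ _ _ h1 h2 (hatJ_mem f g c σ _)]

theorem jetI_hat (hκ : Nonres κ) (f g : Tp κ →ₐ[ℝ] B) (c : Fin 5 → B) {σ : Sym} (h1 : σ.InW)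
    (h2 : ¬ σ.IsPoly) : jetI (hat f g c) (mon B σ)
      = hatJ f g c σ (GamB (hat f g c) (mon B σ))
        - trGt B (deg κ σ + 2) (hatJ f g c σ (GamB (hat f g c) (mon B σ))) := by
  rw [GamB_hat_eq hκ f g c h1, hat, jetI_charOf hκ _ _ h1 h2 (hatJ_mem f g c σ _)]

/-- The truncation in the jets of `hat f g` has no effect, provided that the intertwining relation
holds at the symbol in question. -/
theorem trGt_hatJ (hκ : Nonres κ) (f g : Tp κ →ₐ[ℝ] B) (c : Fin 5 → B) {σ : Sym} (h1 : σ.InW)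
    {u : AmbB B} (hu : u ∈ supp B {ρ | deg κ ρ ≤ deg κ σ})
    (h : renB f c u = GamB g (renB (comp f g) c (mon B σ))) :
    trGt B (deg κ σ + 2) (hatJ f g c σ u) = 0 := by
  -- Each symbol ρ of u has its own cutoff |ρ| + 2 ≤ |σ| + 2, which becomes invisible above the
  -- common level |σ| + 2. Once the cutoffs coincide, the cocycle formula for the jets of `comp f g`
  -- makes all terms cancel.
  have h3 : trGt B (deg κ σ + 2) (corrL f c u)
      = -trGt B (deg κ σ + 2) (trans (-charX f) (jetI f (renB f c u))) := by
    refine linMap_congr (trGt B (deg κ σ + 2) ∘ₗ corrL f c) (-(trGt B (deg κ σ + 2) ∘ₗ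
      (trans (-charX f)).toLinearMap ∘ₗ jetI f ∘ₗ renB f c)) (fun ρ hρ => ?_) hu
    rw [Set.mem_ofPred_eq] at hρ
    simp only [LinearMap.neg_apply, LinearMap.comp_apply, AlgHom.toLinearMap_apply]
    rw [corrL_mon, corr_apply, map_neg, trGt_trGt (by linarith)]
  have h4 := renB_mem_W (comp f g) c h1
  rw [hatJ, map_sub, map_add, GamB_poly g (corr_mem_poly _ _ _), corr_apply, map_neg, map_neg,
    trGt_trans_trGt, trans_trans, jetI_comp hκ f g h4, h3, h, charX_comp, map_add, map_add,
    GamB_poly f (jetI_mem_poly g _), trans_trans]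
  have e1 : charX g + -(charX f + charX g) = -charX f := by abel
  rw [e1, neg_add_cancel, trans_zero]
  abel

/-- On I(σ) the definition of `hatJ` is the relation required, provided that its truncation costs
nothing; this follows from the induction hypothesis through `trGt_hatJ`. Products are handled by
multiplicativity, and the factor 1 + R because R commutes with Γ. The induction is on the weight
since R produces symbols that are not branches of τ. -/
theorem renB_hat_mon (hκ : Nonres κ) (f g : Tp κ →ₐ[ℝ] B) (c : Fin 5 → B) {τ : Sym}
    (hτ : τ.InW) :
    renB f c (GamB (hat f g c) (mon B τ)) = GamB g (renB (comp f g) c (mon B τ)) := by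
  induction hn : τ.wt using Nat.strong_induction_on generalizing τ with
  | _ n ih =>
    subst hn
    have key : ∀ ρ : Sym, (∀ σ ∈ ρ.branches, σ.InW ∧ ¬ σ.IsPoly ∧ σ.wt < τ.wt) →
        renMul f c (GamB (hat f g c) (mon B ρ)) = GamB g (renMul (comp f g) c (mon B ρ)) := by
      intro ρ hρ
      refine algHom_congr ((renMul f c).comp (GamB (hat f g c)))
        ((GamB g).comp (renMul (comp f g) c)) ρ (fun i => ?_) (fun _ => ?_) fun σ hσ => ?_
      · rw [AlgHom.comp_apply, AlgHom.comp_apply, GamB_X, map_add, renMul_X, AlgHom.commutes,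
          renMul_X, GamB_X, charX_hat]
      · rw [AlgHom.comp_apply, AlgHom.comp_apply, GamB_Xi, renMul_Xi, renMul_Xi, GamB_Xi]
      · obtain ⟨h1, h2, h3⟩ := hρ σ hσ
        have h4 := ih σ.wt h3 h1 rfl
        rw [AlgHom.comp_apply, AlgHom.comp_apply, GamB_int, map_add, renMul_intB,
          renMul_poly f c (jetI_mem_poly _ _), renMul_int, map_add, GamB_intB, h4,
          jetI_hat hκ f g c h1 h2, trGt_hatJ hκ f g c h1 (GamB_mem_deg _ h1) h4, sub_zero, hatJ]
        abel
    rw [renB_apply, renB_mon, rootB_GamB _ _ (mon_mem_supp (mem_setW.2 hτ)), map_add]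
    have e1 := key τ fun σ hσ => by
      have := Sym.wt_branch hσ
      exact ⟨(hτ.branch hσ).1, (hτ.branch hσ).2, by omega⟩
    have e2 := linMap_congr ((renMul f c).comp (GamB (hat f g c))).toLinearMap
        ((GamB g).comp (renMul (comp f g) c)).toLinearMap (fun ρ hρ => by
      rw [Set.mem_ofPred_eq] at hρ
      exact key ρ (hρ.inW hτ).2.2.1) (rootB_mem c τ)
    rw [AlgHom.toLinearMap_apply, AlgHom.toLinearMap_apply, AlgHom.comp_apply,
      AlgHom.comp_apply] at e2
    rw [e1, e2]

/-- The intertwining relation between renormalisation and the structure group. -/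
theorem renB_hat (hκ : Nonres κ) (f g : Tp κ →ₐ[ℝ] B) (c : Fin 5 → B) {u : AmbB B}
    (hu : u ∈ supp B setW) :
    renB f c (GamB (hat f g c) u) = GamB g (renB (comp f g) c u) := by
  refine linMap_congr (renB f c ∘ₗ (GamB (hat f g c)).toLinearMap)
    ((GamB g).toLinearMap ∘ₗ renB (comp f g) c) (fun τ hτ => ?_) hu
  rw [LinearMap.comp_apply, LinearMap.comp_apply]
  exact renB_hat_mon hκ f g c (mem_setW.1 hτ)

theorem jetI_hat_eq (hκ : Nonres κ) (f g : Tp κ →ₐ[ℝ] B) (c : Fin 5 → B) {σ : Sym} (h1 : σ.InW)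
    (h2 : ¬ σ.IsPoly) :
    jetI (hat f g c) (mon B σ) = hatJ f g c σ (GamB (hat f g c) (mon B σ)) := by
  rw [jetI_hat hκ f g c h1 h2,
    trGt_hatJ hκ f g c h1 (GamB_mem_deg _ h1) (renB_hat_mon hκ f g c h1), sub_zero]

theorem push_hatJ (φ : B →ₐ[ℝ] B') (f g : Tp κ →ₐ[ℝ] B) (c : Fin 5 → B) (σ : Sym) (u : AmbB B) :
    push φ (hatJ f g c σ u) = hatJ (φ.comp f) (φ.comp g) (fun i => φ (c i)) σ (push φ u) := by
  rw [hatJ, hatJ, map_sub, map_add, push_jetI, push_renB_mon, push_GamB, push_corr, push_renB_mon,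
    push_comp, push_corrL]

theorem push_hatG (φ : B →ₐ[ℝ] B') (f g : Tp κ →ₐ[ℝ] B) (c : Fin 5 → B) (τ : Sym) :
    push φ (hatG f g c τ) = hatG (φ.comp f) (φ.comp g) (fun i => φ (c i)) τ := by
  induction hn : τ.wt using Nat.strong_induction_on generalizing τ with
  | _ n ih =>
    subst hn
    rw [hatG, hatG]
    refine push_algHom φ _ _ τ (fun i => ?_) ?_ fun σ hσ => ?_
    · rw [evAlg_X, evAlg_X, map_add, push_mon, push_algebraMap]; rfl
    · rw [evAlg_Xi, evAlg_Xi, push_mon]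
    · have := Sym.wt_branch hσ
      rw [evAlg_int, evAlg_int, dif_pos (by omega), dif_pos (by omega), map_add, map_sub,
        push_intB, push_trGt, push_hatJ, ih σ.wt (by omega) σ rfl]

theorem push_hat (φ : B →ₐ[ℝ] B') (f g : Tp κ →ₐ[ℝ] B) (c : Fin 5 → B) :
    φ.comp (hat f g c) = hat (φ.comp f) (φ.comp g) fun i => φ (c i) := by
  have h2 : (fun σ => push φ (hatJ f g c σ (hatG f g c σ)))
      = fun σ => hatJ (φ.comp f) (φ.comp g) (fun i => φ (c i)) σ
        (hatG (φ.comp f) (φ.comp g) (fun i => φ (c i)) σ) :=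
    funext fun σ => by rw [push_hatJ, push_hatG]
  rw [hat, hat, comp_charOf, h2]
  rfl

/-! ### Locality -/

/-- The characters `f` and `g` agree on the `X_i` and on the `𝓘_k(σ)` with `σ` of weight at most
`n - 2`. -/
def AgreeTo (n : ℕ) (f g : Tp κ →ₐ[ℝ] B) : Prop :=
  charX f = charX g ∧ ∀ σ : Sym, σ.InW → ¬ σ.IsPoly → σ.wt + 2 ≤ n →
    jetI f (mon B σ) = jetI g (mon B σ)

theorem AgreeTo.jetI {n : ℕ} {f g : Tp κ →ₐ[ℝ] B} (h : AgreeTo n f g) {u : AmbB B}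
    (hu : u ∈ supp B {ρ | ρ.wt + 2 ≤ n}) : jetI f u = jetI g u := by
  refine linMap_congr _ _ (fun σ hσ => ?_) hu
  rw [Set.mem_ofPred_eq] at hσ
  by_cases hσ' : σ.InW ∧ ¬ σ.IsPoly
  · exact h.2 σ hσ'.1 hσ'.2 hσ
  · rw [jetI_eq_zero f hσ', jetI_eq_zero g hσ']

theorem AgreeTo.GamB {n : ℕ} {f g : Tp κ →ₐ[ℝ] B} (h : AgreeTo n f g) {τ : Sym} (hτ : τ.wt ≤ n) :
    GamB f (mon B τ) = GamB g (mon B τ) := by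
  induction τ using Sym.induction with
  | h k m s ih =>
    refine algHom_congr _ _ _ (fun i => ?_) (fun _ => ?_) fun σ hσ => ?_
    · rw [GamB_X, GamB_X, h.1]
    · rw [GamB_Xi, GamB_Xi]
    · have := Sym.wt_branch hσ
      rw [GamB_int, GamB_int, ih σ (by simpa using hσ) (by omega),
        h.jetI (mon_mem_supp (show σ ∈ {ρ : Sym | ρ.wt + 2 ≤ n} by
          rw [Set.mem_ofPred_eq]; omega))]

theorem renB_mem_wt (hκ : 0 < κ) (f : Tp κ →ₐ[ℝ] B) (c : Fin 5 → B) {σ : Sym} (hσ : σ.InW) :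
    renB f c (mon B σ) ∈ supp B {ρ | ρ.wt ≤ σ.wt} :=
  supp_mono (fun _ hρ => hρ.2.2) (renB_lead f c hκ hσ).1

/-- M_f τ uses the jets of f only at the symbols of M_f σ, for branches σ of τ or of its
contractions. These are no heavier than σ, so jets beyond the weight of τ never enter. -/
theorem AgreeTo.renB (hκ : 0 < κ) {n : ℕ} {f g : Tp κ →ₐ[ℝ] B} (h : AgreeTo n f g)
    (c : Fin 5 → B) {τ : Sym} (hW : τ.InW) (hτ : τ.wt ≤ n) :
    renB f c (mon B τ) = renB g c (mon B τ) := by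
  induction hn : τ.wt using Nat.strong_induction_on generalizing τ with
  | _ m ih =>
    subst hn
    have key : ∀ ρ : Sym, (∀ σ ∈ ρ.branches, σ.InW ∧ σ.wt + 2 ≤ τ.wt) →
        renMul f c (mon B ρ) = renMul g c (mon B ρ) := by
      intro ρ hρ
      refine algHom_congr _ _ ρ (fun i => ?_) (fun _ => ?_) fun σ hσ => ?_
      · rw [renMul_X, renMul_X]
      · rw [renMul_Xi, renMul_Xi]
      · obtain ⟨h1, h3⟩ := hρ σ hσ
        rw [renMul_int, renMul_int, ← ih σ.wt (by omega) h1 (by omega) rfl, corr_apply,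
          corr_apply, h.1, h.jetI (supp_mono (fun μ hμ => ?_) (renB_mem_wt hκ f c h1))]
        simp only [Set.mem_ofPred_eq] at *; omega
    have e2 := linMap_congr (renMul f c).toLinearMap (renMul g c).toLinearMap
      (fun ρ hρ => key ρ fun σ hσ => by
        rw [Set.mem_ofPred_eq] at hρ
        have h1 := Sym.wt_branch hσ
        have h2 := hρ.wt
        exact ⟨((hρ.inW hW).2.2.1 σ hσ).1, by omega⟩) (rootB_mem c τ)
    rw [AlgHom.toLinearMap_apply, AlgHom.toLinearMap_apply] at e2
    rw [renB_mon, renB_mon, key τ fun σ hσ => ⟨(hW.branch hσ).1, Sym.wt_branch hσ⟩, e2]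

end Comp

end Phi43

end

noncomputable section

namespace Phi43

/-! ## The model space -/

section ModelSpace

variable {κ : ℝ}

theorem incl_sym (w : W) : incl (sym w) = mon ℝ w.1 := by
  simp [incl, sym]

theorem incl_mem (t : T) : incl t ∈ supp ℝ setW := by
  rw [incl, Finsupp.lift_apply]
  exact Submodule.sum_mem _ fun w _ => Submodule.smul_mem _ _ (mon_mem_supp (mem_setW.2 w.2))

theorem proj_mon {τ : Sym} (h : τ.InW) : proj (mon ℝ τ) = sym ⟨τ, h⟩ := by
  simp [proj, h]

theorem proj_mon_of_not {τ : Sym} (h : ¬ τ.InW) : proj (mon ℝ τ) = 0 := by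
  simp [proj, h]

theorem T_hom_ext {V : Type*} [AddCommGroup V] [Module ℝ V] {L L' : T →ₗ[ℝ] V}
    (h : ∀ w, L (sym w) = L' (sym w)) : L = L' :=
  Finsupp.lhom_ext' fun w => LinearMap.ext_ring (h w)

theorem proj_incl (t : T) : proj (incl t) = t := by
  have : proj ∘ₗ incl = LinearMap.id := T_hom_ext fun w => by
    rw [LinearMap.comp_apply, incl_sym, proj_mon w.2]; rfl
  exact LinearMap.congr_fun this t

theorem incl_proj {u : Amb} (hu : u ∈ supp ℝ setW) : incl (proj u) = u := by
  refine linMap_congr (incl ∘ₗ proj) LinearMap.id (fun τ hτ => ?_) hu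
  rw [LinearMap.comp_apply, proj_mon (mem_setW.1 hτ), incl_sym]; rfl

theorem incl_injective : Function.Injective incl :=
  Function.LeftInverse.injective proj_incl

theorem slice_rTensor (f : Tp κ →ₐ[ℝ] ℝ) (x : Amb ⊗[ℝ] Tp κ) :
    slice T f.toLinearMap (LinearMap.rTensor (Tp κ) proj x) = proj (evTensor f x) := by
  induction x using TensorProduct.induction_on with
  | zero => simp
  | tmul u p =>
    have : Algebra.ofId ℝ ℝ = AlgHom.id ℝ ℝ := by ext
    rw [evTensor_tmul, this, map_smul]
    simp [slice]
  | add x y hx hy => simp only [map_add, hx, hy]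

theorem Gam_eq (f : Tp κ →ₐ[ℝ] ℝ) (t : T) : Gam f.toLinearMap t = proj (GamB f (incl t)) := by
  have : Gam f.toLinearMap = proj ∘ₗ (GamB f).toLinearMap ∘ₗ incl := T_hom_ext fun w => by
    rw [LinearMap.comp_apply, LinearMap.comp_apply, incl_sym, AlgHom.toLinearMap_apply,
      GamB_eq_evTensor, ← slice_rTensor, Gam, LinearMap.comp_apply, Delta]
    congr 1
    simp [sym]
  rw [this]; rfl

theorem incl_Gam (f : Tp κ →ₐ[ℝ] ℝ) (t : T) : incl (Gam f.toLinearMap t) = GamB f (incl t) := by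
  rw [Gam_eq, incl_proj (GamB_mem_supp_W f (incl_mem t))]

theorem incl_intT (t : T) : incl (intT t) = intB ℝ (incl t) := by
  have h : intB ℝ (incl t) ∈ supp ℝ setW :=
    supp_mono (fun σ h => mem_setW.2 (Sym.InU.inW (mem_setU.1 h))) (intB_mem_U (incl_mem t))
  exact incl_proj h

/-- The map on `T` induced by `M_f`. -/
def renT (f : Tp κ →ₐ[ℝ] ℝ) (c : Fin 5 → ℝ) : T →ₗ[ℝ] T := proj ∘ₗ renB f c ∘ₗ incl

theorem incl_renT (f : Tp κ →ₐ[ℝ] ℝ) (c : Fin 5 → ℝ) (t : T) :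
    incl (renT f c t) = renB f c (incl t) :=
  incl_proj (renB_mem_supp_W f c (incl_mem t))

/-- An element of the ambient algebra with coefficients in `B`, as a tensor. -/
def toTensor (B : Type) [CommRing B] [Algebra ℝ B] : AmbB B →ₗ[ℝ] T ⊗[ℝ] B :=
  (Finsupp.lsum ℝ fun τ => TensorProduct.mk ℝ T B (proj (mon ℝ τ))) ∘ₗ
    (MonoidAlgebra.coeffLinearEquiv ℝ).toLinearMap

theorem toTensor_single {B : Type} [CommRing B] [Algebra ℝ B] (τ : Sym) (b : B) :
    toTensor B (MonoidAlgebra.single τ b) = proj (mon ℝ τ) ⊗ₜ b := by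
  rw [toTensor, LinearMap.comp_apply]
  exact Finsupp.lsum_single ℝ (fun τ => TensorProduct.mk ℝ T B (proj (mon ℝ τ))) τ b

theorem slice_toTensor (f : Tp κ →ₐ[ℝ] ℝ) (u : AmbB (Tp κ)) :
    slice T f.toLinearMap (toTensor (Tp κ) u) = proj (push f u) := by
  induction u using MonoidAlgebra.induction_linear with
  | zero => simp
  | add x y hx hy => simp only [map_add, hx, hy]
  | single τ p =>
    rw [toTensor_single, MonoidAlgebra.mapAlgHom_single]
    have : MonoidAlgebra.single τ (f p) = f p • mon ℝ τ := by rw [smul_mon]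
    rw [this, map_smul]
    simp [slice]

variable (κ) in
/-- The map `Δ^M`. -/
def renDelta (c : Fin 5 → ℝ) : T →ₗ[ℝ] T ⊗[ℝ] Tp κ :=
  Finsupp.lift (T ⊗[ℝ] Tp κ) ℝ W fun w =>
    toTensor (Tp κ) (renB (AlgHom.id ℝ (Tp κ)) (fun i => algebraMap ℝ (Tp κ) (c i)) (mon _ w.1))

theorem renDelta_sym (c : Fin 5 → ℝ) (w : W) : renDelta κ c (sym w) =
    toTensor (Tp κ)
      (renB (AlgHom.id ℝ (Tp κ)) (fun i => algebraMap ℝ (Tp κ) (c i)) (mon _ w.1)) := by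
  simp [renDelta, sym]

/-- Δ^M is the map M_f of the tautological character id : T⁺ → T⁺; specialising its coefficients
along f turns id into f. -/
theorem slice_renDelta (f : Tp κ →ₐ[ℝ] ℝ) (c : Fin 5 → ℝ) :
    slice T f.toLinearMap ∘ₗ renDelta κ c = renT f c := T_hom_ext fun w => by
  have h : (fun i => f (algebraMap ℝ (Tp κ) (c i))) = c := funext fun i => by simp
  rw [LinearMap.comp_apply, renDelta_sym, slice_toTensor, push_renB_mon, AlgHom.comp_id, h, renT,
    LinearMap.comp_apply, LinearMap.comp_apply, incl_sym]

theorem PiM_renDelta (Z : Model κ) (K : Kernel) (c : Fin 5 → ℝ) (x : Pt) :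
    PiM Z K (renDelta κ c) x = Z.Pi x ∘ₗ renT (fchar κ K Z.Pi x) c := by
  rw [PiM, slice_renDelta]

variable (κ) in
/-- The map `Δ̂^M`. -/
def renDeltaHat (c : Fin 5 → ℝ) : Tp κ →ₐ[ℝ] Tp κ ⊗[ℝ] Tp κ :=
  hat Algebra.TensorProduct.includeRight Algebra.TensorProduct.includeLeft
    fun i => algebraMap ℝ _ (c i)

/-- In Δ̂^M the base character f is the inclusion of the right factor and g that of the left one,
matching γ^M = (γ ⊗ f_x) Δ̂^M. As `hat` always produces an algebra morphism, multiplicativity of γ^M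
is automatic. -/
theorem slice_renDeltaHat (f g : Tp κ →ₐ[ℝ] ℝ) (c : Fin 5 → ℝ) :
    g.toLinearMap ∘ₗ slice (Tp κ) f.toLinearMap ∘ₗ (renDeltaHat κ c).toLinearMap
      = (hat f g c).toLinearMap := by
  let Ψ : Tp κ ⊗[ℝ] Tp κ →ₐ[ℝ] ℝ := Algebra.TensorProduct.lift g f fun _ _ => Commute.all _ _
  have h1 : g.toLinearMap ∘ₗ slice (Tp κ) f.toLinearMap = Ψ.toLinearMap := by
    apply TensorProduct.ext'
    intro p q
    simp [slice, Ψ, mul_comm]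
  have h2 : Ψ.comp (renDeltaHat κ c) = hat f g c := by
    rw [renDeltaHat, push_hat]
    congr 1
    · ext p; simp [Ψ]
    · ext p; simp [Ψ]
    · funext i; exact Ψ.commutes (c i)
  rw [← LinearMap.comp_assoc, h1, ← h2]; rfl

theorem gamM_renDeltaHat (Z : Model κ) (K : Kernel) (c : Fin 5 → ℝ) (x y : Pt) :
    gamM Z K (renDeltaHat κ c).toLinearMap x y
      = (hat (fchar κ K Z.Pi x) (Z.γ x y) c).toLinearMap := slice_renDeltaHat _ _ _

/-! ### Commutation of the renormalisation map with `I` and the `X_i` -/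

theorem renT_triv_intT (c : Fin 5 → ℝ) (t : T) :
    renT (triv κ ℝ) c (intT t) = intT (renT (triv κ ℝ) c t) := by
  apply incl_injective
  rw [incl_renT, incl_intT, incl_intT, incl_renT]
  refine linMap_congr (S := Set.univ) (renB (triv κ ℝ) c ∘ₗ intB ℝ) (intB ℝ ∘ₗ renB (triv κ ℝ) c)
    (fun τ _ => ?_) (mem_supp_univ _)
  rw [LinearMap.comp_apply, LinearMap.comp_apply]
  by_cases hp : τ.IsPoly
  · rw [intB_poly hp, map_zero, renB_poly _ _ (mon_mem_supp (mem_polySet.2 hp)), intB_poly hp]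
  · rw [intB_mon hp, renB_int, corr_triv, add_zero]

theorem leafB_Xpow {B : Type} [CommRing B] (j : ℕ) (k : Idx) (u : AmbB B) :
    leafB B j (mon B (Sym.Xpow k) * u) = mon B (Sym.Xpow k) * leafB B j u := by
  rw [leafB_apply, map_mul, shiftS_poly (mon_mem_supp (mem_polySet.2 (Sym.isPoly_Xpow k))),
    Polynomial.coeff_C_mul, leafB_apply]

theorem cherryB_Xpow {B : Type} [CommRing B] (i j : ℕ) (k : Idx) (u : AmbB B) :
    cherryB B i j (mon B (Sym.Xpow k) * u) = mon B (Sym.Xpow k) * cherryB B i j u := by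
  rw [cherryB_apply, map_mul, shiftT_poly i (mon_mem_supp (mem_polySet.2 (Sym.isPoly_Xpow k))),
    Polynomial.coeff_C_mul, Polynomial.coeff_C_mul, cherryB_apply]

theorem rootB_Xpow {B : Type} [CommRing B] (c : Fin 5 → B) (k : Idx) (u : AmbB B) :
    rootB c (mon B (Sym.Xpow k) * u) = mon B (Sym.Xpow k) * rootB c u := by
  simp only [rootB_apply, leafB_Xpow, cherryB_Xpow, mul_neg, mul_add, mul_smul_comm]

theorem renB_Xpow {B : Type} [CommRing B] [Algebra ℝ B] (f : Tp κ →ₐ[ℝ] B) (c : Fin 5 → B)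
    (k : Idx) (u : AmbB B) :
    renB f c (mon B (Sym.Xpow k) * u) = mon B (Sym.Xpow k) * renB f c u := by
  rw [renB_apply, renB_apply, rootB_Xpow, map_mul, map_mul,
    renMul_poly f c (mon_mem_supp (mem_polySet.2 (Sym.isPoly_Xpow k))), mul_add]

theorem renT_isMonoMul (f : Tp κ →ₐ[ℝ] ℝ) (c : Fin 5 → ℝ) {k : Idx} {τ σ : T}
    (h : IsMonoMul k τ σ) : IsMonoMul k (renT f c τ) (renT f c σ) := by
  rw [IsMonoMul, ← mon_eq_of] at *
  rw [incl_renT, incl_renT, h, renB_Xpow]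

/-! ### The degree condition for `Δ^M` -/

theorem tmul_mem_tensorTp {E : Type} [AddCommGroup E] [Module ℝ E] {V : Submodule ℝ E} {v : E}
    (hv : v ∈ V) (p : Tp κ) : v ⊗ₜ[ℝ] p ∈ tensorTp κ V :=
  ⟨(⟨v, hv⟩ : V) ⊗ₜ p, by simp⟩

theorem toTensor_mem {S : Set Sym} {V : Submodule ℝ T} (h : ∀ w : W, w.1 ∈ S → sym w ∈ V)
    {u : AmbB (Tp κ)} (hu : u ∈ supp (Tp κ) S) : toTensor (Tp κ) u ∈ tensorTp κ V := by
  rw [supp_eq_span] at hu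
  induction hu using Submodule.closure_induction with
  | zero => rw [map_zero]; exact zero_mem _
  | add x y _ _ hx hy => rw [map_add]; exact add_mem hx hy
  | smul_mem p x hx =>
    obtain ⟨τ, hτ, rfl⟩ := hx
    rw [smul_mon, toTensor_single]
    by_cases hW : τ.InW
    · rw [proj_mon hW]; exact tmul_mem_tensorTp (h ⟨τ, hW⟩ hτ) p
    · rw [proj_mon_of_not hW, TensorProduct.zero_tmul]; exact zero_mem _

theorem renDelta_degree (hκ : 0 < κ) (c : Fin 5 → ℝ) (α : ℝ) {τ : T} (hτ : τ ∈ Teq κ α) :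
    renDelta κ c τ - τ ⊗ₜ[ℝ] (1 : Tp κ) ∈ tensorTp κ (Tgt κ α) := by
  rw [Teq, Finsupp.supported_eq_span_single] at hτ
  induction hτ using Submodule.span_induction with
  | zero =>
    have : renDelta κ c 0 - (0 : T) ⊗ₜ[ℝ] (1 : Tp κ) = 0 := by
      rw [map_zero, TensorProduct.zero_tmul]; exact sub_self _
    rw [this]; exact zero_mem _
  | add x y _ _ hx hy =>
    have : renDelta κ c (x + y) - (x + y) ⊗ₜ[ℝ] (1 : Tp κ)
        = (renDelta κ c x - x ⊗ₜ[ℝ] (1 : Tp κ)) + (renDelta κ c y - y ⊗ₜ[ℝ] (1 : Tp κ)) := by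
      rw [map_add, TensorProduct.add_tmul]; exact add_sub_add_comm (α := T ⊗[ℝ] Tp κ) _ _ _ _
    rw [this]; exact add_mem hx hy
  | smul r x _ hx =>
    have : renDelta κ c (r • x) - (r • x) ⊗ₜ[ℝ] (1 : Tp κ)
        = r • (renDelta κ c x - x ⊗ₜ[ℝ] (1 : Tp κ)) := by
      rw [map_smul, ← TensorProduct.smul_tmul']; exact (smul_sub (A := T ⊗[ℝ] Tp κ) r _ _).symm
    rw [this]; exact Submodule.smul_mem _ _ hx
  | mem x hx =>
  obtain ⟨w, hw, rfl⟩ := hx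
  rw [Set.mem_ofPred_eq] at hw
  have h := (renB_lead (AlgHom.id ℝ (Tp κ)) (fun i => algebraMap ℝ (Tp κ) (c i)) hκ w.2).2.1
  rw [Lead, hw] at h
  have h2 := toTensor_mem (V := Tgt κ α) (fun v hv => Finsupp.single_mem_supported ℝ 1 hv) h
  rw [map_sub, ← renDelta_sym, toTensor_single, proj_mon w.2] at h2
  exact h2

end ModelSpace

end Phi43

end

noncomputable section

namespace Phi43

/-! ## The degree condition for `Δ̂^M` -/

section Filtration

variable {κ : ℝ} {B : Type} [CommRing B] [Algebra ℝ B]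

/-- A decreasing filtration of a ring, indexed by a degree; `F true c` stands for the elements of
degree strictly larger than `c`, and `F false c` for those of degree at least `c`. -/
structure Filt (B : Type) [CommRing B] [Algebra ℝ B] where
  F : Bool → ℝ → Submodule ℝ B
  mul : ∀ {s t c d a b}, a ∈ F s c → b ∈ F t d → a * b ∈ F (s || t) (c + d)
  lt : ∀ {s c d}, c < d → F s d ≤ F true c
  le : ∀ c, F true c ≤ F false c
  top : ∀ b, b ∈ F false 0

/-- The induced filtration of the ambient algebra, where a symbol `σ` has degree `|σ|`. -/
def FilA (κ : ℝ) (P : Filt B) (s : Bool) (c : ℝ) : Submodule ℝ (AmbB B) where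
  carrier := {u | ∀ ρ, u.coeff ρ ∈ P.F s (c - deg κ ρ)}
  add_mem' hu hv ρ := add_mem (hu ρ) (hv ρ)
  zero_mem' _ := zero_mem _
  smul_mem' r _ hu ρ := Submodule.smul_mem _ r (hu ρ)

variable {P : Filt B}

theorem mem_FilA {s : Bool} {c : ℝ} {u : AmbB B} :
    u ∈ FilA κ P s c ↔ ∀ ρ, u.coeff ρ ∈ P.F s (c - deg κ ρ) := Iff.rfl

theorem single_mem_FilA {s : Bool} {c : ℝ} {ρ : Sym} {b : B} (hb : b ∈ P.F s (c - deg κ ρ)) :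
    MonoidAlgebra.single ρ b ∈ FilA κ P s c := by
  classical
  intro μ
  rw [MonoidAlgebra.coeff_single, Finsupp.single_apply]
  split_ifs with h
  · rw [← h]; exact hb
  · exact zero_mem _

theorem FilA_induction {s : Bool} {c : ℝ} {N : AddSubgroup (AmbB B)}
    (h : ∀ ρ b, b ∈ P.F s (c - deg κ ρ) → MonoidAlgebra.single ρ b ∈ N) {u : AmbB B}
    (hu : u ∈ FilA κ P s c) : u ∈ N := by
  have h1 : u = ∑ ρ ∈ u.coeff.support, MonoidAlgebra.single ρ (u.coeff ρ) := by
    have := Finsupp.sum_single u.coeff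
    rw [Finsupp.sum] at this
    apply MonoidAlgebra.coeff_injective
    rw [MonoidAlgebra.coeff_sum]
    simpa only [MonoidAlgebra.coeff_single] using this.symm
  rw [h1]
  exact sum_mem fun ρ _ => h ρ _ (hu ρ)

theorem FilA_le (c : ℝ) : FilA κ P true c ≤ FilA κ P false c := fun _ hu ρ => P.le _ (hu ρ)

theorem FilA_mul {s t : Bool} {c d : ℝ} {u v : AmbB B} (hu : u ∈ FilA κ P s c)
    (hv : v ∈ FilA κ P t d) : u * v ∈ FilA κ P (s || t) (c + d) := by
  refine FilA_induction (N := (FilA κ P (s || t) (c + d)).toAddSubgroup.comap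
    (AddMonoidHom.mulRight v)) (fun ρ a ha => ?_) hu
  change MonoidAlgebra.single ρ a * v ∈ FilA κ P (s || t) (c + d)
  refine FilA_induction (N := (FilA κ P (s || t) (c + d)).toAddSubgroup.comap
    (AddMonoidHom.mulLeft (MonoidAlgebra.single ρ a))) (fun μ b hb => ?_) hv
  change MonoidAlgebra.single ρ a * MonoidAlgebra.single μ b ∈ FilA κ P (s || t) (c + d)
  rw [MonoidAlgebra.single_mul_single]
  refine single_mem_FilA ?_
  have := P.mul ha hb
  rwa [show c + d - deg κ (ρ * μ) = c - deg κ ρ + (d - deg κ μ) by rw [Sym.deg_mul]; ring]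

theorem FilA_smul {s t : Bool} {c d : ℝ} {b : B} {v : AmbB B} (hb : b ∈ P.F s c)
    (hv : v ∈ FilA κ P t d) : b • v ∈ FilA κ P (s || t) (c + d) := by
  have h : MonoidAlgebra.single 1 b ∈ FilA κ P s c := single_mem_FilA (by
    have : deg κ 1 = 0 := by rw [Sym.one_eq_Xpow, Sym.deg_Xpow, sdeg_zero]; simp
    rwa [this, sub_zero])
  have := FilA_mul h hv
  rwa [show MonoidAlgebra.single 1 b * v = b • v by rw [Algebra.smul_def]; rfl] at this

/-- Images of filtered elements under a linear map which raises the degree of each symbol by at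
least `d`. -/
theorem FilA_map {s t : Bool} {c d : ℝ} (L : AmbB B →ₗ[B] AmbB B)
    (hL : ∀ ρ, L (mon B ρ) ∈ FilA κ P t (deg κ ρ + d)) {u : AmbB B} (hu : u ∈ FilA κ P s c) :
    L u ∈ FilA κ P (s || t) (c + d) := by
  refine FilA_induction (N := (FilA κ P (s || t) (c + d)).toAddSubgroup.comap L.toAddMonoidHom)
    (fun ρ b hb => ?_) hu
  change L (MonoidAlgebra.single ρ b) ∈ FilA κ P (s || t) (c + d)
  rw [← smul_mon, map_smul]
  have := FilA_smul hb (hL ρ)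
  rwa [show c - deg κ ρ + (deg κ ρ + d) = c + d by ring] at this

theorem mon_mem_FilA (ρ : Sym) : mon B ρ ∈ FilA κ P false (deg κ ρ) :=
  single_mem_FilA (by rw [sub_self]; exact P.top _)

theorem supp_le_FilA {c : ℝ} {u : AmbB B} (hu : u ∈ supp B {ρ | c < deg κ ρ}) :
    u ∈ FilA κ P true c := by
  classical
  intro ρ
  rcases lt_or_ge c (deg κ ρ) with h | h
  · exact P.lt (by linarith) (P.top _)
  · rw [MonoidAlgebra.mem_supported'] at hu
    rw [hu ρ (by rw [Set.mem_ofPred_eq]; exact not_lt.2 h)]; exact zero_mem _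

theorem intB_mem_FilA {s : Bool} {c : ℝ} {u : AmbB B} (hu : u ∈ FilA κ P s c) :
    intB B u ∈ FilA κ P s (c + 2) := by
  have h : ∀ ρ, intB B (mon B ρ) ∈ FilA κ P false (deg κ ρ + 2) := fun ρ => by
    by_cases hp : ρ.IsPoly
    · rw [intB_poly hp]; exact zero_mem _
    · rw [intB_mon hp, ← Sym.deg_int]; exact mon_mem_FilA _
  have := FilA_map (intB B) h hu
  rwa [Bool.or_false] at this

/-- The character `g` respects the degrees. -/
def Graded (P : Filt B) (g : Tp κ →ₐ[ℝ] B) : Prop :=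
  ∀ i, g (MvPolynomial.X i) ∈ P.F false (genDeg κ i)

variable {f g : Tp κ →ₐ[ℝ] B}

theorem Graded.jetI_mon (hg : Graded P g) (σ : Sym) :
    jetI g (mon B σ) ∈ FilA κ P false (deg κ σ + 2) := by
  rw [Phi43.jetI_mon]
  refine sum_mem fun k _ => single_mem_FilA (Submodule.smul_mem _ _ ?_)
  rw [JJ]
  split_ifs with h
  · rw [Sym.deg_Xpow]; exact hg (Sum.inr ⟨(k, σ), h⟩)
  · rw [map_zero]; exact zero_mem _

theorem Graded.GamB_X (hg : Graded P g) (i : Fin 4) :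
    GamB g (mon B (Xg i)) ∈ FilA κ P false (deg κ (Xg i)) := by
  rw [Phi43.GamB_X]
  refine add_mem (mon_mem_FilA _) (single_mem_FilA (ρ := 1) ?_)
  have : deg κ 1 = 0 := by rw [Sym.one_eq_Xpow, Sym.deg_Xpow, sdeg_zero]; simp
  rw [this, sub_zero, Sym.deg_Xpow]
  exact hg (Sum.inl i)

theorem Graded.GamB_mon (hg : Graded P g) (τ : Sym) :
    GamB g (mon B τ) ∈ FilA κ P false (deg κ τ) := by
  induction τ using Sym.induction with
  | h k m s ih =>
    refine Sym.gen_induction (fun σ u => u ∈ FilA κ P false (deg κ σ))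
      ((GamB g : AmbB B →* AmbB B).comp (MonoidAlgebra.of B Sym)) (mon_mem_FilA 1)
      (fun σ τ a b ha hb => ?_) hg.GamB_X _ (fun _ => ?_) fun σ hσ => ?_
    · rw [Sym.deg_mul]; exact FilA_mul ha hb
    · change GamB g (mon B Sym.Xi) ∈ _
      rw [GamB_Xi]; exact mon_mem_FilA _
    · change GamB g (mon B σ.int) ∈ _
      rw [GamB_int, Sym.deg_int]
      exact add_mem (intB_mem_FilA (ih σ (by simpa using hσ))) (hg.jetI_mon σ)

theorem Graded.jetI {s : Bool} {c : ℝ} (hg : Graded P g) {u : AmbB B} (hu : u ∈ FilA κ P s c) :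
    jetI g u ∈ FilA κ P s (c + 2) := by
  have := FilA_map (Phi43.jetI g) hg.jetI_mon hu
  rwa [Bool.or_false] at this

theorem Graded.GamB {s : Bool} {c : ℝ} (hg : Graded P g) {u : AmbB B} (hu : u ∈ FilA κ P s c) :
    GamB g u ∈ FilA κ P s c := by
  have := FilA_map (d := 0) (Phi43.GamB g).toLinearMap
    (fun ρ => by rw [add_zero]; exact hg.GamB_mon ρ) hu
  rwa [Bool.or_false, add_zero] at this

theorem corr_mem_gt (f : Tp κ →ₐ[ℝ] B) (σ : Sym) (u : AmbB B) :
    corr f σ u ∈ FilA κ P true (deg κ σ + 2) := by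
  refine supp_le_FilA (neg_mem (trGt_mem_supp (S := polySet) (fun ρ hρ hk => ?_)
    (trans_mem_poly _ (jetI_mem_poly f u))))
  obtain ⟨k, rfl⟩ := mem_polySet.1 hρ
  rw [Set.mem_ofPred_eq, Sym.deg_Xpow]
  rwa [Sym.exp_Xpow] at hk

theorem corrL_mem_gt (f : Tp κ →ₐ[ℝ] B) (c : Fin 5 → B) {s : Bool} {a : ℝ} {u : AmbB B}
    (hu : u ∈ FilA κ P s a) : corrL f c u ∈ FilA κ P true (a + 2) := by
  have := FilA_map (d := 2) (t := true) (corrL f c)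
    (fun ρ => by rw [corrL_mon]; exact corr_mem_gt f ρ _) hu
  rwa [Bool.or_true] at this

/-- Three contributions remain: the jets of M σ - σ, which has larger homogeneity than σ; the image
under Γ_g of the correction, which starts above |σ| + 2; and `corrL`, which raises the degree of
each symbol strictly by more than 2. -/
theorem jetI_hat_mem_gt (hn : Nonres κ) (hκ : 0 < κ) (hg : Graded P g) (c : Fin 5 → B) {σ : Sym}
    (h1 : σ.InW) (h2 : ¬ σ.IsPoly)
    (h : Phi43.GamB (hat f g c) (mon B σ) ∈ FilA κ P false (deg κ σ)) :
    Phi43.jetI (hat f g c) (mon B σ) - Phi43.jetI g (mon B σ)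
      ∈ FilA κ P true (deg κ σ + 2) := by
  rw [jetI_hat_eq hn f g c h1 h2, hatJ, sub_right_comm]
  refine sub_mem ?_ (corrL_mem_gt f c h)
  rw [add_sub_right_comm, ← map_sub]
  exact add_mem (hg.jetI (supp_le_FilA (renB_lead _ c hκ h1).2.1)) (hg.GamB (corr_mem_gt _ σ _))

theorem GamB_hat_mem_gt (hn : Nonres κ) (hκ : 0 < κ) (hg : Graded P g) (c : Fin 5 → B) {τ : Sym}
    (hτ : τ.InW) : Phi43.GamB (hat f g c) (mon B τ) - Phi43.GamB g (mon B τ)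
      ∈ FilA κ P true (deg κ τ) := by
  induction τ using Sym.induction with
  | h k m s ih =>
    have := Sym.gen_induction
      (fun σ (u : AmbB B × AmbB B) => u.1 - u.2 ∈ FilA κ P true (deg κ σ) ∧
        u.2 ∈ FilA κ P false (deg κ σ))
      (((Phi43.GamB (hat f g c) : AmbB B →* AmbB B).comp (MonoidAlgebra.of B Sym)).prod
        ((Phi43.GamB g : AmbB B →* AmbB B).comp (MonoidAlgebra.of B Sym)))
      ⟨by rw [Prod.fst_one, Prod.snd_one, sub_self]; exact zero_mem _, mon_mem_FilA 1⟩
      (fun σ τ a b ha hb => ?_) (fun i => ⟨?_, hg.GamB_mon _⟩) (Sym.node k m s)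
      (fun _ => ⟨?_, hg.GamB_mon _⟩) fun σ hσ => ⟨?_, hg.GamB_mon _⟩
    · exact this.1
    · have h : (a * b).1 - (a * b).2 = (a.1 - a.2) * (b.1 - b.2) + (a.1 - a.2) * b.2
          + a.2 * (b.1 - b.2) := by
        rw [Prod.fst_mul, Prod.snd_mul]; ring
      rw [h, Sym.deg_mul]
      refine ⟨add_mem (add_mem ?_ ?_) ?_, FilA_mul ha.2 hb.2⟩
      · exact FilA_mul ha.1 hb.1
      · exact FilA_mul ha.1 hb.2
      · exact FilA_mul ha.2 hb.1
    · change Phi43.GamB (hat f g c) (mon B (Xg i)) - Phi43.GamB g (mon B (Xg i)) ∈ _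
      rw [Phi43.GamB_X, Phi43.GamB_X, charX_hat, sub_self]; exact zero_mem _
    · change Phi43.GamB (hat f g c) (mon B Sym.Xi) - Phi43.GamB g (mon B Sym.Xi) ∈ _
      rw [GamB_Xi, GamB_Xi, sub_self]; exact zero_mem _
    · change Phi43.GamB (hat f g c) (mon B σ.int) - Phi43.GamB g (mon B σ.int) ∈ _
      obtain ⟨h1, h2⟩ := hτ.branch hσ
      have h3 := ih σ (by simpa using hσ) h1
      have h4 := add_mem (FilA_le _ h3) (hg.GamB_mon σ)
      rw [sub_add_cancel] at h4
      rw [GamB_int, GamB_int, add_sub_add_comm, ← map_sub, Sym.deg_int]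
      exact add_mem (intB_mem_FilA h3) (jetI_hat_mem_gt hn hκ hg c h1 h2 h4)

theorem hat_gen (hn : Nonres κ) (hκ : 0 < κ) (hg : Graded P g) (c : Fin 5 → B)
    (i : Fin 4 ⊕ JGen κ) :
    hat f g c (MvPolynomial.X i) - g (MvPolynomial.X i) ∈ P.F true (genDeg κ i) := by
  rcases i with i | ⟨⟨k, σ⟩, h⟩
  · have := congrFun (charX_hat f g c) i
    rw [charX, charX] at this
    rw [this, sub_self]; exact zero_mem _
  · have h1 := GamB_hat_mem_gt (f := f) hn hκ hg c h.1
    have h2 := add_mem (FilA_le _ h1) (hg.GamB_mon σ)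
    rw [sub_add_cancel] at h2
    have h3 := jetI_hat_mem_gt hn hκ hg c h.1 h.2.1 h2 (Sym.Xpow k)
    rw [MonoidAlgebra.coeff_sub, Finsupp.sub_apply, coeff_jetI _ h.2.2, coeff_jetI _ h.2.2,
      ← smul_sub, Sym.deg_Xpow] at h3
    have h4 := Submodule.smul_mem _ (ifac k : ℝ) h3
    rw [smul_smul, mul_inv_cancel₀ (ifac_ne_zero k), one_smul, JJ, dif_pos h] at h4
    exact h4

/-- The degree of a monomial in `T⁺`. -/
abbrev tdeg (κ : ℝ) (m : Fin 4 ⊕ JGen κ →₀ ℕ) : ℝ := Finsupp.weight (genDeg κ) m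

theorem tdeg_single (i : Fin 4 ⊕ JGen κ) : tdeg κ (Finsupp.single i 1) = genDeg κ i := by
  rw [tdeg, Finsupp.weight_single, one_smul]

/-- Both characters are multiplicative, so the strict gain on generators spreads to monomials by
telescoping ab - a'b'. The second component is what makes the telescoping close. -/
theorem hat_monomial (hn : Nonres κ) (hκ : 0 < κ) (hg : Graded P g) (c : Fin 5 → B)
    (m : Fin 4 ⊕ JGen κ →₀ ℕ) :
    hat f g c (MvPolynomial.monomial m 1) - g (MvPolynomial.monomial m 1)
        ∈ P.F true (tdeg κ m) ∧ g (MvPolynomial.monomial m 1) ∈ P.F false (tdeg κ m) := by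
  induction m using Finsupp.induction_linear with
  | zero =>
    rw [show MvPolynomial.monomial (0 : Fin 4 ⊕ JGen κ →₀ ℕ) (1 : ℝ) = 1 from rfl, map_one, map_one,
      sub_self, tdeg, map_zero]
    exact ⟨zero_mem _, P.top _⟩
  | add m n hm hn' =>
    have h : MvPolynomial.monomial (m + n) (1 : ℝ)
        = MvPolynomial.monomial m 1 * MvPolynomial.monomial n 1 := by
      rw [MvPolynomial.monomial_mul, one_mul]
    rw [h, map_mul, map_mul, tdeg, map_add]
    refine ⟨?_, P.mul hm.2 hn'.2⟩
    have h2 : ∀ a b a' b' : B, a * b - a' * b' = (a - a') * (b - b') + (a - a') * b'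
        + a' * (b - b') := fun a b a' b' => by ring
    rw [h2]
    exact add_mem (add_mem (P.mul hm.1 hn'.1) (P.mul hm.1 hn'.2)) (P.mul hm.2 hn'.1)
  | single i n =>
    induction n with
    | zero =>
      rw [Finsupp.single_zero, show MvPolynomial.monomial (0 : Fin 4 ⊕ JGen κ →₀ ℕ) (1 : ℝ) = 1
        from rfl, map_one, map_one, sub_self, tdeg, map_zero]
      exact ⟨zero_mem _, P.top _⟩
    | succ n ih =>
      have h : MvPolynomial.monomial (Finsupp.single i (n + 1)) (1 : ℝ)
          = MvPolynomial.monomial (Finsupp.single i n) 1 * MvPolynomial.X i := by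
        rw [MvPolynomial.X, MvPolynomial.monomial_mul, one_mul, ← Finsupp.single_add]
      have hw : tdeg κ (Finsupp.single i (n + 1)) = tdeg κ (Finsupp.single i n) + genDeg κ i := by
        rw [tdeg, Finsupp.single_add, map_add, ← tdeg_single i]
      rw [h, map_mul, map_mul, hw]
      refine ⟨?_, P.mul ih.2 (hg i)⟩
      have h2 : ∀ a b a' b' : B, a * b - a' * b' = (a - a') * (b - b') + (a - a') * b'
          + a' * (b - b') := fun a b a' b' => by ring
      rw [h2]
      have h3 := hat_gen (f := f) hn hκ hg c i
      exact add_mem (add_mem (P.mul ih.1 h3) (P.mul ih.1 (hg i))) (P.mul ih.2 h3)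

end Filtration

/-! ### The filtration of `T⁺ ⊗ T⁺` by the degree of the left factor -/

section Tensor

variable {κ : ℝ}

/-- Monomials of degree larger than, or at least, `c`. -/
def tset (κ : ℝ) : Bool → ℝ → Set (Fin 4 ⊕ JGen κ →₀ ℕ)
  | true, c => {m | c < tdeg κ m}
  | false, c => {m | c ≤ tdeg κ m}

theorem tset_add {s t : Bool} {c d : ℝ} {m n : Fin 4 ⊕ JGen κ →₀ ℕ} (hm : m ∈ tset κ s c)
    (hn : n ∈ tset κ t d) : m + n ∈ tset κ (s || t) (c + d) := by
  have h : tdeg κ (m + n) = tdeg κ m + tdeg κ n := map_add _ _ _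
  cases s <;> cases t <;>
    simp only [tset, Set.mem_ofPred_eq, Bool.or_false, Bool.or_true] at * <;>
    linarith

theorem tdeg_nonneg (m : Fin 4 ⊕ JGen κ →₀ ℕ) : 0 ≤ tdeg κ m := by
  rw [tdeg, Finsupp.weight_apply]
  refine Finset.sum_nonneg fun i _ => nsmul_nonneg ?_ _
  rcases i with i | p
  · exact Nat.cast_nonneg _
  · have := p.2.2.2
    simp only [genDeg]; linarith

/-- The span of the `m ⊗ q` where `m` is a monomial with the given bound on the degree. -/
def tfilF (κ : ℝ) (s : Bool) (c : ℝ) : Submodule ℝ (Tp κ ⊗[ℝ] Tp κ) :=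
  Submodule.span ℝ {u | ∃ m ∈ tset κ s c, ∃ q : Tp κ, u = MvPolynomial.monomial m 1 ⊗ₜ q}

theorem tfilF_mono {s t : Bool} {c d : ℝ} (h : tset κ s c ⊆ tset κ t d) :
    tfilF κ s c ≤ tfilF κ t d :=
  Submodule.span_mono fun _ ⟨m, hm, q, hu⟩ => ⟨m, h hm, q, hu⟩

/-- The filtration of `T⁺ ⊗ T⁺` by the degree of the left factor. -/
def tfil (κ : ℝ) : Filt (Tp κ ⊗[ℝ] Tp κ) where
  F := tfilF κ
  mul {s t c d a b} ha hb := by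
    have h := Submodule.mul_mem_mul ha hb
    rw [tfilF, tfilF, Submodule.span_mul_span] at h
    refine Submodule.span_mono ?_ h
    rintro _ ⟨_, ⟨m, hm, p, rfl⟩, _, ⟨n, hn, q, rfl⟩, rfl⟩
    refine ⟨m + n, tset_add hm hn, p * q, ?_⟩
    change _ * _ = _
    rw [Algebra.TensorProduct.tmul_mul_tmul, MvPolynomial.monomial_mul, one_mul]
  lt {s c d} h := tfilF_mono fun m hm => by
    cases s <;> simp only [tset, Set.mem_ofPred_eq] at * <;> linarith
  le c := tfilF_mono fun m hm => by
    simp only [tset, Set.mem_ofPred_eq] at *; linarith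
  top b := by
    induction b using TensorProduct.induction_on with
    | zero => exact zero_mem _
    | add x y hx hy => exact add_mem hx hy
    | tmul p q =>
      induction p using MvPolynomial.induction_on' with
      | add p p' h h' => rw [TensorProduct.add_tmul]; exact add_mem h h'
      | monomial m r =>
        have : MvPolynomial.monomial m r = r • MvPolynomial.monomial m (1 : ℝ) := by
          rw [MvPolynomial.smul_monomial, smul_eq_mul, mul_one]
        rw [this, ← TensorProduct.smul_tmul']
        exact Submodule.smul_mem _ _ (Submodule.subset_span ⟨m, tdeg_nonneg m, q, rfl⟩)

theorem graded_includeLeft : Graded (tfil κ)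
    (Algebra.TensorProduct.includeLeft : Tp κ →ₐ[ℝ] Tp κ ⊗[ℝ] Tp κ) := fun i => by
  refine Submodule.subset_span ⟨Finsupp.single i 1, ?_, 1, rfl⟩
  exact (tdeg_single i).ge

theorem tfil_le_tensorTp (c : ℝ) : (tfil κ).F true c ≤ tensorTp κ (Tpgt κ c) := by
  refine Submodule.span_le.2 ?_
  rintro _ ⟨m, hm, q, rfl⟩
  refine tmul_mem_tensorTp ?_ q
  have h : MvPolynomial.monomial m (1 : ℝ) ∈ Tpeq κ (tdeg κ m) :=
    MvPolynomial.isWeightedHomogeneous_monomial _ _ _ rfl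
  exact Submodule.mem_iSup_of_mem (⟨tdeg κ m, hm⟩ : Set.Ioi c) h

theorem renDeltaHat_degree (hn : Nonres κ) (hκ : 0 < κ) (c : Fin 5 → ℝ) (α : ℝ) {σ : Tp κ}
    (hσ : σ ∈ Tpeq κ α) :
    (renDeltaHat κ c).toLinearMap σ - σ ⊗ₜ[ℝ] (1 : Tp κ) ∈ tensorTp κ (Tpgt κ α) := by
  refine tfil_le_tensorTp α ?_
  let ι : Tp κ →ₐ[ℝ] Tp κ ⊗[ℝ] Tp κ := Algebra.TensorProduct.includeLeft
  change renDeltaHat κ c σ - ι σ ∈ (tfil κ).F true α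
  have h1 : ∀ p : Tp κ, renDeltaHat κ c p - ι p
      = ∑ m ∈ p.support, p.coeff m • (renDeltaHat κ c (MvPolynomial.monomial m 1)
        - ι (MvPolynomial.monomial m 1)) := by
    intro p
    conv_lhs => rw [p.as_sum]
    rw [map_sum, map_sum, ← Finset.sum_sub_distrib]
    refine Finset.sum_congr rfl fun m _ => ?_
    have : MvPolynomial.monomial m (p.coeff m) = p.coeff m • MvPolynomial.monomial m (1 : ℝ) := by
      rw [MvPolynomial.smul_monomial, smul_eq_mul, mul_one]
    rw [this, map_smul, map_smul, smul_sub]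
  rw [h1]
  refine Submodule.sum_mem _ fun m hm => Submodule.smul_mem _ _ ?_
  have h2 : tdeg κ m = α := hσ (MvPolynomial.mem_support_iff.1 hm)
  rw [← h2]
  exact (hat_monomial (f := Algebra.TensorProduct.includeRight) hn hκ graded_includeLeft
    (fun i => algebraMap ℝ _ (c i)) m).1

end Tensor

end Phi43

end

noncomputable section

namespace Phi43

/-! ## The renormalisation map as an exponential -/

section Semigroup

variable {κ : ℝ} {B : Type} [CommRing B] [Algebra ℝ B]

/-- Every pattern needs at least two branches at the root. Since a contracted symbol has at most
one, contractions at the root compose to zero on W. -/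
theorem rootB_eq_zero (c : Fin 5 → B) {τ : Sym} (h : τ.branches.card ≤ 1) :
    rootB c (mon B τ) = 0 := by
  refine (Submodule.mem_bot B).1 ?_
  have h1 := rootB_mem c τ
  have h0 : {ρ : Sym | Contr τ ρ} = ∅ := by
    refine Set.eq_empty_of_forall_notMem fun ρ hρ => ?_
    rw [Set.mem_ofPred_eq] at hρ
    cases hρ with
    | leaf j ρ hj =>
      simp only [Sym.branches_mul, Sym.branches_int_Xi_pow, Multiset.card_add,
        Multiset.card_replicate] at h
      omega
    | cherry i j ρ₁ ρ₂ hi hj hij =>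
      simp only [Sym.branches_mul, Sym.branches_int, Sym.branches_int_Xi_pow, Multiset.card_add,
        Multiset.card_replicate, Multiset.card_singleton] at h
      omega
  rw [h0, supp_eq_span, Set.image_empty, Submodule.span_empty] at h1
  exact h1

theorem renMul_noise (f : Tp κ →ₐ[ℝ] B) (c : Fin 5 → B) (τ : Sym) :
    renMul f c (mon B τ) ∈ supp B {ρ | ρ.noise = τ.noise} := by
  refine Sym.gen_induction (fun σ u => u ∈ supp B {ρ : Sym | ρ.noise = σ.noise})
    ((renMul f c : AmbB B →* AmbB B).comp (MonoidAlgebra.of B Sym)) (mon_mem_supp rfl)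
    (fun σ τ u v hu hv => ?_) (fun i => ?_) τ (fun _ => ?_) fun σ _ => ?_
  · refine mul_mem_supp (fun a ha b hb => ?_) hu hv
    simp only [Set.mem_ofPred_eq, Sym.noise_mul] at *
    rw [ha, hb]
  · change renMul f c (mon B (Xg i)) ∈ _
    rw [renMul_X]; exact mon_mem_supp rfl
  · change renMul f c (mon B Sym.Xi) ∈ _
    rw [renMul_Xi]; exact mon_mem_supp rfl
  · change renMul f c (mon B σ.int) ∈ _
    rw [renMul_int]
    refine add_mem (intB_mem_supp (fun ρ _ _ => ?_) (mem_supp_univ _))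
      (supp_mono (fun ρ hρ => ?_) (corr_mem_poly f σ _))
    · rw [Set.mem_ofPred_eq, Sym.noise_int, Sym.noise_int]
    · rw [Set.mem_ofPred_eq, Sym.noise_int]; exact (Sym.isPoly_iff.1 (mem_polySet.1 hρ)).1

theorem renB_coeff_Xi (f : Tp κ →ₐ[ℝ] B) (c : Fin 5 → B) {σ : Sym} (hσ : σ.InW) :
    (renB f c (mon B σ)).coeff Sym.Xi = (mon B σ).coeff Sym.Xi := by
  by_cases h : σ = Sym.Xi
  · rw [h, renB_Xi]
  rw [coeff_mon_Xi h]
  apply coeff_Xi_of_noise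
  rw [renB_mon]
  refine add_mem ?_ (map_mem_of_supp (renMul f c).toLinearMap _ (fun ρ hρ => ?_) (rootB_mem c σ))
  · have := renMul_noise f c σ
    rwa [hσ.noise h] at this
  · rw [Set.mem_ofPred_eq] at hρ
    have := renMul_noise f c ρ
    rw [(hρ.inW hσ).1] at this
    exact this

theorem corrL_triv (c : Fin 5 → B) (u : AmbB B) : corrL (triv κ B) c u = 0 := by
  refine (Submodule.mem_bot B).1 (map_mem_of_supp (S := Set.univ) _ ⊥ (fun σ _ => ?_)
    (mem_supp_univ u))
  rw [corrL_mon, corr_triv]; exact zero_mem _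

theorem renMul_triv_intB (c : Fin 5 → B) (u : AmbB B) :
    renMul (triv κ B) c (intB B u) = intB B (renB (triv κ B) c u) := by
  rw [renMul_intB, corrL_triv, add_zero]

theorem renMul_triv_data (c : Fin 5 → B) {σ : Sym} (hσ : σ.InW) :
    renMul (triv κ B) c (mon B σ.int) = intB B (renB (triv κ B) c (mon B σ)) + 0 ∧
      (0 : AmbB B) ∈ supp B polySet ∧
      (renB (triv κ B) c (mon B σ)).coeff Sym.Xi = (mon B σ).coeff Sym.Xi := by
  refine ⟨?_, zero_mem _, renB_coeff_Xi _ c hσ⟩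
  rw [renMul_int, corr_triv]

theorem renMul_X' (f : Tp κ →ₐ[ℝ] B) (c : Fin 5 → B) (i : Fin 4) :
    ∃ a, renMul f c (mon B (Xg i)) = mon B (Xg i) + algebraMap B _ a :=
  ⟨0, by rw [renMul_X, map_zero, add_zero]⟩

theorem leafB_renMul (c : Fin 5 → B) {τ : Sym} (hτ : τ.InW) (i : ℕ) :
    leafB B i (renMul (triv κ B) c (mon B τ)) = renMul (triv κ B) c (leafB B i (mon B τ)) :=
  leafB_comm (renMul (triv κ B) c) (renMul_X' _ c) (renMul_Xi _ c)
    (fun σ => renB (triv κ B) c (mon B σ)) (fun _ => 0) τ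
    (fun _ hρ => renMul_triv_data c (hτ.branch hρ).1) i

/-- Of the two parts of M τ, the one coming from a contraction has at most one branch at the root,
so removing i ≥ 2 leaves annihilates it. -/
theorem leafB_renB (c : Fin 5 → B) {τ : Sym} (hτ : τ.InW) {i : ℕ} (hi : 2 ≤ i) :
    leafB B i (renB (triv κ B) c (mon B τ)) = renMul (triv κ B) c (leafB B i (mon B τ)) := by
  rw [renB_mon, map_add, leafB_renMul c hτ]
  have h := linMap_congr (leafB B i ∘ₗ (renMul (triv κ B) c).toLinearMap) 0 (fun ρ hρ => by
    rw [Set.mem_ofPred_eq] at hρ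
    obtain ⟨-, h2, -, h4⟩ := hρ.inW hτ
    rw [LinearMap.comp_apply, AlgHom.toLinearMap_apply, leafB_renMul c h4,
      leafB_eq_zero (by omega), map_zero, LinearMap.zero_apply]) (rootB_mem c τ)
  rw [LinearMap.comp_apply, AlgHom.toLinearMap_apply, LinearMap.zero_apply] at h
  rw [h, add_zero]

theorem rootB_renMul (c d : Fin 5 → B) {τ : Sym} (hτ : τ.InW) :
    rootB c (renMul (triv κ B) d (mon B τ)) = renMul (triv κ B) d (rootB c (mon B τ)) :=
  rootB_comm (renMul (triv κ B) d) (renMul_X' _ d) (renMul_Xi _ d)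
    (fun σ => renB (triv κ B) d (mon B σ)) (fun _ => 0) τ
    (fun _ hρ => renMul_triv_data d (hτ.branch hρ).1)
    (fun _ hσ _ hi => leafB_renB d (hτ.branch hσ).1 hi) c

theorem rootB_add (c d : Fin 5 → B) (u : AmbB B) : rootB (c + d) u = rootB c u + rootB d u := by
  simp only [rootB_apply, Pi.add_apply, add_smul]; abel

theorem rootB_smul (b : B) (c : Fin 5 → B) (u : AmbB B) : rootB (b • c) u = b • rootB c u := by
  simp only [rootB_apply, Pi.smul_apply, smul_neg, smul_add, smul_smul, smul_eq_mul]

theorem renB_renMul (c d : Fin 5 → B) {τ : Sym} (hτ : τ.InW) :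
    renB (triv κ B) c (renMul (triv κ B) d (mon B τ))
      = renMul (triv κ B) c (renMul (triv κ B) d (mon B τ + rootB c (mon B τ))) := by
  rw [renB_apply, rootB_renMul c d hτ, ← map_add, ← map_add]

/-- Since R_c commutes with M_d° and R_c R_d = 0, the factors combine as (1 + R_c)(1 + R_d) = 1 +
R_{c+d}, while M_c° M_d° = M_{c+d}° is the induction hypothesis on branches. At the trivial
character there are no polynomial corrections. -/
theorem renB_renB_mon (c d : Fin 5 → B) {τ : Sym} (hτ : τ.InW) :
    renB (triv κ B) c (renB (triv κ B) d (mon B τ)) = renB (triv κ B) (c + d) (mon B τ) := by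
  induction hn : τ.wt using Nat.strong_induction_on generalizing τ with
  | _ n ih =>
    subst hn
    have key : ∀ ρ : Sym, (∀ σ ∈ ρ.branches, σ.InW ∧ σ.wt < τ.wt) →
        renMul (triv κ B) c (renMul (triv κ B) d (mon B ρ))
          = renMul (triv κ B) (c + d) (mon B ρ) := by
      intro ρ hρ
      refine algHom_congr ((renMul (triv κ B) c).comp (renMul (triv κ B) d))
        (renMul (triv κ B) (c + d)) ρ (fun i => ?_) (fun _ => ?_) fun σ hσ => ?_
      · rw [AlgHom.comp_apply, renMul_X, renMul_X, renMul_X]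
      · rw [AlgHom.comp_apply, renMul_Xi, renMul_Xi, renMul_Xi]
      · obtain ⟨h1, h2⟩ := hρ σ hσ
        rw [AlgHom.comp_apply, renMul_int, renMul_int, corr_triv, corr_triv, add_zero, add_zero,
          renMul_triv_intB, ih σ.wt h2 h1 rfl]
    have e0 : ∀ σ ∈ τ.branches, σ.InW ∧ σ.wt < τ.wt := fun σ hσ => by
      have := Sym.wt_branch hσ
      exact ⟨(hτ.branch hσ).1, by omega⟩
    have hR : ∀ {ρ : Sym}, Contr τ ρ →
        renB (triv κ B) c (renMul (triv κ B) d (mon B ρ))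
          = renMul (triv κ B) (c + d) (mon B ρ) := fun {ρ} hρ => by
      obtain ⟨-, h2, h3, h4⟩ := hρ.inW hτ
      rw [renB_renMul c d h4, rootB_eq_zero c h2, add_zero,
        key ρ fun σ hσ => ⟨(h3 σ hσ).1, (h3 σ hσ).2.2⟩]
    have e2 : ∀ b : Fin 5 → B, renB (triv κ B) c (renMul (triv κ B) d (rootB b (mon B τ)))
        = renMul (triv κ B) (c + d) (rootB b (mon B τ)) := fun b => by
      have h := linMap_congr (renB (triv κ B) c ∘ₗ (renMul (triv κ B) d).toLinearMap)
        (renMul (triv κ B) (c + d)).toLinearMap (fun ρ hρ => by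
          rw [Set.mem_ofPred_eq] at hρ
          rw [LinearMap.comp_apply]
          exact hR hρ) (rootB_mem b τ)
      rw [LinearMap.comp_apply, AlgHom.toLinearMap_apply, AlgHom.toLinearMap_apply] at h
      exact h
    have e3 : renMul (triv κ B) c (renMul (triv κ B) d (rootB c (mon B τ)))
        = renMul (triv κ B) (c + d) (rootB c (mon B τ)) := by
      have h := linMap_congr ((renMul (triv κ B) c).comp (renMul (triv κ B) d)).toLinearMap
        (renMul (triv κ B) (c + d)).toLinearMap (fun ρ hρ => by
          rw [Set.mem_ofPred_eq] at hρ
          obtain ⟨-, -, h3, -⟩ := hρ.inW hτ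
          exact key ρ fun σ hσ => ⟨(h3 σ hσ).1, (h3 σ hσ).2.2⟩) (rootB_mem c τ)
      rw [AlgHom.toLinearMap_apply, AlgHom.toLinearMap_apply, AlgHom.comp_apply] at h
      exact h
    rw [renB_mon _ d, map_add, e2 d, renB_renMul c d hτ, map_add, map_add, key τ e0, e3,
      renB_mon, rootB_add, map_add, add_assoc]

theorem rootB_zero (u : AmbB B) : rootB (0 : Fin 5 → B) u = 0 := by
  simp [rootB_apply]

theorem renB_triv_zero {τ : Sym} (hτ : τ.InW) :
    renB (triv κ B) 0 (mon B τ) = mon B τ ∧ renMul (triv κ B) 0 (mon B τ) = mon B τ := by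
  induction τ using Sym.induction with
  | h k m s ih =>
    have h : renMul (triv κ B) 0 (mon B (Sym.node k m s)) = mon B (Sym.node k m s) := by
      refine algHom_congr (renMul (triv κ B) 0) (AlgHom.id B _) _ (fun i => ?_) (fun _ => ?_)
        fun σ hσ => ?_
      · rw [renMul_X]; rfl
      · rw [renMul_Xi]; rfl
      · rw [renMul_int, (ih σ (by simpa using hσ) (hτ.branch hσ).1).1, corr_triv, add_zero,
          intB_mon (hτ.branch hσ).2]; rfl
    exact ⟨by rw [renB_mon, rootB_zero, map_zero, add_zero, h], h⟩

end Semigroup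

end Phi43

end

noncomputable section

namespace Phi43

/-! ### The one-parameter group t ↦ M_{tC} and its generator -/

section Exponential

open Polynomial

variable {κ : ℝ} {B : Type} [CommRing B] [Algebra ℝ B]

/-- The coefficient of `X^n`, for polynomial coefficients. -/
def co (B : Type) [CommRing B] (n : ℕ) : AmbB B[X] →ₗ[B] AmbB B :=
  (MonoidAlgebra.coeffLinearEquiv B).symm.toLinearMap ∘ₗ
    Finsupp.mapRange.linearMap (lcoeff B n) ∘ₗ (MonoidAlgebra.coeffLinearEquiv B).toLinearMap

theorem coeff_co (n : ℕ) (u : AmbB B[X]) (ρ : Sym) : (co B n u).coeff ρ = (u.coeff ρ).coeff n :=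
  rfl

theorem co_single (n : ℕ) (ρ : Sym) (p : B[X]) :
    co B n (MonoidAlgebra.single ρ p) = MonoidAlgebra.single ρ (p.coeff n) := by
  classical
  apply MonoidAlgebra.coeff_injective
  ext μ
  rw [coeff_co, MonoidAlgebra.coeff_single, MonoidAlgebra.coeff_single, Finsupp.single_apply,
    Finsupp.single_apply]
  split_ifs <;> simp

theorem co_zero_mul (u v : AmbB B[X]) : co B 0 (u * v) = co B 0 u * co B 0 v := by
  induction u using MonoidAlgebra.induction_linear with
  | zero => simp
  | add x y hx hy => rw [add_mul, map_add, map_add, add_mul, hx, hy]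
  | single ρ p =>
    induction v using MonoidAlgebra.induction_linear with
    | zero => simp
    | add x y hx hy => rw [mul_add, map_add, map_add, mul_add, hx, hy]
    | single μ q =>
      rw [MonoidAlgebra.single_mul_single, co_single, co_single, co_single,
        MonoidAlgebra.single_mul_single, mul_coeff_zero]

theorem co_one_mul (u v : AmbB B[X]) :
    co B 1 (u * v) = co B 1 u * co B 0 v + co B 0 u * co B 1 v := by
  induction u using MonoidAlgebra.induction_linear with
  | zero => simp
  | add x y hx hy =>
    rw [add_mul, map_add, map_add, map_add, add_mul, add_mul, hx, hy]; abel
  | single ρ p =>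
    induction v using MonoidAlgebra.induction_linear with
    | zero => simp
    | add x y hx hy =>
      rw [mul_add, map_add, map_add, map_add, mul_add, mul_add, hx, hy]; abel
    | single μ q =>
      rw [MonoidAlgebra.single_mul_single]
      simp only [co_single]
      rw [MonoidAlgebra.single_mul_single, MonoidAlgebra.single_mul_single,
        ← MonoidAlgebra.single_add, mul_coeff_one, add_comm]

theorem co_mon (n : ℕ) (ρ : Sym) : co B n (mon B[X] ρ) = if n = 0 then mon B ρ else 0 := by
  rw [co_single, coeff_one]
  split_ifs <;> simp

theorem co_smul (n : ℕ) (b : B) (u : AmbB B[X]) : co B n (C b • u) = b • co B n u := by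
  apply MonoidAlgebra.coeff_injective
  ext μ
  rw [coeff_co]
  change (C b * u.coeff μ).coeff n = b * (u.coeff μ).coeff n
  rw [coeff_C_mul]

theorem co_X_smul (n : ℕ) (u : AmbB B[X]) : co B (n + 1) ((X : B[X]) • u) = co B n u := by
  apply MonoidAlgebra.coeff_injective
  ext μ
  rw [coeff_co]
  change (X * u.coeff μ).coeff (n + 1) = (u.coeff μ).coeff n
  rw [coeff_X_mul]

theorem co_intB (n : ℕ) (u : AmbB B[X]) : co B n (intB B[X] u) = intB B (co B n u) := by
  induction u using MonoidAlgebra.induction_linear with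
  | zero => simp
  | add x y hx hy => simp only [map_add, hx, hy]
  | single ρ p =>
    rw [co_single, ← smul_mon, ← smul_mon, (intB B[X]).map_smul, (intB B).map_smul]
    by_cases hp : ρ.IsPoly
    · rw [intB_poly hp, intB_poly hp, smul_zero, smul_zero, map_zero]
    · rw [intB_mon hp, intB_mon hp, smul_mon, smul_mon, co_single]

theorem co_mem (n : ℕ) {S : Set Sym} {u : AmbB B[X]} (hu : u ∈ supp B[X] S) :
    co B n u ∈ supp B S := by
  rw [MonoidAlgebra.mem_supported'] at *
  intro ρ hρ
  rw [coeff_co, hu ρ hρ, coeff_zero]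

theorem co_prod (s : Multiset Sym) (h : Sym → AmbB B[X]) [DecidableEq Sym] :
    co B 0 ((s.map h).prod) = (s.map fun σ => co B 0 (h σ)).prod ∧
    co B 1 ((s.map h).prod)
      = (s.map fun σ => co B 1 (h σ) * ((s.erase σ).map fun σ => co B 0 (h σ)).prod).sum := by
  induction s using Multiset.induction with
  | empty =>
    have := co_mon (B := B) 0 1
    have h1 := co_mon (B := B) 1 1
    simp only [Multiset.map_zero, Multiset.prod_zero, Multiset.sum_zero]
    exact ⟨this, h1⟩
  | cons a s ih =>
    refine ⟨by rw [Multiset.map_cons, Multiset.prod_cons, co_zero_mul, ih.1, Multiset.map_cons,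
      Multiset.prod_cons], ?_⟩
    rw [Multiset.map_cons, Multiset.prod_cons, co_one_mul, ih.1, ih.2, Multiset.map_cons,
      Multiset.sum_cons, Multiset.erase_cons_head, ← Multiset.sum_map_mul_left]
    congr 2
    refine Multiset.map_congr rfl fun σ hσ => ?_
    by_cases hs : σ = a
    · subst hs
      rw [Multiset.erase_cons_head]
      conv_rhs => rw [← Multiset.cons_erase hσ]
      rw [Multiset.map_cons, Multiset.prod_cons]; ring
    · rw [Multiset.erase_cons_tail _ (fun h => hs h.symm), Multiset.map_cons, Multiset.prod_cons]; ring

/-- The generator of the renormalisation map. -/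
def contrA (c : Fin 5 → ℝ) (τ : Sym) : Amb := -∑ i, c i • contractA i τ

open Classical in
theorem contrA_eq (c : Fin 5 → ℝ) (τ : Sym) : contrA c τ = rootB c (mon ℝ τ) +
    (τ.branches.map fun σ => intB ℝ (contrA c σ) *
      mon ℝ (Sym.node τ.exp τ.noise (τ.branches.erase σ))).sum := by
  have h : ∀ i, contractA i τ = contractRoot i τ + (τ.branches.map fun σ =>
      intB ℝ (contractA i σ) * mon ℝ (Sym.node τ.exp τ.noise (τ.branches.erase σ))).sum := by
    intro i
    rw [contractA, Multiset.attach_map_val' τ.branches (fun σ => intA (contractA i σ) *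
      MonoidAlgebra.of ℝ Sym (Sym.node τ.exp τ.noise (τ.branches.erase σ)))]
    rfl
  have h2 : ∀ s t : Multiset Sym, (s.map fun σ => intB ℝ (contrA c σ) *
        mon ℝ (Sym.node τ.exp τ.noise (t.erase σ))).sum
      = -∑ i, c i • (s.map fun σ =>
        intB ℝ (contractA i σ) * mon ℝ (Sym.node τ.exp τ.noise (t.erase σ))).sum := by
    intro s t
    induction s using Multiset.induction with
    | empty => simp
    | cons a s ih =>
      simp only [Multiset.map_cons, Multiset.sum_cons, smul_add, Finset.sum_add_distrib, neg_add]
      rw [ih, contrA]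
      congr 1
      rw [map_neg, map_sum, neg_mul, Finset.sum_mul]
      simp only [map_smul, smul_mul_assoc]
  rw [h2, rootB_real, contrA]
  simp only [h, smul_add, Finset.sum_add_distrib, neg_add]

/-- The constants `c`, multiplied by the variable. -/
def cvar (B : Type) [CommRing B] [Algebra ℝ B] (c : Fin 5 → ℝ) : Fin 5 → B[X] :=
  (X : B[X]) • fun i => algebraMap ℝ B[X] (c i)

/-- Evaluation at `0`. -/
def evz (B : Type) [CommRing B] [Algebra ℝ B] : B[X] →ₐ[ℝ] B :=
  (aeval (0 : B)).restrictScalars ℝ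

theorem evz_apply (p : B[X]) : evz B p = p.coeff 0 := by
  simp [evz, coeff_zero_eq_aeval_zero]

theorem evz_cvar (c : Fin 5 → ℝ) : (fun i => evz B (cvar B c i)) = 0 := by
  funext i; simp [cvar, evz_apply]

theorem co_zero_eq (u : AmbB B[X]) : co B 0 u = push (evz B) u := by
  apply MonoidAlgebra.coeff_injective
  ext ρ
  rw [coeff_co, coeff_push, evz_apply]

theorem co_zero_renB (c : Fin 5 → ℝ) {τ : Sym} (hτ : τ.InW) :
    co B 0 (renB (triv κ B[X]) (cvar B c) (mon B[X] τ)) = mon B τ := by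
  rw [co_zero_eq, push_renB_mon, push_triv, evz_cvar, (renB_triv_zero hτ).1]

theorem co_zero_renMul (c : Fin 5 → ℝ) {u : AmbB B[X]} (hu : u ∈ supp B[X] setW) :
    co B 0 (renMul (triv κ B[X]) (cvar B c) u) = co B 0 u := by
  rw [co_zero_eq, co_zero_eq]
  refine push_linear (evz B) (renMul (triv κ B[X]) (cvar B c)).toLinearMap LinearMap.id
    (fun ρ hρ => ?_) hu
  rw [AlgHom.toLinearMap_apply]
  refine push_algHom (evz B) _ (AlgHom.id B _) ρ (fun i => ?_) ?_ fun σ hσ => ?_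
  · rw [renMul_X, push_mon]; rfl
  · rw [renMul_Xi, push_mon]; rfl
  · obtain ⟨h1, h2⟩ := Sym.InW.branch (mem_setW.1 hρ) hσ
    rw [renMul_int, corr_triv, add_zero, push_intB, ← co_zero_eq, co_zero_renB c h1, intB_mon h2]
    rfl

theorem renMul_mon_eq (f : Tp κ →ₐ[ℝ] B) (c : Fin 5 → B) (τ : Sym) : renMul f c (mon B τ)
    = mon B (Sym.node τ.exp τ.noise 0) *
      (τ.branches.map fun σ => renMul f c (mon B σ.int)).prod := by
  have h : renMul f c (mon B (Sym.node τ.exp τ.noise 0)) = mon B (Sym.node τ.exp τ.noise 0) :=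
    algHom_congr (renMul f c) (AlgHom.id B _) _ (fun i => renMul_X f c i) (fun _ => renMul_Xi f c)
      fun σ hσ => by simp at hσ
  conv_lhs => rw [← Sym.node_eta τ, mon_node, map_mul, h, map_multiset_prod, Multiset.map_map]
  rfl

/-- Differentiating M_{tc} = M_{tc}° (1 + tR) at t = 0 gives R from the second factor, and from the
first, by the Leibniz rule, one term per branch. This is the recursion defining the contraction at
an arbitrary place. -/
theorem co_one_renB (c : Fin 5 → ℝ) {τ : Sym} (hτ : τ.InW) :
    co B 1 (renB (triv κ B[X]) (cvar B c) (mon B[X] τ))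
      = push (Algebra.ofId ℝ B) (contrA c τ) := by
  classical
  induction τ using Sym.induction with
  | h k m s ih =>
  rw [renB_mon, map_add, contrA_eq, map_add, add_comm]
  congr 1
  · rw [cvar, rootB_smul, map_smul, co_X_smul, ← cvar,
      co_zero_renMul c (rootB_mem_W _ (mon_mem_supp (mem_setW.2 hτ))), co_zero_eq, push_rootB,
      push_rootB, push_mon, push_mon]
    refine congrArg (fun b => rootB b (mon B _)) (funext fun i => ?_)
    rw [AlgHom.commutes]; rfl
  · rw [renMul_mon_eq, co_one_mul, co_mon, co_mon, (co_prod _ _).2]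
    simp only [one_ne_zero, if_false, if_true, zero_mul, zero_add, Sym.branches_node, Sym.exp_node,
      Sym.noise_node]
    rw [← Multiset.sum_map_mul_left, map_multiset_sum, Multiset.map_map]
    congr 1
    refine Multiset.map_congr rfl fun σ hσ => ?_
    have h1 : ∀ σ ∈ s, σ.InW ∧ ¬ σ.IsPoly := fun σ hσ => hτ.branch (by simpa using hσ)
    rw [Function.comp_apply, map_mul, push_intB, push_mon, ← ih σ hσ (h1 σ hσ).1, renMul_int,
      corr_triv, add_zero, co_intB, mon_node k m (s.erase σ)]
    have h2 : ((s.erase σ).map fun σ =>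
        co B 0 (renMul (triv κ B[X]) (cvar B c) (mon B[X] σ.int)))
        = (s.erase σ).map fun σ => mon B σ.int := by
      refine Multiset.map_congr rfl fun ρ hρ => ?_
      have h3 := h1 ρ (Multiset.mem_of_mem_erase hρ)
      rw [renMul_int, corr_triv, add_zero, co_intB, co_zero_renB c h3.1, intB_mon h3.2]
    rw [h2]; ring

/-- The generator of the renormalisation map. -/
def genB (B : Type) [CommRing B] [Algebra ℝ B] (c : Fin 5 → ℝ) : AmbB B →ₗ[B] AmbB B :=
  linExt fun τ => push (Algebra.ofId ℝ B) (contrA c τ)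

theorem genB_mon (c : Fin 5 → ℝ) (τ : Sym) :
    genB B c (mon B τ) = push (Algebra.ofId ℝ B) (contrA c τ) := linExt_mon _ _

theorem co_one_renB_push (c : Fin 5 → ℝ) {u : AmbB B} (hu : u ∈ supp B setW) :
    co B 1 (renB (triv κ B[X]) (cvar B c) (push (CAlgHom (R := ℝ)) u)) = genB B c u := by
  rw [supp_eq_span] at hu
  induction hu using Submodule.span_induction with
  | mem x hx =>
    obtain ⟨σ, hσ, rfl⟩ := hx
    rw [push_mon, co_one_renB c (mem_setW.1 hσ), genB_mon]
  | zero => simp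
  | add x y _ _ hx hy => simp only [map_add, hx, hy]
  | smul b x _ hx =>
    rw [push_smul, LinearMap.map_smul, LinearMap.map_smul, ← hx]
    exact co_smul 1 b _

/-- `M` with polynomial coefficients: the constants are multiplied by the variable. -/
def renPoly (κ : ℝ) (c : Fin 5 → ℝ) (τ : Sym) : AmbB ℝ[X] :=
  renB (triv κ ℝ[X]) (cvar ℝ c) (mon ℝ[X] τ)

/-- The differential equation d/dt M_{tc} = L M_{tc} follows from the group law at t + s by
extracting the coefficient of s. -/
theorem derivative_coeff_renPoly (c : Fin 5 → ℝ) {τ : Sym} (hτ : τ.InW) (ρ : Sym) :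
    derivative ((renPoly κ c τ).coeff ρ) = (genB ℝ[X] c (renPoly κ c τ)).coeff ρ := by
  -- The outer variable is the increment s and the inner one the time t.
  let φ : ℝ[X] →ₐ[ℝ] ℝ[X][X] := aeval (X + C X)
  have h1 : ∀ p : ℝ[X], (φ p).coeff 1 = derivative p := by
    intro p
    have : φ p = taylor X (p.map C) := by
      rw [taylor_apply, Polynomial.comp, eval₂_map]; rfl
    rw [this, taylor_coeff_one, derivative_map, eval_map, eval₂_C_X]
  have h2 : (fun i => φ (cvar ℝ c i))
      = cvar ℝ[X] c + fun i => CAlgHom (R := ℝ) (cvar ℝ c i) := by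
    funext i
    simp only [cvar, Pi.add_apply, Pi.smul_apply, smul_eq_mul, map_mul, AlgHom.commutes]
    rw [← add_mul]
    congr 1
    simp [φ]
  have h3 := congrArg (fun u => (co ℝ[X] 1 u).coeff ρ)
    (push_renB_mon (triv κ ℝ[X]) (cvar ℝ c) φ τ)
  rw [coeff_co, coeff_push, h1, push_triv, h2, ← renB_renB_mon _ _ hτ] at h3
  have h4 : renB (triv κ ℝ[X][X]) (fun i => CAlgHom (R := ℝ) (cvar ℝ c i)) (mon ℝ[X][X] τ)
      = push (CAlgHom (R := ℝ)) (renPoly κ c τ) := by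
    rw [renPoly, push_renB_mon, push_triv]
  have h5 : renPoly κ c τ ∈ supp ℝ[X] setW := renB_mem_W _ _ hτ
  rw [h4, co_one_renB_push c h5] at h3
  exact h3

/-- The generator is the linear coefficient of M_{tc}, which preserves W; this replaces a direct
check for contractions deep inside a symbol. The number κ only serves to name a trivial character.
-/
theorem genB_mem_W (κ : ℝ) (c : Fin 5 → ℝ) {u : Amb} (hu : u ∈ supp ℝ setW) :
    genB ℝ c u ∈ supp ℝ setW := by
  refine map_mem_of_supp _ _ (fun τ hτ => ?_) hu
  rw [genB_mon, ← co_one_renB (κ := κ) c (mem_setW.1 hτ)]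
  exact co_mem 1 (renB_mem_W _ _ (mem_setW.1 hτ))

theorem co_genB (n : ℕ) (c : Fin 5 → ℝ) (u : AmbB ℝ[X]) :
    co ℝ n (genB ℝ[X] c u) = genB ℝ c (co ℝ n u) := by
  have h : ∀ (p : ℝ[X]) (v : Amb), co ℝ n (p • push (Algebra.ofId ℝ ℝ[X]) v)
      = p.coeff n • push (Algebra.ofId ℝ ℝ) v := by
    intro p v
    apply MonoidAlgebra.coeff_injective
    ext ρ
    rw [coeff_co]
    change (p * C (v.coeff ρ)).coeff n = p.coeff n * v.coeff ρ
    rw [coeff_mul_C]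
  induction u using MonoidAlgebra.induction_linear with
  | zero => simp
  | add x y hx hy => simp only [map_add, hx, hy]
  | single ρ p =>
    rw [co_single, ← smul_mon, ← smul_mon, (genB ℝ[X] c).map_smul, (genB ℝ c).map_smul, genB_mon,
      genB_mon, h]

/-- Comparison of the coefficients of t^n in the differential equation. Together with M_0 = id it
shows that the Taylor coefficients of M_{tc} are the powers of the generator divided by factorials.
-/
theorem genB_co (n : ℕ) (c : Fin 5 → ℝ) {τ : Sym} (hτ : τ.InW) :
    genB ℝ c (co ℝ n (renPoly κ c τ)) = ((n : ℝ) + 1) • co ℝ (n + 1) (renPoly κ c τ) := by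
  rw [← co_genB]
  apply MonoidAlgebra.coeff_injective
  ext ρ
  rw [coeff_co, ← derivative_coeff_renPoly c hτ, coeff_derivative]
  change _ = ((n : ℝ) + 1) * ((renPoly κ c τ).coeff ρ).coeff (n + 1)
  rw [mul_comm]

/-- The generator of the renormalisation map on the model space. -/
theorem incl_contract (c : Fin 5 → ℝ) (t : T) :
    incl ((-∑ i, c i • contract i : Module.End ℝ T) t) = genB ℝ c (incl t) := by
  have h1 : (-∑ i, c i • contract i : Module.End ℝ T) = proj ∘ₗ genB ℝ c ∘ₗ incl := by
    refine T_hom_ext fun w => ?_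
    rw [LinearMap.comp_apply, LinearMap.comp_apply, incl_sym, genB_mon]
    have h2 : push (Algebra.ofId ℝ ℝ) (contrA c w.1) = contrA c w.1 := by
      apply MonoidAlgebra.coeff_injective
      ext ρ; rfl
    have h3 : ∀ i, contract i (sym w) = proj (contractA i w.1) := fun i => by
      simp [contract, sym]
    rw [h2, contrA, map_neg, map_sum, LinearMap.neg_apply, LinearMap.sum_apply]
    simp only [map_smul, LinearMap.smul_apply, h3]
  rw [h1]
  exact incl_proj (genB_mem_W 0 c (incl_mem t))

theorem incl_pow (κ : ℝ) (c : Fin 5 → ℝ) (w : W) (n : ℕ) :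
    incl (((-∑ i, c i • contract i : Module.End ℝ T) ^ n) (sym w))
      = (n.factorial : ℝ) • co ℝ n (renPoly κ c w.1) := by
  induction n with
  | zero =>
    rw [pow_zero, Module.End.one_apply, incl_sym, renPoly, co_zero_renB c w.2]; simp
  | succ n ih =>
    rw [pow_succ', Module.End.mul_apply, incl_contract, ih, map_smul, genB_co n c w.2, smul_smul,
      Nat.factorial_succ]
    push_cast
    rw [mul_comm]

/-- The exponential of the contractions is the renormalisation map based at the trivial
character. -/
theorem renormMap_eq (κ : ℝ) (c : Fin 5 → ℝ) : renormMap c = renT (triv κ ℝ) c := by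
  refine T_hom_ext fun w => incl_injective ?_
  set A : Module.End ℝ T := -∑ i, c i • contract i with hA
  have h1 : ∀ n ∉ Finset.range (w.1.numXi + 1), ((n.factorial : ℝ)⁻¹ • (A ^ n) (sym w)) = 0 := by
    intro n hn
    rw [sum_contract_pow c w n (by simpa using hn), smul_zero]
  have h2 : ∀ n, incl ((n.factorial : ℝ)⁻¹ • (A ^ n) (sym w)) = co ℝ n (renPoly κ c w.1) := by
    intro n
    rw [map_smul, incl_pow κ, smul_smul, inv_mul_cancel₀ (by positivity), one_smul]
  have h3 : renormMap c (sym w) = ∑ n ∈ Finset.range (w.1.numXi + 1),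
      ((n.factorial : ℝ)⁻¹ • (A ^ n) (sym w)) := by
    have : renormMap c (sym w) = ∑ᶠ n : ℕ, ((n.factorial : ℝ)⁻¹ • (A ^ n) (sym w)) := by
      simp [renormMap, expT, sym, hA]
    rw [this]
    refine finsum_eq_sum_of_support_subset _ fun n hn => ?_
    by_contra h
    exact hn (h1 n h)
  have h4 : renB (triv κ ℝ) c (mon ℝ w.1) = push (aeval (1 : ℝ)) (renPoly κ c w.1) := by
    rw [renPoly, push_renB_mon, push_triv]
    refine congrArg (fun b => renB (triv κ ℝ) b (mon ℝ w.1)) (funext fun i => ?_)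
    simp [cvar]
  rw [h3, map_sum, incl_renT, incl_sym, h4]
  simp only [h2]
  apply MonoidAlgebra.coeff_injective
  ext ρ
  rw [coeff_push, MonoidAlgebra.coeff_sum, Finsupp.finsetSum_apply]
  -- Nilpotency of the contractions bounds the degree in t, so evaluation at t = 1 sums the same
  -- finite set of coefficients as the exponential.
  have h5 : ((renPoly κ c w.1).coeff ρ).natDegree < w.1.numXi + 1 := by
    refine Nat.lt_succ_of_le (natDegree_le_iff_coeff_eq_zero.2 fun n hn => ?_)
    rw [← coeff_co, ← h2, h1 n (by simpa using hn), map_zero]; rfl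
  rw [coe_aeval_eq_eval, eval_eq_sum_range' h5]
  simp only [one_pow, mul_one, coeff_co]

end Exponential

end Phi43

end

noncomputable section

namespace Phi43

open MeasureTheory

/-! ## Polynomials and kernels -/

/-- `F` is orthogonal to all monomials of degree at most `N`. -/
def Kills (F : Pt → ℝ) (N : ℕ) : Prop := ∀ k : Idx, sdeg k ≤ N → ∫ y, F y * ipow y k = 0

theorem continuous_ipow (k : Idx) : Continuous fun x => ipow x k := by
  unfold ipow; fun_prop

theorem differentiableAt_ipow (k : Idx) (x : Pt) : DifferentiableAt ℝ (fun x => ipow x k) x := by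
  unfold ipow; fun_prop

/-- The truncated subtraction in the exponent is harmless: where k i = 0 the prefactor vanishes. -/
theorem pd_ipow (i : Fin 4) (k : Idx) (x : Pt) :
    pd i (fun x => ipow x k) x = k i * ipow x (k - Finsupp.single i 1) := by
  have h : HasFDerivAt (fun x : Pt => ∏ j, x j ^ k j)
      (∑ j, (∏ l ∈ Finset.univ.erase j, x l ^ k l) •
        ((k j * x j ^ (k j - 1)) • (ContinuousLinearMap.proj j : Pt →L[ℝ] ℝ))) x := by
    refine HasFDerivAt.finsetProd fun j _ => ?_
    have := (hasDerivAt_pow (k j) (x j)).comp_hasFDerivAt x (hasFDerivAt_apply (𝕜 := ℝ) j x)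
    exact this
  have h2 : pd i (fun x => ipow x k) x
      = (∏ l ∈ Finset.univ.erase i, x l ^ k l) * (k i * x i ^ (k i - 1)) := by
    change fderiv ℝ (fun x : Pt => ∏ j, x j ^ k j) x (Pi.single i 1) = _
    rw [h.fderiv]
    simp only [_root_.sum_apply, _root_.smul_apply,
      ContinuousLinearMap.proj_apply, smul_eq_mul]
    rw [Finset.sum_eq_single i]
    · simp
    · intro j _ hj
      simp [Pi.single_eq_of_ne hj]
    · simp
  rw [h2, ipow, ← Finset.mul_prod_erase Finset.univ _ (Finset.mem_univ i)]
  have : ∏ l ∈ Finset.univ.erase i, x l ^ (k - Finsupp.single i 1 : Idx) l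
      = ∏ l ∈ Finset.univ.erase i, x l ^ k l := by
    refine Finset.prod_congr rfl fun l hl => ?_
    rw [Finsupp.tsub_apply, Finsupp.single_eq_of_ne (Finset.ne_of_mem_erase hl), tsub_zero]
  rw [this]
  simp only [Finsupp.tsub_apply, Finsupp.single_eq_same]
  ring

theorem sdeg_mono {k l : Idx} (h : k ≤ l) : sdeg k ≤ sdeg l := by
  have h0 := h 0; have h1 := h 1; have h2 := h 2; have h3 := h 3
  unfold sdeg; omega

/-- Integration by parts moves the derivative onto x^k, which becomes a multiple of a monomial of no
larger degree. -/
theorem Kills.pd {F : Pt → ℝ} {N : ℕ} (h : Kills F N) (hF : ContDiff ℝ ∞ F)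
    (hc : HasCompactSupport F) (i : Fin 4) : Kills (pd i F) N := by
  intro k hk
  have hd : ∀ x, DifferentiableAt ℝ F x := fun x => (hF.differentiable (by simp)) x
  have hpd := contDiff_pd i hF
  have h1 := integral_mul_fderiv_eq_neg_fderiv_mul_of_integrable (μ := volume)
    (f := fun x => ipow x k) (g := F) (v := Pi.single i 1)
    (by
      have : (fun x => Phi43.pd i (fun x => ipow x k) x * F x)
          = fun x => k i * ipow x (k - Finsupp.single i 1) * F x := by
        funext x; rw [pd_ipow]
      change Integrable (fun x => Phi43.pd i (fun x => ipow x k) x * F x) volume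
      rw [this]
      exact ((continuous_const.mul (continuous_ipow _)).mul hF.continuous).integrable_of_hasCompactSupport
        hc.mul_left)
    (((continuous_ipow k).mul hpd.continuous).integrable_of_hasCompactSupport
      (hasCompactSupport_pd i hc).mul_left)
    (((continuous_ipow k).mul hF.continuous).integrable_of_hasCompactSupport hc.mul_left)
    (fun x _ => differentiableAt_ipow k x) (fun x _ => hd x)
  have h2 : ∫ x, Phi43.pd i (fun x => ipow x k) x * F x = 0 := by
    have h3 := h (k - Finsupp.single i 1) ((sdeg_mono tsub_le_self).trans hk)
    calc ∫ x, Phi43.pd i (fun x => ipow x k) x * F x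
        = ∫ x, (k i : ℝ) * (F x * ipow x (k - Finsupp.single i 1)) := by
          refine integral_congr_ae (Filter.Eventually.of_forall fun x => ?_)
          simp only [pd_ipow]; ring
      _ = 0 := by rw [integral_const_mul, h3, mul_zero]
  calc ∫ y, Phi43.pd i F y * ipow y k = ∫ y, ipow y k * Phi43.pd i F y := by
        simp only [mul_comm]
    _ = -∫ x, Phi43.pd i (fun x => ipow x k) x * F x := h1
    _ = 0 := by rw [h2, neg_zero]

theorem Kills.pd_iter {F : Pt → ℝ} {N : ℕ} (h : Kills F N) (hF : ContDiff ℝ ∞ F)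
    (hc : HasCompactSupport F) (i : Fin 4) (n : ℕ) : Kills ((Phi43.pd i)^[n] F) N := by
  induction n with
  | zero => exact h
  | succ n ih =>
    rw [Function.iterate_succ_apply']
    exact ih.pd (contDiff_pd_iter i n hF) (hasCompactSupport_pd_iter i n hc) i

theorem Kills.pdk {F : Pt → ℝ} {N : ℕ} (h : Kills F N) (hF : ContDiff ℝ ∞ F)
    (hc : HasCompactSupport F) (k : Idx) : Kills (pdk k F) N := by
  have s3 := contDiff_pd_iter 3 (k 3) hF
  have s2 := contDiff_pd_iter 2 (k 2) s3
  have s1 := contDiff_pd_iter 1 (k 1) s2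
  have c3 := hasCompactSupport_pd_iter 3 (k 3) hc
  have c2 := hasCompactSupport_pd_iter 2 (k 2) c3
  have c1 := hasCompactSupport_pd_iter 1 (k 1) c2
  exact (((h.pd_iter hF hc 3 _).pd_iter s3 c3 2 _).pd_iter s2 c2 1 _).pd_iter s1 c1 0 _

theorem ipow_neg (z : Pt) (k : Idx) : ipow (-z) k = (∏ i, (-1 : ℝ) ^ k i) * ipow z k := by
  rw [ipow, ipow, ← Finset.prod_mul_distrib]
  refine Finset.prod_congr rfl fun i _ => ?_
  rw [Pi.neg_apply, neg_pow]

/-- After the substitution z = x - y the monomial is ± z^k, and the derivatives of K_n inherit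
orthogonality to monomials from K_n. -/
theorem testD_poly {K : Kernel} {N : ℕ} (hK : K.Annihilates N) {Pi : Pt → T →ₗ[ℝ] Dist}
    (hP : AdmissiblePoly Pi) (x : Pt) {k : Idx} (hk : sdeg k ≤ N) (n : ℕ) (l : Idx) :
    Pi x (mono k) (K.testD n l x) = 0 := by
  have h1 : Kills (Phi43.pdk l (K.part n)) N :=
    Kills.pdk (fun k hk => hK n k hk) (K.smooth n) (K.hasCompactSupport n) l
  rw [hP]
  change ∫ y, ipow (y - x) k * Phi43.pdk l (K.part n) (x - y) = 0
  have h2 := integral_sub_left_eq_self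
    (fun z => ipow (-z) k * Phi43.pdk l (K.part n) z) volume x
  simp only [neg_sub] at h2
  rw [h2]
  simp only [ipow_neg]
  calc ∫ z, (∏ i, (-1 : ℝ) ^ k i) * ipow z k * Phi43.pdk l (K.part n) z
      = ∫ z, (∏ i, (-1 : ℝ) ^ k i) * (Phi43.pdk l (K.part n) z * ipow z k) := by
        congr 1; funext z; ring
    _ = 0 := by rw [integral_const_mul, h1 k hk, mul_zero]

/-! ## Continuous representatives -/

theorem IsContRep.unique {η : Dist} {g h : Pt → ℝ} (hg : IsContRep η g) (hh : IsContRep η h) :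
    g = h := by
  have hc : Continuous fun y => g y - h y := hg.1.sub hh.1
  have h0 : ∀ᵐ y ∂(volume : Measure Pt), g y - h y = 0 := by
    refine ae_eq_zero_of_integral_contDiff_smul_eq_zero hc.locallyIntegrable fun φ hφ hφc => ?_
    let ψ : TestFn := ⟨φ, hφ, hφc, fun _ _ => trivial⟩
    have e1 := hg.2 ψ
    have e2 := hh.2 ψ
    have i1 : Integrable (fun y => g y * φ y) volume :=
      (hg.1.mul hφ.continuous).integrable_of_hasCompactSupport hφc.mul_left
    have i2 : Integrable (fun y => h y * φ y) volume :=
      (hh.1.mul hφ.continuous).integrable_of_hasCompactSupport hφc.mul_left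
    calc ∫ y, φ y • (g y - h y) = ∫ y, (g y * φ y - h y * φ y) := by
          congr 1; funext y; rw [smul_eq_mul]; ring
      _ = (∫ y, g y * φ y) - ∫ y, h y * φ y := integral_sub i1 i2
      _ = 0 := by
        change η ψ = ∫ y, g y * φ y at e1
        change η ψ = ∫ y, h y * φ y at e2
        rw [← e1, ← e2, sub_self]
  have h1 := (Continuous.ae_eq_iff_eq (μ := (volume : Measure Pt)) hc
    (continuous_const (y := (0 : ℝ)))).1 h0
  funext y
  exact sub_eq_zero.1 (congrFun h1 y)

theorem isContRep_zero : IsContRep 0 0 := ⟨continuous_const, fun φ => by simp⟩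

theorem IsContRep.add {η θ : Dist} {g h : Pt → ℝ} (hg : IsContRep η g) (hh : IsContRep θ h) :
    IsContRep (η + θ) (g + h) := by
  refine ⟨hg.1.add hh.1, fun φ => ?_⟩
  have i1 : Integrable (fun y => g y * φ y) volume :=
    (hg.1.mul φ.continuous).integrable_of_hasCompactSupport φ.hasCompactSupport.mul_left
  have i2 : Integrable (fun y => h y * φ y) volume :=
    (hh.1.mul φ.continuous).integrable_of_hasCompactSupport φ.hasCompactSupport.mul_left
  change η φ + θ φ = _
  rw [hg.2, hh.2, ← integral_add i1 i2]
  congr 1; funext y; rw [Pi.add_apply]; ring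

theorem IsContRep.smul {η : Dist} {g : Pt → ℝ} (hg : IsContRep η g) (a : ℝ) :
    IsContRep (a • η) (a • g) := by
  refine ⟨continuous_const.mul hg.1, fun φ => ?_⟩
  change a * η φ = _
  rw [hg.2, ← integral_const_mul]
  congr 1; funext y; rw [Pi.smul_apply, smul_eq_mul]; ring

theorem IsContRep.sum {ι : Type*} (s : Finset ι) {η : ι → Dist} {g : ι → Pt → ℝ}
    (h : ∀ i ∈ s, IsContRep (η i) (g i)) : IsContRep (∑ i ∈ s, η i) (∑ i ∈ s, g i) := by
  classical
  induction s using Finset.induction_on with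
  | empty => simpa using isContRep_zero
  | insert i s hi ih =>
    rw [Finset.sum_insert hi, Finset.sum_insert hi]
    exact (h i (Finset.mem_insert_self i s)).add
      (ih fun j hj => h j (Finset.mem_insert_of_mem hj))

theorem isContRep_mono {Pi : Pt → T →ₗ[ℝ] Dist} (hP : AdmissiblePoly Pi) (x : Pt) (k : Idx) :
    IsContRep (Pi x (mono k)) fun y => ipow (y - x) k :=
  ⟨(continuous_ipow k).comp (continuous_id.sub continuous_const), hP x k⟩

/-! ## Polynomials as functions -/

/-- Evaluation of a polynomial in the `X_i` at a point. -/
def evalP (z : Pt) : Amb →ₐ[ℝ] ℝ := evAlg ℝ z 0 fun _ => 0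

theorem evalP_Xpow (z : Pt) (k : Idx) : evalP z (mon ℝ (Sym.Xpow k)) = ipow z k := by
  rw [evalP, evAlg_mon]
  simp [Sym.Xpow, ipow]

/-- The polynomial underlying a linear combination of monomials. -/
def toMv : Amb →ₐ[ℝ] MvPolynomial (Fin 4) ℝ := evAlg ℝ MvPolynomial.X 0 fun _ => 0

theorem toMv_Xpow (k : Idx) : toMv (mon ℝ (Sym.Xpow k)) = MvPolynomial.monomial k 1 := by
  rw [toMv, evAlg_mon, MvPolynomial.monomial_eq]
  simp [Sym.Xpow, Finsupp.prod_fintype]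

theorem eval_toMv (z : Pt) {u : Amb} (hu : u ∈ supp ℝ polySet) :
    MvPolynomial.eval z (toMv u) = evalP z u := by
  have h := linMap_congr ((MvPolynomial.aeval z).comp toMv).toLinearMap (evalP z).toLinearMap
    (S := polySet) (by
      rintro _ ⟨k, rfl⟩
      change MvPolynomial.aeval z (toMv (mon ℝ (Sym.Xpow k))) = evalP z (mon ℝ (Sym.Xpow k))
      rw [toMv_Xpow, evalP_Xpow, MvPolynomial.aeval_monomial, map_one, one_mul,
        Finsupp.prod_fintype _ _ fun _ => pow_zero _, ipow]) hu
  exact h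

theorem coeff_toMv (k : Idx) {u : Amb} (hu : u ∈ supp ℝ polySet) :
    (toMv u).coeff k = u.coeff (Sym.Xpow k) := by
  have h := linMap_congr (MvPolynomial.lcoeff ℝ k ∘ₗ toMv.toLinearMap)
    (Finsupp.lapply (Sym.Xpow k) ∘ₗ (MonoidAlgebra.coeffLinearEquiv ℝ).toLinearMap)
    (S := polySet) (by
      classical
      rintro _ ⟨l, rfl⟩
      change (toMv (mon ℝ (Sym.Xpow l))).coeff k = (mon ℝ (Sym.Xpow l)).coeff (Sym.Xpow k)
      rw [toMv_Xpow, MvPolynomial.coeff_monomial, MonoidAlgebra.coeff_single, Finsupp.single_apply]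
      have : Sym.Xpow l = Sym.Xpow k ↔ l = k := ⟨fun h => by
        simpa [Sym.Xpow] using congrArg Sym.exp h, fun h => by rw [h]⟩
      simp only [this]) hu
  exact h

theorem eq_zero_of_evalP {u : Amb} (hu : u ∈ supp ℝ polySet) (h : ∀ z, evalP z u = 0) : u = 0 := by
  have h1 : toMv u = 0 := MvPolynomial.funext fun z => by rw [eval_toMv z hu, h, map_zero]
  refine MonoidAlgebra.ext (Finsupp.ext fun τ => ?_)
  by_cases hτ : τ.IsPoly
  · obtain ⟨k, rfl⟩ := hτ
    rw [← coeff_toMv k hu, h1]; simp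
  · by_contra h2
    exact hτ (hu (Finsupp.mem_support_iff.2 h2))

theorem evalP_trans (z : Pt) (a : Fin 4 → ℝ) {u : Amb} (hu : u ∈ supp ℝ polySet) :
    evalP z (trans a u) = evalP (z + a) u :=
  algHom_poly_congr ((evalP z).comp (trans a)) (evalP (z + a)) (fun i => by
    rw [AlgHom.comp_apply, trans_X, map_add, AlgHom.commutes, evalP, evalP, evAlg_X, evAlg_X]
    rfl) hu

theorem polySet_subset_W : polySet ⊆ setW := by
  rintro _ ⟨k, rfl⟩; exact Sym.InW.Xpow k

theorem isContRep_poly {Pi : Pt → T →ₗ[ℝ] Dist} (hP : AdmissiblePoly Pi) (x : Pt) {u : Amb}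
    (hu : u ∈ supp ℝ polySet) : IsContRep (Pi x (proj u)) fun y => evalP (y - x) u := by
  rw [supp_eq_span] at hu
  induction hu using Submodule.span_induction with
  | mem u hu =>
    obtain ⟨_, ⟨k, rfl⟩, rfl⟩ := hu
    have := isContRep_mono hP x k
    simp only [evalP_Xpow]
    rwa [proj_mon (Sym.InW.Xpow k)]
  | zero => simp only [map_zero]; exact isContRep_zero
  | add u v _ _ h1 h2 =>
    have := h1.add h2
    simp only [map_add]
    exact this
  | smul a u _ h =>
    have := h.smul a
    simp only [map_smul]
    exact this

/-- A polynomial is determined by the distribution it represents. Identities between jets can thus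
be read off from identities between distributions. -/
theorem eq_zero_of_Pi {Pi : Pt → T →ₗ[ℝ] Dist} (hP : AdmissiblePoly Pi) (x : Pt) {u : Amb}
    (hu : u ∈ supp ℝ polySet) (h : Pi x (proj u) = 0) : u = 0 := by
  have h1 := isContRep_poly hP x hu
  rw [h] at h1
  have h2 := h1.unique isContRep_zero
  refine eq_zero_of_evalP hu fun z => ?_
  have := congrFun h2 (z + x)
  simpa using this

end Phi43

end

noncomputable section

namespace Phi43

/-! ## The functional `f_x` -/

theorem add_pow_div (a b : ℝ) (n : ℕ) : (a + b) ^ n / n.factorial =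
    ∑ p ∈ Finset.HasAntidiagonal.antidiagonal n, a ^ p.1 / p.1.factorial * (b ^ p.2 / p.2.factorial) := by
  rw [(Commute.all a b).add_pow', Finset.sum_div]
  refine Finset.sum_congr rfl fun p hp => ?_
  rw [← Finset.HasAntidiagonal.mem_antidiagonal.1 hp]
  have h := Nat.add_choose_mul_factorial_mul_factorial p.1 p.2
  have h' : ((p.1 + p.2).choose p.1 : ℝ) * p.1.factorial * p.2.factorial
      = (p.1 + p.2).factorial := by rw [Nat.choose_symm_add]; exact_mod_cast h
  have h1 : (p.1.factorial : ℝ) ≠ 0 := by exact_mod_cast p.1.factorial_ne_zero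
  have h2 : (p.2.factorial : ℝ) ≠ 0 := by exact_mod_cast p.2.factorial_ne_zero
  have h3 : ((p.1 + p.2).factorial : ℝ) ≠ 0 := by exact_mod_cast (p.1 + p.2).factorial_ne_zero
  rw [nsmul_eq_mul]
  field_simp
  rw [← h']
  ring

theorem ipow_add_div (x y : Pt) (m : Idx) : ipow (x + y) m / ifac m =
    ∑ p ∈ Finset.HasAntidiagonal.antidiagonal m, ipow x p.1 / ifac p.1 * (ipow y p.2 / ifac p.2) := by
  have h : ∀ (z : Pt) (k : Idx), ipow z k / ifac k = ∏ i, (z i ^ k i / (k i).factorial) := by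
    intro z k
    rw [ipow, ifac, Finset.prod_div_distrib, Nat.cast_prod]
  simp only [h, ← Finset.prod_mul_distrib, Pi.add_apply, add_pow_div]
  rw [Finset.prod_univ_sum]
  refine Finset.sum_bij'
    (fun p _ => (Finsupp.equivFunOnFinite.symm fun i => (p i).1,
      Finsupp.equivFunOnFinite.symm fun i => (p i).2))
    (fun p _ i => (p.1 i, p.2 i)) ?_ ?_ ?_ ?_ ?_
  · intro p hp
    rw [Finset.HasAntidiagonal.mem_antidiagonal]
    ext i
    exact Finset.HasAntidiagonal.mem_antidiagonal.1 (Fintype.mem_piFinset.1 hp i)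
  · intro p hp
    rw [Fintype.mem_piFinset]
    intro i
    rw [Finset.HasAntidiagonal.mem_antidiagonal, ← Finset.HasAntidiagonal.mem_antidiagonal.1 hp]
    rfl
  · intro p _; rfl
  · intro p _
    refine Prod.ext ?_ ?_ <;> ext i <;> rfl
  · intro p _; rfl

variable {κ : ℝ} (K : Kernel) (Pi : Pt → T →ₗ[ℝ] Dist) (x : Pt)

theorem charX_fchar : charX (fchar κ K Pi x) = -x := by
  funext i
  rw [charX, fchar, MvPolynomial.aeval_X]; rfl

theorem fchar_JJ (w : W) (hw : ¬ w.1.IsPoly) {l : Idx} (hl : (sdeg l : ℝ) < deg κ w.1 + 2) :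
    fchar κ K Pi x (JJ κ l w.1) = -∑ k ∈ idxBelow (deg κ w.1 + 2 - sdeg l),
        ipow (-x) k / ifac k * K.jet (Pi x (sym w)) (l + k) x := by
  have h : w.1.InW ∧ ¬ w.1.IsPoly ∧ (sdeg l : ℝ) < deg κ w.1 + 2 := ⟨w.2, hw, hl⟩
  rw [JJ, dif_pos h, fchar, MvPolynomial.aeval_X]

theorem evalP_Jmap (z : Pt) (w : W) : evalP z (incl (Jmap κ K Pi x w)) =
    ∑ k ∈ idxBelow (deg κ w.1 + 2), K.jet (Pi x (sym w)) k x * (ipow z k / ifac k) := by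
  rw [Jmap, map_sum, map_sum]
  refine Finset.sum_congr rfl fun k _ => ?_
  rw [incl.map_smul, map_smul, mono, incl_sym, evalP_Xpow, smul_eq_mul]
  ring

theorem incl_Jmap_mem (w : W) : incl (Jmap κ K Pi x w) ∈ supp ℝ polySet := by
  rw [Jmap, map_sum]
  refine Submodule.sum_mem _ fun k _ => ?_
  rw [incl.map_smul, mono, incl_sym]
  exact Submodule.smul_mem _ _ (mon_mem_supp ⟨k, rfl⟩)

/-- By the binomial formula, collecting the terms of the definition of f_x with l + k = m recentres
the Taylor polynomial 𝒥(x)σ from x to the origin. Hence f_x and 𝒥(x) carry the same information up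
to a translation and a sign. -/
theorem evalP_jetI_fchar (z : Pt) (w : W) (hw : ¬ w.1.IsPoly) :
    evalP z (jetI (fchar κ K Pi x) (mon ℝ w.1)) = -evalP (z - x) (incl (Jmap κ K Pi x w)) := by
  rw [jetI_mon, map_sum, evalP_Jmap]
  have h1 : ∀ l ∈ idxBelow (deg κ w.1 + 2), evalP z (MonoidAlgebra.single (Sym.Xpow l)
      ((ifac l : ℝ)⁻¹ • fchar κ K Pi x (JJ κ l w.1)))
      = ∑ k ∈ idxBelow (deg κ w.1 + 2 - sdeg l), -(ipow z l / ifac l * (ipow (-x) k / ifac k)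
          * K.jet (Pi x (sym w)) (l + k) x) := by
    intro l hl
    rw [← smul_mon, map_smul, evalP_Xpow, fchar_JJ K Pi x w hw (mem_idxBelow.1 hl), smul_eq_mul,
      smul_eq_mul, Finset.sum_neg_distrib, mul_neg, neg_mul, Finset.mul_sum, Finset.sum_mul]
    congr 1
    refine Finset.sum_congr rfl fun k _ => ?_
    ring
  rw [Finset.sum_congr rfl h1, ← Finset.sum_neg_distrib]
  have h2 : ∀ m ∈ idxBelow (deg κ w.1 + 2),
      -(K.jet (Pi x (sym w)) m x * (ipow (z - x) m / ifac m))
      = ∑ p ∈ Finset.HasAntidiagonal.antidiagonal m, -(ipow z p.1 / ifac p.1 * (ipow (-x) p.2 / ifac p.2)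
          * K.jet (Pi x (sym w)) (p.1 + p.2) x) := by
    intro m _
    rw [sub_eq_add_neg, ipow_add_div, Finset.mul_sum, ← Finset.sum_neg_distrib]
    refine Finset.sum_congr rfl fun p hp => ?_
    rw [Finset.HasAntidiagonal.mem_antidiagonal.1 hp]
    ring
  rw [Finset.sum_congr rfl h2, Finset.sum_sigma', Finset.sum_sigma']
  refine Finset.sum_bij' (fun p _ => ⟨p.1 + p.2, (p.1, p.2)⟩) (fun p _ => ⟨p.2.1, p.2.2⟩)
    ?_ ?_ ?_ ?_ ?_
  · rintro ⟨l, k⟩ hp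
    simp only [Finset.mem_sigma, mem_idxBelow] at hp
    simp only [Finset.mem_sigma, mem_idxBelow, Finset.HasAntidiagonal.mem_antidiagonal, and_true]
    rw [sdeg_add]; push_cast; linarith [hp.2]
  · rintro ⟨m, ⟨l, k⟩⟩ hp
    simp only [Finset.mem_sigma, mem_idxBelow, Finset.HasAntidiagonal.mem_antidiagonal] at hp
    simp only [Finset.mem_sigma, mem_idxBelow]
    have : (sdeg m : ℝ) = sdeg l + sdeg k := by rw [← hp.2, sdeg_add]; push_cast; rfl
    have h0 : (0 : ℝ) ≤ sdeg k := Nat.cast_nonneg _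
    constructor <;> linarith [hp.1]
  · intro p _; rfl
  · rintro ⟨m, ⟨l, k⟩⟩ hp
    simp only [Finset.mem_sigma, Finset.HasAntidiagonal.mem_antidiagonal] at hp
    obtain rfl := hp.2
    rfl
  · intro p _; rfl

/-- `𝒥(x)`, as an operation on the ambient algebra. -/
def jx (f : Tp κ →ₐ[ℝ] ℝ) : Amb →ₗ[ℝ] Amb := -((trans (-charX f)).toLinearMap ∘ₗ jetI f)

theorem jx_apply (f : Tp κ →ₐ[ℝ] ℝ) (u : Amb) : jx f u = -trans (-charX f) (jetI f u) := rfl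

theorem jx_mem (f : Tp κ →ₐ[ℝ] ℝ) (u : Amb) : jx f u ∈ supp ℝ polySet :=
  neg_mem (trans_mem_poly _ (jetI_mem_poly f u))

theorem corr_eq_jx (f : Tp κ →ₐ[ℝ] ℝ) (σ : Sym) (u : Amb) :
    corr f σ u = trGt ℝ (deg κ σ + 2) (jx f u) := by
  rw [corr_apply, jx_apply, map_neg]

theorem incl_Jmap (w : W) (hw : ¬ w.1.IsPoly) :
    incl (Jmap κ K Pi x w) = jx (fchar κ K Pi x) (mon ℝ w.1) := by
  refine sub_eq_zero.1 (eq_zero_of_evalP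
    (sub_mem (incl_Jmap_mem K Pi x w) (jx_mem _ _)) fun z => ?_)
  rw [map_sub, jx_apply, map_neg, evalP_trans _ _ (jetI_mem_poly _ _), evalP_jetI_fchar _ _ _ _ _ hw,
    charX_fchar, neg_neg, neg_neg, add_sub_cancel_right, sub_self]

variable {K Pi}

/-- Characters of T⁺ have no generators for the X^k, in line with I(X^k) = 0, whereas 𝒥(x)X^k
involves integrals of derivatives of K against monomials. The moment condition on K reconciles the
two. -/
theorem Jmap_poly {N : ℕ} (hK : K.Annihilates N) (hP : AdmissiblePoly Pi) {w : W}
    (hw : w.1.IsPoly) (hN : w.1.wt ≤ N) : Jmap κ K Pi x w = 0 := by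
  obtain ⟨k, hk⟩ := hw
  have hw : sym w = mono k := congrArg sym (Subtype.ext hk)
  have hwt : sdeg k ≤ N := by
    have : w.1.wt = sdeg k := by rw [hk, Sym.wt_eq]; simp [Sym.Xpow]
    omega
  refine Finset.sum_eq_zero fun l _ => ?_
  rw [Kernel.jet, hw]
  simp [testD_poly hK hP x hwt]

theorem incl_Jmap' {N : ℕ} (hK : K.Annihilates N) (hP : AdmissiblePoly Pi) {w : W}
    (hN : w.1.wt ≤ N) : incl (Jmap κ K Pi x w) = jx (fchar κ K Pi x) (mon ℝ w.1) := by
  by_cases hw : w.1.IsPoly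
  · rw [Jmap_poly x hK hP hw hN, map_zero, jx_apply, jetI_poly _ (mon_mem_supp hw), map_zero,
      neg_zero]
  · exact incl_Jmap K Pi x w hw

/-- The linear extension of `𝒥(x)`. -/
def JT (κ : ℝ) (K : Kernel) (Pi : Pt → T →ₗ[ℝ] Dist) (x : Pt) : T →ₗ[ℝ] T :=
  Finsupp.lift T ℝ W (Jmap κ K Pi x)

theorem JT_sym (w : W) : JT κ K Pi x (sym w) = Jmap κ K Pi x w := by
  simp [JT, sym]

theorem T_congr {V : Type*} [AddCommGroup V] [Module ℝ V] (L L' : T →ₗ[ℝ] V) {t : T}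
    (h : ∀ w ∈ t.support, L (sym w) = L' (sym w)) : L t = L' t := by
  have : t = ∑ w ∈ t.support, t w • sym w := by
    conv_lhs => rw [← Finsupp.sum_single t]
    refine Finset.sum_congr rfl fun w _ => ?_
    rw [sym, Finsupp.smul_single, smul_eq_mul, mul_one]
  rw [this, map_sum, map_sum]
  exact Finset.sum_congr rfl fun w hw => by rw [L.map_smul, L'.map_smul, h w hw]

theorem mem_support_incl {t : T} {w : W} : w ∈ t.support ↔ w.1 ∈ (incl t).coeff.support := by
  have h : (incl t).coeff w.1 = t w := by
    have := LinearMap.congr_fun (T_hom_ext (L := Finsupp.lapply w.1 ∘ₗ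
      (MonoidAlgebra.coeffLinearEquiv ℝ).toLinearMap ∘ₗ incl) (L' := Finsupp.lapply w)
      fun v => by
        classical
        change (incl (sym v)).coeff w.1 = sym v w
        rw [incl_sym, MonoidAlgebra.coeff_single, sym, Finsupp.single_apply, Finsupp.single_apply]
        simp only [Subtype.ext_iff]) t
    exact this
  rw [Finsupp.mem_support_iff, Finsupp.mem_support_iff, h]

theorem of_incl_mem {t : T} {S : Set Sym} (h : incl t ∈ supp ℝ S) : ∀ w ∈ t.support, w.1 ∈ S :=
  fun _ hw => h (mem_support_incl.1 hw)

theorem incl_JT {N : ℕ} (hK : K.Annihilates N) (hP : AdmissiblePoly Pi) {t : T}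
    (ht : ∀ w ∈ t.support, w.1.wt ≤ N) :
    incl (JT κ K Pi x t) = jx (fchar κ K Pi x) (incl t) :=
  T_congr (incl ∘ₗ JT κ K Pi x) (jx (fchar κ K Pi x) ∘ₗ incl) fun w hw => by
    change incl (JT κ K Pi x (sym w)) = jx (fchar κ K Pi x) (incl (sym w))
    rw [JT_sym, incl_sym, incl_Jmap' x hK hP (ht w hw)]

theorem T_eq_sum (t : T) : t = ∑ w ∈ t.support, t w • sym w := by
  conv_lhs => rw [← Finsupp.sum_single t]
  refine Finset.sum_congr rfl fun w _ => ?_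
  rw [sym, Finsupp.smul_single, smul_eq_mul, mul_one]

theorem Pi_apply_eq (t : T) (φ : TestFn) :
    Pi x t φ = ∑ w ∈ t.support, t w * Pi x (sym w) φ := by
  let E : T →ₗ[ℝ] ℝ :=
    { toFun := fun t => Pi x t φ
      map_add' := fun s t => by rw [map_add]; rfl
      map_smul' := fun a t => by rw [(Pi x).map_smul]; rfl }
  change E t = ∑ w ∈ t.support, t w * E (sym w)
  conv_lhs => rw [T_eq_sum t, map_sum]
  exact Finset.sum_congr rfl fun w _ => E.map_smul _ _

theorem hasSum_jet (hA : ∀ w, AdmissibleInt κ K Pi w) {t : T} {k : Idx}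
    (hk : ∀ w ∈ t.support, (sdeg k : ℝ) < deg κ w.1 + 2) :
    HasSum (fun n => Pi x t (K.testD n k x))
      (∑ w ∈ t.support, t w * K.jet (Pi x (sym w)) k x) := by
  simp only [Pi_apply_eq x t]
  refine hasSum_sum fun w hw => HasSum.mul_left _ ?_
  exact ((hA w x).1 k (mem_idxBelow.2 (hk w hw))).hasSum

/-- The left side cuts all jets of t at the common level |v| + 2, while `JT` cuts each symbol w of t
at its own, higher level |w| + 2. The surplus is the part above |v| + 2, where equality is excluded
by nonresonance. The case of interest is t = M_f v. -/
theorem jets_truncate (hn : Nonres κ) (hA : ∀ w, AdmissibleInt κ K Pi w) (v : W)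
    (hv : ¬ v.1.IsPoly) {t : T} (ht : ∀ w ∈ t.support, deg κ v.1 ≤ deg κ w.1) :
    incl (∑ k ∈ idxBelow (deg κ v.1 + 2), (K.jet (Pi x t) k x / ifac k) • mono k)
      = incl (JT κ K Pi x t) - trGt ℝ (deg κ v.1 + 2) (incl (JT κ K Pi x t)) := by
  have h1 : ∀ k ∈ idxBelow (deg κ v.1 + 2), incl ((K.jet (Pi x t) k x / ifac k) • mono k)
      = ∑ w ∈ t.support, t w • (K.jet (Pi x (sym w)) k x / ifac k) • mon ℝ (Sym.Xpow k) := by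
    intro k hk
    have h2 : K.jet (Pi x t) k x = ∑ w ∈ t.support, t w * K.jet (Pi x (sym w)) k x :=
      (hasSum_jet x hA fun w hw => by
        have := mem_idxBelow.1 hk
        linarith [ht w hw]).tsum_eq
    rw [incl.map_smul, mono, incl_sym, h2, Finset.sum_div, Finset.sum_smul]
    refine Finset.sum_congr rfl fun w _ => ?_
    rw [smul_smul, mul_div_assoc]
  rw [map_sum, Finset.sum_congr rfl h1, Finset.sum_comm]
  let L : T →ₗ[ℝ] Amb := (LinearMap.id - trGt ℝ (deg κ v.1 + 2)) ∘ₗ incl ∘ₗ JT κ K Pi x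
  change _ = L t
  conv_rhs => rw [T_eq_sum t, map_sum]
  refine Finset.sum_congr rfl fun w hw => ?_
  rw [L.map_smul, ← Finset.smul_sum]
  congr 1
  change _ = incl (JT κ K Pi x (sym w)) - trGt ℝ (deg κ v.1 + 2) (incl (JT κ K Pi x (sym w)))
  rw [JT_sym, Jmap, map_sum, map_sum, ← Finset.sum_sub_distrib]
  have h3 : idxBelow (deg κ v.1 + 2) ⊆ idxBelow (deg κ w.1 + 2) := fun k hk => by
    have := mem_idxBelow.1 hk
    exact mem_idxBelow.2 (by linarith [ht w hw])
  have hx : ∀ k : Idx, sdeg (Sym.Xpow k).exp = sdeg k := fun k => by simp [Sym.Xpow]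
  rw [← Finset.sum_subset h3]
  · refine Finset.sum_congr rfl fun k hk => ?_
    rw [incl.map_smul, mono, incl_sym, map_smul, trGt_mon_of_le, smul_zero, sub_zero]
    rw [hx]; exact (mem_idxBelow.1 hk).le
  · intro k _ hk
    rw [incl.map_smul, mono, incl_sym, map_smul, trGt_mon_of_lt, sub_self]
    rw [hx]
    refine lt_of_le_of_ne (not_lt.1 fun h => hk (mem_idxBelow.2 h)) (hn v.1 v.2 hv _)

end Phi43

end

noncomputable section

namespace Phi43

/-! ## Inverting the elements of the structure group -/

/-- The elements of `T` all of whose symbols have weight less than `n`. -/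
def Twt (n : ℕ) : Submodule ℝ T := Finsupp.supported ℝ ℝ {w | w.1.wt < n}

theorem mem_Twt {n : ℕ} {t : T} : t ∈ Twt n ↔ ∀ w ∈ t.support, w.1.wt < n := Iff.rfl

theorem mem_Twt_of_incl {n : ℕ} {t : T} (h : incl t ∈ supp ℝ {σ : Sym | σ.wt < n}) : t ∈ Twt n :=
  mem_Twt.2 (of_incl_mem h)

theorem sym_mem_Twt {n : ℕ} {w : W} (h : w.1.wt < n) : sym w ∈ Twt n :=
  Finsupp.single_mem_supported ℝ 1 h

theorem map_mem_of_Twt {n : ℕ} {V : Submodule ℝ T} (L : T →ₗ[ℝ] T)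
    (h : ∀ w : W, w.1.wt < n → L (sym w) ∈ V) {t : T} (ht : t ∈ Twt n) : L t ∈ V := by
  rw [T_eq_sum t, map_sum]
  refine Submodule.sum_mem _ fun w hw => ?_
  rw [L.map_smul]
  exact V.smul_mem _ (h w (mem_Twt.1 ht w hw))

theorem exists_mem_Twt (t : T) : ∃ n, t ∈ Twt n :=
  ⟨(t.support.sup fun w => w.1.wt) + 1, mem_Twt.2 fun _ hw =>
    Nat.lt_succ_of_le (Finset.le_sup (f := fun w : W => w.1.wt) hw)⟩

theorem Twt_mono {m n : ℕ} (h : m ≤ n) : Twt m ≤ Twt n :=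
  Finsupp.supported_mono fun _ (hw : _ < m) => hw.trans_le h

variable {κ : ℝ}

theorem Gam_sub_mem (hκ : 0 < κ) (f : Tp κ →ₐ[ℝ] ℝ) {n : ℕ} {t : T} (ht : t ∈ Twt (n + 1)) :
    Gam f.toLinearMap t - t ∈ Twt n := by
  refine map_mem_of_Twt (Gam f.toLinearMap - LinearMap.id) (fun w hw => mem_Twt_of_incl ?_) ht
  change incl (Gam f.toLinearMap (sym w) - sym w) ∈ _
  rw [map_sub, incl_Gam, incl_sym]
  refine supp_mono (fun σ hσ => ?_) (GamB_lead_wt hκ f w.2)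
  simp only [Set.mem_ofPred_eq, neg_lt_neg_iff, Nat.cast_lt] at hσ ⊢
  omega

theorem Gam_mem_Twt (hκ : 0 < κ) (f : Tp κ →ₐ[ℝ] ℝ) {n : ℕ} {t : T} (ht : t ∈ Twt n) :
    Gam f.toLinearMap t ∈ Twt n := by
  have h := Gam_sub_mem hκ f (Twt_mono n.le_succ ht)
  have := add_mem h ht
  rwa [sub_add_cancel] at this

/-- As Γ_f - 1 lowers the weight, a preimage of t is t minus a preimage of Γ_f t - t, found one
level lower. That preimages can be kept within the same weight matters later, when characters are
known only up to a given weight. -/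
theorem Twt_le_map (hκ : 0 < κ) (f : Tp κ →ₐ[ℝ] ℝ) (n : ℕ) :
    Twt n ≤ (Twt n).map (Gam f.toLinearMap) := by
  induction n with
  | zero =>
    intro t ht
    have : t = 0 := by
      rw [T_eq_sum t]
      exact Finset.sum_eq_zero fun w hw => absurd (mem_Twt.1 ht w hw) (Nat.not_lt_zero _)
    rw [this]; exact zero_mem _
  | succ n ih =>
    intro t ht
    obtain ⟨s, hs, hs'⟩ := ih (Gam_sub_mem hκ f ht)
    refine ⟨t - s, sub_mem ht (Twt_mono n.le_succ hs), ?_⟩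
    rw [map_sub, hs', sub_sub_cancel]

theorem Gam_injective (hκ : 0 < κ) (f : Tp κ →ₐ[ℝ] ℝ) :
    Function.Injective (Gam f.toLinearMap) := by
  refine (injective_iff_map_eq_zero _).2 fun t ht => ?_
  have key : ∀ n, t ∈ Twt n → t = 0 := by
    intro n
    induction n with
    | zero =>
      intro h
      rw [T_eq_sum t]
      exact Finset.sum_eq_zero fun w hw => absurd (mem_Twt.1 h w hw) (Nat.not_lt_zero _)
    | succ n ih =>
      intro h
      have := Gam_sub_mem hκ f h
      rw [ht, zero_sub] at this
      exact ih (by simpa using this)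
  obtain ⟨n, hn⟩ := exists_mem_Twt t
  exact key n hn

/-- `Ring.inverse` is 0 at non-units, so 𝚷 is meaningful only once Γ_f is known to be bijective;
this follows from unipotency, as the spaces `Twt n` exhaust T. -/
theorem inverse_Gam (hκ : 0 < κ) (f : Tp κ →ₐ[ℝ] ℝ) (t : T) :
    (Ring.inverse (Gam f.toLinearMap : Module.End ℝ T) : Module.End ℝ T) (Gam f.toLinearMap t)
      = t := by
  have hu : IsUnit (Gam f.toLinearMap : Module.End ℝ T) := by
    rw [Module.End.isUnit_iff]
    refine ⟨Gam_injective hκ f, fun t => ?_⟩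
    obtain ⟨n, hn⟩ := exists_mem_Twt t
    obtain ⟨s, -, hs⟩ := Twt_le_map hκ f n hn
    exact ⟨s, hs⟩
  have := Ring.inverse_mul_cancel _ hu
  exact LinearMap.congr_fun this t

theorem bold_Gam (hκ : 0 < κ) (K : Kernel) (Pi : Pt → T →ₗ[ℝ] Dist) (x : Pt) (t : T) :
    bold κ K Pi x (Gam (fchar κ K Pi x).toLinearMap t) = Pi x t := by
  rw [bold, LinearMap.comp_apply]
  exact congrArg (Pi x) (inverse_Gam hκ _ t)

theorem AgreeTo.Gam {n : ℕ} {f g : Tp κ →ₐ[ℝ] ℝ} (h : AgreeTo n f g) {t : T}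
    (ht : t ∈ Twt (n + 1)) : Gam f.toLinearMap t = Gam g.toLinearMap t :=
  T_congr _ _ fun w hw => incl_injective (by
    rw [incl_Gam, incl_Gam, incl_sym]
    exact AgreeTo.GamB h (Nat.lt_succ_iff.1 (mem_Twt.1 ht w hw)))

theorem AgreeTo.renT (hκ : 0 < κ) {n : ℕ} {f g : Tp κ →ₐ[ℝ] ℝ} (h : AgreeTo n f g)
    (c : Fin 5 → ℝ) {t : T} (ht : t ∈ Twt (n + 1)) : renT f c t = renT g c t :=
  T_congr _ _ fun w hw => incl_injective (by
    rw [incl_renT, incl_renT, incl_sym]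
    exact AgreeTo.renB hκ h c w.2 (Nat.lt_succ_iff.1 (mem_Twt.1 ht w hw)))

theorem renT_mem_Twt (hκ : 0 < κ) (f : Tp κ →ₐ[ℝ] ℝ) (c : Fin 5 → ℝ) {n : ℕ} {t : T}
    (ht : t ∈ Twt n) : renT f c t ∈ Twt n := by
  refine map_mem_of_Twt (Phi43.renT f c) (fun w hw => mem_Twt_of_incl ?_) ht
  rw [incl_renT, incl_sym]
  refine supp_mono (fun σ hσ => ?_) (renB_mem_wt hκ f c w.2)
  simp only [Set.mem_ofPred_eq] at hσ ⊢
  omega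

theorem Gam_Gam (hn : Nonres κ) (f g : Tp κ →ₐ[ℝ] ℝ) (t : T) :
    Gam f.toLinearMap (Gam g.toLinearMap t) = Gam (comp f g).toLinearMap t :=
  incl_injective (by rw [incl_Gam, incl_Gam, incl_Gam, GamB_comp hn f g (incl_mem t)])

theorem renT_Gam_hat (hn : Nonres κ) (f g : Tp κ →ₐ[ℝ] ℝ) (c : Fin 5 → ℝ) (t : T) :
    renT f c (Gam (hat f g c).toLinearMap t) = Gam g.toLinearMap (renT (comp f g) c t) :=
  incl_injective (by
    rw [incl_renT, incl_Gam, incl_Gam, incl_renT, renB_hat hn f g c (incl_mem t)])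

theorem renT_poly (f : Tp κ →ₐ[ℝ] ℝ) (c : Fin 5 → ℝ) {t : T} (ht : incl t ∈ supp ℝ polySet) :
    renT f c t = t :=
  incl_injective (by rw [incl_renT, renB_poly f c ht])

/-! ## Comparison of the functionals at different points -/

variable {K : Kernel} {Z : Model κ}

theorem hasSum_conv {Pi : Pt → T →ₗ[ℝ] Dist} (hA : ∀ w, AdmissibleInt κ K Pi w) (x : Pt) (t : T)
    (φ : TestFn) : HasSum (fun n => Pi x t (K.testConv n φ))
      (Pi x (intT t) φ + Pi x (JT κ K Pi x t) φ) := by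
  let E : T →ₗ[ℝ] ℝ :=
    { toFun := fun t => Pi x t φ
      map_add' := fun s t => by rw [map_add]; rfl
      map_smul' := fun a t => by rw [(Pi x).map_smul]; rfl }
  have h : Pi x (intT t) φ + Pi x (JT κ K Pi x t) φ
      = ∑ w ∈ t.support, t w * (Pi x (intT (sym w)) φ + Pi x (Jmap κ K Pi x w) φ) := by
    change (E ∘ₗ intT + E ∘ₗ JT κ K Pi x) t = _
    conv_lhs => rw [T_eq_sum t, map_sum]
    refine Finset.sum_congr rfl fun w _ => ?_
    rw [LinearMap.map_smul, ← JT_sym (K := K) (Pi := Pi) x w]; rfl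
  rw [h]
  simp only [Pi_apply_eq x t]
  exact hasSum_sum fun w _ => ((hA w x).2 φ).mul_left _

/-- The values are forced by Π_x Γ_xy X_i = Π_y X_i: both sides are affine functions, compared at
the point x, where the contribution of X_i centred at x vanishes. -/
theorem charX_γ (hP : AdmissiblePoly Z.Pi) (x y : Pt) : charX (Z.γ x y) = x - y := by
  funext i
  have h := LinearMap.congr_fun (Z.Pi_Γ x y) (mono (Finsupp.single i 1))
  rw [LinearMap.comp_apply] at h
  have hX : mon ℝ (Xg i) ∈ supp ℝ polySet := mon_mem_supp ⟨_, rfl⟩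
  have e1 : Gam (Z.γ x y).toLinearMap (mono (Finsupp.single i 1))
      = proj (GamB (Z.γ x y) (mon ℝ (Xg i))) := by rw [Gam_eq, mono, incl_sym]
  have e2 := isContRep_poly hP x (u := GamB (Z.γ x y) (mon ℝ (Xg i)))
    (by rw [GamB_poly _ hX]; exact trans_mem_poly _ hX)
  rw [← e1, h] at e2
  have e3 := isContRep_mono hP y (Finsupp.single i 1)
  have e4 := congrFun (e2.unique e3) x
  rw [GamB_X, map_add, AlgHom.commutes, evalP_Xpow] at e4
  have hp : ∀ z : Pt, ipow z (Finsupp.single i 1) = z i := by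
    intro z
    rw [ipow, Finset.prod_eq_single i]
    · simp
    · intro j _ hj; rw [Finsupp.single_eq_of_ne hj, pow_zero]
    · simp
  rw [hp, hp] at e4
  simpa using e4

/-- Admissibility expresses K * Π_y σ in two ways, from the base point y, and from x after writing
Π_y σ = Π_x Γ_xy σ. The parts involving I cancel up to jets, leaving a polynomial u with Π_x u = 0,
hence u = 0. Annihilation up to n is used since Γ_xy σ may contain monomials, of weight at most that
of σ. -/
theorem agreeTo_fchar (hn : Nonres κ) (hκ : 0 < κ) (hZ : Z.Admissible K) {n : ℕ}
    (hK : K.Annihilates n) (x y : Pt) :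
    AgreeTo n (fchar κ K Z.Pi y) (comp (fchar κ K Z.Pi x) (Z.γ x y)) := by
  have hγ := charX_γ hZ.1 x y
  refine ⟨by rw [charX_comp, charX_fchar, charX_fchar, hγ]; abel, fun σ h1 h2 h3 => ?_⟩
  rw [jetI_comp hn _ _ (mon_mem_supp (mem_setW.2 h1)), GamB_poly _ (jetI_mem_poly _ _), charX_fchar]
  set f := fchar κ K Z.Pi x
  set f' := fchar κ K Z.Pi y with hf'
  set g := Z.γ x y
  let w : W := ⟨σ, h1⟩
  have hw : incl (sym w) = mon ℝ σ := incl_sym w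
  have hΓ : incl (Gam g.toLinearMap (sym w)) = GamB g (mon ℝ σ) := by rw [incl_Gam, hw]
  have hJx : incl (JT κ K Z.Pi x (Gam g.toLinearMap (sym w))) = jx f (GamB g (mon ℝ σ)) := by
    rw [incl_JT x hK hZ.1, hΓ]
    intro v hv
    have := mem_Twt.1 (Gam_mem_Twt hκ g (sym_mem_Twt (n := n + 1) (w := w) (by
      change σ.wt < n + 1; omega))) v hv
    omega
  have hJy : incl (Jmap κ K Z.Pi y w) = jx f' (mon ℝ σ) := incl_Jmap K Z.Pi y w h2
  have hPi : ∀ t, Z.Pi x (Gam g.toLinearMap t) = Z.Pi y t := fun t =>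
    LinearMap.congr_fun (Z.Pi_Γ x y) t
  have hsum : Z.Pi x (intT (Gam g.toLinearMap (sym w))) + Z.Pi x (JT κ K Z.Pi x
      (Gam g.toLinearMap (sym w))) = Z.Pi y (intT (sym w)) + Z.Pi y (Jmap κ K Z.Pi y w) := by
    refine ContinuousLinearMap.ext fun φ => ?_
    have a := hasSum_conv hZ.2 x (Gam g.toLinearMap (sym w)) φ
    have b := (hZ.2 w y).2 φ
    rw [hPi] at a
    exact a.unique b
  let u : Amb := jetI g (mon ℝ σ) + trans (charX g) (jx f' (mon ℝ σ)) - jx f (GamB g (mon ℝ σ))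
  have hu : u ∈ supp ℝ polySet :=
    sub_mem (add_mem (jetI_mem_poly _ _) (trans_mem_poly _ (jx_mem _ _))) (jx_mem _ _)
  have hu0 : u = 0 := by
    refine eq_zero_of_Pi hZ.1 x hu ?_
    have e : proj u = Gam g.toLinearMap (intT (sym w)) + Gam g.toLinearMap (Jmap κ K Z.Pi y w)
        - (intT (Gam g.toLinearMap (sym w)) + JT κ K Z.Pi x (Gam g.toLinearMap (sym w))) := by
      refine incl_injective ?_
      rw [incl_proj (supp_mono polySet_subset_W hu), map_sub, map_add, map_add, incl_Gam, incl_Gam,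
        incl_intT, incl_intT, hΓ, hw, hJx, hJy, GamB_intB, GamB_poly g (jx_mem _ _)]
      change jetI g (mon ℝ σ) + trans (charX g) (jx f' (mon ℝ σ)) - jx f (GamB g (mon ℝ σ)) = _
      abel
    rw [e, map_sub, map_add, map_add, hPi, hPi, hsum, sub_self]
  -- Moving the origin back from x turns each 𝒥 into minus a jet of a character and leaves the
  -- cocycle relation.
  have h4 := congrArg (trans (-x)) hu0
  simp only [u, jx_apply, map_sub, map_add, map_neg, trans_trans, map_zero] at h4
  rw [show charX f' = -y from charX_fchar K Z.Pi y, show charX f = -x from charX_fchar K Z.Pi x,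
    show charX g = x - y from hγ, show -x + (x - y + - -y) = 0 by abel,
    show -x + - -x = 0 by abel, trans_zero, trans_zero] at h4
  rw [sub_neg_eq_add] at h4
  have h5 : jetI f' (mon ℝ σ) = trans (-x) (jetI g (mon ℝ σ)) + jetI f (GamB g (mon ℝ σ)) := by
    rw [← sub_eq_zero, ← neg_eq_zero, ← h4]; abel
  rw [h5, add_comm]

end Phi43

end

noncomputable section

namespace Phi43

/-! ## The renormalised model -/

variable {κ : ℝ} {K : Kernel} {Z : Model κ}

theorem incl_mono_mem (k : Idx) : incl (mono k) ∈ supp ℝ polySet := by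
  rw [mono, incl_sym]; exact mon_mem_supp ⟨k, rfl⟩

theorem renT_sym_deg (hκ : 0 < κ) (f : Tp κ →ₐ[ℝ] ℝ) (c : Fin 5 → ℝ) (w : W) :
    ∀ v ∈ (renT f c (sym w)).support, deg κ w.1 ≤ deg κ v.1 ∧ v.1.wt ≤ w.1.wt := by
  intro v hv
  have h : incl (renT f c (sym w)) ∈ supp ℝ (renSet κ w.1) := by
    rw [incl_renT, incl_sym]; exact (renB_lead f c hκ w.2).1
  have := of_incl_mem h v hv
  exact ⟨this.1, this.2.2⟩

theorem PiM_apply (c : Fin 5 → ℝ) (x : Pt) (t : T) :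
    PiM Z K (renDelta κ c) x t = Z.Pi x (renT (fchar κ K Z.Pi x) c t) :=
  LinearMap.congr_fun (PiM_renDelta Z K c x) t

/-- The jets of the renormalised model at σ are those of M_f σ, but cut at |σ| + 2; what is cut away
is the correction in M_f I(σ). -/
theorem incl_Jmap_PiM (hn : Nonres κ) (hκ : 0 < κ) (hZ : Z.Admissible K) (c : Fin 5 → ℝ)
    {w : W} (hw : ¬ w.1.IsPoly) (hK : K.Annihilates w.1.wt) (x : Pt) :
    incl (Jmap κ K (PiM Z K (renDelta κ c)) x w)
      = jx (fchar κ K Z.Pi x) (renB (fchar κ K Z.Pi x) c (mon ℝ w.1))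
        - corr (fchar κ K Z.Pi x) w.1 (renB (fchar κ K Z.Pi x) c (mon ℝ w.1)) := by
  have h := renT_sym_deg hκ (fchar κ K Z.Pi x) c w
  have h1 := jets_truncate x hn hZ.2 w hw fun v hv => (h v hv).1
  rw [incl_JT x hK hZ.1 fun v hv => (h v hv).2, incl_renT, incl_sym] at h1
  rw [corr_eq_jx, ← h1, Jmap]
  simp only [PiM_apply]

theorem admissiblePoly_PiM (hZ : Z.Admissible K) (c : Fin 5 → ℝ) :
    AdmissiblePoly (PiM Z K (renDelta κ c)) := by
  intro x k φ
  rw [PiM_apply, renT_poly _ _ (incl_mono_mem k)]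
  exact hZ.1 x k φ

/-- Admissibility of Π gives K * Π^M_x σ as Π_x of I(M_f σ) + 𝒥(x) M_f σ. The correction is added in
M_f I(σ) and missing from the renormalised jets, so the sum is unchanged and equals M_f I(σ) plus
the renormalised 𝒥(x)σ. -/
theorem admissibleInt_PiM (hn : Nonres κ) (hκ : 0 < κ) (hZ : Z.Admissible K) (c : Fin 5 → ℝ)
    (w : W) (hK : K.Annihilates w.1.wt) : AdmissibleInt κ K (PiM Z K (renDelta κ c)) w := by
  intro x
  simp only [PiM_apply]
  set f := fchar κ K Z.Pi x
  have h := renT_sym_deg hκ f c w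
  refine ⟨fun k hk => (hasSum_jet x hZ.2 fun v hv => ?_).summable, fun φ => ?_⟩
  · have := mem_idxBelow.1 hk
    linarith [(h v hv).1]
  · have h1 := hasSum_conv hZ.2 x (renT f c (sym w)) φ
    have hJ : renT f c (Jmap κ K (PiM Z K (renDelta κ c)) x w)
        = Jmap κ K (PiM Z K (renDelta κ c)) x w := renT_poly _ _ (incl_Jmap_mem _ _ _ _)
    have e : intT (renT f c (sym w)) + JT κ K Z.Pi x (renT f c (sym w))
        = renT f c (intT (sym w)) + Jmap κ K (PiM Z K (renDelta κ c)) x w := by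
      refine incl_injective ?_
      rw [map_add, map_add, incl_JT x hK hZ.1 fun v hv => (h v hv).2, incl_intT, incl_renT,
        incl_renT, incl_intT, incl_sym]
      by_cases hw : w.1.IsPoly
      · have hp : mon ℝ w.1 ∈ supp ℝ polySet := mon_mem_supp hw
        rw [Jmap_poly x hK (admissiblePoly_PiM hZ c) hw le_rfl, renB_poly _ _ hp, intB_eq_zero hp,
          jx_apply, jetI_poly _ hp, map_zero, map_zero, map_zero, neg_zero]
      · rw [incl_Jmap_PiM hn hκ hZ c hw hK, intB_mon hw, renB_int]
        abel
    rw [hJ]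
    have e2 : Z.Pi x (intT (renT f c (sym w))) φ + Z.Pi x (JT κ K Z.Pi x (renT f c (sym w))) φ
        = Z.Pi x (renT f c (intT (sym w))) φ
          + Z.Pi x (Jmap κ K (PiM Z K (renDelta κ c)) x w) φ := by
      have := congrArg (fun η : Dist => η φ) (congrArg (Z.Pi x) e)
      rw [map_add, map_add] at this
      exact this
    rw [← e2]
    exact h1

theorem PiM_Gam (hn : Nonres κ) (hκ : 0 < κ) (hZ : Z.Admissible K) (c : Fin 5 → ℝ)
    (w : W) (hK : K.Annihilates w.1.wt) (x y : Pt) :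
    PiM Z K (renDelta κ c) x (Gam (gamM Z K (renDeltaHat κ c).toLinearMap x y) (sym w))
      = PiM Z K (renDelta κ c) y (sym w) := by
  rw [PiM_apply, PiM_apply, gamM_renDeltaHat, renT_Gam_hat hn,
    ← AgreeTo.renT hκ (agreeTo_fchar hn hκ hZ hK x y) c (sym_mem_Twt (Nat.lt_succ_self _))]
  exact LinearMap.congr_fun (Z.Pi_Γ x y) _

/-- With the trivial base character `corrL` vanishes, and the jets of `hat` reduce to those of M_f σ
plus the translated correction. By `incl_Jmap_PiM` these are the jets of the character built from
Π^M. -/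
theorem agreeTo_PiM (hn : Nonres κ) (hκ : 0 < κ) (hZ : Z.Admissible K) (c : Fin 5 → ℝ) {n : ℕ}
    (hK : K.Annihilates n) (x : Pt) :
    AgreeTo n (fchar κ K (PiM Z K (renDelta κ c)) x)
      (hat (triv κ ℝ) (fchar κ K Z.Pi x) c) := by
  refine ⟨by rw [charX_hat, charX_fchar, charX_fchar], fun σ h1 h2 h3 => ?_⟩
  have hb := incl_Jmap_PiM hn hκ hZ c (w := ⟨σ, h1⟩) h2
    (fun m k hk => hK m k (by change sdeg k ≤ σ.wt at hk; omega)) x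
  rw [incl_Jmap _ _ _ _ h2] at hb
  rw [jetI_hat_eq hn _ _ _ h1 h2, hatJ, comp_triv hn, corrL_triv, sub_zero,
    GamB_poly _ (corr_mem_poly _ _ _), charX_fchar]
  have h4 := congrArg (trans (-x)) hb
  simp only [jx_apply, map_sub, map_neg, trans_trans, charX_fchar] at h4
  rw [show -x + - -x = 0 by abel, trans_zero, trans_zero] at h4
  rw [← neg_inj, h4]
  abel

/-- Write w = F^M_x u. From M F^M_x = F_x M_{f_x} one gets M w = F_x M_{f_x} u, so both sides equal
Π_x M_{f_x} u when y = x. For another y, write M w = F_y s; then F_y = F_x Γ_xy on the weights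
involved, hence M_{f_x} u = Γ_xy s. -/
theorem bold_PiM (hn : Nonres κ) (hκ : 0 < κ) (hZ : Z.Admissible K) (c : Fin 5 → ℝ)
    (w : W) (hK : K.Annihilates w.1.wt) (x y : Pt) :
    bold κ K (PiM Z K (renDelta κ c)) x (sym w)
      = bold κ K Z.Pi y (renT (triv κ ℝ) c (sym w)) := by
  obtain ⟨u, hu, hu'⟩ := Twt_le_map hκ (fchar κ K (PiM Z K (renDelta κ c)) x) (w.1.wt + 1)
    (sym_mem_Twt (Nat.lt_succ_self w.1.wt))
  have h1 : renT (triv κ ℝ) c (sym w)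
      = Gam (fchar κ K Z.Pi x).toLinearMap (renT (fchar κ K Z.Pi x) c u) := by
    rw [← hu', AgreeTo.Gam (agreeTo_PiM hn hκ hZ c hK x) hu, renT_Gam_hat hn, comp_triv hn]
  obtain ⟨s, hs, hs'⟩ := Twt_le_map hκ (fchar κ K Z.Pi y) (w.1.wt + 1)
    (renT_mem_Twt hκ (triv κ ℝ) c (sym_mem_Twt (Nat.lt_succ_self w.1.wt)))
  have h2 : renT (fchar κ K Z.Pi x) c u = Gam (Z.γ x y).toLinearMap s := by
    refine Gam_injective hκ (fchar κ K Z.Pi x) ?_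
    rw [← h1, Gam_Gam hn, ← AgreeTo.Gam (agreeTo_fchar hn hκ hZ hK x y) hs, hs']
  rw [← hs', bold_Gam hκ, ← hu', bold_Gam hκ, PiM_apply, h2]
  exact LinearMap.congr_fun (Z.Pi_Γ x y) s

/-- The degree up to which a kernel has to annihilate polynomials. -/
def annDeg (w : W) : ℕ := w.1.wt

theorem describes_renDelta (hn : Nonres κ) (hκ : 0 < κ) (c : Fin 5 → ℝ) :
    Describes κ annDeg (renormMap c) (renDelta κ c) (renDeltaHat κ c).toLinearMap where
  γ_one K Z _ x y := by rw [gamM_renDeltaHat]; exact map_one (hat _ _ _)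
  γ_mul K Z _ x y σ σ' := by rw [gamM_renDeltaHat]; exact map_mul (hat _ _ _) _ _
  poly K Z hZ := admissiblePoly_PiM hZ c
  int w K hK Z hZ := admissibleInt_PiM hn hκ hZ c w hK
  Pi_Γ w K hK Z hZ x y := PiM_Gam hn hκ hZ c w hK x y
  bold w K hK Z hZ x y := by
    rw [renormMap_eq κ c]; exact bold_PiM hn hκ hZ c w hK x y

theorem renormMap_mem (hn : Nonres κ) (hκ : 0 < κ) (c : Fin 5 → ℝ) :
    renormMap c ∈ RenormGroup κ annDeg := by
  refine ⟨fun τ => ?_, fun k τ σ h => ?_, renDelta κ c, (renDeltaHat κ c).toLinearMap,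
    describes_renDelta hn hκ c, fun α τ hτ => renDelta_degree hκ c α hτ,
    fun α σ hσ => renDeltaHat_degree hn hκ c α hσ⟩
  · rw [renormMap_eq κ c]; exact renT_triv_intT c τ
  · rw [renormMap_eq κ c]; exact renT_isMonoMul _ c h

end Phi43

end

noncomputable section

namespace Phi43

/-! ## Uniqueness of the renormalised model -/

variable {κ : ℝ} {K : Kernel} {Z : Model κ}

theorem agreeTo_of_eq {P P' : Pt → T →ₗ[ℝ] Dist} (x : Pt) {n : ℕ}
    (h : ∀ w : W, w.1.wt + 2 ≤ n → P x (sym w) = P' x (sym w)) :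
    AgreeTo n (fchar κ K P x) (fchar κ K P' x) := by
  refine ⟨by rw [charX_fchar, charX_fchar], fun σ h1 h2 h3 => ?_⟩
  have e : Jmap κ K P x ⟨σ, h1⟩ = Jmap κ K P' x ⟨σ, h1⟩ := by
    rw [Jmap, Jmap, h ⟨σ, h1⟩ h3]
  have e2 := congrArg (fun t => trans (-x) (incl t)) e
  simp only [incl_Jmap K P x ⟨σ, h1⟩ h2, incl_Jmap K P' x ⟨σ, h1⟩ h2, jx_apply, map_neg,
    trans_trans, charX_fchar] at e2
  rwa [show -x + - -x = 0 by abel, trans_zero, trans_zero, neg_inj] at e2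

/-- One recovers P x τ by applying 𝚷 to F_x τ. The operator F_x depends at τ only on the values of P
at symbols of smaller weight, so 𝚷 determines P recursively. -/
theorem eq_of_bold_eq (hκ : 0 < κ) {P P' : Pt → T →ₗ[ℝ] Dist} {n : ℕ}
    (h : ∀ w : W, w.1.wt ≤ n → ∀ x, bold κ K P x (sym w) = bold κ K P' x (sym w)) (w : W)
    (hw : w.1.wt ≤ n) (x : Pt) : P x (sym w) = P' x (sym w) := by
  induction hm : w.1.wt using Nat.strong_induction_on generalizing w with
  | _ m ih =>
    have hA : AgreeTo m (fchar κ K P x) (fchar κ K P' x) :=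
      agreeTo_of_eq x fun v hv => ih v.1.wt (by omega) v (by omega) rfl
    have hm' : sym w ∈ Twt (m + 1) := sym_mem_Twt (by omega)
    rw [← bold_Gam hκ K P x (sym w), ← bold_Gam hκ K P' x (sym w), AgreeTo.Gam hA hm']
    refine T_congr _ _ fun v hv => h v ?_ x
    have := mem_Twt.1 (Gam_mem_Twt hκ (fchar κ K P' x) hm') v hv
    omega

theorem PiM_unique (hn : Nonres κ) (hκ : 0 < κ) (c : Fin 5 → ℝ) {ΔM : T →ₗ[ℝ] T ⊗[ℝ] Tp κ}
    {ΔhM : Tp κ →ₗ[ℝ] Tp κ ⊗[ℝ] Tp κ} (h : Describes κ annDeg (renormMap c) ΔM ΔhM)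
    (hZ : Z.Admissible K) (w : W) (hK : K.Annihilates (annDeg w)) (x : Pt) :
    PiM Z K ΔM x (sym w) = Z.Pi x (renT (fchar κ K Z.Pi x) c (sym w)) := by
  rw [← PiM_apply]
  refine eq_of_bold_eq (K := K) hκ (n := w.1.wt) (fun v hv x => ?_) w le_rfl x
  have hKv : K.Annihilates (annDeg v) := fun m k hk => hK m k (hk.trans hv)
  rw [h.bold v K hKv Z hZ x x, (describes_renDelta hn hκ c).bold v K hKv Z hZ x x]

/-! ## The symbols which occur in the difference of the two renormalisation maps -/

/-- Apart from Ξ, a symbol has at most three branches, each contributing |I(Ξ)| = -1/2 - κ at worst.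
For small κ the resulting -3/2 - 3κ exceeds |Ξ|, so the bound propagates. -/
theorem deg_lower (hκ : 0 < κ) (hκ' : κ < 1 / 100) {σ : Sym} (hσ : σ.InW) :
    -(5 / 2) - κ ≤ deg κ σ ∧ (σ ≠ Sym.Xi → 3 * (-(1 / 2) - κ) ≤ deg κ σ) := by
  induction σ using Sym.induction with
  | h k m s ih =>
    have h2 : Sym.node k m s ≠ Sym.Xi → 3 * (-(1 / 2) - κ) ≤ deg κ (Sym.node k m s) := by
      intro hX
      rcases Sym.inW_iff.1 hσ with h | ⟨h0, hb, hc, -⟩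
      · exact absurd h hX
      · rw [Sym.noise_node] at h0
        rw [Sym.branches_node] at hb hc
        rw [deg_eq, Sym.exp_node, Sym.noise_node, Sym.branches_node, h0]
        have h3 := Multiset.card_nsmul_le_sum (s := s.map fun σ => deg κ σ + 2)
          (a := -(1 / 2) - κ) (by
            intro a ha
            obtain ⟨σ, hσ, rfl⟩ := Multiset.mem_map.1 ha
            linarith [(ih σ hσ (hb σ hσ).1).1])
        rw [Multiset.card_map, nsmul_eq_mul] at h3
        have h4 : (s.card : ℝ) ≤ 3 := by exact_mod_cast hc
        have h5 : (0 : ℝ) ≤ sdeg k := Nat.cast_nonneg _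
        push_cast
        nlinarith
    refine ⟨?_, h2⟩
    by_cases hX : Sym.node k m s = Sym.Xi
    · rw [hX, Sym.deg_Xi]
    · linarith [h2 hX]

/-- A set containing the symbols which occur in the difference of `renMul f c τ` and
`renMul (triv κ B) c τ`, for symbols `τ` with `n` branches. -/
def diffSet (κ : ℝ) (n : ℕ) : Set Sym :=
  {ρ | (ρ.exp ≠ 0 ∧ 1 + (n - 1) * (-(1 / 2) - κ) ≤ deg κ ρ) ∨
    2 - 2 * κ + (n - 1) * (-(1 / 2) - κ) ≤ deg κ ρ}

theorem mem_diffSet {n : ℕ} {ρ : Sym} : ρ ∈ diffSet κ n ↔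
    (ρ.exp ≠ 0 ∧ 1 + (n - 1) * (-(1 / 2) - κ) ≤ deg κ ρ) ∨
      2 - 2 * κ + (n - 1) * (-(1 / 2) - κ) ≤ deg κ ρ := Iff.rfl

theorem exp_mul_ne_zero {σ τ : Sym} (h : σ.exp ≠ 0 ∨ τ.exp ≠ 0) : (σ * τ).exp ≠ 0 := by
  rw [Sym.exp_mul]
  intro h0
  have h1 := add_eq_zero.1 h0
  tauto

theorem diffSet_mono (hκ : 0 < κ) {m n : ℕ} (h : m ≤ n) : diffSet κ m ⊆ diffSet κ n := by
  intro ρ hρ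
  have h1 : (m : ℝ) ≤ n := by exact_mod_cast h
  rcases hρ with ⟨h2, h3⟩ | h3
  · exact Or.inl ⟨h2, by nlinarith⟩
  · exact Or.inr (by nlinarith)

theorem diffSet_mul_deg {n n' : ℕ} {σ τ : Sym} (hσ : σ ∈ diffSet κ n)
    (hτ : n' * (-(1 / 2) - κ) ≤ deg κ τ) : σ * τ ∈ diffSet κ (n + n') := by
  rw [mem_diffSet, Sym.deg_mul]
  push_cast
  rcases hσ with ⟨h2, h3⟩ | h3
  · exact Or.inl ⟨exp_mul_ne_zero (Or.inl h2), by linarith⟩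
  · exact Or.inr (by linarith)

theorem diffSet_deg (hκ : 0 < κ) (hκ' : κ < 1 / 100) {n : ℕ} {σ : Sym} (hσ : σ ∈ diffSet κ n) :
    n * (-(1 / 2) - κ) ≤ deg κ σ := by
  rcases hσ with ⟨h2, h3⟩ | h3 <;> linarith

/-- The two thresholds in `diffSet` reproduce themselves. A correction at I(σ) with σ ≠ Ξ is a
combination of X^k with |k| > 1/2 - 3κ > 0, hence |k| ≥ 1 and k ≠ 0; at I(Ξ) there is none, as |Ξ| +
2 < 0. A difference inside σ has homogeneity at least -2κ, the first bound for n = 3, so under I it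
reaches 2 - 2κ. Every further branch costs at most 1/2 + κ. -/
theorem renMul_sub_mem (hκ : 0 < κ) (hκ' : κ < 1 / 100) (f : Tp κ →ₐ[ℝ] ℝ) (c : Fin 5 → ℝ)
    {τ : Sym} (h0 : τ.noise = 0) (hb : ∀ σ ∈ τ.branches, σ.InW ∧ ¬ σ.IsPoly ∧
      renB f c (mon ℝ σ) - renB (triv κ ℝ) c (mon ℝ σ) ∈ supp ℝ (diffSet κ 3)) :
    renMul f c (mon ℝ τ) - renMul (triv κ ℝ) c (mon ℝ τ)
      ∈ supp ℝ (diffSet κ τ.branches.card) := by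
  let Φ : Sym →* Amb × Amb :=
    ((renMul f c).toMonoidHom.comp (MonoidAlgebra.of ℝ Sym)).prod
      ((renMul (triv κ ℝ) c).toMonoidHom.comp (MonoidAlgebra.of ℝ Sym))
  let p : Sym → Amb × Amb → Prop := fun τ a =>
    a.2 ∈ supp ℝ {ρ | τ.branches.card * (-(1 / 2) - κ) ≤ deg κ ρ} ∧
      a.1 - a.2 ∈ supp ℝ (diffSet κ τ.branches.card)
  have key : p τ (Φ τ) := by
    refine Sym.gen_induction p Φ ?_ ?_ ?_ τ (fun h => absurd h0 h) ?_
    · refine ⟨?_, ?_⟩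
      · change mon ℝ (1 : Sym) ∈ _
        refine mon_mem_supp ?_
        rw [Set.mem_ofPred_eq, Sym.one_eq_Xpow, Sym.deg_Xpow]
        simp [Sym.Xpow, sdeg]
      · change (1 : Amb) - 1 ∈ _
        rw [sub_self]; exact zero_mem _
    · rintro σ τ ⟨a, b⟩ ⟨a', b'⟩ ⟨h1, h2⟩ ⟨h3, h4⟩
      have hcard : (σ * τ).branches.card = σ.branches.card + τ.branches.card := by
        rw [Sym.branches_mul, Multiset.card_add]
      refine ⟨?_, ?_⟩
      · change b * b' ∈ _
        refine mul_mem_supp (fun ρ hρ ρ' hρ' => ?_) h1 h3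
        rw [Set.mem_ofPred_eq] at hρ hρ' ⊢
        rw [hcard, Sym.deg_mul]
        push_cast
        linarith
      · change a * a' - b * b' ∈ _
        have e : a * a' - b * b' = (a - b) * (a' - b') + (a - b) * b' + (a' - b') * b := by ring
        rw [e, hcard]
        refine add_mem (add_mem ?_ ?_) ?_
        · exact mul_mem_supp (fun ρ hρ ρ' hρ' =>
            diffSet_mul_deg hρ (diffSet_deg hκ hκ' hρ')) h2 h4
        · exact mul_mem_supp (fun ρ hρ ρ' hρ' => diffSet_mul_deg hρ hρ') h2 h3
        · rw [add_comm σ.branches.card]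
          exact mul_mem_supp (fun ρ hρ ρ' hρ' => diffSet_mul_deg hρ hρ') h4 h1
    · intro i
      refine ⟨?_, ?_⟩
      · change renMul (triv κ ℝ) c (mon ℝ (Xg i)) ∈ _
        rw [renMul_X]
        refine mon_mem_supp ?_
        rw [Set.mem_ofPred_eq, Sym.deg_Xpow]
        simp [Sym.Xpow]
      · change renMul f c (mon ℝ (Xg i)) - renMul (triv κ ℝ) c (mon ℝ (Xg i)) ∈ _
        rw [renMul_X, renMul_X, sub_self]; exact zero_mem _
    · intro σ hσ
      obtain ⟨h1, h2, h3⟩ := hb σ hσ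
      have hc : σ.int.branches.card = 1 := by simp
      refine ⟨?_, ?_⟩
      · change renMul (triv κ ℝ) c (mon ℝ σ.int) ∈ _
        rw [renMul_int, corr_triv, add_zero]
        refine intB_mem_supp (fun ρ hρ _ => ?_) (renB_lead (triv κ ℝ) c hκ h1).1
        rw [Set.mem_ofPred_eq, hc, Sym.deg_int]
        have := (mem_renSet.1 hρ).1
        have := (deg_lower hκ hκ' h1).1
        push_cast
        linarith
      · change renMul f c (mon ℝ σ.int) - renMul (triv κ ℝ) c (mon ℝ σ.int) ∈ _
        rw [renMul_int, renMul_int, corr_triv, add_zero, hc, add_sub_right_comm, ← map_sub]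
        refine add_mem ?_ ?_
        · refine intB_mem_supp (fun ρ hρ _ => Or.inr ?_) h3
          rw [Sym.deg_int]
          rw [mem_diffSet] at hρ
          push_cast at hρ ⊢
          rcases hρ with ⟨-, hρ⟩ | hρ <;> linarith
        · by_cases hX : σ = Sym.Xi
          · have : corr f σ (renB f c (mon ℝ σ)) = 0 := by
              rw [hX, renB_Xi, corr_apply, jetI_mon, Sym.deg_Xi]
              have : idxBelow (-(5 / 2) - κ + 2) = ∅ := by
                refine Finset.eq_empty_of_forall_notMem fun k hk => ?_
                have := mem_idxBelow.1 hk
                have h5 : (0 : ℝ) ≤ sdeg k := Nat.cast_nonneg _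
                linarith
              rw [this]; simp
            rw [this]; exact zero_mem _
          · have h4 := (deg_lower hκ hκ' h1).2 hX
            rw [corr_apply]
            refine neg_mem (trGt_mem_supp (S := polySet) (fun ρ hρ hd => Or.inl ?_)
              (trans_mem_poly _ (jetI_mem_poly f _)))
            obtain ⟨k, rfl⟩ := hρ
            rw [Sym.deg_Xpow]
            have he : (Sym.Xpow k).exp = k := by simp [Sym.Xpow]
            rw [he] at hd ⊢
            have h6 : 0 < sdeg k := by
              have : (0 : ℝ) < sdeg k := by linarith
              exact_mod_cast this
            have h7 : (1 : ℝ) ≤ sdeg k := by exact_mod_cast h6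
            refine ⟨fun hk => ?_, by push_cast; linarith⟩
            rw [hk] at h6
            simp [sdeg] at h6
  exact key.2

theorem renB_sub_mem (hκ : 0 < κ) (hκ' : κ < 1 / 100) (f : Tp κ →ₐ[ℝ] ℝ) (c : Fin 5 → ℝ)
    {τ : Sym} (hτ : τ.InW) :
    renB f c (mon ℝ τ) - renB (triv κ ℝ) c (mon ℝ τ) ∈ supp ℝ (diffSet κ 3) := by
  induction hm : τ.wt using Nat.strong_induction_on generalizing τ with
  | _ m ih =>
    by_cases hX : τ = Sym.Xi
    · rw [hX, renB_Xi, renB_Xi, sub_self]; exact zero_mem _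
    have hb : ∀ σ ∈ τ.branches, σ.InW ∧ ¬ σ.IsPoly ∧
        renB f c (mon ℝ σ) - renB (triv κ ℝ) c (mon ℝ σ) ∈ supp ℝ (diffSet κ 3) := fun σ hσ =>
      ⟨(hτ.branch hσ).1, (hτ.branch hσ).2,
        ih σ.wt (by have := Sym.wt_branch hσ; omega) (hτ.branch hσ).1 rfl⟩
    have hc : τ.branches.card ≤ 3 := by
      rcases Sym.inW_iff.1 hτ with h | h
      · exact absurd h hX
      · exact h.2.2.1
    rw [renB_mon, renB_mon, add_sub_add_comm]
    refine add_mem (supp_mono (diffSet_mono hκ hc)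
      (renMul_sub_mem hκ hκ' f c (hτ.noise hX) hb)) ?_
    refine map_mem_of_supp ((renMul f c).toLinearMap - (renMul (triv κ ℝ) c).toLinearMap) _
      (fun ρ hρ => ?_) (rootB_mem c τ)
    obtain ⟨g1, g2, g3, -⟩ := Contr.inW hρ hτ
    refine supp_mono (diffSet_mono hκ (g2.trans (by norm_num)))
      (renMul_sub_mem hκ hκ' f c g1 fun σ hσ => ?_)
    obtain ⟨k1, k2, k3⟩ := g3 σ hσ
    exact ⟨k1, k2, ih σ.wt (by omega) k1 rfl⟩

/-- With three branches the second threshold is 1 - 4κ > 0. The first is only -2κ, which is why the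
factor X^k has to be remembered. -/
theorem renT_sub_support (hκ : 0 < κ) (hκ' : κ < 1 / 100) (f : Tp κ →ₐ[ℝ] ℝ) (c : Fin 5 → ℝ)
    (t : T) : ∀ w ∈ (renT f c t - renT (triv κ ℝ) c t).support, 0 < deg κ w.1 ∨ w.1.exp ≠ 0 := by
  have h : incl (renT f c t - renT (triv κ ℝ) c t) ∈ supp ℝ (diffSet κ 3) := by
    rw [map_sub, incl_renT, incl_renT]
    exact map_mem_of_supp (renB f c - renB (triv κ ℝ) c) _
      (fun σ hσ => renB_sub_mem hκ hκ' f c hσ) (incl_mem t)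
  intro w hw
  rcases mem_diffSet.1 (of_incl_mem h w hw) with ⟨h1, -⟩ | h1
  · exact Or.inr h1
  · push_cast at h1
    exact Or.inl (by linarith)

end Phi43

end

noncomputable section

namespace Phi43

open MeasureTheory

/-! ## Bump functions -/

theorem pd_smul (a : ℝ) (i : Fin 4) {f : Pt → ℝ} (hf : ContDiff ℝ ∞ f) :
    pd i (a • f) = a • pd i f := by
  funext x
  rw [pd, fderiv_const_smul ((hf.differentiable (by simp)) x)]
  rfl

theorem pd_iter_smul (a : ℝ) (i : Fin 4) (n : ℕ) {f : Pt → ℝ} (hf : ContDiff ℝ ∞ f) :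
    (pd i)^[n] (a • f) = a • (pd i)^[n] f := by
  induction n with
  | zero => rfl
  | succ n ih =>
    rw [Function.iterate_succ_apply', ih, pd_smul a i (contDiff_pd_iter i n hf),
      Function.iterate_succ_apply']

theorem pdk_smul (a : ℝ) (k : Idx) {f : Pt → ℝ} (hf : ContDiff ℝ ∞ f) :
    pdk k (a • f) = a • pdk k f := by
  have s3 := contDiff_pd_iter 3 (k 3) hf
  have s2 := contDiff_pd_iter 2 (k 2) s3
  have s1 := contDiff_pd_iter 1 (k 1) s2
  rw [pdk, pd_iter_smul a 3 _ hf, pd_iter_smul a 2 _ s3, pd_iter_smul a 1 _ s2,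
    pd_iter_smul a 0 _ s1]
  rfl

/-- The class of test functions in the definition of a model contains a non-negative function
with positive integral. -/
theorem exists_bump (r : ℕ) : ∃ φ ∈ Bump r, (∀ y, 0 ≤ φ y) ∧ 0 < ∫ y, φ y := by
  -- The ball is Euclidean in no coordinate but given by the sup norm: radius 1/16 bounds the
  -- parabolic size by 1/4 + 3/16 ≤ 1.
  let b : ContDiffBump (0 : Pt) := ⟨1 / 32, 1 / 16, by norm_num, by norm_num⟩
  have hb : ContDiff ℝ ∞ b := b.contDiff
  have hbc : HasCompactSupport b := b.hasCompactSupport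
  have hfin : {k : Idx | k 0 + k 1 + k 2 + k 3 ≤ r}.Finite := by
    refine (idxBelow (2 * r + 1)).finite_toSet.subset fun k hk => ?_
    rw [Set.mem_ofPred_eq] at hk
    rw [Finset.mem_coe, mem_idxBelow]
    have : sdeg k < 2 * r + 1 := by unfold sdeg; omega
    exact_mod_cast this
  have hbd : ∀ k : Idx, ∃ C, ∀ y, ‖pdk k b y‖ ≤ C := fun k =>
    (contDiff_pdk k hb).continuous.bounded_above_of_compact_support (hasCompactSupport_pdk k hbc)
  choose C hC using hbd
  have hC0 : ∀ k, 0 ≤ C k := fun k => (norm_nonneg _).trans (hC k 0)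
  let A : ℝ := 1 + ∑ k ∈ hfin.toFinset, C k
  have hA : 0 < A := by
    have := Finset.sum_nonneg fun k (_ : k ∈ hfin.toFinset) => hC0 k
    simp only [A]; linarith
  refine ⟨A⁻¹ • ⇑b, ⟨(hb.const_smul A⁻¹ : ContDiff ℝ ∞ fun y => A⁻¹ • b y), fun y hy => ?_, fun k hk y => ?_⟩, fun y => ?_, ?_⟩
  · have h1 : y ∈ Function.support b := by
      intro h
      exact hy (by rw [Pi.smul_apply, h, smul_zero])
    rw [b.support_eq, mem_ball_zero_iff] at h1
    have h2 : ∀ i, |y i| ≤ 1 / 16 := fun i => (norm_le_pi_norm y i).trans h1.le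
    have h3 : Real.sqrt |y 0| ≤ 1 / 4 := by
      rw [Real.sqrt_le_left (by norm_num)]
      linarith [h2 0]
    unfold snorm
    linarith [h2 1, h2 2, h2 3]
  · rw [pdk_smul _ _ hb, Pi.smul_apply, smul_eq_mul, abs_mul, abs_of_pos (inv_pos.2 hA)]
    have h1 : |pdk k b y| ≤ A := by
      refine (hC k y).trans ?_
      have := Finset.single_le_sum (fun k (_ : k ∈ hfin.toFinset) => hC0 k)
        (hfin.mem_toFinset.2 hk)
      simp only [A]; linarith
    rw [inv_mul_le_iff₀ hA, mul_one]
    exact h1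
  · exact smul_nonneg (inv_pos.2 hA).le b.nonneg
  · have h1 : 0 < ∫ y, b y := b.integral_pos
    simp only [Pi.smul_apply, smul_eq_mul]
    rw [integral_const_mul]
    exact mul_pos (inv_pos.2 hA) h1

/-- The diagonal scaling in the definition of `rescale`. -/
def scaling (l : ℝ) : Fin 4 → ℝ := fun i => if i = 0 then (l ^ 2)⁻¹ else l⁻¹

theorem rescale_eq (φ : Pt → ℝ) (x : Pt) (l : ℝ) (y : Pt) :
    rescale φ x l y = (l ^ 5)⁻¹ * φ (scaling l * (y - x)) := by
  rw [rescale]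
  congr 2
  funext i
  simp only [scaling, Pi.mul_apply, Pi.sub_apply]
  split <;> rfl

theorem scaling_ne_zero {l : ℝ} (hl : 0 < l) (i : Fin 4) : scaling l i ≠ 0 := by
  unfold scaling
  split <;> positivity

theorem contDiff_rescale {φ : Pt → ℝ} (hφ : ContDiff ℝ ∞ φ) (x : Pt) (l : ℝ) :
    ContDiff ℝ ∞ (rescale φ x l) := by
  have : rescale φ x l = fun y => (l ^ 5)⁻¹ * φ (scaling l * (y - x)) :=
    funext (rescale_eq φ x l)
  rw [this]
  refine contDiff_const.mul (hφ.comp (contDiff_const.mul (contDiff_id.sub contDiff_const)))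

theorem rescale_support {φ : Pt → ℝ} (hφ : ∀ y, φ y ≠ 0 → snorm y ≤ 1) {x : Pt} {l : ℝ}
    (hl : 0 < l) (hl1 : l ≤ 1) {y : Pt} (hy : rescale φ x l y ≠ 0) : ‖y - x‖ ≤ l := by
  rw [rescale_eq] at hy
  have h1 := hφ _ (right_ne_zero_of_mul hy)
  unfold snorm at h1
  have h0 := Real.sqrt_nonneg |(scaling l * (y - x)) 0|
  have h2 : ∀ i, |(scaling l * (y - x)) i| ≤ 1 := by
    have a1 := abs_nonneg ((scaling l * (y - x)) 1)
    have a2 := abs_nonneg ((scaling l * (y - x)) 2)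
    have a3 := abs_nonneg ((scaling l * (y - x)) 3)
    have a0 : |(scaling l * (y - x)) 0| ≤ 1 := by
      have : Real.sqrt |(scaling l * (y - x)) 0| ≤ 1 := by linarith
      nlinarith [Real.sq_sqrt (abs_nonneg ((scaling l * (y - x)) 0))]
    intro i
    fin_cases i
    · exact a0
    · change |(scaling l * (y - x)) 1| ≤ 1; linarith
    · change |(scaling l * (y - x)) 2| ≤ 1; linarith
    · change |(scaling l * (y - x)) 3| ≤ 1; linarith
  refine (pi_norm_le_iff_of_nonneg hl.le).2 fun i => ?_
  have h3 := h2 i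
  have h4 : l⁻¹ ≤ scaling l i := by
    unfold scaling
    split
    · exact inv_anti₀ (by positivity) (by nlinarith)
    · exact le_rfl
  rw [Pi.mul_apply, abs_mul, abs_of_pos (lt_of_lt_of_le (inv_pos.2 hl) h4)] at h3
  rw [Real.norm_eq_abs]
  have h5 := (mul_le_mul_of_nonneg_right h4 (abs_nonneg ((y - x) i))).trans h3
  rwa [inv_mul_le_iff₀ hl, mul_one] at h5

/-- The diagonal scaling has determinant λ⁻² λ⁻¹ λ⁻¹ λ⁻¹ = λ⁻⁵, the normalisation of the rescaled
function. -/
theorem integral_rescale (φ : Pt → ℝ) (x : Pt) {l : ℝ} (hl : 0 < l) :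
    ∫ y, rescale φ x l y = ∫ y, φ y := by
  have hdet : (Matrix.diagonal (scaling l)).det = (l ^ 5)⁻¹ := by
    rw [Matrix.det_diagonal, Fin.prod_univ_four]
    simp only [scaling, if_true, Fin.reduceEq, if_false]
    field_simp
  have hpos : 0 < (l ^ 5)⁻¹ := by positivity
  have h1 := Real.smul_map_diagonal_volume_pi (D := scaling l) (by rw [hdet]; exact hpos.ne')
  have hinj : MeasurableEmbedding (Matrix.toLin' (Matrix.diagonal (scaling l))) := by
    have hc : Continuous (Matrix.toLin' (Matrix.diagonal (scaling l))) :=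
      LinearMap.continuous_of_finiteDimensional _
    refine hc.measurableEmbedding fun u v huv => ?_
    funext i
    have := congrFun huv i
    rw [Matrix.toLin'_apply, Matrix.toLin'_apply, Matrix.mulVec_diagonal,
      Matrix.mulVec_diagonal] at this
    exact mul_left_cancel₀ (scaling_ne_zero hl i) this
  simp only [rescale_eq]
  rw [integral_sub_right_eq_self (fun y => (l ^ 5)⁻¹ * φ (scaling l * y)) x,
    integral_const_mul]
  have h2 : ∫ y, φ (scaling l * y)
      = ∫ y, φ y ∂(Measure.map (Matrix.toLin' (Matrix.diagonal (scaling l))) volume) := by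
    rw [hinj.integral_map]
    congr 1; funext y; congr 1; funext i
    rw [Matrix.toLin'_apply, Matrix.mulVec_diagonal]; rfl
  rw [h2]
  conv_rhs => rw [← h1, integral_smul_measure, hdet, abs_of_pos hpos,
    ENNReal.toReal_ofReal hpos.le]
  rfl

/-! ## Values at the base point -/

variable {κ : ℝ} {Z : Model κ}

/-- Tested against φ_x^λ with φ ≥ 0 of positive integral, a continuous g gives g(x)∫φ in the limit λ
→ 0, whereas the bound λ^{|τ|} on the model tends to 0. -/
theorem rep_eq_zero_of_deg_pos {w : W} (hw : 0 < deg κ w.1) {x : Pt} {g : Pt → ℝ}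
    (hg : IsContRep (Z.Pi x (sym w)) g) : g x = 0 := by
  obtain ⟨φ, hφ, h0, hI⟩ := exists_bump Z.r
  obtain ⟨C, hC⟩ := Z.Pi_bound {x} isCompact_singleton w
  set I := ∫ y, φ y
  have key : ∀ ε : ℝ, 0 < ε → |g x| ≤ 2 * ε := by
    intro ε hε
    obtain ⟨δ, hδ, hδ'⟩ := Metric.continuous_iff.1 hg.1 x ε hε
    have ht : Filter.Tendsto (fun l : ℝ => C * l ^ deg κ w.1) (nhdsWithin 0 (Set.Ioi 0))
        (nhds (C * 0 ^ deg κ w.1)) :=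
      ((Real.continuousAt_rpow_const 0 _ (Or.inr hw.le)).tendsto.mono_left
        nhdsWithin_le_nhds).const_mul C
    rw [Real.zero_rpow hw.ne', mul_zero] at ht
    have e1 : ∀ᶠ l : ℝ in nhdsWithin 0 (Set.Ioi 0), C * l ^ deg κ w.1 < ε * I :=
      ht.eventually (gt_mem_nhds (mul_pos hε hI))
    have e2 : ∀ᶠ l : ℝ in nhdsWithin 0 (Set.Ioi 0), l < min 1 δ :=
      nhdsWithin_le_nhds (gt_mem_nhds (lt_min one_pos hδ))
    obtain ⟨l, h1, h2, hl⟩ := (e1.and (e2.and self_mem_nhdsWithin)).exists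
    replace hl : 0 < l := hl
    have hl1 : l ≤ 1 := (h2.trans_le (min_le_left _ _)).le
    have hlδ : l < δ := h2.trans_le (min_le_right _ _)
    have hsupp : ∀ y, rescale φ x l y ≠ 0 → ‖y - x‖ ≤ l := fun y hy =>
      rescale_support hφ.2.1 hl hl1 hy
    have hsm := contDiff_rescale hφ.1 x l
    have hcs : HasCompactSupport (rescale φ x l) := by
      refine HasCompactSupport.of_support_subset_isCompact (isCompact_closedBall x l) ?_
      intro y hy
      rw [mem_closedBall_iff_norm]
      exact hsupp y hy
    have hnn : ∀ y, 0 ≤ rescale φ x l y := fun y => by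
      rw [rescale_eq]
      exact mul_nonneg (by positivity) (h0 _)
    let ψ : TestFn := ⟨rescale φ x l, hsm, hcs, fun _ _ => trivial⟩
    have hb : |Z.Pi x (sym w) ψ| ≤ C * l ^ deg κ w.1 :=
      hC x rfl l hl hl1 φ hφ ψ rfl
    have hrep : Z.Pi x (sym w) ψ = ∫ y, g y * rescale φ x l y := hg.2 ψ
    have i1 : Integrable (fun y => g y * rescale φ x l y) :=
      (hg.1.mul hsm.continuous).integrable_of_hasCompactSupport hcs.mul_left
    have i2 : Integrable (fun y => g x * rescale φ x l y) :=
      (continuous_const.mul hsm.continuous).integrable_of_hasCompactSupport hcs.mul_left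
    have i3 : Integrable (fun y => ε * rescale φ x l y) :=
      (continuous_const.mul hsm.continuous).integrable_of_hasCompactSupport hcs.mul_left
    have hd : |(∫ y, g y * rescale φ x l y) - g x * I| ≤ ε * I := by
      have e3 : g x * I = ∫ y, g x * rescale φ x l y := by
        rw [integral_const_mul, integral_rescale φ x hl]
      have e4 : ε * I = ∫ y, ε * rescale φ x l y := by
        rw [integral_const_mul, integral_rescale φ x hl]
      rw [e3, e4, ← integral_sub i1 i2]
      refine (norm_integral_le_integral_norm _).trans
        (integral_mono (i1.sub i2).norm i3 fun y => ?_)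
      simp only [Pi.sub_apply]
      rw [← sub_mul, norm_mul, Real.norm_of_nonneg (hnn y)]
      by_cases hy : rescale φ x l y = 0
      · rw [hy, mul_zero, mul_zero]
      · refine mul_le_mul_of_nonneg_right ?_ (hnn y)
        have := hδ' y (by rw [dist_eq_norm]; exact (hsupp y hy).trans_lt hlδ)
        rw [dist_eq_norm] at this
        exact this.le
    rw [← hrep] at hd
    have hfin : |g x| * I ≤ 2 * ε * I := by
      rw [← abs_of_pos hI, ← abs_mul, abs_of_pos hI]
      have := abs_sub_abs_le_abs_sub (g x * I) (Z.Pi x (sym w) ψ)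
      rw [abs_sub_comm] at this
      linarith
    exact le_of_mul_le_mul_right hfin hI
  by_contra hne
  have := key (|g x| / 4) (by positivity)
  have h5 : 0 < |g x| := abs_pos.2 hne
  linarith

/-- Stripping the factor X^k leaves a symbol v of W, so g is (· - x)^k times a continuous
representative of Π_x v, and the prefactor vanishes at x. No positivity of the homogeneity is
needed. -/
theorem rep_eq_zero_of_exp (hX : Z.RespectsX) (hc : Z.IsContinuous) {w : W} (hw : w.1.exp ≠ 0)
    {x : Pt} {g : Pt → ℝ} (hg : IsContRep (Z.Pi x (sym w)) g) : g x = 0 := by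
  have hXi : w.1 ≠ Sym.Xi := fun h => hw (by rw [h]; simp [Sym.Xi])
  have hv : (Sym.node 0 w.1.noise w.1.branches).InW := by
    rcases Sym.inW_iff.1 w.2 with h | ⟨h1, h2, h3, -⟩
    · exact absurd h hXi
    · refine Sym.inW_iff.2 (Or.inr ⟨by simpa using h1, by simpa using h2, by simpa using h3, ?_⟩)
      intro _; simp
  let v : W := ⟨_, hv⟩
  have hm : IsMonoMul w.1.exp (sym v) (sym w) := by
    change incl (sym w) = mon ℝ (Sym.Xpow w.1.exp) * incl (sym v)
    rw [incl_sym, incl_sym, ← mon_mul]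
    congr 1
    rw [Sym.ext_iff3]
    simp [v, Sym.Xpow]
  obtain ⟨g', hg'⟩ := hc x (sym v)
  have hcp : Continuous fun y => ipow (y - x) w.1.exp :=
    (continuous_ipow _).comp (continuous_id.sub continuous_const)
  have hr : IsContRep (Z.Pi x (sym w)) fun y => ipow (y - x) w.1.exp * g' y := by
    refine ⟨hcp.mul hg'.1, fun φ => ?_⟩
    have hsm : ContDiff ℝ ∞ fun y : Pt => ipow (y - x) w.1.exp := by
      unfold ipow; fun_prop
    let ψ : TestFn := ⟨fun y => ipow (y - x) w.1.exp * φ y, hsm.mul φ.contDiff,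
      φ.hasCompactSupport.mul_left, fun _ _ => trivial⟩
    rw [hX _ _ _ hm x φ ψ fun y => rfl, hg'.2 ψ]
    congr 1; funext y
    change g' y * (ipow (y - x) w.1.exp * φ y) = _
    ring
  rw [hg.unique hr]
  have : ipow (x - x) w.1.exp = 0 := by
    obtain ⟨i, hi⟩ := Finsupp.ne_iff.1 hw
    rw [ipow]
    refine Finset.prod_eq_zero (Finset.mem_univ i) ?_
    rw [sub_self, Pi.zero_apply]
    exact zero_pow hi
  change ipow (x - x) w.1.exp * g' x = 0
  rw [this, zero_mul]

theorem rep_eq_zero_of_support (hX : Z.RespectsX) (hc : Z.IsContinuous) {t : T}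
    (ht : ∀ w ∈ t.support, 0 < deg κ w.1 ∨ w.1.exp ≠ 0) {x : Pt} {g : Pt → ℝ}
    (hg : IsContRep (Z.Pi x t) g) : g x = 0 := by
  choose G hG using fun w => hc x (sym w)
  have h : IsContRep (Z.Pi x t) (∑ w ∈ t.support, t w • G w) := by
    have := IsContRep.sum t.support (η := fun w => t w • Z.Pi x (sym w))
      (g := fun w => t w • G w) fun w _ => (hG w).smul (t w)
    have e : Z.Pi x t = ∑ w ∈ t.support, t w • Z.Pi x (sym w) := by
      conv_lhs => rw [T_eq_sum t, map_sum]
      exact Finset.sum_congr rfl fun w _ => (Z.Pi x).map_smul _ _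
    rwa [e]
  rw [hg.unique h, Finset.sum_apply]
  refine Finset.sum_eq_zero fun w hw => ?_
  have : G w x = 0 := by
    rcases ht w hw with h1 | h1
    · exact rep_eq_zero_of_deg_pos h1 (hG w)
    · exact rep_eq_zero_of_exp hX hc h1 (hG w)
  rw [Pi.smul_apply, this, smul_zero]

theorem exists_reps_eq (hκ : 0 < κ) (hκ' : κ < 1 / 100) (f : Tp κ →ₐ[ℝ] ℝ) (c : Fin 5 → ℝ)
    (hc : Z.IsContinuous) (hX : Z.RespectsX) (x : Pt) (t : T) : ∃ g h : Pt → ℝ,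
      IsContRep (Z.Pi x (renT f c t)) g ∧ IsContRep (Z.Pi x (renT (triv κ ℝ) c t)) h ∧
        g x = h x := by
  obtain ⟨h, hh⟩ := hc x (renT (triv κ ℝ) c t)
  obtain ⟨d, hd⟩ := hc x (renT f c t - renT (triv κ ℝ) c t)
  refine ⟨h + d, h, ?_, hh, ?_⟩
  · have := hh.add hd
    rwa [← map_add, add_sub_cancel] at this
  · rw [Pi.add_apply, rep_eq_zero_of_support hX hc (renT_sub_support hκ hκ' f c t) hd, add_zero]

end Phi43

end

theorem mainTheorem10 :
    ∃ κ₀ : ℝ, 0 < κ₀ ∧ ∀ κ : ℝ, 0 < κ → κ < κ₀ →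
      (∀ w : Phi43.W, ¬ w.1.IsPoly → ∀ n : ℕ, Phi43.deg κ w.1 + 2 ≠ n) →
      ∃ N : Phi43.W → ℕ, ∀ C : Fin 5 → ℝ,
        Phi43.renormMap C ∈ Phi43.RenormGroup κ N ∧
        ∀ (ΔM : Phi43.T →ₗ[ℝ] Phi43.T ⊗[ℝ] Phi43.Tp κ)
          (ΔhM : Phi43.Tp κ →ₗ[ℝ] Phi43.Tp κ ⊗[ℝ] Phi43.Tp κ),
          Phi43.Describes κ N (Phi43.renormMap C) ΔM ΔhM →
          ∀ (τ : Phi43.T) (K : Phi43.Kernel), (∀ w ∈ τ.support, K.Annihilates (N w)) →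
            ∀ Z : Phi43.Model κ, Z.Admissible K → Z.IsContinuous → Z.RespectsX →
              ∀ x : Phi43.Pt, ∃ g h : Phi43.Pt → ℝ,
                Phi43.IsContRep (Phi43.PiM Z K ΔM x τ) g ∧
                Phi43.IsContRep (Z.Pi x (Phi43.renormMap C τ)) h ∧
                g x = h x := by
  -- Smallness of κ enters only through the bookkeeping of homogeneities for the values at x, in
  -- inequalities such as 1/2 - 3κ > 0 and 1 - 4κ > 0; the value 1/100 leaves ample room.
  refine ⟨1 / 100, by norm_num, fun κ hκ hκ' hnr => ?_⟩
  have hn : Phi43.Nonres κ := fun σ h1 h2 n => hnr ⟨σ, h1⟩ h2 n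
  refine ⟨Phi43.annDeg, fun C => ⟨Phi43.renormMap_mem hn hκ C, ?_⟩⟩
  intro ΔM ΔhM hD τ K hK Z hZ hc hX x
  have h1 : Phi43.PiM Z K ΔM x τ = Z.Pi x (Phi43.renT (Phi43.fchar κ K Z.Pi x) C τ) :=
    Phi43.T_congr (Phi43.PiM Z K ΔM x) (Z.Pi x ∘ₗ Phi43.renT (Phi43.fchar κ K Z.Pi x) C)
      fun w hw => Phi43.PiM_unique hn hκ C hD hZ w (hK w hw) x
  rw [h1, Phi43.renormMap_eq κ C]
  exact Phi43.exists_reps_eq hκ hκ' _ C hc hX x τ
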